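/- Work over $\mathbb{C}[[\hbar]]$ with $\hbar$-adically complete algebras; $[x]=\frac{e^{\hbar x}-e^{-\hbar x}}{e^{\hbar}-e^{-\hbar}}$, $[n]!=[1]\cdots[n]$, $\left[{n\atop k}\right]=e^{\hbar k(k-n)}\frac{[n]!}{[n-k]!\,[k]!}$. Square roots of power series with positive constant coefficient are those with positive constant coefficient, and $\sqrt0=0$. **Symmetry.** $U_\hbar(\mathrm{sl}_2)$ is the $\hbar$-adic algebra generated by $\hat E,\hat F,\hat H$ with $[\hat H,\hat E]=2\hat E$, $[\hat H,\hat F]=-2\hat F$, $[\hat E,\hat F]=[\hat H]$, and $U_\hbar(\mathrm{so}_4)=U_\hbar(\mathrm{sl}_2)\hat\otimes U_\hbar(\mathrm{sl}_2)$. In $U(\mathrm{sl}_2)$ (generators $E,H,F$, $[H,E]=2E$, $[H,F]=-2F$, $[E,F]=H$) put $M=\frac12H$, $C=EF+FE+\frac12H^2$, and formally $(2J+1)^2=2C+1$. There is a unique isomorphism of $\mathbb{C}[[\hbar]]$-algebras $\alpha:U(\mathrm{sl}_2)[[\hbar]]\to U_\hbar(\mathrm{sl}_2)$ with $$\alpha^{-1}(\hat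 E)=E\,e^{\hbar(M+1)}\sqrt{\tfrac{[J+M+1][J-M]}{(J+M+1)(J-M)}},\quad \alpha^{-1}(\hat F)=F\,e^{-\hbar M}\sqrt{\tfrac{[J+M][J-M+1]}{(J+M)(J-M+1)}},\quad \alpha^{-1}(\hat H)=H$$ (the radicands are $\hbar$-adic series with constant term $1$ whose coefficients are polynomials in $C$ and $H$, and the roots are their binomial series), and a unique isomorphism $\beta=\alpha\otimes\alpha:U(\mathrm{so}_4)[[\hbar]]=(U(\mathrm{sl}_2)\otimes U(\mathrm{sl}_2))[[\hbar]]\to U_\hbar(\mathrm{so}_4)$. **Spaces.** $M(2)=\mathbb{C}[a,b,c,d]$, $l^2=ad-bc$. $M_\hbar(2)$ is the $\hbar$-adic algebra generated by $\hat a,\hat b,\hat c,\hat d$ with $\hat a\hat b=e^\hbar\hat b\hat a$, $\hat a\hat c=e^\hbar\hat c\hat a$, $\hat b\hat d=e^\hbar\hat d\hat b$, $\hat c\hat d=e^\hbar\hat d\hat c$, $\hat b\hat c=\hat c\hat b$, $\hat a\hat d-\hat d\hat a=(e^\hbar-e^{-\hbar})\hat b\hat c$, and $\hat l^2=\hat a\hat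 d-e^\hbar\hat b\hat c$. For $2j\in\mathbb{N}_0$ the spin-$j$ representation of $U_\hbar(\mathrm{sl}_2)$ has a basis $|j,m\rangle$, $m=-j,\dots,j$, with $$\hat E|j,m\rangle=e^{\hbar(m+1)}\sqrt{[j+m+1][j-m]}\,|j,m+1\rangle,\quad \hat F|j,m\rangle=e^{-\hbar m}\sqrt{[j+m][j-m+1]}\,|j,m-1\rangle,\quad \hat H|j,m\rangle=2m|j,m\rangle,$$ and that of $U(\mathrm{sl}_2)$ is obtained by setting $\hbar=0$. $U(\mathrm{so}_4)$ acts on $M(2)$, by derivations for elements of the Lie algebra, so that $\bigl(\begin{smallmatrix}a&b\\c&d\end{smallmatrix}\bigr)$ transforms by the $(\frac12,\frac12)$-representation: the first copy of $\mathrm{sl}_2$ acts on the row index, the second on the column index, both with weights $-\frac12,\frac12$. $U_\hbar(\mathrm{so}_4)$ has a unique action on $M_\hbar(2)$ for which the matrix of generators transforms likewise and, for both copies, $\hat E(xy)=(\hat Ex)(e^{\hbar\hat H}y)+x(\hat Ey)$, $\hat F(xy)=(\hat Fx)y+(e^{-\hbar\hat H}x)(\hat Fy)$, $\hat H(xy)=(\hat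 Hx)y+x(\hat Hy)$. For each $j$ there are unique families $T^{(j,j)}_{mm'}\in M(2)$ and $\hat T^{(j,j)}_{mm'}\in M_\hbar(2)$, $m,m'\in\{-j,\dots,j\}$, that transform by the $(j,j)$-representation in the above bases and satisfy $T^{(j,j)}_{jj}=d^{2j}$, $\hat T^{(j,j)}_{jj}=\hat d^{2j}$. **Clebsch–Gordan coefficients.** $\left(\begin{smallmatrix}j_1&j_2&j\\m_1&m_2&m\end{smallmatrix}\right)_q$ is zero unless $m_1+m_2=m$, $m$ and the $m_i$ are weights of spin $j$ and $j_i$, and $|j_1-j_2|\le j\le j_1+j_2$; otherwise it is $$e^{\hbar\left(\frac12(j_1+j_2-j)(j_1+j_2+j+1)+j_1m_2-j_2m_1\right)}\sqrt{\tfrac{[j_1+j_2-j]!\,[j_1-j_2+j]!\,[-j_1+j_2+j]!\,[2j+1]}{[j_1+j_2+j+1]!}}\,\sqrt{[j_1+m_1]!\,[j_1-m_1]!\,[j_2+m_2]!\,[j_2-m_2]!\,[j+m]!\,[j-m]!}$$ $$\times\sum_r\frac{(-1)^re^{-\hbar r(j_1+j_2+j+1)}}{[r]!\,[j_1+j_2-j-r]!\,[j_1-m_1-r]!\,[j_2+m_2-r]!\,[j-j_2+m_1+r]!\,[j-j_1-m_2+r]!},$$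 the sum being over the integers $r$ for which all arguments are nonnegative. The ordinary coefficient $\left(\begin{smallmatrix}j_1&j_2&j\\m_1&m_2&m\end{smallmatrix}\right)$ is its value at $\hbar=0$. **Theorem.** There is a unique $\mathbb{C}[[\hbar]]$-linear isomorphism $\varphi:M(2)[[\hbar]]\to M_\hbar(2)$ with $\varphi(l^{2n}T^{(j,j)}_{mm'})=\hat l^{2n}\hat T^{(j,j)}_{mm'}$ for all $n\in\mathbb{N}_0$, $2j\in\mathbb{N}_0$ and all $m,m'$. It preserves the symmetry: $\varphi(g\triangleright x)=\beta(g)\triangleright\varphi(x)$ for all $g\in U(\mathrm{so}_4)[[\hbar]]$, $x\in M(2)[[\hbar]]$. For all $n_a,n_b,n_c,n_d\in\frac12\mathbb{N}_0$, with $n=n_a+n_b+n_c+n_d$, $n_1=-n_a-n_b+n_c+n_d$ and $n_2=-n_a+n_b-n_c+n_d$, $$\varphi(a^{2n_a}b^{2n_b}c^{2n_c}d^{2n_d})=\sum_{j,k}\frac{\left(\begin{smallmatrix}n_a+n_b&n_c+n_d&j\\-n_a-n_b&n_c+n_d&n_1\end{smallmatrix}\right)\left[{2n_a+2n_b\atop2n_b+k}\right]^{\frac12}\left[{2n_c+2n_d\atop2n_c+k}\right]^{\frac12}}{\left(\begin{smallmatrix}n_a+n_b&n_c+n_d&j\\-n_a-n_b&n_c+n_d&n_1\end{smallmatrix}\right)_q\binom{2n_a+2n_b}{2n_b}^{\frac12}\binom{2n_c+2n_d}{2n_c}^{\frac12}}$$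 $$\times\left(\begin{smallmatrix}n_a+n_b&n_c+n_d&j\\-n_a+n_b&-n_c+n_d&n_2\end{smallmatrix}\right)\left(\begin{smallmatrix}n_a+n_b&n_c+n_d&j\\-n_a+n_b+k&-n_c+n_d-k&n_2\end{smallmatrix}\right)_q\hat a^{2n_a-k}\hat b^{2n_b+k}\hat c^{2n_c+k}\hat d^{2n_d-k},$$ where $j$ runs through $n,n-1,\dots,|n_a+n_b-n_c-n_d|$ and $k$ through the integers for which all four exponents are nonnegative; for these $j$ the quantum Clebsch–Gordan coefficient in the denominator is invertible in $\mathbb{C}[[\hbar]]$. -/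

import Mathlib

open scoped PowerSeries TensorProduct

noncomputable section

namespace QuantumEuclid

/-! ### Formal power series in `ℏ` -/

/-- The ground ring `ℂ[[ℏ]]`; the variable `PowerSeries.X` is `ℏ`. -/
abbrev Ch : Type := ℂ⟦X⟧

section Series

variable (A : Type) [Ring A] [Algebra ℂ A]

/-- For a (possibly noncommutative) `ℂ`-algebra `A`, the ring `A[[ℏ]]` is a `ℂ[[ℏ]]`-algebra. -/
instance (priority := low) seriesAlgebra : Algebra Ch A⟦X⟧ :=
  RingHom.toAlgebra' (PowerSeries.map (algebraMap ℂ A)) (by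
    intro c x
    ext n
    rw [PowerSeries.coeff_mul, PowerSeries.coeff_mul, ← Finset.Nat.sum_antidiagonal_swap]
    refine Finset.sum_congr rfl fun p _ => ?_
    simp only [PowerSeries.coeff_map, Prod.fst_swap, Prod.snd_swap]
    exact Algebra.commutes _ _)

variable {A}

/-- `e^{ℏ x}`. -/
def expH (x : A) : A⟦X⟧ :=
  PowerSeries.mk fun n => ((n.factorial : ℂ)⁻¹) • x ^ n

/-- `(e^{ℏ x} - e^{-ℏ x}) / (2ℏ)`. -/
def sinhc (x : A) : A⟦X⟧ :=
  PowerSeries.mk fun n => if Even n then (((n + 1).factorial : ℂ)⁻¹) • x ^ (n + 1) else 0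

/-- The quantum number `[x] = (e^{ℏ x} - e^{-ℏ x}) / (e^ℏ - e^{-ℏ})`
(numerator and denominator are divided by `2ℏ`). -/
def qNum (x : A) : A⟦X⟧ :=
  PowerSeries.map (algebraMap ℂ A) ((sinhc (1 : ℂ))⁻¹) * sinhc x

/-- `g^{1/2}`, as the binomial series in `g - 1`, for `g` with constant coefficient `1`. -/
def sqrtOne (g : A⟦X⟧) : A⟦X⟧ :=
  PowerSeries.mk fun n => ∑ k ∈ Finset.range (n + 1),
    ((Ring.choose (1 / 2 : ℚ) k : ℚ) : ℂ) • PowerSeries.coeff n ((g - 1) ^ k)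

end Series

/-- The square root of a complex power series with positive constant coefficient (the root whose
constant coefficient is positive); it sends `0` to `0`. -/
def csqrt (f : Ch) : Ch :=
  PowerSeries.C ((Real.sqrt (PowerSeries.constantCoeff f).re : ℝ) : ℂ) *
    sqrtOne (PowerSeries.C (PowerSeries.constantCoeff f)⁻¹ * f)

theorem X_mul_sinhc {A : Type} [Ring A] [Algebra ℂ A] (x : A) :
    PowerSeries.X * ((2 : ℂ) • sinhc x) = expH x - expH (-x) := by
  ext n
  cases n with
  | zero => simp [expH]
  | succ n =>
    rw [PowerSeries.coeff_succ_X_mul]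
    rw [two_smul]
    simp only [map_sub, map_add, sinhc, expH, PowerSeries.coeff_mk]
    by_cases h : Even n
    · rw [if_pos h, Odd.neg_pow h.add_one, smul_neg, sub_neg_eq_add]
    · rw [if_neg h, Even.neg_pow (Nat.not_even_iff_odd.mp h).add_one]
      simp

/-- The defining property of the quantum numbers. -/
theorem qNum_spec {A : Type} [Ring A] [Algebra ℂ A] (x : A) :
    PowerSeries.map (algebraMap ℂ A) (expH (1 : ℂ) - expH (-1 : ℂ)) * qNum x =
      expH x - expH (-x) := by
  have h0 : PowerSeries.constantCoeff (sinhc (1 : ℂ)) ≠ 0 := by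
    simp [sinhc, ← PowerSeries.coeff_zero_eq_constantCoeff_apply]
  rw [← X_mul_sinhc, ← X_mul_sinhc, qNum, ← mul_assoc, ← map_mul, mul_assoc, smul_mul_assoc,
    PowerSeries.mul_inv_cancel _ h0, map_mul, PowerSeries.map_X, mul_assoc]
  congr 1
  ext n
  rw [show (2 : ℂ) • (1 : ℂ⟦X⟧) = PowerSeries.C (2 : ℂ) by
    rw [PowerSeries.smul_eq_C_mul, mul_one], PowerSeries.map_C, PowerSeries.coeff_C_mul,
    map_ofNat, two_smul, map_add, two_mul]

/-! ### Factorials, binomial coefficients, Clebsch--Gordan coefficients -/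

/-- `[n]! = [1][2]⋯[n]`. -/
def qFact (n : ℕ) : Ch := ∏ i ∈ Finset.range n, qNum ((i : ℂ) + 1)

/-- The deformed binomial coefficient `e^{ℏ k (k - n)} [n]! / ([n - k]! [k]!)`, for `k ≤ n`. -/
def qBinom (n k : ℕ) : Ch :=
  expH ((k : ℂ) * ((k : ℂ) - n)) * qFact n * (qFact (n - k) * qFact k)⁻¹

open Classical in
/-- `1 / x!` for `x ∈ ℕ`, and `0` for all other rational numbers. -/
def invFact (x : ℚ) : ℝ := if ∃ n : ℕ, x = n then ((⌊x⌋₊.factorial : ℝ))⁻¹ else 0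

open Classical in
/-- `1 / [x]!` for `x ∈ ℕ`, and `0` for all other rational numbers. -/
def qInvFact (x : ℚ) : Ch := if ∃ n : ℕ, x = n then (qFact ⌊x⌋₊)⁻¹ else 0

/-- `m ∈ {-j, -j + 1, …, j}` with `j ∈ ½ℕ`. -/
def IsSpinWeight (j m : ℚ) : Prop := (∃ p : ℕ, j - m = p) ∧ (∃ p : ℕ, j + m = p)

/-- The selection rules for Clebsch--Gordan coefficients. -/
def Admissible (j₁ j₂ j m₁ m₂ m : ℚ) : Prop :=
  IsSpinWeight j₁ m₁ ∧ IsSpinWeight j₂ m₂ ∧ IsSpinWeight j m ∧ m₁ + m₂ = m ∧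
    |j₁ - j₂| ≤ j ∧ j ≤ j₁ + j₂

open Classical in
/-- The ordinary Clebsch--Gordan coefficient `⟨j₁ m₁ j₂ m₂ | j m⟩` (Racah's formula). -/
def cg (j₁ j₂ j m₁ m₂ m : ℚ) : ℝ :=
  if Admissible j₁ j₂ j m₁ m₂ m then
    Real.sqrt ((⌊j₁ + j₂ - j⌋₊.factorial * ⌊j₁ - j₂ + j⌋₊.factorial * ⌊-j₁ + j₂ + j⌋₊.factorial)
        * invFact (j₁ + j₂ + j + 1) * ((2 * j + 1 : ℚ) : ℝ) *
        (⌊j₁ + m₁⌋₊.factorial * ⌊j₁ - m₁⌋₊.factorial * ⌊j₂ + m₂⌋₊.factorial *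
          ⌊j₂ - m₂⌋₊.factorial * ⌊j + m⌋₊.factorial * ⌊j - m⌋₊.factorial)) *
      ∑ r ∈ Finset.range (⌊j₁ + j₂ - j⌋₊ + 1), (-1) ^ r *
        (invFact r * invFact (j₁ + j₂ - j - r) * invFact (j₁ - m₁ - r) * invFact (j₂ + m₂ - r) *
          invFact (j - j₂ + m₁ + r) * invFact (j - j₁ - m₂ + r))
  else 0

open Classical in
/-- The `ℏ`-adic quantum Clebsch--Gordan coefficient of `U_ℏ(sl₂)`: the `q`-deformed
Clebsch--Gordan coefficient at `q = e^ℏ`, for the coproduct `Δ E = E ⊗ e^{ℏH} + 1 ⊗ E`,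
`Δ F = F ⊗ 1 + e^{-ℏH} ⊗ F`. -/
def qcg (j₁ j₂ j m₁ m₂ m : ℚ) : Ch :=
  if Admissible j₁ j₂ j m₁ m₂ m then
    expH (((1 / 2 * (j₁ + j₂ - j) * (j₁ + j₂ + j + 1) + j₁ * m₂ - j₂ * m₁ : ℚ)) : ℂ) *
      csqrt ((qFact ⌊j₁ + j₂ - j⌋₊ * qFact ⌊j₁ - j₂ + j⌋₊ * qFact ⌊-j₁ + j₂ + j⌋₊) *
        qInvFact (j₁ + j₂ + j + 1) * qNum (((2 * j + 1 : ℚ)) : ℂ) *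
        (qFact ⌊j₁ + m₁⌋₊ * qFact ⌊j₁ - m₁⌋₊ * qFact ⌊j₂ + m₂⌋₊ *
          qFact ⌊j₂ - m₂⌋₊ * qFact ⌊j + m⌋₊ * qFact ⌊j - m⌋₊)) *
      ∑ r ∈ Finset.range (⌊j₁ + j₂ - j⌋₊ + 1),
        (-1) ^ r * expH (((-(r * (j₁ + j₂ + j + 1)) : ℚ)) : ℂ) *
        (qInvFact r * qInvFact (j₁ + j₂ - j - r) * qInvFact (j₁ - m₁ - r) *
          qInvFact (j₂ + m₂ - r) * qInvFact (j - j₂ + m₁ + r) * qInvFact (j - j₁ - m₂ + r))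
  else 0

/-! ### `ℏ`-adic algebras given by generators and relations -/

section Presented

variable {S : Type}

/-- The free `ℏ`-adic algebra `ℂ⟨S⟩[[ℏ]]`. -/
abbrev HFree (S : Type) : Type := (FreeAlgebra ℂ S)⟦X⟧

/-- A two-sided ideal of `ℂ⟨S⟩[[ℏ]]` that is closed in the `ℏ`-adic topology. -/
def IsHClosed (I : TwoSidedIdeal (HFree S)) : Prop :=
  ∀ x : HFree S, (∀ n : ℕ, ∃ y ∈ I, ∀ k < n, PowerSeries.coeff k x = PowerSeries.coeff k y) → x ∈ I

/-- The closed two-sided ideal generated by a set of relators. -/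
def closedIdeal (rels : Set (HFree S)) : TwoSidedIdeal (HFree S) :=
  sInf {I | rels ⊆ {x | x ∈ I} ∧ IsHClosed I}

/-- The `ℏ`-adic algebra generated by `S` with the given relators. -/
abbrev HAlg (rels : Set (HFree S)) : Type := (closedIdeal rels).ringCon.Quotient

/-- The quotient map `ℂ⟨S⟩[[ℏ]] → ℂ⟨S⟩[[ℏ]] / ⟨rels⟩`. -/
def HAlg.mk (rels : Set (HFree S)) : HFree S →ₐ[Ch] HAlg rels :=
  RingCon.mkₐ Ch _

/-- A generator, as a constant power series. -/
def gen (s : S) : HFree S := PowerSeries.C (FreeAlgebra.ι ℂ s)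

end Presented

/-! ### Completed tensor products -/

section Tensor

variable (A : Type) [Ring A] [Algebra Ch A]

/-- The ideal `ℏⁿ A`. -/
def hIdeal (n : ℕ) : Ideal A := Ideal.span {algebraMap Ch A (PowerSeries.X ^ n)}

instance hIdeal_isTwoSided (n : ℕ) : (hIdeal A n).IsTwoSided := by
  refine ⟨fun {a} b ha => ?_⟩
  obtain ⟨c, rfl⟩ := Ideal.mem_span_singleton'.mp ha
  refine Ideal.mem_span_singleton'.mpr ⟨c * b, ?_⟩
  rw [mul_assoc, mul_assoc, Algebra.commutes]

theorem hIdeal_succ_le (n : ℕ) : hIdeal A (n + 1) ≤ hIdeal A n := by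
  refine (Ideal.span_singleton_le_iff_mem _).mpr (Ideal.mem_span_singleton'.mpr
    ⟨algebraMap Ch A PowerSeries.X, ?_⟩)
  rw [← map_mul, ← pow_succ']

/-- The `ℏ`-adic completion `lim A / ℏⁿ A`. -/
def hCompletion : Subalgebra Ch (∀ n : ℕ, A ⧸ hIdeal A n) where
  carrier := {f | ∀ n, Ideal.Quotient.factorₐ Ch (hIdeal_succ_le A n) (f (n + 1)) = f n}
  mul_mem' hf hg n := by simp only [Pi.mul_apply, map_mul]; rw [hf n, hg n]
  add_mem' hf hg n := by simp only [Pi.add_apply, map_add]; rw [hf n, hg n]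
  algebraMap_mem' r n := by simp only [Pi.algebraMap_apply, AlgHom.commutes]

/-- The canonical map from an algebra to its `ℏ`-adic completion. -/
def hCompletion.of : A →ₐ[Ch] hCompletion A :=
  AlgHom.codRestrict (AlgHom.pi fun n => Ideal.Quotient.mkₐ Ch (hIdeal A n)) _
    fun _ _ => rfl

/-- The topological tensor product of two `ℏ`-adic algebras. -/
abbrev HTensor (B C : Type) [Ring B] [Algebra Ch B] [Ring C] [Algebra Ch C] : Type :=
  hCompletion (B ⊗[Ch] C)

end Tensor

/-! ### `U(sl₂)`, `U(so₄) = U(sl₂) ⊗ U(sl₂)` and their deformations -/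

/-- `sl₂`; rows and columns `0, 1` correspond to the weights `-½, ½`. -/
abbrev Sl2 : Type := LieAlgebra.SpecialLinear.sl (Fin 2) ℂ

/-- The raising operator of `sl₂`. -/
def slE : Sl2 := ⟨!![0, 0; 1, 0], by simp [LieAlgebra.SpecialLinear.sl, Matrix.trace_fin_two]⟩

/-- The lowering operator of `sl₂`. -/
def slF : Sl2 := ⟨!![0, 1; 0, 0], by simp [LieAlgebra.SpecialLinear.sl, Matrix.trace_fin_two]⟩

/-- The weight operator of `sl₂`. -/
def slH : Sl2 := ⟨!![-1, 0; 0, 1], by simp [LieAlgebra.SpecialLinear.sl, Matrix.trace_fin_two]⟩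

theorem slE_slF : ⁅slE, slF⁆ = slH := by
  refine Subtype.ext ?_
  rw [LieAlgebra.SpecialLinear.sl_bracket]
  ext i j
  fin_cases i <;> fin_cases j <;>
    norm_num [slE, slF, slH, Matrix.mul_apply, Fin.sum_univ_two]

theorem slH_slE : ⁅slH, slE⁆ = (2 : ℂ) • slE := by
  refine Subtype.ext ?_
  rw [LieAlgebra.SpecialLinear.sl_bracket]
  ext i j
  fin_cases i <;> fin_cases j <;>
    norm_num [slE, slF, slH, Matrix.mul_apply, Fin.sum_univ_two]

theorem slH_slF : ⁅slH, slF⁆ = (-2 : ℂ) • slF := by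
  refine Subtype.ext ?_
  rw [LieAlgebra.SpecialLinear.sl_bracket]
  ext i j
  fin_cases i <;> fin_cases j <;>
    norm_num [slE, slF, slH, Matrix.mul_apply, Fin.sum_univ_two]

/-- `U(sl₂)`. -/
abbrev U : Type := UniversalEnvelopingAlgebra ℂ Sl2

/-- `E` in `U(sl₂)`. -/
def uE : U := UniversalEnvelopingAlgebra.ι ℂ slE

/-- `F` in `U(sl₂)`. -/
def uF : U := UniversalEnvelopingAlgebra.ι ℂ slF

/-- `H` in `U(sl₂)`. -/
def uH : U := UniversalEnvelopingAlgebra.ι ℂ slH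

/-- The Casimir element `C = EF + FE + H²/2`. -/
def uC : U := uE * uF + uF * uE + (2⁻¹ : ℂ) • uH ^ 2

/-- `U(so₄) = U(sl₂) ⊗ U(sl₂)`. -/
abbrev Uso : Type := U ⊗[ℂ] U

/-- Names of the generators of `U_ℏ(sl₂)`. -/
inductive Gen : Type
  | E | F | H

/-- The relations `[H,E] = 2E`, `[H,F] = -2F`, `[E,F] = (e^{ℏH} - e^{-ℏH}) / (e^ℏ - e^{-ℏ})`. -/
def UhRels : Set (HFree Gen) :=
  {gen .H * gen .E - gen .E * gen .H - (2 : ℂ) • gen .E,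
   gen .H * gen .F - gen .F * gen .H + (2 : ℂ) • gen .F,
   gen .E * gen .F - gen .F * gen .E - qNum (FreeAlgebra.ι ℂ Gen.H)}

/-- `U_ℏ(sl₂)`. -/
abbrev Uh : Type := HAlg UhRels

/-- The generators of `U_ℏ(sl₂)`. -/
def Uh.gen (s : Gen) : Uh := HAlg.mk UhRels (QuantumEuclid.gen s)

/-- `e^{cℏH}` in `U_ℏ(sl₂)`. -/
def Uh.expCH (c : ℂ) : Uh := HAlg.mk UhRels (expH (c • FreeAlgebra.ι ℂ Gen.H))

/-- `U_ℏ(so₄)`, the topological tensor product of two copies of `U_ℏ(sl₂)`. -/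
abbrev UhSo : Type := HTensor Uh Uh

/-- The two embeddings `g ↦ g ⊗ 1` and `g ↦ 1 ⊗ g` of `U_ℏ(sl₂)` into `U_ℏ(so₄)`. -/
def emb (s : Fin 2) (g : Uh) : UhSo :=
  hCompletion.of (Uh ⊗[Ch] Uh) (if s = 0 then g ⊗ₜ[Ch] 1 else 1 ⊗ₜ[Ch] g)

/-! ### The isomorphisms `α` and `β` -/

/-- For commuting `u`, `v`, the series
`4 (e^{ℏ√u} + e^{-ℏ√u} - e^{ℏ√v} - e^{-ℏ√v}) / ((e^ℏ - e^{-ℏ})² (u - v))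
  = 2 (2ℏ / (e^ℏ - e^{-ℏ}))² ∑ₙ ℏ²ⁿ / (2n+2)! ∑_{i ≤ n} uⁱ vⁿ⁻ⁱ`.
At `u = (x + y)²`, `v = (x - y)²` it is `[x][y] / (x y)`. -/
def bracketRatio (u v : U) : U⟦X⟧ :=
  PowerSeries.map (algebraMap ℂ U) ((2 : ℂ) • ((sinhc (1 : ℂ))⁻¹) ^ 2) *
    PowerSeries.mk fun n => if Even n then
      (((n + 2).factorial : ℂ)⁻¹) • ∑ i ∈ Finset.range (n / 2 + 1), u ^ i * v ^ (n / 2 - i) else 0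

/-- `α⁻¹(Ê) = E e^{ℏ(M+1)} √([J+M+1][J-M] / ((J+M+1)(J-M)))`, where `M = H/2`,
`(2J+1)² = 2C+1`; here `x = J+M+1`, `y = J-M`, so that `x+y = 2J+1` and `x-y = H+1`. -/
def alphaInvE : U⟦X⟧ :=
  PowerSeries.C uE * expH ((2⁻¹ : ℂ) • uH + 1) *
    sqrtOne (bracketRatio ((2 : ℂ) • uC + 1) ((uH + 1) ^ 2))

/-- `α⁻¹(F̂) = F e^{-ℏM} √([J+M][J-M+1] / ((J+M)(J-M+1)))`;
here `x = J+M`, `y = J-M+1`, so that `x+y = 2J+1` and `x-y = H-1`. -/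
def alphaInvF : U⟦X⟧ :=
  PowerSeries.C uF * expH (-((2⁻¹ : ℂ) • uH)) *
    sqrtOne (bracketRatio ((2 : ℂ) • uC + 1) ((uH - 1) ^ 2))

/-- `α : U(sl₂)[[ℏ]] ≅ U_ℏ(sl₂)` is the isomorphism whose inverse takes the given values on
the generators. -/
def IsAlpha (α : U⟦X⟧ ≃ₐ[Ch] Uh) : Prop :=
  α.symm (Uh.gen .E) = alphaInvE ∧ α.symm (Uh.gen .F) = alphaInvF ∧
    α.symm (Uh.gen .H) = PowerSeries.C uH

/-- `β = α ⊗ α : U(so₄)[[ℏ]] ≅ U_ℏ(so₄)`. -/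
def IsBeta (α : U⟦X⟧ ≃ₐ[Ch] Uh) (β : Uso⟦X⟧ ≃ₐ[Ch] UhSo) : Prop :=
  ∀ x y : U⟦X⟧,
    β (PowerSeries.map (Algebra.TensorProduct.includeLeft : U →ₐ[ℂ] Uso).toRingHom x *
        PowerSeries.map (Algebra.TensorProduct.includeRight : U →ₐ[ℂ] Uso).toRingHom y) =
      hCompletion.of (Uh ⊗[Ch] Uh) (α x ⊗ₜ[Ch] α y)

/-! ### Commutative Euclidean four-space -/

/-- `M(2) = ℂ[a,b,c,d]`; the matrix of coordinates is `((a, b), (c, d))`, and the indices `0, 1`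
of rows and columns correspond to the weights `-½, ½`. -/
abbrev Mcl : Type := MvPolynomial (Fin 2 × Fin 2) ℂ

/-- The coordinate in row `i` and column `k`. -/
abbrev xcl (i k : Fin 2) : Mcl := MvPolynomial.X (i, k)

/-- The square `l² = ad - bc` of the four-length. -/
def lsq : Mcl := xcl 0 0 * xcl 1 1 - xcl 0 1 * xcl 1 0

section ClassicalAction

attribute [local instance] LieRing.ofAssociativeRing

/-- The vector field by which the first copy of `sl₂` acts (on the row index). -/
def rowField (g : Matrix (Fin 2) (Fin 2) ℂ) : Derivation ℂ Mcl Mcl :=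
  MvPolynomial.mkDerivation ℂ fun p => ∑ i, g i p.1 • xcl i p.2

/-- The vector field by which the second copy of `sl₂` acts (on the column index). -/
def colField (g : Matrix (Fin 2) (Fin 2) ℂ) : Derivation ℂ Mcl Mcl :=
  MvPolynomial.mkDerivation ℂ fun p => ∑ k, g k p.2 • xcl p.1 k

/-- The action of the first copy of `sl₂` on `M(2)`. -/
def rowAction : Sl2 →ₗ⁅ℂ⁆ Module.End ℂ Mcl where
  toFun g := (rowField g.val : Mcl →ₗ[ℂ] Mcl)
  map_add' g h := by
    rw [← Derivation.coe_add_linearMap]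
    congr 1
    refine MvPolynomial.derivation_ext fun p => ?_
    simp [rowField, MvPolynomial.mkDerivation_X, add_smul, Finset.sum_add_distrib]
  map_smul' c g := by
    rw [RingHom.id_apply, ← Derivation.coe_smul_linearMap]
    congr 1
    refine MvPolynomial.derivation_ext fun p => ?_
    simp [rowField, MvPolynomial.mkDerivation_X, mul_smul]
  map_lie' {g h} := by
    rw [← Derivation.commutator_coe_linear_map]
    congr 1
    refine MvPolynomial.derivation_ext fun p => ?_
    simp only [Derivation.commutator_apply, rowField, MvPolynomial.mkDerivation_X, map_add,
      Derivation.map_smul, LieAlgebra.SpecialLinear.sl_bracket, Matrix.sub_apply,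
      Matrix.mul_apply, Fin.sum_univ_two]
    module

/-- The action of the second copy of `sl₂` on `M(2)`. -/
def colAction : Sl2 →ₗ⁅ℂ⁆ Module.End ℂ Mcl where
  toFun g := (colField g.val : Mcl →ₗ[ℂ] Mcl)
  map_add' g h := by
    rw [← Derivation.coe_add_linearMap]
    congr 1
    refine MvPolynomial.derivation_ext fun p => ?_
    simp [colField, MvPolynomial.mkDerivation_X, add_smul, Finset.sum_add_distrib]
  map_smul' c g := by
    rw [RingHom.id_apply, ← Derivation.coe_smul_linearMap]
    congr 1
    refine MvPolynomial.derivation_ext fun p => ?_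
    simp [colField, MvPolynomial.mkDerivation_X, mul_smul]
  map_lie' {g h} := by
    rw [← Derivation.commutator_coe_linear_map]
    congr 1
    refine MvPolynomial.derivation_ext fun p => ?_
    simp only [Derivation.commutator_apply, colField, MvPolynomial.mkDerivation_X, map_add,
      Derivation.map_smul, LieAlgebra.SpecialLinear.sl_bracket, Matrix.sub_apply,
      Matrix.mul_apply, Fin.sum_univ_two]
    module

theorem rowAction_commute (g h : Sl2) : Commute (rowAction g) (colAction h) := by
  have key : ⁅rowField g.val, colField h.val⁆ = 0 := by
    refine MvPolynomial.derivation_ext fun p => ?_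
    simp only [Derivation.commutator_apply, rowField, colField, MvPolynomial.mkDerivation_X,
      map_add, Derivation.map_smul, Fin.sum_univ_two, Derivation.zero_apply]
    module
  have h2 := Derivation.commutator_coe_linear_map (D1 := rowField g.val) (D2 := colField h.val)
  rw [key] at h2
  exact sub_eq_zero.mp h2.symm

theorem lift_mem {B : Type} [Ring B] [Algebra ℂ B] (f : Sl2 →ₗ⁅ℂ⁆ B) (S : Subalgebra ℂ B)
    (h : ∀ g, f g ∈ S) (x : U) : UniversalEnvelopingAlgebra.lift ℂ f x ∈ S := by
  obtain ⟨t, rfl⟩ : ∃ t, UniversalEnvelopingAlgebra.mkAlgHom ℂ Sl2 t = x :=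
    RingCon.mkₐ_surjective _ x
  induction t using TensorAlgebra.induction with
  | algebraMap r => rw [AlgHom.commutes, AlgHom.commutes]; exact S.algebraMap_mem r
  | ι g => rw [UniversalEnvelopingAlgebra.lift_ι_apply']; exact h g
  | mul a b ha hb => rw [map_mul, map_mul]; exact S.mul_mem ha hb
  | add a b ha hb => rw [map_add, map_add]; exact S.add_mem ha hb

theorem lift_commute (x y : U) :
    Commute (UniversalEnvelopingAlgebra.lift ℂ rowAction x)
      (UniversalEnvelopingAlgebra.lift ℂ colAction y) := by
  have h1 : ∀ g : Sl2, UniversalEnvelopingAlgebra.lift ℂ colAction y ∈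
      Subalgebra.centralizer ℂ {rowAction g} := fun g =>
    lift_mem colAction _ (fun h => Subalgebra.mem_centralizer_iff ℂ |>.mpr fun z hz => by
      rw [Set.mem_singleton_iff.mp hz]; exact rowAction_commute g h) y
  have h2 : UniversalEnvelopingAlgebra.lift ℂ rowAction x ∈
      Subalgebra.centralizer ℂ {UniversalEnvelopingAlgebra.lift ℂ colAction y} :=
    lift_mem rowAction _ (fun g => Subalgebra.mem_centralizer_iff ℂ |>.mpr fun z hz => by
      rw [Set.mem_singleton_iff.mp hz]
      exact (Subalgebra.mem_centralizer_iff ℂ |>.mp (h1 g) _ rfl).symm) x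
  exact (Subalgebra.mem_centralizer_iff ℂ |>.mp h2 _ rfl).symm

/-- The undeformed action of `U(so₄) = U(sl₂) ⊗ U(sl₂)` on `M(2)`. -/
def rho : Uso →ₐ[ℂ] Module.End ℂ Mcl :=
  Algebra.TensorProduct.lift (UniversalEnvelopingAlgebra.lift ℂ rowAction)
    (UniversalEnvelopingAlgebra.lift ℂ colAction) lift_commute

end ClassicalAction

/-- The `ℏ`-linear extension of `rho` to an action of `U(so₄)[[ℏ]]` on `M(2)[[ℏ]]`. -/
def rhoSeries (g : Uso⟦X⟧) (x : Mcl⟦X⟧) : Mcl⟦X⟧ :=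
  PowerSeries.mk fun n => ∑ p ∈ Finset.HasAntidiagonal.antidiagonal n,
    rho (PowerSeries.coeff p.1 g) (PowerSeries.coeff p.2 x)

/-! ### Quantum Euclidean four-space -/

/-- The coordinate in row `i` and column `k`, in the free `ℏ`-adic algebra. -/
abbrev fx (i k : Fin 2) : HFree (Fin 2 × Fin 2) := gen (i, k)

/-- The relations of quantum `2 × 2`-matrices, with `q = e^ℏ`. -/
def MhRels : Set (HFree (Fin 2 × Fin 2)) :=
  let q : Ch := expH (1 : ℂ)
  let q' : Ch := expH (-1 : ℂ)
  {fx 0 0 * fx 0 1 - q • (fx 0 1 * fx 0 0),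
   fx 0 0 * fx 1 0 - q • (fx 1 0 * fx 0 0),
   fx 0 1 * fx 1 1 - q • (fx 1 1 * fx 0 1),
   fx 1 0 * fx 1 1 - q • (fx 1 1 * fx 1 0),
   fx 0 1 * fx 1 0 - fx 1 0 * fx 0 1,
   fx 0 0 * fx 1 1 - fx 1 1 * fx 0 0 - (q - q') • (fx 0 1 * fx 1 0)}

/-- Quantum Euclidean four-space `M_ℏ(2)`. -/
abbrev Mh : Type := HAlg MhRels

/-- The generator of `M_ℏ(2)` in row `i` and column `k`. -/
def xh (i k : Fin 2) : Mh := HAlg.mk MhRels (fx i k)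

/-- The quantum determinant `l̂² = âd̂ - e^ℏ b̂ĉ`. -/
def lsqh : Mh := xh 0 0 * xh 1 1 - expH (1 : ℂ) • (xh 0 1 * xh 1 0)

/-! ### Irreducible representations -/

/-- The matrix of a generator in the spin-`N/2` representation of `U_ℏ(sl₂)`;
the index `p` stands for the weight `m = p - N/2`. -/
def irrepH (N : ℕ) : Gen → Matrix (Fin (N + 1)) (Fin (N + 1)) Ch
  | .E => Matrix.of fun r p =>
      let j : ℂ := N / 2
      let m : ℂ := p - N / 2
      if (r : ℕ) = p + 1 then expH (m + 1) * csqrt (qNum (j + m + 1) * qNum (j - m)) else 0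
  | .F => Matrix.of fun r p =>
      let j : ℂ := N / 2
      let m : ℂ := p - N / 2
      if (r : ℕ) + 1 = p then expH (-m) * csqrt (qNum (j + m) * qNum (j - m + 1)) else 0
  | .H => Matrix.of fun r p =>
      let m : ℂ := p - N / 2
      if r = p then PowerSeries.C (2 * m) else 0

/-- The matrix of a generator in the spin-`N/2` representation of `U(sl₂)`. -/
def irrepCl (N : ℕ) : Gen → Matrix (Fin (N + 1)) (Fin (N + 1)) ℂ
  | .E => Matrix.of fun r p =>
      let j : ℝ := N / 2
      let m : ℝ := p - N / 2
      if (r : ℕ) = p + 1 then ((Real.sqrt ((j + m + 1) * (j - m)) : ℝ) : ℂ) else 0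
  | .F => Matrix.of fun r p =>
      let j : ℝ := N / 2
      let m : ℝ := p - N / 2
      if (r : ℕ) + 1 = p then ((Real.sqrt ((j + m) * (j - m + 1)) : ℝ) : ℂ) else 0
  | .H => Matrix.of fun r p =>
      let m : ℂ := p - N / 2
      if r = p then 2 * m else 0

/-- The generators of `U(sl₂)`. -/
def uGen : Gen → U
  | .E => uE
  | .F => uF
  | .H => uH

/-- The family `T p p' = T^{(j,j)}_{mm'}` in `M_ℏ(2)`, with `j = N/2`, `m = p - j`, `m' = p' - j`,
transforms by the irreducible `(j,j)`-representation of `U_ℏ(so₄)`. -/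
def TransformsH (ρ : UhSo →ₐ[Ch] Module.End Ch Mh) (N : ℕ)
    (T : Fin (N + 1) → Fin (N + 1) → Mh) : Prop :=
  ∀ (g : Gen) (p p' : Fin (N + 1)),
    ρ (emb 0 (Uh.gen g)) (T p p') = ∑ r, irrepH N g r p • T r p' ∧
    ρ (emb 1 (Uh.gen g)) (T p p') = ∑ r, irrepH N g r p' • T p r

/-- The action `ρ` of `U_ℏ(so₄)` on `M_ℏ(2)`: the matrix of generators is the
`(½,½)`-representation, and products obey the deformed Leibniz rule, for both copies of
`U_ℏ(sl₂)`. -/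
structure IsDeformedAction (ρ : UhSo →ₐ[Ch] Module.End Ch Mh) : Prop where
  gens : TransformsH ρ 1 xh
  leibniz_E : ∀ (s : Fin 2) (x y : Mh), ρ (emb s (Uh.gen .E)) (x * y) =
    ρ (emb s (Uh.gen .E)) x * ρ (emb s (Uh.expCH 1)) y + x * ρ (emb s (Uh.gen .E)) y
  leibniz_F : ∀ (s : Fin 2) (x y : Mh), ρ (emb s (Uh.gen .F)) (x * y) =
    ρ (emb s (Uh.gen .F)) x * y + ρ (emb s (Uh.expCH (-1))) x * ρ (emb s (Uh.gen .F)) y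
  leibniz_H : ∀ (s : Fin 2) (x y : Mh), ρ (emb s (Uh.gen .H)) (x * y) =
    ρ (emb s (Uh.gen .H)) x * y + x * ρ (emb s (Uh.gen .H)) y

/-- The basis `T̂^{(j,j)}_{mm'}` of the irreducible `(j,j)`-subrepresentation of `M_ℏ(2)` that is
generated by `d̂^{2j}`, where `j = N/2`. -/
def IsIrrepBasisH (ρ : UhSo →ₐ[Ch] Module.End Ch Mh) (N : ℕ)
    (T : Fin (N + 1) → Fin (N + 1) → Mh) : Prop :=
  TransformsH ρ N T ∧ T (Fin.last N) (Fin.last N) = xh 1 1 ^ N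

/-- The basis `T^{(j,j)}_{mm'}` of the irreducible `(j,j)`-subrepresentation of `M(2)` that is
generated by `d^{2j}`, where `j = N/2`. -/
def IsIrrepBasisCl (N : ℕ) (T : Fin (N + 1) → Fin (N + 1) → Mcl) : Prop :=
  (∀ (g : Gen) (p p' : Fin (N + 1)),
    rho (uGen g ⊗ₜ[ℂ] 1) (T p p') = ∑ r, irrepCl N g r p • T r p' ∧
    rho (1 ⊗ₜ[ℂ] uGen g) (T p p') = ∑ r, irrepCl N g r p' • T p r) ∧
  T (Fin.last N) (Fin.last N) = xcl 1 1 ^ N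

/-! ### The symmetry preserving ordering -/

/-- `φ(l^{2n} T^{(j,j)}_{mm'}) = l̂^{2n} T̂^{(j,j)}_{mm'}` for all `n`, `j = N/2`, `m`, `m'`. -/
def IsOrdering (T : ∀ N : ℕ, Fin (N + 1) → Fin (N + 1) → Mcl)
    (Th : ∀ N : ℕ, Fin (N + 1) → Fin (N + 1) → Mh) (φ : Mcl⟦X⟧ ≃ₗ[Ch] Mh) : Prop :=
  ∀ (n N : ℕ) (p p' : Fin (N + 1)),
    φ (PowerSeries.C (lsq ^ n * T N p p')) = lsqh ^ n * Th N p p'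

/-- `φ(ρ(g ⊗ x)) = ρ_ℏ(β(g) ⊗ φ(x))`. -/
def IsSymmetryPreserving (β : Uso⟦X⟧ ≃ₐ[Ch] UhSo) (ρ : UhSo →ₐ[Ch] Module.End Ch Mh)
    (φ : Mcl⟦X⟧ ≃ₗ[Ch] Mh) : Prop :=
  ∀ (g : Uso⟦X⟧) (x : Mcl⟦X⟧), φ (rhoSeries g x) = ρ (β g) (φ x)

end QuantumEuclid

/-!
# The symmetry preserving ordering of quantum Euclidean four-space

All objects are complete over `ℂ[[ℏ]]`, and statements are reduced to `ℏ = 0` wherever possible: a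
linear map of complete modules is bijective if it is so modulo `ℏ` and the target has no torsion.

*The isomorphisms `α` and `β`.* The prescribed values of `α⁻¹` satisfy the relations of
`U_ℏ(sl₂)`, since the radicands are divided differences of `u ↦ cosh (ℏ √u)` between `(2J + 1)²`
and `(H ± 1)²` (`alphaInv_bracket`). Modulo `ℏ` the resulting homomorphism is the identity of
`U(sl₂)` (`alphaInv_bijective`). The isomorphism `β` is the completion of `α ⊗ α`.

*Quantum space.* The kernel of the reduction `red : M_ℏ(2) → M(2)` is `ℏ M_ℏ(2)`, and `M_ℏ(2)` has no
`ℏ`-torsion (`Mh.X_smul_eq_zero`), because it acts on sequences of power series in such a way that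
modulo `ℏ` there are enough common eigenvectors. This replaces a basis theorem for `M_ℏ(2)`. The
operators `op s g` of the deformed action are twisted derivations, which may be prescribed on
generators (`exists_twistedDer`); the relation between `Ê` and `F̂` holds because both sides are
twisted derivations up to the factor `e^ℏ - e^{-ℏ}`.

*The ordering.* The vectors `T̂^{(j,j)}_{mm'}` arise from `d̂^{2j}` by the lowering operators, and
reduce to `T^{(j,j)}_{mm'}`. The Segre map `x_{ik} ↦ s_i t_k`, whose kernel is generated by the
determinant `l²`, takes the latter to multiples of different monomials, so that the `l²ⁿ T^{(j,j)}_{mm'}`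
form a basis of `M(2)` (`expand_injective`, `expand_surjective`). Hence the ordering `phi` exists and
is unique; modulo `ℏ` it is the identity. It preserves the symmetry since the series by which
`α⁻¹(Ê)` and `α⁻¹(F̂)` differ from `E` and `F` act on the basis vectors by scalars, namely the
quotients of the deformed and undeformed matrix coefficients (`phi_rhoHom`).

*The formula.* In `âˣ b̂ʸ ĉᶻ d̂ʷ` the two rows are doublets of the second copy of `U_ℏ(sl₂)`. The
quantum Clebsch--Gordan coefficients couple them to vectors `cgVec` of spin `j`: they satisfy the
lowering relation (`cgNat_lowering`), as the error terms in the sum over `r` telescope. The coupled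
vector of highest weight is a multiple of `l̂²ⁱ b̂ᴮ d̂ᴰ` (`cgVec_top`), where `i = j₁ + j₂ - j`, and
`b̂ᴮ d̂ᴰ` is in turn a multiple of some `T̂^{(j,j)}_{mj}`. Lowering gives
`cgVec = κ_q l̂²ⁱ T̂^{(j,j)}_{mm'}` (`cgVec_eq`), where `κ_q` is the coefficient in the denominator of
the formula; it is invertible since its sum has a single term. At `ℏ = 0` the same holds with the
value `κ` of `κ_q`, so that `phi` takes the undeformed coupled vectors to `κ / κ_q` times the deformed
ones (`phi_red_cgVec`). The ordinary coefficients are orthogonal (`sum_cgCl_mul_cgCl`): rows for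
different spins because lowering is adjoint to raising, and the norms by a Vandermonde convolution.
Therefore a monomial of `M(2)` is a known combination of coupled vectors
(`red_doublet_mul_doublet`), and the expansion of their images is the formula (`phi_monomial`).
-/


namespace QuantumEuclid

/-! ### Exponentials, quantum numbers and square roots -/

section Series

variable {A : Type} [Ring A] [Algebra ℂ A]

@[simp] theorem constantCoeff_expH (x : A) : PowerSeries.constantCoeff (expH x) = 1 := by
  simp [expH, ← PowerSeries.coeff_zero_eq_constantCoeff_apply]

@[simp] theorem expH_zero : expH (0 : A) = 1 := by
  ext n
  cases n <;> simp [expH, PowerSeries.coeff_one]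

theorem expH_add {x y : A} (h : Commute x y) : expH (x + y) = expH x * expH y := by
  ext n
  rw [PowerSeries.coeff_mul]
  simp only [expH, PowerSeries.coeff_mk]
  rw [h.add_pow', Finset.smul_sum]
  refine Finset.sum_congr rfl fun p hp => ?_
  rw [Finset.HasAntidiagonal.mem_antidiagonal] at hp
  rw [smul_mul_smul_comm, ← Nat.cast_smul_eq_nsmul ℂ, smul_smul]
  congr 1
  rw [← hp, Nat.cast_add_choose]
  have h1 : ((p.1 + p.2).factorial : ℂ) ≠ 0 := by exact_mod_cast Nat.factorial_ne_zero _
  field_simp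

/-- The square of `g^{1/2}` is `g`: the binomial series is truncated to a polynomial. -/
theorem sqrtOne_mul_self {g : A⟦X⟧} (hg : PowerSeries.constantCoeff g = 1) :
    sqrtOne g * sqrtOne g = g := by
  have hh : PowerSeries.constantCoeff (g - 1) = 0 := by simp [hg]
  obtain ⟨h, hgh⟩ : ∃ h, g = 1 + h := ⟨g - 1, by abel⟩
  have hX : PowerSeries.X ∣ h := by
    rw [PowerSeries.X_dvd_iff]; simpa [hgh] using hh
  obtain ⟨h', rfl⟩ := hX
  have hpow (k : ℕ) : (PowerSeries.X * h') ^ k = PowerSeries.X ^ k * h' ^ k :=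
    (PowerSeries.commute_X h').symm.mul_pow k
  have hvan (n k : ℕ) (hnk : n < k) (z : A⟦X⟧) :
      PowerSeries.coeff n (z * (PowerSeries.X * h') ^ k) = 0 := by
    rw [hpow, ← mul_assoc, ← (PowerSeries.commute_X_pow z k).eq.symm, mul_assoc]
    rw [PowerSeries.coeff_X_pow_mul', if_neg (by omega)]
  subst hgh
  ext n
  let B : ℂ⟦X⟧ := PowerSeries.binomialSeries ℂ (1 / 2 : ℚ)
  let P : Polynomial ℂ := PowerSeries.trunc (n + 1) B
  -- to order `n` the square of the truncation `P` agrees with `(1 + x)^{1/2} (1 + x)^{1/2} = 1 + x`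
  have hBB : B * B = 1 + PowerSeries.X := by
    rw [← PowerSeries.binomialSeries_add]
    have := PowerSeries.binomialSeries_nat (R := ℚ) (A := ℂ) 1
    rw [pow_one] at this
    rw [← this]
    norm_num
  obtain ⟨R, hR⟩ : Polynomial.X ^ (n + 1) ∣ P * P - (1 + Polynomial.X) := by
    rw [Polynomial.X_pow_dvd_iff]
    intro d hd
    have := PowerSeries.coeff_mul_eq_coeff_trunc_mul_trunc B B hd
    rw [Polynomial.coeff_sub, ← Polynomial.coeff_coe (P * P), Polynomial.coe_mul, ← this, hBB]
    simp [PowerSeries.coeff_one, PowerSeries.coeff_X, Polynomial.coeff_one, Polynomial.coeff_X,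
      eq_comm]
  have hcoef (m : ℕ) (hm : m ≤ n) : PowerSeries.coeff m (sqrtOne (1 + PowerSeries.X * h')) =
      PowerSeries.coeff m (Polynomial.aeval (PowerSeries.X * h') P) := by
    rw [Polynomial.aeval_def, PowerSeries.eval₂_trunc_eq_sum_range]
    simp only [sqrtOne, PowerSeries.coeff_mk, add_sub_cancel_left, map_sum]
    have hsub : Finset.range (m + 1) ⊆ Finset.range (n + 1) :=
      Finset.range_subset_range.mpr (by omega)
    rw [← Finset.sum_subset hsub (f := fun k => PowerSeries.coeff m
      (algebraMap ℂ A⟦X⟧ (PowerSeries.coeff k B) * (PowerSeries.X * h') ^ k))]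
    · refine Finset.sum_congr rfl fun k _ => ?_
      rw [← Algebra.smul_def, PowerSeries.coeff_smul]
      congr 1
      simp [B, Algebra.smul_def]
    · intro k _ hk
      exact hvan m k (by simpa using hk) _
  have e1 : PowerSeries.coeff n (sqrtOne (1 + PowerSeries.X * h') *
      sqrtOne (1 + PowerSeries.X * h')) =
      PowerSeries.coeff n (Polynomial.aeval (PowerSeries.X * h') (P * P)) := by
    rw [map_mul (Polynomial.aeval _), PowerSeries.coeff_mul, PowerSeries.coeff_mul]
    refine Finset.sum_congr rfl fun p hp => ?_
    rw [Finset.HasAntidiagonal.mem_antidiagonal] at hp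
    rw [hcoef _ (by omega), hcoef _ (by omega)]
  rw [e1, show P * P = 1 + Polynomial.X + R * Polynomial.X ^ (n + 1) by
    rw [mul_comm R, ← hR]; ring]
  simp only [map_add, map_mul, map_one, map_pow, Polynomial.aeval_X]
  rw [hvan n (n + 1) (by omega), add_zero]

theorem constantCoeff_sqrtOne (g : A⟦X⟧) : PowerSeries.constantCoeff (sqrtOne g) = 1 := by
  rw [← PowerSeries.coeff_zero_eq_constantCoeff_apply]
  simp [sqrtOne]

theorem constantCoeff_qNum (x : A) : PowerSeries.constantCoeff (qNum x) = x := by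
  rw [qNum, map_mul, ← PowerSeries.coeff_zero_eq_constantCoeff_apply,
    ← PowerSeries.coeff_zero_eq_constantCoeff_apply, PowerSeries.coeff_map]
  simp [sinhc]

end Series

theorem expH_add' (x y : ℂ) : expH (x + y) = expH x * expH y := expH_add (Commute.all x y)

theorem expH_neg_mul (x : ℂ) : expH (-x) * expH x = 1 := by
  rw [← expH_add']; simp

theorem expH_natMul (x : ℂ) (n : ℕ) : expH (n * x) = expH x ^ n := by
  induction n with
  | zero => simp
  | succ n ih => rw [pow_succ, ← ih, ← expH_add']; congr 1; push_cast; ring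

theorem isUnit_of_constantCoeff {f : Ch} (h : PowerSeries.constantCoeff f ≠ 0) : IsUnit f := by
  rw [PowerSeries.isUnit_iff_constantCoeff]; exact h.isUnit

theorem isUnit_expH (x : ℂ) : IsUnit (expH x) := isUnit_of_constantCoeff (by simp)

/-- `e^ℏ - e^{-ℏ}`. -/
def qDiff : Ch := expH (1 : ℂ) - expH (-1 : ℂ)

theorem qDiff_mul_qNum (x : ℂ) : qDiff * qNum x = expH x - expH (-x) := by
  have := qNum_spec (A := ℂ) x
  rwa [Algebra.algebraMap_self, PowerSeries.map_id] at this

theorem qDiff_ne_zero : qDiff ≠ 0 := by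
  intro h
  have := congrArg (PowerSeries.coeff 1) h
  simp [qDiff, expH] at this

theorem qNum_zero : qNum (0 : ℂ) = 0 := by
  refine mul_left_cancel₀ qDiff_ne_zero ?_
  rw [qDiff_mul_qNum]; simp

theorem qNum_one : qNum (1 : ℂ) = 1 := by
  refine mul_left_cancel₀ qDiff_ne_zero ?_
  rw [qDiff_mul_qNum]; simp [qDiff]

theorem qNum_add (x y : ℂ) : qNum (x + y) = expH y * qNum x + expH (-x) * qNum y := by
  refine mul_left_cancel₀ qDiff_ne_zero ?_
  rw [mul_add, mul_left_comm qDiff (expH y), mul_left_comm qDiff (expH (-x)), qDiff_mul_qNum,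
    qDiff_mul_qNum, qDiff_mul_qNum, neg_add, expH_add', expH_add']
  ring

theorem qNum_add_one (x : ℂ) : qNum (x + 1) = expH 1 * qNum x + expH (-x) := by
  rw [qNum_add, qNum_one, mul_one]

theorem qNum_neg (x : ℂ) : qNum (-x) = -qNum x := by
  refine mul_left_cancel₀ qDiff_ne_zero ?_
  rw [mul_neg, qDiff_mul_qNum, qDiff_mul_qNum, neg_neg]; ring

/-- Power series whose constant coefficient is a positive real number. -/
def IsPos (f : Ch) : Prop := ∃ r : ℝ, 0 < r ∧ PowerSeries.constantCoeff f = (r : ℂ)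

theorem IsPos.mul {f g : Ch} (hf : IsPos f) (hg : IsPos g) : IsPos (f * g) := by
  obtain ⟨r, hr, h⟩ := hf
  obtain ⟨s, hs, h'⟩ := hg
  exact ⟨r * s, mul_pos hr hs, by rw [map_mul, h, h']; push_cast; rfl⟩

theorem IsPos.ne_zero {f : Ch} (hf : IsPos f) : PowerSeries.constantCoeff f ≠ 0 := by
  obtain ⟨r, hr, h⟩ := hf
  rw [h]; exact_mod_cast hr.ne'

theorem IsPos.isUnit {f : Ch} (hf : IsPos f) : IsUnit f := isUnit_of_constantCoeff hf.ne_zero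

theorem IsPos.inv {f : Ch} (hf : IsPos f) : IsPos f⁻¹ := by
  obtain ⟨r, hr, h⟩ := hf
  exact ⟨r⁻¹, inv_pos.mpr hr, by rw [PowerSeries.constantCoeff_inv, h]; push_cast; rfl⟩

theorem isPos_one : IsPos 1 := ⟨1, one_pos, by simp⟩

theorem isPos_expH (x : ℂ) : IsPos (expH x) := ⟨1, one_pos, by simp⟩

theorem isPos_qNum {r : ℝ} (hr : 0 < r) : IsPos (qNum (r : ℂ)) :=
  ⟨r, hr, constantCoeff_qNum _⟩

theorem isPos_qNum_nat {n : ℕ} (hr : 0 < n) : IsPos (qNum (n : ℂ)) := by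
  have := isPos_qNum (r := (n : ℝ)) (by exact_mod_cast hr)
  simpa using this

theorem constantCoeff_csqrt (f : Ch) : PowerSeries.constantCoeff (csqrt f) =
    ((Real.sqrt (PowerSeries.constantCoeff f).re : ℝ) : ℂ) := by
  rw [csqrt, map_mul, constantCoeff_sqrtOne, mul_one, PowerSeries.constantCoeff_C]

theorem IsPos.csqrt {f : Ch} (hf : IsPos f) : IsPos (csqrt f) := by
  obtain ⟨r, hr, h⟩ := hf
  exact ⟨Real.sqrt r, Real.sqrt_pos.mpr hr, by rw [constantCoeff_csqrt, h, Complex.ofReal_re]⟩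

theorem csqrt_mul_self {f : Ch} (hf : IsPos f) : csqrt f * csqrt f = f := by
  have h0 := hf.ne_zero
  obtain ⟨r, hr, h⟩ := hf
  rw [csqrt, mul_mul_mul_comm, sqrtOne_mul_self, ← map_mul, ← mul_assoc, ← map_mul, h]
  · rw [Complex.ofReal_re, ← Complex.ofReal_mul, Real.mul_self_sqrt hr.le, mul_inv_cancel₀, map_one,
      one_mul]
    exact_mod_cast hr.ne'
  · rw [map_mul, PowerSeries.constantCoeff_C, inv_mul_cancel₀ h0]

/-- Among the two square roots of a series, `csqrt` is the one with positive constant coefficient.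
-/
theorem csqrt_of_mul_self {f g : Ch} (hg : IsPos g) (h : g * g = f) : csqrt f = g := by
  have hf : IsPos f := h ▸ hg.mul hg
  have h1 : (csqrt f - g) * (csqrt f + g) = 0 := by
    have := csqrt_mul_self hf
    linear_combination this - h
  rcases mul_eq_zero.mp h1 with h2 | h2
  · exact sub_eq_zero.mp h2
  · exfalso
    obtain ⟨r, hr, h3⟩ := hf.csqrt
    obtain ⟨s, hs, h4⟩ := hg
    have := congrArg PowerSeries.constantCoeff h2
    rw [map_add, h3, h4, map_zero] at this
    have h5 : r + s = 0 := by exact_mod_cast this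
    linarith

theorem csqrt_mul {f g : Ch} (hf : IsPos f) (hg : IsPos g) :
    csqrt (f * g) = csqrt f * csqrt g := by
  refine csqrt_of_mul_self (hf.csqrt.mul hg.csqrt) ?_
  rw [mul_mul_mul_comm, csqrt_mul_self hf, csqrt_mul_self hg]

theorem csqrt_one : csqrt 1 = 1 := csqrt_of_mul_self isPos_one (mul_one 1)

theorem csqrt_zero : csqrt 0 = 0 := by simp [csqrt]

theorem csqrt_expH (x : ℂ) : csqrt (expH x) = expH (x / 2) := by
  refine csqrt_of_mul_self (isPos_expH _) ?_
  rw [← expH_add', add_halves]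

theorem qFact_succ (n : ℕ) : qFact (n + 1) = qNum ((n : ℂ) + 1) * qFact n := by
  rw [qFact, Finset.prod_range_succ, mul_comm]; rfl

theorem qFact_zero : qFact 0 = 1 := by simp [qFact]

theorem constantCoeff_qFact (n : ℕ) : PowerSeries.constantCoeff (qFact n) = (n.factorial : ℂ) := by
  induction n with
  | zero => simp [qFact_zero]
  | succ n ih =>
    rw [qFact_succ, map_mul, ih, constantCoeff_qNum, Nat.factorial_succ]
    push_cast
    rfl

theorem isPos_qFact (n : ℕ) : IsPos (qFact n) :=
  ⟨n.factorial, by exact_mod_cast n.factorial_pos, by rw [constantCoeff_qFact]; simp⟩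

end QuantumEuclid

namespace QuantumEuclid

/-! ### Complete modules over `ℂ[[ℏ]]` -/

/-- `ℏ`-adically separated and complete `ℂ[[ℏ]]`-modules: completeness is expressed by the
existence of all sums `∑ ℏᵏ bₖ`. -/
class HComplete (M : Type) [AddCommGroup M] [Module Ch M] : Prop where
  haus : ∀ x : M, (∀ n : ℕ, ∃ y : M, x = (PowerSeries.X : Ch) ^ n • y) → x = 0
  exists_sum : ∀ b : ℕ → M, ∃ s : M, ∀ n : ℕ, ∃ y : M,
    s = ∑ k ∈ Finset.range n, (PowerSeries.X : Ch) ^ k • b k + (PowerSeries.X : Ch) ^ n • y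

section Complete

variable {M N : Type} [AddCommGroup M] [Module Ch M] [AddCommGroup N] [Module Ch N]

/-- In a separated module a family that is stable under division by `ℏ` vanishes. -/
theorem eq_zero_of_eq_X_smul [HComplete M] {ι : Type*} (D : ι → M)
    (h : ∀ i, ∃ i', D i = (PowerSeries.X : Ch) • D i') (i : ι) : D i = 0 := by
  refine HComplete.haus _ fun n => ?_
  suffices ∀ n i, ∃ i', D i = (PowerSeries.X : Ch) ^ n • D i' by
    obtain ⟨i', hi⟩ := this n i
    exact ⟨_, hi⟩
  intro n
  induction n with
  | zero => exact fun i => ⟨i, by simp⟩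
  | succ n ih =>
    intro i
    obtain ⟨i', hi⟩ := ih i
    obtain ⟨j, hj⟩ := h i'
    exact ⟨j, by rw [hi, hj, smul_smul, ← pow_succ]⟩

/-- The sum `∑ ℏᵏ bₖ` in a complete module. -/
def hsum [HComplete M] (b : ℕ → M) : M := Classical.choose (HComplete.exists_sum b)

theorem hsum_spec [HComplete M] (b : ℕ → M) (n : ℕ) : ∃ y : M,
    hsum b = ∑ k ∈ Finset.range n, (PowerSeries.X : Ch) ^ k • b k +
      (PowerSeries.X : Ch) ^ n • y :=
  Classical.choose_spec (HComplete.exists_sum b) n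

theorem eq_hsum [HComplete M] {b : ℕ → M} {s : M}
    (h : ∀ n : ℕ, ∃ y : M, s = ∑ k ∈ Finset.range n, (PowerSeries.X : Ch) ^ k • b k +
      (PowerSeries.X : Ch) ^ n • y) : s = hsum b := by
  refine sub_eq_zero.mp (HComplete.haus _ fun n => ?_)
  obtain ⟨y, hy⟩ := h n
  obtain ⟨z, hz⟩ := hsum_spec b n
  exact ⟨y - z, by rw [hy, hz, smul_sub]; abel⟩

theorem map_hsum [HComplete M] [HComplete N] (f : M →ₗ[Ch] N) (b : ℕ → M) :
    f (hsum b) = hsum fun k => f (b k) := by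
  refine eq_hsum fun n => ?_
  obtain ⟨y, hy⟩ := hsum_spec b n
  exact ⟨f y, by rw [hy]; simp⟩

theorem hsum_add [HComplete M] (b c : ℕ → M) :
    hsum (fun k => b k + c k) = hsum b + hsum c := by
  refine (eq_hsum fun n => ?_).symm
  obtain ⟨y, hy⟩ := hsum_spec b n
  obtain ⟨z, hz⟩ := hsum_spec c n
  refine ⟨y + z, ?_⟩
  rw [hy, hz]
  simp only [smul_add, Finset.sum_add_distrib]
  abel

theorem hsum_smul [HComplete M] (a : Ch) (b : ℕ → M) :
    hsum (fun k => a • b k) = a • hsum b :=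
  (map_hsum (LinearMap.lsmul Ch M a) b).symm

theorem hsum_succ [HComplete M] (b : ℕ → M) :
    hsum b = b 0 + (PowerSeries.X : Ch) • hsum fun k => b (k + 1) := by
  refine (eq_hsum fun n => ?_).symm
  obtain ⟨y, hy⟩ := hsum_spec (fun k => b (k + 1)) n
  cases n with
  | zero => exact ⟨b 0 + (PowerSeries.X : Ch) • hsum fun k => b (k + 1), by simp⟩
  | succ n =>
    obtain ⟨y, hy⟩ := hsum_spec (fun k => b (k + 1)) n
    refine ⟨y, ?_⟩
    rw [hy, Finset.sum_range_succ', pow_zero, one_smul, smul_add, Finset.smul_sum, smul_smul,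
      ← pow_succ']
    simp only [smul_smul, ← pow_succ']
    abel

theorem hsum_zero [HComplete M] : hsum (fun _ => (0 : M)) = 0 :=
  (eq_hsum fun n => ⟨0, by simp⟩).symm

theorem HComplete.of_surjective [HComplete M] (f : M →ₗ[Ch] N) (hf : Function.Surjective f)
    (h : ∀ x : N, (∀ n : ℕ, ∃ y : N, x = (PowerSeries.X : Ch) ^ n • y) → x = 0) :
    HComplete N := by
  refine ⟨h, fun b => ?_⟩
  choose c hc using fun k => hf (b k)
  refine ⟨f (hsum c), fun n => ?_⟩
  obtain ⟨y, hy⟩ := hsum_spec c n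
  exact ⟨f y, by rw [hy]; simp [hc]⟩

instance [HComplete M] {ι : Type} : HComplete (ι → M) where
  haus x h := funext fun i => HComplete.haus _ fun n => by
    obtain ⟨y, hy⟩ := h n
    exact ⟨y i, by rw [hy]; rfl⟩
  exists_sum b := by
    refine ⟨fun i => hsum fun k => b k i, fun n => ?_⟩
    choose y hy using fun i => hsum_spec (fun k => b k i) n
    exact ⟨y, funext fun i => by simp [hy i]⟩

instance [HComplete M] {m n : Type} : HComplete (Matrix m n M) :=
  inferInstanceAs (HComplete (m → n → M))

instance [HComplete M] : HComplete (Module.End Ch M) where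
  haus x h := LinearMap.ext fun i => HComplete.haus _ fun n => by
    obtain ⟨y, hy⟩ := h n
    exact ⟨y i, by rw [hy]; rfl⟩
  exists_sum b := by
    have key : ∀ c : ℕ → Module.End Ch M, ∃ s : Module.End Ch M,
        ∀ x, s x = hsum fun k => c k x := fun c =>
      ⟨{ toFun := fun x => hsum fun k => c k x
         map_add' := fun x y => by simp only [map_add]; exact hsum_add _ _
         map_smul' := fun a x => by simp only [map_smul]; exact hsum_smul _ _ }, fun _ => rfl⟩
    obtain ⟨s, hs⟩ := key b
    refine ⟨s, fun n => ?_⟩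
    induction n with
    | zero => exact ⟨s, by simp⟩
    | succ n _ =>
      obtain ⟨t, ht⟩ := key fun k => b (k + (n + 1))
      refine ⟨t, LinearMap.ext fun x => ?_⟩
      have : ∀ m, hsum (fun k => b k x) = ∑ k ∈ Finset.range m, (PowerSeries.X : Ch) ^ k • b k x +
          (PowerSeries.X : Ch) ^ m • hsum fun k => b (k + m) x := by
        intro m
        induction m with
        | zero => simp
        | succ m ih =>
          rw [ih, hsum_succ, Finset.sum_range_succ, smul_add, smul_smul, ← pow_succ, add_assoc]
          simp only [zero_add, add_assoc, add_comm 1]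
      rw [hs, this (n + 1)]
      simp [ht]

end Complete

/-! ### Power series with coefficients in a `ℂ`-algebra -/

section SeriesModule

section

variable {A : Type} [Ring A]

theorem HComplete.of_series [Module Ch A⟦X⟧]
    (h : ∀ x : A⟦X⟧, (PowerSeries.X : Ch) • x = PowerSeries.X * x) : HComplete A⟦X⟧ := by
  have h' (n : ℕ) (x : A⟦X⟧) : (PowerSeries.X : Ch) ^ n • x = PowerSeries.X ^ n * x := by
    induction n with
    | zero => simp
    | succ n ih => rw [pow_succ', mul_smul, ih, h, pow_succ', mul_assoc]
  constructor
  · intro x hx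
    ext n
    obtain ⟨y, hy⟩ := hx (n + 1)
    rw [hy, h', PowerSeries.coeff_X_pow_mul', if_neg (by omega), map_zero]
  · intro b
    refine ⟨PowerSeries.mk fun n => ∑ k ∈ Finset.range (n + 1), PowerSeries.coeff (n - k) (b k),
      fun n => ?_⟩
    simp only [h']
    have hd : PowerSeries.X ^ n ∣ (PowerSeries.mk fun n => ∑ k ∈ Finset.range (n + 1),
        PowerSeries.coeff (n - k) (b k)) -
        ∑ k ∈ Finset.range n, PowerSeries.X ^ k * b k := by
      rw [PowerSeries.X_pow_dvd_iff]
      intro m hm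
      rw [map_sub, PowerSeries.coeff_mk, map_sum, sub_eq_zero]
      simp only [PowerSeries.coeff_X_pow_mul']
      rw [Finset.sum_ite, Finset.sum_const_zero, add_zero]
      refine Finset.sum_congr ?_ fun _ _ => rfl
      ext k
      simp only [Finset.mem_range, Finset.mem_filter]
      omega
    obtain ⟨y, hy⟩ := hd
    exact ⟨y, by rw [← hy]; abel⟩

theorem exists_series_eq (x : A⟦X⟧) : ∃ y : A⟦X⟧,
    x = PowerSeries.C (PowerSeries.constantCoeff x) + PowerSeries.X * y := by
  have : PowerSeries.X ∣ x - PowerSeries.C (PowerSeries.constantCoeff x) := by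
    rw [PowerSeries.X_dvd_iff]; simp
  obtain ⟨y, hy⟩ := this
  exact ⟨y, by rw [← hy]; abel⟩

instance : HComplete Ch := HComplete.of_series (A := ℂ) fun _ => rfl

variable {M : Type} [AddCommGroup M] [Module Ch M]

/-- An additive map on `A[[ℏ]]` that commutes with `ℏ` vanishes if it vanishes on constant series.
Linearity over `ℂ[[ℏ]]` is not required, so that `x ↦ F (x y) - F x F y` is covered without any
compatibility of scalars with products. -/
theorem series_additive_ext [HComplete M] (D : A⟦X⟧ →+ M)
    (hX : ∀ x, D (PowerSeries.X * x) = (PowerSeries.X : Ch) • D x)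
    (hC : ∀ a, D (PowerSeries.C a) = 0) (x : A⟦X⟧) : D x = 0 := by
  refine eq_zero_of_eq_X_smul D (fun x => ?_) x
  obtain ⟨y, hy⟩ := exists_series_eq x
  exact ⟨y, by rw [hy, map_add, hC, hX, zero_add]⟩

end

variable {A : Type} [Ring A] [Algebra ℂ A]

theorem X_smul_series (x : A⟦X⟧) : (PowerSeries.X : Ch) • x = PowerSeries.X * x := by
  rw [Algebra.smul_def]
  change PowerSeries.map (algebraMap ℂ A) PowerSeries.X * x = _
  rw [PowerSeries.map_X]

theorem C_smul_series (c : ℂ) (x : A⟦X⟧) : (PowerSeries.C c : Ch) • x = c • x := by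
  rw [Algebra.smul_def]
  change PowerSeries.map (algebraMap ℂ A) (PowerSeries.C c) * x = _
  rw [PowerSeries.map_C]
  ext n
  rw [PowerSeries.coeff_C_mul, PowerSeries.coeff_smul, Algebra.smul_def]

instance : HComplete A⟦X⟧ := HComplete.of_series X_smul_series

variable {M : Type} [AddCommGroup M] [Module Ch M]

/-- Linear maps from `A[[ℏ]]` to a complete module are determined by their values on `A`. -/
theorem series_linear_ext [HComplete M] {f g : A⟦X⟧ →ₗ[Ch] M}
    (h : ∀ a, f (PowerSeries.C a) = g (PowerSeries.C a)) : f = g := by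
  refine LinearMap.ext fun x => sub_eq_zero.mp ?_
  refine series_additive_ext ((f - g : A⟦X⟧ →ₗ[Ch] M) : A⟦X⟧ →+ M) (fun x => ?_) (fun a => ?_) x
  · rw [← X_smul_series]; exact map_smul (f - g) _ _
  · exact sub_eq_zero.mpr (h a)

/-- The extension of a `ℂ`-linear map `A → M` to `A[[ℏ]]`, for a complete module `M`. -/
def seriesLin [HComplete M] (g : A → M) (h0 : ∀ a b, g (a + b) = g a + g b)
    (hg : ∀ (c : ℂ) (a : A), g (c • a) = (PowerSeries.C c : Ch) • g a) : A⟦X⟧ →ₗ[Ch] M where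
  toFun x := hsum fun k => g (PowerSeries.coeff k x)
  map_add' x y := by simp only [map_add, h0]; exact hsum_add _ _
  map_smul' c x := by
    have h00 : g 0 = 0 := by simpa using h0 0 0
    let F : A⟦X⟧ →+ M :=
      { toFun := fun x => hsum fun k => g (PowerSeries.coeff k x)
        map_zero' := by simp only [map_zero, h00]; exact hsum_zero
        map_add' := fun x y => by simp only [map_add, h0]; exact hsum_add _ _ }
    have hFX (x : A⟦X⟧) : F (PowerSeries.X * x) = (PowerSeries.X : Ch) • F x := by
      change hsum _ = _
      rw [hsum_succ]
      simp only [PowerSeries.coeff_zero_X_mul, h00, zero_add, PowerSeries.coeff_succ_X_mul]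
      rfl
    have hFC (c : ℂ) (x : A⟦X⟧) : F ((PowerSeries.C c : Ch) • x) =
        (PowerSeries.C c : Ch) • F x := by
      change hsum _ = _ • hsum _
      rw [← hsum_smul]
      simp only [C_smul_series, PowerSeries.coeff_smul, hg]
    let D : ℂ⟦X⟧ →+ M := ((AddMonoidHom.smul.flip (F x)) : Ch →+ M)
    let D' : ℂ⟦X⟧ →+ M := F.comp ((AddMonoidHom.smul.flip x) : Ch →+ A⟦X⟧)
    refine sub_eq_zero.mp (series_additive_ext (D' - D) (fun c => ?_) (fun a => ?_) c)
    · change F (((PowerSeries.X : Ch) * c) • x) - ((PowerSeries.X : Ch) * c) • F x =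
        _ • (F (c • x) - c • F x)
      rw [mul_smul, X_smul_series, hFX, smul_sub, mul_smul]
    · exact sub_eq_zero.mpr (hFC a x)

theorem seriesLin_apply [HComplete M] (g : A → M) (h0 : ∀ a b, g (a + b) = g a + g b)
    (hg : ∀ (c : ℂ) (a : A), g (c • a) = (PowerSeries.C c : Ch) • g a) (x : A⟦X⟧) :
    seriesLin g h0 hg x = hsum fun k => g (PowerSeries.coeff k x) := rfl

theorem seriesLin_C [HComplete M] (g : A → M) (h0 : ∀ a b, g (a + b) = g a + g b)
    (hg : ∀ (c : ℂ) (a : A), g (c • a) = (PowerSeries.C c : Ch) • g a) (a : A) :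
    seriesLin g h0 hg (PowerSeries.C a) = g a := by
  have h00 : g 0 = 0 := by simpa using h0 0 0
  rw [seriesLin_apply, hsum_succ]
  simp only [PowerSeries.coeff_zero_C, PowerSeries.coeff_succ_C, h00]
  rw [hsum_zero, smul_zero, add_zero]

variable {B : Type} [Ring B] [Algebra Ch B]

theorem map_mul_of_map_C_mul [HComplete B] (F : A⟦X⟧ →ₗ[Ch] B)
    (h : ∀ a y, F (PowerSeries.C a * y) = F (PowerSeries.C a) * F y) (x y : A⟦X⟧) :
    F (x * y) = F x * F y := by
  have hX : ∀ y : A⟦X⟧, F (PowerSeries.X * y) = (PowerSeries.X : Ch) • F y := fun y => by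
    rw [← X_smul_series, map_smul]
  let D : A⟦X⟧ →+ B := (F : A⟦X⟧ →+ B).comp (AddMonoidHom.mulRight y)
  let D' : A⟦X⟧ →+ B := (AddMonoidHom.mulRight (F y)).comp (F : A⟦X⟧ →+ B)
  refine sub_eq_zero.mp (series_additive_ext (D - D') (fun x => ?_) (fun a => ?_) x)
  · change F (PowerSeries.X * x * y) - F (PowerSeries.X * x) * F y =
      (PowerSeries.X : Ch) • (F (x * y) - F x * F y)
    rw [mul_assoc, hX, hX, smul_sub, smul_mul_assoc]
  · exact sub_eq_zero.mpr (h a y)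

/-- The extension of a homomorphism `A → B` to `A[[ℏ]]`, for a complete algebra `B`. -/
def seriesLift [HComplete B] (g : A →+* B)
    (hg : ∀ (c : ℂ) (a : A), g (c • a) = (PowerSeries.C c : Ch) • g a) : A⟦X⟧ →ₐ[Ch] B :=
  AlgHom.ofLinearMap (seriesLin g (map_add g) hg)
    (by rw [← map_one (PowerSeries.C (R := A)), seriesLin_C]; exact map_one g)
    (map_mul_of_map_C_mul _ fun a y => by
      rw [seriesLin_C, seriesLin_apply, seriesLin_apply,
        ← LinearMap.mulLeft_apply (R := Ch) (g a), map_hsum]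
      simp)

theorem seriesLift_C [HComplete B] (g : A →+* B)
    (hg : ∀ (c : ℂ) (a : A), g (c • a) = (PowerSeries.C c : Ch) • g a) (a : A) :
    seriesLift g hg (PowerSeries.C a) = g a := seriesLin_C g (map_add g) hg a

/-- Linear maps on `A[[ℏ]]` are automatically `ℏ`-adically continuous. -/
theorem series_map_eq_hsum [HComplete M] (f : A⟦X⟧ →ₗ[Ch] M) (x : A⟦X⟧) :
    f x = hsum fun k => f (PowerSeries.C (PowerSeries.coeff k x)) := by
  have h : f = seriesLin (fun a => f (PowerSeries.C a)) (fun a b => by simp only [map_add])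
      (fun c a => by
        rw [← map_smul, C_smul_series]
        congr 1
        ext n
        simp [PowerSeries.coeff_C]) :=
    series_linear_ext fun a => by rw [seriesLin_C]
  conv_lhs => rw [h, seriesLin_apply]

end SeriesModule

/-! ### Algebras given by generators and relations -/

section Presented

variable {S : Type} {B : Type} [Ring B] [Algebra Ch B]

/-- Evaluation of noncommutative polynomials in a `ℂ[[ℏ]]`-algebra. -/
def evalFree (g : S → B) : FreeAlgebra ℂ S →+* B :=
  letI : Algebra ℂ B := Algebra.compHom B (PowerSeries.C : ℂ →+* Ch)
  (FreeAlgebra.lift ℂ g : FreeAlgebra ℂ S →ₐ[ℂ] B).toRingHom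

@[simp] theorem evalFree_ι (g : S → B) (s : S) : evalFree g (FreeAlgebra.ι ℂ s) = g s := by
  let _ : Algebra ℂ B := Algebra.compHom B (PowerSeries.C : ℂ →+* Ch)
  exact FreeAlgebra.lift_ι_apply g s

theorem evalFree_smul (g : S → B) (c : ℂ) (a : FreeAlgebra ℂ S) :
    evalFree g (c • a) = (PowerSeries.C c : Ch) • evalFree g a := by
  let _ : Algebra ℂ B := Algebra.compHom B (PowerSeries.C : ℂ →+* Ch)
  exact map_smul (FreeAlgebra.lift ℂ g : FreeAlgebra ℂ S →ₐ[ℂ] B) c a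

/-- Evaluation of noncommutative power series in a complete algebra. -/
def evalH [HComplete B] (g : S → B) : HFree S →ₐ[Ch] B :=
  seriesLift (evalFree g) (evalFree_smul g)

@[simp] theorem evalH_gen [HComplete B] (g : S → B) (s : S) : evalH g (gen s) = g s := by
  rw [evalH, gen, seriesLift_C, evalFree_ι]

variable (rels : Set (HFree S))

theorem HAlg.mk_surjective : Function.Surjective (HAlg.mk rels) := RingCon.mkₐ_surjective _

variable {rels}

theorem HAlg.mk_eq_zero {x : HFree S} : HAlg.mk rels x = 0 ↔ x ∈ closedIdeal rels := by
  rw [TwoSidedIdeal.mem_iff]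
  exact RingCon.eq _

theorem isHClosed_closedIdeal : IsHClosed (closedIdeal rels) := by
  intro x hx
  rw [closedIdeal, TwoSidedIdeal.mem_sInf]
  intro I hI
  refine hI.2 x fun n => ?_
  obtain ⟨y, hy, hxy⟩ := hx n
  rw [closedIdeal, TwoSidedIdeal.mem_sInf] at hy
  exact ⟨y, hy I hI, hxy⟩

theorem HAlg.mk_rel {x : HFree S} (hx : x ∈ rels) : HAlg.mk rels x = 0 := by
  rw [HAlg.mk_eq_zero, closedIdeal, TwoSidedIdeal.mem_sInf]
  exact fun I hI => hI.1 hx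

theorem X_pow_smul_series {A : Type} [Ring A] [Algebra ℂ A] (n : ℕ) (x : A⟦X⟧) :
    (PowerSeries.X : Ch) ^ n • x = PowerSeries.X ^ n * x := by
  induction n with
  | zero => simp
  | succ n ih => rw [pow_succ', mul_smul, ih, X_smul_series, pow_succ', mul_assoc]

instance : HComplete (HAlg rels) := by
  refine HComplete.of_surjective (HAlg.mk rels).toLinearMap (HAlg.mk_surjective rels) fun x h => ?_
  obtain ⟨f, rfl⟩ := HAlg.mk_surjective rels x
  rw [HAlg.mk_eq_zero]
  refine isHClosed_closedIdeal f fun n => ?_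
  obtain ⟨y, hy⟩ := h n
  obtain ⟨g, rfl⟩ := HAlg.mk_surjective rels y
  refine ⟨f - (PowerSeries.X : Ch) ^ n • g, ?_, fun k hk => ?_⟩
  · rw [← HAlg.mk_eq_zero, map_sub, map_smul, hy, sub_self]
  · rw [X_pow_smul_series, map_sub, PowerSeries.coeff_X_pow_mul', if_neg (by omega), sub_zero]

/-- A homomorphism of rings that kills the relators and has a closed kernel descends to the
presented algebra. -/
theorem closedIdeal_le_ker {R : Type} [Ring R] (Φ : HFree S →+* R) (h : ∀ r ∈ rels, Φ r = 0)
    (hc : ∀ x, (∀ n : ℕ, ∃ y, Φ y = 0 ∧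
      ∀ k < n, PowerSeries.coeff k x = PowerSeries.coeff k y) → Φ x = 0) :
    (closedIdeal rels).ringCon ≤ RingCon.ker Φ := by
  intro x y hxy
  rw [TwoSidedIdeal.rel_iff, closedIdeal, TwoSidedIdeal.mem_sInf] at hxy
  have := hxy (TwoSidedIdeal.ker Φ) ⟨fun r hr => by
    rw [Set.mem_ofPred_eq, TwoSidedIdeal.mem_ker]; exact h r hr, fun x hx => by
    rw [TwoSidedIdeal.mem_ker]
    refine hc x fun n => ?_
    obtain ⟨y, hy, hxy⟩ := hx n
    exact ⟨y, by rwa [TwoSidedIdeal.mem_ker] at hy, hxy⟩⟩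
  rw [TwoSidedIdeal.mem_ker, map_sub] at this
  exact sub_eq_zero.mp this

/-- The universal property of an algebra given by generators and relations. -/
def HAlg.lift [HComplete B] (g : S → B) (h : ∀ r ∈ rels, evalH g r = 0) : HAlg rels →ₐ[Ch] B :=
  RingCon.liftₐ _ (evalH g) (closedIdeal_le_ker _ h fun x hx => by
    refine HComplete.haus _ fun n => ?_
    obtain ⟨y, hy, hxy⟩ := hx n
    have hd : PowerSeries.X ^ n ∣ x - y := by
      rw [PowerSeries.X_pow_dvd_iff]
      intro m hm
      rw [map_sub, hxy m hm, sub_self]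
    obtain ⟨z, hz⟩ := hd
    refine ⟨evalH g z, ?_⟩
    change evalH g y = 0 at hy
    change evalH g x = _
    rw [← map_smul, X_pow_smul_series, ← hz, map_sub, hy, sub_zero])

theorem HAlg.lift_mk [HComplete B] (g : S → B) (h : ∀ r ∈ rels, evalH g r = 0) (x : HFree S) :
    HAlg.lift g h (HAlg.mk rels x) = evalH g x := rfl

theorem HAlg.lift_gen [HComplete B] (g : S → B) (h : ∀ r ∈ rels, evalH g r = 0) (s : S) :
    HAlg.lift g h (HAlg.mk rels (gen s)) = g s := by
  rw [HAlg.lift_mk, evalH_gen]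

/-- Two linear maps that agree on all words in the generators are equal. -/
theorem HAlg.linear_ext {M : Type} [AddCommGroup M] [Module Ch M] [HComplete M]
    {f f' : HAlg rels →ₗ[Ch] M} (h1 : f 1 = f' 1)
    (h : ∀ (s : S) (x : HAlg rels), f x = f' x →
      f (HAlg.mk rels (gen s) * x) = f' (HAlg.mk rels (gen s) * x)) : f = f' := by
  suffices f ∘ₗ (HAlg.mk rels).toLinearMap = f' ∘ₗ (HAlg.mk rels).toLinearMap by
    refine LinearMap.ext fun x => ?_
    obtain ⟨y, rfl⟩ := HAlg.mk_surjective rels x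
    exact LinearMap.congr_fun this y
  refine series_linear_ext fun a => ?_
  change f (HAlg.mk rels (PowerSeries.C a)) = f' (HAlg.mk rels (PowerSeries.C a))
  have hmem : ∀ a : FreeAlgebra ℂ S, ∀ x : HAlg rels, f x = f' x →
      f (HAlg.mk rels (PowerSeries.C a) * x) = f' (HAlg.mk rels (PowerSeries.C a) * x) := by
    -- stability under left multiplication is an induction hypothesis that passes to products
    intro a
    induction a using FreeAlgebra.induction with
    | grade0 r =>
      intro x hx
      have : HAlg.mk rels (PowerSeries.C (algebraMap ℂ _ r)) =
          algebraMap Ch _ (PowerSeries.C r) := by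
        rw [← AlgHom.commutes (HAlg.mk rels)]
        congr 1
        exact (PowerSeries.map_C _ _).symm
      rw [this, ← Algebra.smul_def, map_smul, map_smul, hx]
    | grade1 s => exact h s
    | mul a b ha hb =>
      intro x hx
      rw [map_mul PowerSeries.C, map_mul (HAlg.mk rels), mul_assoc]
      exact ha _ (hb x hx)
    | add a b ha hb =>
      intro x hx
      rw [map_add, map_add, add_mul, map_add, map_add, ha x hx, hb x hx]
  simpa using hmem a 1 h1

theorem HAlg.algHom_ext [HComplete B] {f f' : HAlg rels →ₐ[Ch] B}
    (h : ∀ s, f (HAlg.mk rels (gen s)) = f' (HAlg.mk rels (gen s))) : f = f' := by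
  have : f.toLinearMap = f'.toLinearMap := HAlg.linear_ext (by simp) fun s x hx => by
    simp only [AlgHom.toLinearMap_apply, map_mul] at hx ⊢
    rw [hx, h]
  exact AlgHom.ext fun x => LinearMap.congr_fun this x

end Presented

end QuantumEuclid

namespace QuantumEuclid

/-! ### Bijectivity modulo `ℏ` -/

section Bijectivity

variable {M N : Type} [AddCommGroup M] [Module Ch M] [AddCommGroup N] [Module Ch N]

/-- A linear map of complete modules that is surjective modulo `ℏ` is surjective: preimages are
built up order by order. -/
theorem surjective_of_surjective_mod [HComplete M] [HComplete N] (f : M →ₗ[Ch] N)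
    (h : ∀ z : N, ∃ x y, z = f x + (PowerSeries.X : Ch) • y) : Function.Surjective f := by
  choose s t hst using h
  intro z
  refine ⟨hsum fun k => s (t^[k] z), ?_⟩
  rw [map_hsum]
  refine (eq_hsum fun n => ⟨t^[n] z, ?_⟩).symm
  induction n with
  | zero => simp
  | succ n ih =>
    conv_lhs => rw [ih, hst (t^[n] z)]
    rw [Finset.sum_range_succ, Function.iterate_succ_apply', smul_add, smul_smul, ← pow_succ]
    abel

/-- A linear map from a separated module is injective if every element of the kernel is `ℏ` times
an element of the kernel. -/
theorem injective_of_injective_mod [HComplete M] (f : M →ₗ[Ch] N)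
    (h : ∀ x, f x = 0 → ∃ y, x = (PowerSeries.X : Ch) • y ∧ f y = 0) : Function.Injective f := by
  refine (injective_iff_map_eq_zero f).mpr fun x hx => ?_
  exact eq_zero_of_eq_X_smul (fun x : {x // f x = 0} => x.1)
    (fun x => by obtain ⟨y, hy, hy'⟩ := h x.1 x.2; exact ⟨⟨y, hy'⟩, hy⟩) ⟨x, hx⟩

theorem smul_eq_hsum [HComplete M] (c : Ch) (v : M) :
    c • v = hsum fun k => (PowerSeries.C (PowerSeries.coeff k c) : Ch) • v := by
  refine eq_hsum fun n => ⟨(PowerSeries.mk fun i => PowerSeries.coeff (i + n) c : Ch) • v, ?_⟩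
  conv_lhs => rw [PowerSeries.eq_X_pow_mul_shift_add_trunc n c]
  rw [add_smul, mul_smul, add_comm]
  congr 1
  rw [PowerSeries.trunc_apply]
  simp only [Nat.Ico_zero_eq_range]
  rw [show ((∑ m ∈ Finset.range n, Polynomial.monomial m (PowerSeries.coeff m c) :
    Polynomial ℂ) : Ch) = ∑ m ∈ Finset.range n, PowerSeries.X ^ m *
      PowerSeries.C (PowerSeries.coeff m c) by
    rw [← Polynomial.coeToPowerSeries.ringHom_apply, map_sum]
    refine Finset.sum_congr rfl fun m _ => ?_
    rw [Polynomial.coeToPowerSeries.ringHom_apply, Polynomial.coe_monomial,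
      PowerSeries.monomial_eq_C_mul_X_pow, mul_comm]]
  rw [Finset.sum_smul]
  simp only [mul_smul]

end Bijectivity

/-! ### Functional calculus in complete algebras -/

section Calculus

variable {A : Type} [Ring A] [Algebra ℂ A] {B : Type} [Ring B] [Algebra Ch B] [HComplete B]

/-- `e^{ℏ b}` in a complete algebra. -/
def hexp (b : B) : B := hsum fun k => (PowerSeries.C ((k.factorial : ℂ)⁻¹) : Ch) • b ^ k

/-- `[b]` in a complete algebra. -/
def hqNum (b : B) : B := (sinhc (1 : ℂ))⁻¹ • hsum fun k =>
  if Even k then (PowerSeries.C (((k + 1).factorial : ℂ)⁻¹) : Ch) • b ^ (k + 1) else 0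

theorem C_smul_eq (c : ℂ) (a : A) :
    (PowerSeries.C (c • a) : A⟦X⟧) = (PowerSeries.C c : Ch) • PowerSeries.C a := by
  rw [C_smul_series]
  ext n
  simp [PowerSeries.coeff_C]

theorem map_expH_series (F : A⟦X⟧ →ₐ[Ch] B) (x : A) : F (expH x) = hexp (F (PowerSeries.C x)) := by
  rw [← AlgHom.toLinearMap_apply, series_map_eq_hsum, hexp]
  congr 1
  ext k
  simp only [expH, PowerSeries.coeff_mk, AlgHom.toLinearMap_apply]
  rw [C_smul_eq, map_smul, map_pow, map_pow]

theorem qNum_eq_smul (x : A) : qNum x = (sinhc (1 : ℂ))⁻¹ • sinhc x := by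
  rw [Algebra.smul_def]; rfl

theorem map_qNum_series (F : A⟦X⟧ →ₐ[Ch] B) (x : A) : F (qNum x) = hqNum (F (PowerSeries.C x)) := by
  rw [qNum_eq_smul, map_smul, ← AlgHom.toLinearMap_apply, series_map_eq_hsum, hqNum]
  congr 2
  ext k
  simp only [sinhc, PowerSeries.coeff_mk, AlgHom.toLinearMap_apply]
  split_ifs
  · rw [C_smul_eq, map_smul, map_pow, map_pow]
  · simp

theorem hqNum_eq_qNum (x : A) : hqNum (PowerSeries.C x : A⟦X⟧) = qNum x :=
  (map_qNum_series (AlgHom.id Ch A⟦X⟧) x).symm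

variable {M : Type} [AddCommGroup M] [Module Ch M] [HComplete M]

omit [HComplete M] in
theorem pow_apply_of_eigen {T : Module.End Ch M} {v : M} {c : ℂ}
    (h : T v = (PowerSeries.C c : Ch) • v) (k : ℕ) :
    (T ^ k) v = (PowerSeries.C (c ^ k) : Ch) • v := by
  induction k with
  | zero => simp
  | succ k ih => rw [pow_succ', Module.End.mul_apply, ih, map_smul, h, smul_smul, ← map_mul,
      pow_succ]

theorem hexp_apply_of_eigen {T : Module.End Ch M} {v : M} {c : ℂ}
    (h : T v = (PowerSeries.C c : Ch) • v) : hexp T v = expH c • v := by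
  rw [hexp, ← LinearMap.applyₗ_apply_apply (R := Ch) v, map_hsum, smul_eq_hsum]
  congr 1
  ext k
  simp only [LinearMap.applyₗ_apply_apply, LinearMap.smul_apply, expH, PowerSeries.coeff_mk]
  rw [pow_apply_of_eigen h, smul_smul, ← map_mul]
  rfl

theorem hqNum_apply_of_eigen {T : Module.End Ch M} {v : M} {c : ℂ}
    (h : T v = (PowerSeries.C c : Ch) • v) : hqNum T v = qNum c • v := by
  rw [hqNum, LinearMap.smul_apply, ← LinearMap.applyₗ_apply_apply (R := Ch) v, map_hsum, qNum,
    mul_smul, Algebra.algebraMap_self, PowerSeries.map_id, id_eq, smul_eq_hsum (sinhc c)]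
  congr 2
  ext k
  simp only [LinearMap.applyₗ_apply_apply, sinhc, PowerSeries.coeff_mk]
  split_ifs
  · rw [LinearMap.smul_apply, pow_apply_of_eigen h, smul_smul, ← map_mul]
    rfl
  · simp

end Calculus

/-! ### Functions of commuting elements -/

section Commuting

variable {A : Type} [Ring A] [Algebra ℂ A]

theorem semiconjBy_expH {a x y : A} (h : SemiconjBy a x y) :
    SemiconjBy (PowerSeries.C a) (expH x) (expH y) := by
  ext n
  rw [PowerSeries.coeff_C_mul, PowerSeries.coeff_mul_C]
  simp only [expH, PowerSeries.coeff_mk]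
  rw [mul_smul_comm, smul_mul_assoc, (h.pow_right n).eq]

theorem semiconjBy_sqrtOne {a : A} {g g' : A⟦X⟧} (h : SemiconjBy (PowerSeries.C a) g g') :
    SemiconjBy (PowerSeries.C a) (sqrtOne g) (sqrtOne g') := by
  have h1 : SemiconjBy (PowerSeries.C a) (g - 1) (g' - 1) := h.sub_right (SemiconjBy.one_right _)
  ext n
  rw [PowerSeries.coeff_C_mul, PowerSeries.coeff_mul_C]
  simp only [sqrtOne, PowerSeries.coeff_mk]
  rw [Finset.mul_sum, Finset.sum_mul]
  refine Finset.sum_congr rfl fun k _ => ?_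
  rw [mul_smul_comm, smul_mul_assoc, ← PowerSeries.coeff_C_mul, ← PowerSeries.coeff_mul_C,
    (h1.pow_right k).eq]

theorem commute_expH {x : A} {z : A⟦X⟧} (h : Commute (PowerSeries.C x) z) :
    Commute (expH x) z := by
  have hc (k n : ℕ) : x ^ k * PowerSeries.coeff n z = PowerSeries.coeff n z * x ^ k := by
    rw [← PowerSeries.coeff_C_mul, ← PowerSeries.coeff_mul_C, map_pow, (h.pow_left k).eq]
  ext n
  rw [PowerSeries.coeff_mul, PowerSeries.coeff_mul, ← Finset.Nat.sum_antidiagonal_swap]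
  refine Finset.sum_congr rfl fun p _ => ?_
  simp only [expH, PowerSeries.coeff_mk, Prod.fst_swap, Prod.snd_swap]
  rw [smul_mul_assoc, mul_smul_comm, hc]

theorem commute_map_algebraMap (c : Ch) (z : A⟦X⟧) :
    Commute (PowerSeries.map (algebraMap ℂ A) c) z :=
  Algebra.commutes (A := A⟦X⟧) c z

/-- The divided difference `(cosh (ℏ √u) - cosh (ℏ √v)) / (ℏ² (u - v))`, for commuting `u`, `v`. -/
def coshDiff (u v : A) : A⟦X⟧ :=
  PowerSeries.mk fun n => if Even n then
    (((n + 2).factorial : ℂ)⁻¹) • ∑ i ∈ Finset.range (n / 2 + 1), u ^ i * v ^ (n / 2 - i) else 0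

/-- `(cosh (ℏ √u) - 1) / ℏ²`. -/
def coshc (u : A) : A⟦X⟧ :=
  PowerSeries.mk fun n => if Even n then (((n + 2).factorial : ℂ)⁻¹) • u ^ (n / 2 + 1) else 0

theorem C_sub_mul_coshDiff {u v : A} (h : Commute u v) :
    PowerSeries.C (u - v) * coshDiff u v = coshc u - coshc v := by
  ext n
  rw [PowerSeries.coeff_C_mul, map_sub]
  simp only [coshDiff, coshc, PowerSeries.coeff_mk]
  split_ifs
  · rw [mul_smul_comm, ← smul_sub, ← h.mul_geom_sum₂]
    simp
  · simp

theorem semiconjBy_coshDiff {a u v u' v' : A} (hu : SemiconjBy a u u') (hv : SemiconjBy a v v') :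
    SemiconjBy (PowerSeries.C a) (coshDiff u v) (coshDiff u' v') := by
  ext n
  rw [PowerSeries.coeff_C_mul, PowerSeries.coeff_mul_C]
  simp only [coshDiff, PowerSeries.coeff_mk]
  split_ifs
  · rw [mul_smul_comm, smul_mul_assoc, Finset.mul_sum, Finset.sum_mul]
    congr 1
    exact Finset.sum_congr rfl fun i _ => ((hu.pow_right i).mul_right (hv.pow_right _)).eq
  · simp

theorem constantCoeff_coshDiff (u v : A) :
    PowerSeries.constantCoeff (coshDiff u v) = algebraMap ℂ A 2⁻¹ := by
  rw [← PowerSeries.coeff_zero_eq_constantCoeff_apply]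
  simp [coshDiff, Algebra.algebraMap_eq_smul_one]

theorem X_sq_mul_coshc (x : A) :
    PowerSeries.X ^ 2 * ((2 : ℂ) • coshc (x ^ 2)) = expH x + expH (-x) - 2 := by
  ext n
  rw [PowerSeries.coeff_X_pow_mul']
  rcases n with _ | _ | n
  · have : PowerSeries.constantCoeff (2 : A⟦X⟧) = 2 := by
      rw [← map_ofNat (PowerSeries.C (R := A)) 2, PowerSeries.constantCoeff_C]
    simp [expH, this]; norm_num
  · have : PowerSeries.coeff 1 (2 : A⟦X⟧) = 0 := by
      rw [← map_ofNat (PowerSeries.C (R := A)) 2, PowerSeries.coeff_C]; simp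
    simp [expH, this]
  · have : PowerSeries.coeff (n + 2) (2 : A⟦X⟧) = 0 := by
      rw [← map_ofNat (PowerSeries.C (R := A)) 2, PowerSeries.coeff_C]; simp
    rw [if_pos (by omega), map_sub, map_add, this, sub_zero, two_smul, map_add,
      show n + 1 + 1 - 2 = n by omega]
    simp only [coshc, expH, PowerSeries.coeff_mk]
    by_cases h : Even n
    · rw [if_pos h, Even.neg_pow (by simpa [Nat.even_add_one] using h), ← pow_mul,
        show 2 * (n / 2 + 1) = n + 1 + 1 by have := Nat.two_mul_div_two_of_even h; omega]
    · rw [if_neg h, Odd.neg_pow (by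
        rw [← Nat.not_even_iff_odd]; simpa [Nat.even_add_one] using h)]
      simp

/-- The addition theorem `cosh (a + b) - cosh (a - b) = 2 sinh a sinh b`, at `a = ℏ x`, `b = ℏ y`.
-/
theorem coshc_sub_coshc {x y : A} (h : Commute x y) :
    coshc ((x + y) ^ 2) - coshc ((x - y) ^ 2) = (2 : ℂ) • (sinhc x * sinhc y) := by
  have hX2 : ∀ z w : A⟦X⟧, PowerSeries.X ^ 2 * z = PowerSeries.X ^ 2 * w → z = w := by
    intro z w hzw
    ext n
    have := congrArg (PowerSeries.coeff (n + 2)) hzw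
    simpa [PowerSeries.coeff_X_pow_mul'] using this
  have h2 : ∀ z w : A⟦X⟧, (2 : ℂ) • z = (2 : ℂ) • w → z = w := fun z w hzw => by
    have := congrArg ((2⁻¹ : ℂ) • ·) hzw
    simpa [smul_smul] using this
  -- clear the denominators `2` and `ℏ²`
  apply h2
  apply hX2
  rw [smul_sub, mul_sub, X_sq_mul_coshc, X_sq_mul_coshc]
  have e : PowerSeries.X ^ 2 * ((2 : ℂ) • ((2 : ℂ) • (sinhc x * sinhc y))) =
      (PowerSeries.X * ((2 : ℂ) • sinhc x)) * (PowerSeries.X * ((2 : ℂ) • sinhc y)) := by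
    rw [mul_assoc, ← mul_assoc ((2 : ℂ) • sinhc x) PowerSeries.X,
      (PowerSeries.commute_X ((2 : ℂ) • sinhc x)).eq, mul_assoc, ← mul_assoc PowerSeries.X,
      ← pow_two]
    congr 1
    rw [smul_mul_smul_comm, smul_smul]
  rw [e, X_mul_sinhc, X_mul_sinhc]
  have c1 : Commute x (-y) := h.neg_right
  have c2 : Commute (-x) y := h.neg_left
  rw [expH_add h, sub_eq_add_neg x y, expH_add c1, neg_add, neg_add, neg_neg, expH_add c2,
    expH_add c2.neg_right]
  noncomm_ring

/-- The quotient `[x][y] / (x y)` as a function of `u = (x + y)²` and `v = (x - y)²`. This extends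
`bracketRatio` to arbitrary algebras; over `ℂ` it gives the eigenvalues of `bracketRatio`. -/
def bracketQuot (u v : A) : A⟦X⟧ :=
  PowerSeries.map (algebraMap ℂ A) ((2 : ℂ) • ((sinhc (1 : ℂ))⁻¹) ^ 2) * coshDiff u v

theorem constantCoeff_sinhc_one : PowerSeries.constantCoeff (sinhc (1 : ℂ)) = 1 := by
  simp [sinhc, ← PowerSeries.coeff_zero_eq_constantCoeff_apply]

theorem constantCoeff_bracketQuot (u v : A) : PowerSeries.constantCoeff (bracketQuot u v) = 1 := by
  rw [bracketQuot, map_mul, constantCoeff_coshDiff]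
  simp only [← PowerSeries.coeff_zero_eq_constantCoeff_apply, PowerSeries.coeff_map,
    PowerSeries.coeff_smul]
  simp [← map_mul, constantCoeff_sinhc_one]

theorem C_sub_mul_bracketQuot {u v : A} (h : Commute u v) :
    PowerSeries.C (u - v) * bracketQuot u v =
      ((2 : ℂ) • ((sinhc (1 : ℂ))⁻¹) ^ 2 : Ch) • (coshc u - coshc v) := by
  rw [bracketQuot, ← mul_assoc, ← (commute_map_algebraMap _ _).eq, mul_assoc, C_sub_mul_coshDiff h,
    Algebra.smul_def]
  rfl

theorem smul_coshc_sub_coshc {x y : A} (h : Commute x y) :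
    ((2 : ℂ) • ((sinhc (1 : ℂ))⁻¹) ^ 2 : Ch) • (coshc ((x + y) ^ 2) - coshc ((x - y) ^ 2)) =
      (4 : ℂ) • (qNum x * qNum y) := by
  rw [coshc_sub_coshc h, ← C_smul_series 2 (sinhc x * sinhc y), qNum_eq_smul, qNum_eq_smul,
      smul_mul_smul_comm,
    ← C_smul_series 4, smul_smul, smul_smul, PowerSeries.smul_eq_C_mul, pow_two]
  congr 1
  rw [show (4 : ℂ) = 2 * 2 by norm_num, map_mul]
  ring

theorem semiconjBy_bracketQuot {a u v u' v' : A} (hu : SemiconjBy a u u') (hv : SemiconjBy a v v') :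
    SemiconjBy (PowerSeries.C a) (bracketQuot u v) (bracketQuot u' v') :=
  SemiconjBy.mul_right (commute_map_algebraMap _ _).symm (semiconjBy_coshDiff hu hv)

end Commuting

end QuantumEuclid

namespace QuantumEuclid

/-! ### The isomorphism `α` -/

theorem add_two_sub_one {R : Type} [Ring R] (x : R) : x + 2 - 1 = x + 1 := by
  rw [← one_add_one_eq_two]; abel

theorem sub_two_add_one {R : Type} [Ring R] (x : R) : x - 2 + 1 = x - 1 := by
  rw [← one_add_one_eq_two]; abel

theorem inv_two_smul_two {R : Type} [Ring R] [Algebra ℂ R] : (2⁻¹ : ℂ) • (2 : R) = 1 := by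
  have h : (2 : R) = (2 : ℂ) • (1 : R) := by rw [two_smul, one_add_one_eq_two]
  rw [h, smul_smul]; norm_num

section Alpha

attribute [local instance] LieRing.ofAssociativeRing

theorem uE_uF : uE * uF - uF * uE = uH := by
  rw [uE, uF, uH, ← slE_slF, LieHom.map_lie]; rfl

theorem uH_uE : uH * uE - uE * uH = (2 : ℂ) • uE := by
  have := (UniversalEnvelopingAlgebra.ι ℂ : Sl2 →ₗ⁅ℂ⁆ U).map_lie slH slE
  rw [slH_slE, map_smul] at this
  exact this.symm

theorem uH_uF : uH * uF - uF * uH = (-2 : ℂ) • uF := by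
  have := (UniversalEnvelopingAlgebra.ι ℂ : Sl2 →ₗ⁅ℂ⁆ U).map_lie slH slF
  rw [slH_slF, map_smul] at this
  exact this.symm

end Alpha

theorem semiconjBy_uE : SemiconjBy uE (uH + 2) uH := by
  have := uH_uE
  rw [two_smul] at this
  rw [SemiconjBy, mul_add, mul_two, ← this]; abel

theorem semiconjBy_uF : SemiconjBy uF (uH - 2) uH := by
  have := uH_uF
  rw [neg_smul, two_smul, sub_eq_iff_eq_add] at this
  rw [SemiconjBy, mul_sub, mul_two, this]; abel

/-- `(2J + 1)² = 2C + 1`. -/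
def uJ : U := (2 : ℂ) • uC + 1

theorem uJ_eq : uJ = 2 * (uE * uF) + 2 * (uF * uE) + uH ^ 2 + 1 := by
  rw [uJ, uC, smul_add, smul_add, smul_smul, two_smul, two_smul, two_mul, two_mul]
  norm_num [two_mul]

theorem four_uE_uF : uJ - (uH - 1) ^ 2 = 4 * (uE * uF) := by
  rw [uJ_eq, ← sub_eq_zero]
  have := uE_uF
  rw [sub_eq_iff_eq_add] at this
  rw [this]
  noncomm_ring

theorem four_uF_uE : uJ - (uH + 1) ^ 2 = 4 * (uF * uE) := by
  rw [uJ_eq, ← sub_eq_zero]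
  have := uE_uF
  rw [sub_eq_iff_eq_add] at this
  rw [this]
  noncomm_ring

theorem commute_uH_uJ : Commute uH uJ := by
  have hE := semiconjBy_uE
  have hF := semiconjBy_uF
  have h1 : Commute uH (uE * uF) := by
    have : SemiconjBy (uE * uF) uH uH := by
      refine SemiconjBy.mul_left (y := uH + 2) hE ?_
      simpa using hF.add_right (Commute.ofNat_right uF 2)
    exact this.eq.symm
  have h2 : Commute uH (uF * uE) := by
    have : SemiconjBy (uF * uE) uH uH := by
      refine SemiconjBy.mul_left (y := uH - 2) hF ?_
      simpa using hE.sub_right (Commute.ofNat_right uE 2)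
    exact this.eq.symm
  rw [uJ_eq]
  exact (((Commute.ofNat_right _ 2).mul_right h1).add_right
    ((Commute.ofNat_right _ 2).mul_right h2)).add_right ((Commute.refl _).pow_right 2)
    |>.add_right (Commute.one_right _)

theorem commute_uE_uJ : Commute uE uJ := by
  have h1 : uJ = 4 * (uE * uF) + (uH - 1) ^ 2 := by rw [← four_uE_uF]; abel
  have h2 : uJ = 4 * (uF * uE) + (uH + 1) ^ 2 := by rw [← four_uF_uE]; abel
  have h3 : uE * (uH + 1) ^ 2 = (uH - 1) ^ 2 * uE := by
    have : SemiconjBy uE (uH + 2 - 1) (uH - 1) := semiconjBy_uE.sub_right (Commute.one_right _)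
    rw [add_two_sub_one] at this
    exact (this.pow_right 2).eq
  change uE * uJ = uJ * uE
  conv_lhs => rw [h2]
  conv_rhs => rw [h1]
  rw [mul_add, add_mul, h3]
  congr 1
  noncomm_ring

theorem commute_uF_uJ : Commute uF uJ := by
  have h1 : uJ = 4 * (uE * uF) + (uH - 1) ^ 2 := by rw [← four_uE_uF]; abel
  have h2 : uJ = 4 * (uF * uE) + (uH + 1) ^ 2 := by rw [← four_uF_uE]; abel
  have h3 : uF * (uH - 1) ^ 2 = (uH + 1) ^ 2 * uF := by
    have : SemiconjBy uF (uH - 2 + 1) (uH + 1) := semiconjBy_uF.add_right (Commute.one_right _)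
    rw [sub_two_add_one] at this
    exact (this.pow_right 2).eq
  change uF * uJ = uJ * uF
  conv_lhs => rw [h1]
  conv_rhs => rw [h2]
  rw [mul_add, add_mul, h3]
  congr 1
  noncomm_ring

/-- The square root of `[x][y] / (x y)` at `x + y = 2J + 1` and `x - y = h`. -/
def uS (h : U) : U⟦X⟧ := sqrtOne (bracketQuot uJ (h ^ 2))

theorem alphaInvE_eq : alphaInvE = PowerSeries.C uE * expH ((2⁻¹ : ℂ) • uH + 1) * uS (uH + 1) := rfl

theorem alphaInvF_eq : alphaInvF =
    PowerSeries.C uF * expH (-((2⁻¹ : ℂ) • uH)) * uS (uH - 1) := rfl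

theorem uS_mul_self (h : U) : uS h * uS h = bracketQuot uJ (h ^ 2) :=
  sqrtOne_mul_self (constantCoeff_bracketQuot _ _)

theorem commute_C_uH_uS {h : U} (hh : Commute uH h) : Commute (PowerSeries.C uH) (uS h) :=
  semiconjBy_sqrtOne (semiconjBy_bracketQuot commute_uH_uJ (hh.pow_right 2))

theorem commute_expH_uS {h x : U} (hh : Commute uH h)
    (hx : ∃ c d : ℂ, x = c • uH + algebraMap ℂ U d) :
    Commute (expH x) (uS h) := by
  obtain ⟨c, d, rfl⟩ := hx
  refine commute_expH ?_
  refine semiconjBy_sqrtOne (semiconjBy_bracketQuot ?_ ?_)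
  · exact (commute_uH_uJ.smul_left c).add_left (Algebra.commutes d _)
  · exact ((hh.smul_left c).add_left (Algebra.commutes d _)).pow_right 2

/-- The product `E F` is `x y` for `x = J + M`, `y = J - M + 1`, so that the right-hand side
stands for `[J + M][J - M + 1]`. -/
theorem alphaInv_E_F : alphaInvE * alphaInvF =
    PowerSeries.C (uE * uF) * bracketQuot uJ ((uH - 1) ^ 2) := by
  have hF1 : SemiconjBy (PowerSeries.C uF) (expH ((2⁻¹ : ℂ) • uH)) (expH ((2⁻¹ : ℂ) • uH + 1)) := by
    have h1 : SemiconjBy uF ((2⁻¹ : ℂ) • (uH - 2) + 1) ((2⁻¹ : ℂ) • uH + 1) :=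
      SemiconjBy.add_right (by
        rw [SemiconjBy, mul_smul_comm, semiconjBy_uF.eq, smul_mul_assoc]) (Commute.one_right _)
    have h2 : (2⁻¹ : ℂ) • (uH - 2) + 1 = (2⁻¹ : ℂ) • uH := by
      rw [smul_sub, inv_two_smul_two, sub_add_cancel]
    rw [h2] at h1
    exact semiconjBy_expH h1
  have hF2 : SemiconjBy (PowerSeries.C uF) (uS (uH - 1)) (uS (uH + 1)) := by
    have : SemiconjBy uF (uH - 2 + 1) (uH + 1) := semiconjBy_uF.add_right (Commute.one_right _)
    rw [sub_two_add_one] at this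
    exact semiconjBy_sqrtOne (semiconjBy_bracketQuot commute_uF_uJ (this.pow_right 2))
  have hc : Commute (expH (-((2⁻¹ : ℂ) • uH))) (uS (uH - 1)) :=
    commute_expH_uS ((Commute.refl _).sub_right (Commute.one_right _))
      ⟨-2⁻¹, 0, by rw [map_zero, add_zero, neg_smul]⟩
  have hexp : expH ((2⁻¹ : ℂ) • uH) * expH (-((2⁻¹ : ℂ) • uH)) = 1 := by
    rw [← expH_add (Commute.refl _).neg_right, add_neg_cancel, expH_zero]
  rw [alphaInvE_eq, alphaInvF_eq]
  calc _ = PowerSeries.C uE * (expH ((2⁻¹ : ℂ) • uH + 1) * uS (uH + 1) * PowerSeries.C uF) *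
        (expH (-((2⁻¹ : ℂ) • uH)) * uS (uH - 1)) := by simp only [mul_assoc]
    _ = PowerSeries.C uE * (PowerSeries.C uF * (expH ((2⁻¹ : ℂ) • uH) * uS (uH - 1))) *
        (uS (uH - 1) * expH (-((2⁻¹ : ℂ) • uH))) := by
      rw [← (hF1.mul_right hF2).eq, hc.eq]
    _ = PowerSeries.C uE * PowerSeries.C uF * (expH ((2⁻¹ : ℂ) • uH) *
        ((uS (uH - 1) * uS (uH - 1)) * expH (-((2⁻¹ : ℂ) • uH)))) := by simp only [mul_assoc]
    _ = _ := by
      rw [← (hc.mul_right hc).eq, ← mul_assoc (expH _) (expH _), hexp, one_mul, uS_mul_self,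
        map_mul]

theorem alphaInv_F_E : alphaInvF * alphaInvE =
    PowerSeries.C (uF * uE) * bracketQuot uJ ((uH + 1) ^ 2) := by
  have hE1 : SemiconjBy (PowerSeries.C uE) (expH (-((2⁻¹ : ℂ) • uH + 1)))
      (expH (-((2⁻¹ : ℂ) • uH))) := by
    have h1 : SemiconjBy uE (-((2⁻¹ : ℂ) • (uH + 2))) (-((2⁻¹ : ℂ) • uH)) :=
      SemiconjBy.neg_right (by
        rw [SemiconjBy, mul_smul_comm, semiconjBy_uE.eq, smul_mul_assoc])
    have h2 : (2⁻¹ : ℂ) • (uH + 2) = (2⁻¹ : ℂ) • uH + 1 := by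
      rw [smul_add, inv_two_smul_two]
    rw [h2] at h1
    exact semiconjBy_expH h1
  have hE2 : SemiconjBy (PowerSeries.C uE) (uS (uH + 1)) (uS (uH - 1)) := by
    have : SemiconjBy uE (uH + 2 - 1) (uH - 1) := semiconjBy_uE.sub_right (Commute.one_right _)
    rw [add_two_sub_one] at this
    exact semiconjBy_sqrtOne (semiconjBy_bracketQuot commute_uE_uJ (this.pow_right 2))
  have hc : Commute (expH ((2⁻¹ : ℂ) • uH + 1)) (uS (uH + 1)) :=
    commute_expH_uS ((Commute.refl _).add_right (Commute.one_right _))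
      ⟨2⁻¹, 1, by rw [map_one]⟩
  have hexp : expH (-((2⁻¹ : ℂ) • uH + 1)) * expH ((2⁻¹ : ℂ) • uH + 1) = 1 := by
    rw [← expH_add (Commute.refl _).neg_left, neg_add_cancel, expH_zero]
  rw [alphaInvE_eq, alphaInvF_eq]
  calc _ = PowerSeries.C uF * (expH (-((2⁻¹ : ℂ) • uH)) * uS (uH - 1) * PowerSeries.C uE) *
        (expH ((2⁻¹ : ℂ) • uH + 1) * uS (uH + 1)) := by simp only [mul_assoc]
    _ = PowerSeries.C uF * (PowerSeries.C uE * (expH (-((2⁻¹ : ℂ) • uH + 1)) * uS (uH + 1))) *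
        (uS (uH + 1) * expH ((2⁻¹ : ℂ) • uH + 1)) := by
      rw [← (hE1.mul_right hE2).eq, hc.eq]
    _ = PowerSeries.C uF * PowerSeries.C uE * (expH (-((2⁻¹ : ℂ) • uH + 1)) *
        ((uS (uH + 1) * uS (uH + 1)) * expH ((2⁻¹ : ℂ) • uH + 1))) := by simp only [mul_assoc]
    _ = _ := by
      rw [← (hc.mul_right hc).eq, ← mul_assoc (expH _) (expH _), hexp, one_mul, uS_mul_self,
        map_mul]

theorem qNum_one_algebra : qNum (1 : U) = 1 := by
  have h : sinhc (1 : U) = PowerSeries.map (algebraMap ℂ U) (sinhc (1 : ℂ)) := by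
    ext n
    simp only [sinhc, PowerSeries.coeff_mk, PowerSeries.coeff_map]
    split_ifs <;> simp [Algebra.algebraMap_eq_smul_one]
  rw [qNum, h, ← map_mul, PowerSeries.inv_mul_cancel, map_one]
  rw [constantCoeff_sinhc_one]; exact one_ne_zero

/-- The images of `Ê` and `F̂` satisfy the deformed relation, since `4EF` and `4FE` are the
differences of `(2J + 1)²` and `(H ∓ 1)²`: in terms of `κ(u) = cosh (ℏ √u)` the two products are
multiples of `κ((2J + 1)²) - κ((H - 1)²)` and `κ((2J + 1)²) - κ((H + 1)²)`, and `κ((2J + 1)²)`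
cancels. -/
theorem alphaInv_bracket : alphaInvE * alphaInvF - alphaInvF * alphaInvE = qNum uH := by
  have e1 := C_sub_mul_bracketQuot (u := uJ) (v := (uH - 1) ^ 2)
    ((commute_uH_uJ.symm.sub_right (Commute.one_right _)).pow_right 2)
  have e2 := C_sub_mul_bracketQuot (u := uJ) (v := (uH + 1) ^ 2)
    ((commute_uH_uJ.symm.add_right (Commute.one_right _)).pow_right 2)
  have e3 := smul_coshc_sub_coshc (x := uH) (y := 1) (Commute.one_right _)
  rw [four_uE_uF, map_mul, mul_assoc, ← alphaInv_E_F] at e1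
  rw [four_uF_uE, map_mul, mul_assoc, ← alphaInv_F_E] at e2
  have h4 (z : U⟦X⟧) : PowerSeries.C (4 : U) * z = (4 : ℂ) • z := by
    rw [← C_smul_series, Algebra.smul_def]
    change _ = PowerSeries.map (algebraMap ℂ U) (PowerSeries.C 4) * z
    rw [PowerSeries.map_C, map_ofNat (algebraMap ℂ U)]
  rw [h4] at e1 e2
  have : (4 : ℂ) • (alphaInvE * alphaInvF - alphaInvF * alphaInvE) = (4 : ℂ) • qNum uH := by
    rw [smul_sub, e1, e2, ← smul_sub, sub_sub_sub_cancel_left, e3, qNum_one_algebra, mul_one]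
  have := congrArg ((4⁻¹ : ℂ) • ·) this
  simpa [smul_smul] using this

theorem alphaInv_H_E : PowerSeries.C uH * alphaInvE - alphaInvE * PowerSeries.C uH =
    (2 : ℂ) • alphaInvE := by
  have h1 : Commute (PowerSeries.C uH) (expH ((2⁻¹ : ℂ) • uH + 1)) :=
    semiconjBy_expH (((Commute.refl _).smul_right _).add_right (Commute.one_right _))
  have h2 : Commute (PowerSeries.C uH) (uS (uH + 1)) :=
    commute_C_uH_uS ((Commute.refl _).add_right (Commute.one_right _))
  rw [alphaInvE_eq, mul_assoc, mul_assoc (PowerSeries.C uE) _ (PowerSeries.C uH),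
    ← (h1.mul_right h2).eq, ← mul_assoc, ← mul_assoc (PowerSeries.C uE), ← sub_mul, ← map_mul,
    ← map_mul, ← map_sub, uH_uE, C_smul_eq, C_smul_series, smul_mul_assoc]

theorem alphaInv_H_F : PowerSeries.C uH * alphaInvF - alphaInvF * PowerSeries.C uH =
    (-2 : ℂ) • alphaInvF := by
  have h1 : Commute (PowerSeries.C uH) (expH (-((2⁻¹ : ℂ) • uH))) :=
    semiconjBy_expH (((Commute.refl _).smul_right _).neg_right)
  have h2 : Commute (PowerSeries.C uH) (uS (uH - 1)) :=
    commute_C_uH_uS ((Commute.refl _).sub_right (Commute.one_right _))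
  rw [alphaInvF_eq, mul_assoc, mul_assoc (PowerSeries.C uF) _ (PowerSeries.C uH),
    ← (h1.mul_right h2).eq, ← mul_assoc, ← mul_assoc (PowerSeries.C uF), ← sub_mul, ← map_mul,
    ← map_mul, ← map_sub, uH_uF, C_smul_eq, C_smul_series, smul_mul_assoc]

theorem evalH_qNum_gen {S : Type} {B : Type} [Ring B] [Algebra Ch B] [HComplete B] (g : S → B)
    (s : S) : evalH g (qNum (FreeAlgebra.ι ℂ s)) = hqNum (g s) := by
  rw [map_qNum_series, ← gen, evalH_gen]

/-- A representation of `U_ℏ(sl₂)` in a complete algebra, given on the generators. -/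
def Uh.lift {B : Type} [Ring B] [Algebra Ch B] [HComplete B] (g : Gen → B)
    (hE : g .H * g .E - g .E * g .H = (PowerSeries.C 2 : Ch) • g .E)
    (hF : g .H * g .F - g .F * g .H = (PowerSeries.C (-2) : Ch) • g .F)
    (hEF : g .E * g .F - g .F * g .E = hqNum (g .H)) : Uh →ₐ[Ch] B :=
  HAlg.lift g (by
    rintro r (rfl | rfl | rfl)
    · rw [← C_smul_series]
      simp only [map_sub, map_mul, map_smul, evalH_gen]
      rw [hE, sub_self]
    · rw [← C_smul_series]
      simp only [map_sub, map_add, map_mul, map_smul, evalH_gen]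
      rw [hF, map_neg, neg_smul, neg_add_cancel]
    · simp only [map_sub, map_mul, evalH_gen, evalH_qNum_gen]
      rw [hEF, sub_self])

theorem Uh.lift_gen {B : Type} [Ring B] [Algebra Ch B] [HComplete B] (g : Gen → B) (hE) (hF) (hEF)
    (s : Gen) : Uh.lift g hE hF hEF (Uh.gen s) = g s := HAlg.lift_gen _ _ s

/-- The values of `α⁻¹` on the generators. -/
def alphaInvGen : Gen → U⟦X⟧
  | .E => alphaInvE
  | .F => alphaInvF
  | .H => PowerSeries.C uH

/-- The homomorphism `α⁻¹`. -/
def alphaInv : Uh →ₐ[Ch] U⟦X⟧ :=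
  Uh.lift alphaInvGen (by rw [C_smul_series]; exact alphaInv_H_E)
    (by rw [C_smul_series]; exact alphaInv_H_F)
    (by rw [alphaInvGen, alphaInvGen, alphaInvGen, hqNum_eq_qNum]; exact alphaInv_bracket)

end QuantumEuclid

namespace QuantumEuclid

theorem mem_hIdeal {A : Type} [Ring A] [Algebra Ch A] {n : ℕ} {x : A} :
    x ∈ hIdeal A n ↔ ∃ y, x = (PowerSeries.X : Ch) ^ n • y := by
  rw [hIdeal, Ideal.mem_span_singleton']
  simp only [Algebra.smul_def, ← Algebra.commutes, eq_comm (a := x)]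

section Presented

variable {S : Type} {rels : Set (HFree S)}

/-- A retraction onto a presented algebra modulo `ℏ` shows that its defining relations modulo `ℏ`
suffice. -/
theorem HAlg.exists_eq_X_smul {A : Type} [Ring A] [Algebra ℂ A] (π : FreeAlgebra ℂ S →ₐ[ℂ] A)
    (σ : A →ₐ[ℂ] HAlg rels ⧸ hIdeal (HAlg rels) 1)
    (h : ∀ s, σ (π (FreeAlgebra.ι ℂ s)) = Ideal.Quotient.mk _ (HAlg.mk rels (gen s)))
    (f : HFree S) (hf : π (PowerSeries.constantCoeff f) = 0) :
    ∃ y, HAlg.mk rels f = (PowerSeries.X : Ch) • y := by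
  have key (a : FreeAlgebra ℂ S) :
      σ (π a) = Ideal.Quotient.mk _ (HAlg.mk rels (PowerSeries.C a)) := by
    induction a using FreeAlgebra.induction with
    | grade0 r =>
      rw [AlgHom.commutes, AlgHom.commutes, ← Ideal.Quotient.mk_algebraMap]
      exact congrArg (fun x => Ideal.Quotient.mk _ (HAlg.mk rels x)) PowerSeries.algebraMap_apply
    | grade1 s => exact h s
    | mul a b ha hb => simp only [map_mul, ha, hb]
    | add a b ha hb => simp only [map_add, ha, hb]
  obtain ⟨g, hg⟩ := exists_series_eq f
  have h0 := key (PowerSeries.constantCoeff f)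
  rw [hf, map_zero, eq_comm, Ideal.Quotient.eq_zero_iff_mem, mem_hIdeal] at h0
  obtain ⟨y, hy⟩ := h0
  refine ⟨y + HAlg.mk rels g, ?_⟩
  conv_lhs => rw [hg]
  rw [map_add, hy, pow_one, ← X_smul_series, map_smul, smul_add]

end Presented

theorem sl2_trace (g : Sl2) : g.val 0 0 = -g.val 1 1 := by
  have h : Matrix.trace g.val = 0 := by
    have := g.2
    simpa [LieAlgebra.SpecialLinear.sl] using this
  rw [Matrix.trace_fin_two] at h
  linear_combination h

section Sl2Hom

attribute [local instance] LieRing.ofAssociativeRing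

/-- The homomorphism from `sl₂` given by an `sl₂`-triple in an associative algebra. -/
def sl2Hom {Q : Type} [Ring Q] [Algebra ℂ Q] (e f h : Q) (hef : e * f = f * e + h)
    (hhe : h * e = e * h + (2 : ℂ) • e) (hhf : h * f = f * h - (2 : ℂ) • f) : Sl2 →ₗ⁅ℂ⁆ Q where
  toFun g := g.val 1 0 • e + g.val 0 1 • f + g.val 1 1 • h
  map_add' g g' := by
    have h : (g + g').val = g.val + g'.val := rfl
    simp only [h, Matrix.add_apply]
    module
  map_smul' c g := by
    have h : (c • g).val = c • g.val := rfl
    simp only [h, Matrix.smul_apply, smul_eq_mul, RingHom.id_apply]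
    module
  map_lie' {g g'} := by
    simp only [LieAlgebra.SpecialLinear.sl_bracket, Matrix.sub_apply, Matrix.mul_apply,
      Fin.sum_univ_two, sl2_trace, LieRing.of_associative_ring_bracket, mul_add, add_mul,
      smul_mul_smul_comm, hef, hhe, hhf]
    module

theorem sl2Hom_apply {Q : Type} [Ring Q] [Algebra ℂ Q] (e f h : Q) (hef) (hhe) (hhf) (g : Sl2) :
    sl2Hom e f h hef hhe hhf g = g.val 1 0 • e + g.val 0 1 • f + g.val 1 1 • h := rfl

end Sl2Hom

/-- Modulo `ℏ` the generators of `U_ℏ(sl₂)` satisfy the relations of `U(sl₂)`. -/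
theorem exists_hIdeal_hom : ∃ σ : U →ₐ[ℂ] Uh ⧸ hIdeal Uh 1,
    σ uE = Ideal.Quotient.mk _ (Uh.gen .E) ∧ σ uF = Ideal.Quotient.mk _ (Uh.gen .F) ∧
      σ uH = Ideal.Quotient.mk _ (Uh.gen .H) := by
  have hE : Uh.gen .H * Uh.gen .E = Uh.gen .E * Uh.gen .H + (2 : ℂ) • Uh.gen .E := by
    have := HAlg.mk_rel (rels := UhRels) (x := _) (Or.inl rfl)
    rw [map_sub, map_sub, map_mul, map_mul, sub_sub, sub_eq_zero] at this
    exact this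
  have hF : Uh.gen .H * Uh.gen .F = Uh.gen .F * Uh.gen .H - (2 : ℂ) • Uh.gen .F := by
    have := HAlg.mk_rel (rels := UhRels) (x := _) (Or.inr (Or.inl rfl))
    rw [map_add, map_sub, map_mul, map_mul, sub_add, sub_eq_zero] at this
    rw [eq_sub_iff_add_eq, ← sub_eq_zero, ← sub_eq_zero.mpr this]
    change _ = _ - (_ - (2 : ℂ) • Uh.gen .F)
    rw [sub_sub_eq_add_sub]
    rfl
  have hEF : Uh.gen .E * Uh.gen .F = Uh.gen .F * Uh.gen .E +
      HAlg.mk UhRels (qNum (FreeAlgebra.ι ℂ Gen.H)) := by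
    have := HAlg.mk_rel (rels := UhRels) (x := _) (Or.inr (Or.inr rfl))
    rw [map_sub, map_sub, map_mul, map_mul, sub_sub, sub_eq_zero] at this
    exact this
  have hq : Ideal.Quotient.mk (hIdeal Uh 1) (HAlg.mk UhRels (qNum (FreeAlgebra.ι ℂ Gen.H))) =
      Ideal.Quotient.mk (hIdeal Uh 1) (Uh.gen .H) := by
    rw [Ideal.Quotient.eq, mem_hIdeal]
    obtain ⟨g, hg⟩ := exists_series_eq (qNum (FreeAlgebra.ι ℂ Gen.H))
    refine ⟨HAlg.mk UhRels g, ?_⟩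
    rw [hg, constantCoeff_qNum, map_add, ← X_smul_series, map_smul, pow_one]
    exact add_sub_cancel_left _ _
  let m := Ideal.Quotient.mkₐ ℂ (hIdeal Uh 1)
  refine ⟨UniversalEnvelopingAlgebra.lift ℂ (sl2Hom (m (Uh.gen .E)) (m (Uh.gen .F))
    (m (Uh.gen .H)) ?_ ?_ ?_), ?_, ?_, ?_⟩
  · rw [← map_mul, hEF, map_add, map_mul]
    exact congrArg _ hq
  · rw [← map_mul, hE, map_add, map_mul, map_smul]
  · rw [← map_mul, hF, map_sub, map_mul, map_smul]
  · rw [uE, UniversalEnvelopingAlgebra.lift_ι_apply, sl2Hom_apply]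
    simp [slE, m]
  · rw [uF, UniversalEnvelopingAlgebra.lift_ι_apply, sl2Hom_apply]
    simp [slF, m]
  · rw [uH, UniversalEnvelopingAlgebra.lift_ι_apply, sl2Hom_apply]
    simp [slH, m]

theorem alphaInv_gen (s : Gen) : alphaInv (Uh.gen s) = alphaInvGen s := Uh.lift_gen _ _ _ _ s

theorem constantCoeff_alphaInvGen (s : Gen) :
    PowerSeries.constantCoeff (alphaInvGen s) = uGen s := by
  cases s <;> simp [alphaInvGen, alphaInvE_eq, alphaInvF_eq, uS, constantCoeff_sqrtOne, uGen]

section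

attribute [local instance] LieRing.ofAssociativeRing

theorem uGen_adjoin : Algebra.adjoin ℂ (Set.range uGen) = ⊤ := by
  rw [eq_top_iff]
  rintro x -
  have := lift_mem (B := U) (UniversalEnvelopingAlgebra.ι ℂ) (Algebra.adjoin ℂ (Set.range uGen))
    (fun g => ?_) x
  · have h : UniversalEnvelopingAlgebra.lift ℂ (UniversalEnvelopingAlgebra.ι ℂ) =
        AlgHom.id ℂ U :=
      ((UniversalEnvelopingAlgebra.lift_unique ℂ _ (AlgHom.id ℂ U)).mp rfl).symm
    rwa [h] at this
  · have hg : g = g.val 1 0 • slE + g.val 0 1 • slF + g.val 1 1 • slH := by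
      refine Subtype.ext ?_
      ext i j
      fin_cases i <;> fin_cases j <;> simp [slE, slF, slH, sl2_trace]
    change UniversalEnvelopingAlgebra.ι ℂ g ∈ _
    rw [hg, map_add, map_add, map_smul, map_smul, map_smul]
    have hs (s : Gen) : uGen s ∈ Algebra.adjoin ℂ (Set.range uGen) :=
      Algebra.subset_adjoin (Set.mem_range_self s)
    exact add_mem (add_mem (Subalgebra.smul_mem _ (hs .E) _) (Subalgebra.smul_mem _ (hs .F) _))
      (Subalgebra.smul_mem _ (hs .H) _)

end

theorem constantCoeff_alphaInv (f : HFree Gen) :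
    PowerSeries.constantCoeff (alphaInv (HAlg.mk UhRels f)) =
      FreeAlgebra.lift ℂ uGen (PowerSeries.constantCoeff f) := by
  have key (a : FreeAlgebra ℂ Gen) :
      PowerSeries.constantCoeff (alphaInv (HAlg.mk UhRels (PowerSeries.C a))) =
        FreeAlgebra.lift ℂ uGen a := by
    induction a using FreeAlgebra.induction with
    | grade0 r =>
      have : HAlg.mk UhRels (PowerSeries.C (algebraMap ℂ _ r)) =
          algebraMap Ch _ (PowerSeries.C r) := by
        rw [← AlgHom.commutes (HAlg.mk UhRels)]
        congr 1
        exact (PowerSeries.map_C _ _).symm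
      rw [this, AlgHom.commutes, AlgHom.commutes]
      change PowerSeries.constantCoeff (PowerSeries.map (algebraMap ℂ U) (PowerSeries.C r)) = _
      rw [PowerSeries.map_C, PowerSeries.constantCoeff_C]
    | grade1 s =>
      rw [FreeAlgebra.lift_ι_apply, ← constantCoeff_alphaInvGen, ← alphaInv_gen]
      rfl
    | mul a b ha hb => simp only [map_mul, ha, hb]
    | add a b ha hb => simp only [map_add, ha, hb]
  obtain ⟨g, hg⟩ := exists_series_eq f
  conv_lhs => rw [hg]
  rw [map_add, map_add, map_add, key, ← X_smul_series, map_smul, map_smul, X_smul_series]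
  simp

/-- Modulo `ℏ` the homomorphism `α⁻¹` is the isomorphism `U_ℏ(sl₂) / ℏ ≅ U(sl₂)`, and
`U(sl₂)[[ℏ]]` has no `ℏ`-torsion; a basis of `U(sl₂)` is not needed. -/
theorem alphaInv_bijective : Function.Bijective alphaInv := by
  constructor
  · refine injective_of_injective_mod alphaInv.toLinearMap fun x hx => ?_
    obtain ⟨f, rfl⟩ := HAlg.mk_surjective UhRels x
    rw [AlgHom.toLinearMap_apply] at hx
    obtain ⟨σ, hE, hF, hH⟩ := exists_hIdeal_hom
    obtain ⟨y, hy⟩ := HAlg.exists_eq_X_smul (FreeAlgebra.lift ℂ uGen) σ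
      (fun s => by rw [FreeAlgebra.lift_ι_apply]; cases s <;> assumption) f
      (by rw [← constantCoeff_alphaInv, hx, map_zero])
    refine ⟨y, hy, ?_⟩
    rw [hy, map_smul, X_smul_series] at hx
    ext n
    have := congrArg (PowerSeries.coeff (n + 1)) hx
    rw [PowerSeries.coeff_succ_X_mul] at this
    exact this
  · refine surjective_of_surjective_mod alphaInv.toLinearMap fun z => ?_
    have hs : Function.Surjective (FreeAlgebra.lift ℂ uGen : FreeAlgebra ℂ Gen →ₐ[ℂ] U) := by
      rw [← AlgHom.range_eq_top, ← uGen_adjoin, Algebra.adjoin_range_eq_range_freeAlgebra_lift]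
    obtain ⟨a, ha⟩ := hs (PowerSeries.constantCoeff z)
    have h0 : PowerSeries.X ∣ z - alphaInv (HAlg.mk UhRels (PowerSeries.C a)) := by
      rw [PowerSeries.X_dvd_iff, map_sub, constantCoeff_alphaInv, PowerSeries.constantCoeff_C, ha,
        sub_self]
    obtain ⟨y, hy⟩ := h0
    exact ⟨_, y, by rw [X_smul_series, ← hy]; exact (add_sub_cancel (alphaInv _) z).symm⟩

/-- The isomorphism `α`. -/
def alphaEquiv : U⟦X⟧ ≃ₐ[Ch] Uh := (AlgEquiv.ofBijective alphaInv alphaInv_bijective).symm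

theorem isAlpha_alphaEquiv : IsAlpha alphaEquiv :=
  ⟨alphaInv_gen .E, alphaInv_gen .F, alphaInv_gen .H⟩

theorem IsAlpha.symm_gen {α : U⟦X⟧ ≃ₐ[Ch] Uh} (h : IsAlpha α) (s : Gen) :
    α.symm (Uh.gen s) = alphaInvGen s := by
  obtain ⟨h1, h2, h3⟩ := h
  cases s <;> assumption

theorem existsUnique_alpha : ∃! α : U⟦X⟧ ≃ₐ[Ch] Uh, IsAlpha α := by
  refine ⟨alphaEquiv, isAlpha_alphaEquiv, fun α hα => ?_⟩
  have : (α.symm : Uh →ₐ[Ch] U⟦X⟧) = (alphaEquiv.symm : Uh →ₐ[Ch] U⟦X⟧) :=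
    HAlg.algHom_ext fun s => (hα.symm_gen s).trans (isAlpha_alphaEquiv.symm_gen s).symm
  have h2 : α.symm = alphaEquiv.symm := AlgEquiv.ext fun x => AlgHom.congr_fun this x
  rw [← AlgEquiv.symm_symm α, h2, AlgEquiv.symm_symm]

end QuantumEuclid

namespace QuantumEuclid

/-! ### Completed tensor products and the isomorphism `β` -/

section Completion

variable {A : Type} [Ring A] [Algebra Ch A]

theorem hCompletion_X_pow_smul (n : ℕ) (y : A ⧸ hIdeal A n) : (PowerSeries.X : Ch) ^ n • y = 0 := by
  obtain ⟨a, rfl⟩ := Ideal.Quotient.mk_surjective y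
  change Ideal.Quotient.mk (hIdeal A n) ((PowerSeries.X : Ch) ^ n • a) = 0
  rw [Ideal.Quotient.eq_zero_iff_mem, mem_hIdeal]
  exact ⟨a, rfl⟩

theorem hCompletion_X_pow_smul_of_le {n k : ℕ} (h : n ≤ k) (y : A ⧸ hIdeal A n) :
    (PowerSeries.X : Ch) ^ k • y = 0 := by
  obtain ⟨d, rfl⟩ := Nat.exists_eq_add_of_le h
  rw [pow_add, mul_smul, hCompletion_X_pow_smul]

/-- The projection of the completion onto `A / ℏⁿ A`. -/
def hCompletion.proj (n : ℕ) : hCompletion A →ₐ[Ch] A ⧸ hIdeal A n :=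
  (Pi.evalAlgHom Ch (fun n : ℕ => A ⧸ hIdeal A n) n).comp (hCompletion A).val

theorem hCompletion.proj_succ (z : hCompletion A) (n : ℕ) :
    Ideal.Quotient.factorₐ Ch (hIdeal_succ_le A n) (hCompletion.proj (n + 1) z) =
      hCompletion.proj n z := z.2 n

theorem hCompletion.ext {z w : hCompletion A}
    (h : ∀ n, hCompletion.proj n z = hCompletion.proj n w) : z = w :=
  Subtype.ext (funext h)

theorem hCompletion.proj_of (n : ℕ) (a : A) :
    hCompletion.proj n (hCompletion.of A a) = Ideal.Quotient.mk (hIdeal A n) a := rfl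

/-- The sum `∑ ℏᵏ bₖ` in a completion. -/
def hCompletion.sum (b : ℕ → hCompletion A) : hCompletion A :=
  ⟨fun n => hCompletion.proj n (∑ k ∈ Finset.range n, (PowerSeries.X : Ch) ^ k • b k), fun n => by
    rw [hCompletion.proj_succ, Finset.sum_range_succ, map_add, map_smul, hCompletion_X_pow_smul,
      add_zero]⟩

theorem hCompletion.proj_sum (b : ℕ → hCompletion A) {n m : ℕ} (h : n ≤ m) :
    hCompletion.proj n (hCompletion.sum b) =
      hCompletion.proj n (∑ k ∈ Finset.range m, (PowerSeries.X : Ch) ^ k • b k) := by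
  change hCompletion.proj n (∑ k ∈ Finset.range n, (PowerSeries.X : Ch) ^ k • b k) = _
  obtain ⟨d, rfl⟩ := Nat.exists_eq_add_of_le h
  rw [Finset.sum_range_add, map_add, left_eq_add, map_sum]
  refine Finset.sum_eq_zero fun k _ => ?_
  rw [map_smul, hCompletion_X_pow_smul_of_le (by omega)]

instance : HComplete (hCompletion A) where
  haus z h := hCompletion.ext fun n => by
    obtain ⟨y, hy⟩ := h n
    rw [hy, map_smul, hCompletion_X_pow_smul, map_zero]
  exists_sum b := ⟨hCompletion.sum b, fun n => ⟨hCompletion.sum fun k => b (n + k), by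
    refine hCompletion.ext fun m => ?_
    rw [hCompletion.proj_sum b (m := n + m) (by omega), map_add, map_smul,
      hCompletion.proj_sum _ le_rfl, Finset.sum_range_add, map_add, ← map_smul, Finset.smul_sum]
    simp only [pow_add, mul_smul]⟩⟩

/-- Elements of a completion are telescoping sums of differences of approximations. -/
theorem hCompletion.exists_eq_hsum (z : hCompletion A) :
    ∃ (a : A) (c : ℕ → A), z = of A a + hsum fun k => of A (c k) := by
  choose a ha using fun n => Ideal.Quotient.mk_surjective (I := hIdeal A n) (hCompletion.proj n z)
  have h1 (n : ℕ) : ∃ c, a (n + 1) - a n = (PowerSeries.X : Ch) ^ n • c := by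
    rw [← mem_hIdeal, ← Ideal.Quotient.eq, ha, ← hCompletion.proj_succ, ← ha]
    rfl
  choose c hc using h1
  refine ⟨a 0, c, hCompletion.ext fun n => ?_⟩
  obtain ⟨y, hy⟩ := hsum_spec (fun k => of A (c k)) n
  rw [hy, map_add, map_add, map_smul, hCompletion_X_pow_smul, add_zero, ← ha]
  simp only [← map_smul, ← map_sum]
  rw [← map_add, ← map_add, hCompletion.proj_of]
  congr 1
  rw [← sub_eq_iff_eq_add', ← Finset.sum_range_sub]
  exact Finset.sum_congr rfl fun k _ => hc k

end Completion

/-- The embedding of the first factor of `U(sl₂) ⊗ U(sl₂)`, for power series. -/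
def inclL : U⟦X⟧ →+* Uso⟦X⟧ :=
  PowerSeries.map (Algebra.TensorProduct.includeLeft : U →ₐ[ℂ] Uso).toRingHom

/-- The embedding of the second factor of `U(sl₂) ⊗ U(sl₂)`, for power series. -/
def inclR : U⟦X⟧ →+* Uso⟦X⟧ :=
  PowerSeries.map (Algebra.TensorProduct.includeRight : U →ₐ[ℂ] Uso).toRingHom

theorem inclL_C (u : U) : inclL (PowerSeries.C u) = PowerSeries.C (u ⊗ₜ 1) :=
  PowerSeries.map_C _ _

theorem inclR_C (u : U) : inclR (PowerSeries.C u) = PowerSeries.C (1 ⊗ₜ u) :=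
  PowerSeries.map_C _ _

theorem inclL_smul (c : Ch) (x : U⟦X⟧) : inclL (c • x) = c • inclL x := by
  rw [Algebra.smul_def, Algebra.smul_def, map_mul]
  rfl

theorem inclR_smul (c : Ch) (x : U⟦X⟧) : inclR (c • x) = c • inclR x := by
  rw [Algebra.smul_def, Algebra.smul_def, map_mul]
  congr 1
  ext n
  change PowerSeries.coeff n (PowerSeries.map _ (PowerSeries.map _ c)) =
    PowerSeries.coeff n (PowerSeries.map _ c)
  simp

/-- `inclL` as a homomorphism of algebras. -/
def inclLₐ : U⟦X⟧ →ₐ[Ch] Uso⟦X⟧ := AlgHom.ofLinearMap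
  { toFun := inclL, map_add' := map_add _, map_smul' := inclL_smul } (map_one inclL) (map_mul inclL)

/-- `inclR` as a homomorphism of algebras. -/
def inclRₐ : U⟦X⟧ →ₐ[Ch] Uso⟦X⟧ := AlgHom.ofLinearMap
  { toFun := inclR, map_add' := map_add _, map_smul' := inclR_smul } (map_one inclR) (map_mul inclR)

theorem commute_inclL_inclR (x y : U⟦X⟧) : Commute (inclL x) (inclR y) := by
  ext n
  rw [PowerSeries.coeff_mul, PowerSeries.coeff_mul, ← Finset.Nat.sum_antidiagonal_swap]
  refine Finset.sum_congr rfl fun p _ => ?_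
  simp [inclL, inclR]

theorem C_tmul (u v : U) : (PowerSeries.C (u ⊗ₜ[ℂ] v) : Uso⟦X⟧) =
    inclL (PowerSeries.C u) * inclR (PowerSeries.C v) := by
  rw [inclL_C, inclR_C, ← map_mul, Algebra.TensorProduct.tmul_mul_tmul, one_mul, mul_one]

section TensorLift

variable {B : Type} [Ring B] [Algebra Ch B]

/-- Linear maps on `U(so₄)[[ℏ]]` are determined by the products of elements of the two factors. -/
theorem series_Uso_linear_ext {M : Type} [AddCommGroup M] [Module Ch M] [HComplete M]
    {f g : Uso⟦X⟧ →ₗ[Ch] M} (h : ∀ u v : U, f (inclL (PowerSeries.C u) * inclR (PowerSeries.C v)) =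
      g (inclL (PowerSeries.C u) * inclR (PowerSeries.C v))) : f = g := by
  refine series_linear_ext fun w => ?_
  induction w using TensorProduct.induction_on with
  | zero => simp
  | tmul u v => rw [C_tmul]; exact h u v
  | add x y hx hy => rw [map_add, map_add, map_add, hx, hy]

/-- Two commuting homomorphisms from `U(sl₂)[[ℏ]]` combine to one from `U(so₄)[[ℏ]]`. -/
theorem exists_tensorLift [HComplete B] (f g : U⟦X⟧ →ₐ[Ch] B) (hc : ∀ x y, Commute (f x) (g y)) :
    ∃ F : Uso⟦X⟧ →ₐ[Ch] B, ∀ x y, F (inclL x * inclR y) = f x * g y := by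
  let _ : Algebra ℂ B := Algebra.compHom B (PowerSeries.C : ℂ →+* Ch)
  have hsm (c : ℂ) (b : B) : c • b = (PowerSeries.C c : Ch) • b := rfl
  let res (f : U⟦X⟧ →ₐ[Ch] B) : U →ₐ[ℂ] B := AlgHom.ofLinearMap
    { toFun := fun u => f (PowerSeries.C u)
      map_add' := fun u v => by rw [map_add, map_add]
      map_smul' := fun c u => by rw [C_smul_eq, map_smul]; rfl } (by simp) (by simp)
  let F0 : Uso →ₐ[ℂ] B := Algebra.TensorProduct.lift (res f) (res g) fun u v => hc _ _
  let F := seriesLift (B := B) F0.toRingHom (fun c a => map_smul F0 c a)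
  have hF (u v : U) : F (PowerSeries.C (u ⊗ₜ v)) = f (PowerSeries.C u) * g (PowerSeries.C v) := by
    rw [seriesLift_C]
    exact Algebra.TensorProduct.lift_tmul (res f) (res g) _ u v
  have hL : F.comp inclLₐ = f := by
    have : (F.comp inclLₐ).toLinearMap = f.toLinearMap := series_linear_ext fun u => by
      change F (inclL _) = f _
      rw [inclL_C, hF, map_one, map_one, mul_one]
    exact AlgHom.ext fun x => LinearMap.congr_fun this x
  have hR : F.comp inclRₐ = g := by
    have : (F.comp inclRₐ).toLinearMap = g.toLinearMap := series_linear_ext fun u => by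
      change F (inclR _) = g _
      rw [inclR_C, hF, map_one, map_one, one_mul]
    exact AlgHom.ext fun x => LinearMap.congr_fun this x
  refine ⟨F, fun x y => ?_⟩
  rw [map_mul, ← hL, ← hR]
  rfl

end TensorLift

section Completion

variable {A : Type} [Ring A] [Algebra Ch A]

/-- A linear map into a completion is surjective as soon as it reaches the uncompleted algebra. -/
theorem surjective_to_hCompletion {M : Type} [AddCommGroup M] [Module Ch M] [HComplete M]
    (κ : M →ₗ[Ch] hCompletion A) (h : ∀ a, ∃ x, κ x = hCompletion.of A a) :
    Function.Surjective κ := by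
  intro z
  choose s hs using h
  obtain ⟨a, c, rfl⟩ := hCompletion.exists_eq_hsum z
  refine ⟨s a + hsum fun k => s (c k), ?_⟩
  rw [map_add, hs, map_hsum]
  simp only [hs]

/-- A linear map from power series to a completion is injective if on constant series it comes
from the uncompleted algebra and has a left inverse there. -/
theorem injective_to_hCompletion {D : Type} [Ring D] [Algebra ℂ D]
    (κ : D⟦X⟧ →ₗ[Ch] hCompletion A) (Θ : A →ₗ[Ch] D⟦X⟧)
    (hC : ∀ w : D, ∃ a, κ (PowerSeries.C w) = hCompletion.of A a ∧ Θ a = PowerSeries.C w) :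
    Function.Injective κ := by
  refine (injective_iff_map_eq_zero κ).mpr fun f hf => ?_
  choose a ha ha' using fun n => hC (PowerSeries.coeff n f)
  refine HComplete.haus f fun n => ?_
  have hfs : f = hsum fun k => PowerSeries.C (PowerSeries.coeff k f) :=
    series_map_eq_hsum LinearMap.id f
  obtain ⟨y, hy⟩ := hsum_spec (fun k => PowerSeries.C (PowerSeries.coeff k f)) n
  rw [← hfs] at hy
  have h1 := congrArg (fun f => hCompletion.proj n (κ f)) hy
  simp only [hf, map_add, map_sum, map_smul, hCompletion_X_pow_smul, add_zero, ha, map_zero]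
    at h1
  simp only [← map_smul, ← map_sum] at h1
  rw [hCompletion.proj_of, eq_comm, Ideal.Quotient.eq_zero_iff_mem, mem_hIdeal] at h1
  obtain ⟨z, hz⟩ := h1
  refine ⟨Θ z + y, ?_⟩
  rw [smul_add, ← map_smul, ← hz, map_sum]
  simp only [map_smul, ha']
  exact hy

end Completion

/-- The map `α ⊗ α` into the uncompleted tensor product is inverted by this homomorphism. -/
def tensorInv (α : U⟦X⟧ ≃ₐ[Ch] Uh) : Uh ⊗[Ch] Uh →ₐ[Ch] Uso⟦X⟧ := Algebra.TensorProduct.lift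
    (inclLₐ.comp (α.symm : Uh →ₐ[Ch] U⟦X⟧)) (inclRₐ.comp (α.symm : Uh →ₐ[Ch] U⟦X⟧))
    fun _ _ => commute_inclL_inclR _ _

theorem tensorInv_tmul (α : U⟦X⟧ ≃ₐ[Ch] Uh) (x y : Uh) :
    tensorInv α (x ⊗ₜ y) = inclL (α.symm x) * inclR (α.symm y) :=
  Algebra.TensorProduct.lift_tmul _ _ _ x y

/-- The homomorphism `α ⊗ α`. -/
theorem exists_tensorMap (α : U⟦X⟧ ≃ₐ[Ch] Uh) : ∃ κ : Uso⟦X⟧ →ₐ[Ch] UhSo,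
    ∀ x y, κ (inclL x * inclR y) = hCompletion.of (Uh ⊗[Ch] Uh) (α x ⊗ₜ[Ch] α y) := by
  obtain ⟨κ, hκ⟩ := exists_tensorLift
    ((hCompletion.of (Uh ⊗[Ch] Uh)).comp
      ((Algebra.TensorProduct.includeLeft : Uh →ₐ[Ch] _).comp (α : U⟦X⟧ →ₐ[Ch] Uh)))
    ((hCompletion.of (Uh ⊗[Ch] Uh)).comp
      ((Algebra.TensorProduct.includeRight : Uh →ₐ[Ch] _).comp (α : U⟦X⟧ →ₐ[Ch] Uh)))
    fun x y => by
      change hCompletion.of _ (α x ⊗ₜ[Ch] 1) * hCompletion.of _ (1 ⊗ₜ[Ch] α y) =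
        hCompletion.of _ (1 ⊗ₜ[Ch] α y) * hCompletion.of _ (α x ⊗ₜ[Ch] 1)
      rw [← map_mul, ← map_mul, Algebra.TensorProduct.tmul_mul_tmul,
        Algebra.TensorProduct.tmul_mul_tmul, one_mul, mul_one, one_mul, mul_one]
  refine ⟨κ, fun x y => (hκ x y).trans ?_⟩
  change hCompletion.of _ (α x ⊗ₜ[Ch] 1) * hCompletion.of _ (1 ⊗ₜ[Ch] α y) = _
  rw [← map_mul, Algebra.TensorProduct.tmul_mul_tmul, one_mul, mul_one]

theorem exists_isBeta (α : U⟦X⟧ ≃ₐ[Ch] Uh) : ∃ β : Uso⟦X⟧ ≃ₐ[Ch] UhSo, IsBeta α β := by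
  obtain ⟨κ, hκ⟩ := exists_tensorMap α
  -- every constant series comes from the uncompleted tensor product, compatibly with `tensorInv`
  have hC (w : Uso) : ∃ a, κ.toLinearMap (PowerSeries.C w) = hCompletion.of (Uh ⊗[Ch] Uh) a ∧
      (tensorInv α).toLinearMap a = PowerSeries.C w := by
    induction w using TensorProduct.induction_on with
    | zero => exact ⟨0, by rw [map_zero, map_zero, map_zero], by rw [map_zero, map_zero]⟩
    | tmul u v =>
      refine ⟨α (PowerSeries.C u) ⊗ₜ α (PowerSeries.C v), ?_, ?_⟩
      · rw [C_tmul]; exact hκ _ _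
      · refine (tensorInv_tmul α _ _).trans ?_
        rw [AlgEquiv.symm_apply_apply, AlgEquiv.symm_apply_apply, C_tmul]
    | add x y hx hy =>
      obtain ⟨a, ha, ha'⟩ := hx
      obtain ⟨b, hb, hb'⟩ := hy
      exact ⟨a + b, by rw [map_add, map_add, ha, hb, map_add], by rw [map_add, ha', hb', map_add]⟩
  have hof (a : Uh ⊗[Ch] Uh) : ∃ x, κ.toLinearMap x = hCompletion.of _ a := by
    induction a using TensorProduct.induction_on with
    | zero => exact ⟨0, by rw [map_zero, map_zero]⟩
    | tmul b c =>
      refine ⟨inclL (α.symm b) * inclR (α.symm c), (hκ _ _).trans ?_⟩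
      rw [AlgEquiv.apply_symm_apply, AlgEquiv.apply_symm_apply]
    | add x y hx hy =>
      obtain ⟨a, ha⟩ := hx
      obtain ⟨b, hb⟩ := hy
      exact ⟨a + b, by rw [map_add, ha, hb, map_add]⟩
  exact ⟨AlgEquiv.ofBijective κ ⟨injective_to_hCompletion κ.toLinearMap _ hC,
    surjective_to_hCompletion κ.toLinearMap hof⟩, hκ⟩

theorem IsBeta.apply_inclL {α : U⟦X⟧ ≃ₐ[Ch] Uh} {β : Uso⟦X⟧ ≃ₐ[Ch] UhSo} (h : IsBeta α β)
    (x : U⟦X⟧) : β (inclL x) = emb 0 (α x) := by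
  have := h x 1
  rw [map_one, mul_one, map_one] at this
  exact this

theorem IsBeta.apply_inclR {α : U⟦X⟧ ≃ₐ[Ch] Uh} {β : Uso⟦X⟧ ≃ₐ[Ch] UhSo} (h : IsBeta α β)
    (x : U⟦X⟧) : β (inclR x) = emb 1 (α x) := by
  have := h 1 x
  rw [map_one, one_mul, map_one] at this
  exact this

theorem existsUnique_beta (α : U⟦X⟧ ≃ₐ[Ch] Uh) : ∃! β : Uso⟦X⟧ ≃ₐ[Ch] UhSo, IsBeta α β := by
  obtain ⟨β, hβ⟩ := exists_isBeta α
  refine ⟨β, hβ, fun β' hβ' => ?_⟩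
  have : (β' : Uso⟦X⟧ →ₐ[Ch] UhSo).toLinearMap = (β : Uso⟦X⟧ →ₐ[Ch] UhSo).toLinearMap :=
    series_Uso_linear_ext fun u v => (hβ' _ _).trans (hβ _ _).symm
  exact AlgEquiv.ext fun x => LinearMap.congr_fun this x

/-- The two embeddings of `U_ℏ(sl₂)` into `U_ℏ(so₄)`, as homomorphisms of algebras. -/
def embHom (s : Fin 2) : Uh →ₐ[Ch] UhSo :=
  (hCompletion.of (Uh ⊗[Ch] Uh)).comp
    (if s = 0 then (Algebra.TensorProduct.includeLeft : Uh →ₐ[Ch] Uh ⊗[Ch] Uh)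
      else (Algebra.TensorProduct.includeRight : Uh →ₐ[Ch] Uh ⊗[Ch] Uh))

theorem embHom_apply (s : Fin 2) (g : Uh) : embHom s g = emb s g := by
  rw [embHom, emb, AlgHom.comp_apply]
  split_ifs <;> rfl

/-- Homomorphisms from `U_ℏ(so₄)` are determined by the images of the generators. -/
theorem UhSo.algHom_ext {B : Type} [Ring B] [Algebra Ch B] [HComplete B] {f g : UhSo →ₐ[Ch] B}
    (h : ∀ (s : Fin 2) (x : Gen), f (emb s (Uh.gen x)) = g (emb s (Uh.gen x))) : f = g := by
  have h1 (s : Fin 2) : f.comp (embHom s) = g.comp (embHom s) := HAlg.algHom_ext fun x => by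
    rw [AlgHom.comp_apply, AlgHom.comp_apply, embHom_apply]
    exact h s x
  have h2 (s : Fin 2) (y : Uh) : f (emb s y) = g (emb s y) := by
    rw [← embHom_apply]; exact AlgHom.congr_fun (h1 s) y
  obtain ⟨β, hβ⟩ := exists_isBeta alphaEquiv
  have h3 : (f.comp (β : Uso⟦X⟧ →ₐ[Ch] UhSo)).toLinearMap =
      (g.comp (β : Uso⟦X⟧ →ₐ[Ch] UhSo)).toLinearMap := series_Uso_linear_ext fun u v => by
    change f (β _) = g (β _)
    rw [map_mul, map_mul, map_mul, hβ.apply_inclL, hβ.apply_inclR, h2, h2]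
  refine AlgHom.ext fun z => ?_
  rw [← β.apply_symm_apply z]
  exact LinearMap.congr_fun h3 (β.symm z)

end QuantumEuclid

namespace QuantumEuclid

/-! ### Quantum matrices -/

/-- A matrix of elements of an algebra that satisfies the relations of quantum matrices. -/
structure IsQuantumMatrix {B : Type} [Ring B] [Algebra Ch B] (x : Fin 2 → Fin 2 → B) : Prop where
  ab : x 0 0 * x 0 1 = expH (1 : ℂ) • (x 0 1 * x 0 0)
  ac : x 0 0 * x 1 0 = expH (1 : ℂ) • (x 1 0 * x 0 0)
  bd : x 0 1 * x 1 1 = expH (1 : ℂ) • (x 1 1 * x 0 1)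
  cd : x 1 0 * x 1 1 = expH (1 : ℂ) • (x 1 1 * x 1 0)
  bc : x 0 1 * x 1 0 = x 1 0 * x 0 1
  ad : x 0 0 * x 1 1 = x 1 1 * x 0 0 + (expH (1 : ℂ) - expH (-1 : ℂ)) • (x 0 1 * x 1 0)

theorem isQuantumMatrix_xh : IsQuantumMatrix xh := by
  have h {r} (hr : r ∈ MhRels) := HAlg.mk_rel (rels := MhRels) hr
  have h1 := h (Or.inl rfl)
  have h2 := h (Or.inr (Or.inl rfl))
  have h3 := h (Or.inr (Or.inr (Or.inl rfl)))
  have h4 := h (Or.inr (Or.inr (Or.inr (Or.inl rfl))))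
  have h5 := h (Or.inr (Or.inr (Or.inr (Or.inr (Or.inl rfl)))))
  have h6 := h (Or.inr (Or.inr (Or.inr (Or.inr (Or.inr rfl)))))
  simp only [map_sub, map_smul, map_mul, sub_eq_zero] at h1 h2 h3 h4 h5 h6
  exact ⟨h1, h2, h3, h4, h5, eq_add_of_sub_eq' h6⟩

section Lift

variable {B : Type} [Ring B] [Algebra Ch B] [HComplete B]

/-- The universal property of `M_ℏ(2)`. -/
def Mh.lift {x : Fin 2 → Fin 2 → B} (h : IsQuantumMatrix x) : Mh →ₐ[Ch] B :=
  HAlg.lift (fun p => x p.1 p.2) (by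
    rintro r (rfl | rfl | rfl | rfl | rfl | rfl) <;>
      simp only [map_sub, map_smul, map_mul, evalH_gen, sub_eq_zero]
    exacts [h.ab, h.ac, h.bd, h.cd, h.bc, sub_eq_of_eq_add' h.ad])

@[simp] theorem Mh.lift_xh {x : Fin 2 → Fin 2 → B} (h : IsQuantumMatrix x) (i k : Fin 2) :
    Mh.lift h (xh i k) = x i k := HAlg.lift_gen _ _ _

end Lift

theorem Mh.linear_ext {M : Type} [AddCommGroup M] [Module Ch M] [HComplete M]
    {f f' : Mh →ₗ[Ch] M} (h1 : f 1 = f' 1)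
    (h : ∀ (i k : Fin 2) (x : Mh), f x = f' x → f (xh i k * x) = f' (xh i k * x)) : f = f' :=
  HAlg.linear_ext h1 fun s => h s.1 s.2

theorem Mh.algHom_ext {B : Type} [Ring B] [Algebra Ch B] [HComplete B] {f f' : Mh →ₐ[Ch] B}
    (h : ∀ i k, f (xh i k) = f' (xh i k)) : f = f' :=
  HAlg.algHom_ext fun s => h s.1 s.2

/-! ### Reduction modulo `ℏ` -/

theorem constantCoeff_smul_series {A : Type} [Ring A] [Algebra ℂ A] (c : Ch) (x : A⟦X⟧) :
    PowerSeries.constantCoeff (c • x) = PowerSeries.constantCoeff c •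
      PowerSeries.constantCoeff x := by
  rw [Algebra.smul_def, map_mul, Algebra.smul_def]
  rfl

/-- Evaluation of noncommutative polynomials at the coordinates of `M(2)`. -/
def freeToMcl : FreeAlgebra ℂ (Fin 2 × Fin 2) →ₐ[ℂ] Mcl :=
  FreeAlgebra.lift ℂ fun p => MvPolynomial.X p

/-- The reduction `M_ℏ(2) → M(2)` modulo `ℏ`. -/
def red : Mh →+* Mcl := RingCon.lift _ (freeToMcl.toRingHom.comp PowerSeries.constantCoeff)
  (closedIdeal_le_ker _ (by
    rintro r (rfl | rfl | rfl | rfl | rfl | rfl) <;>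
      simp [freeToMcl, gen, constantCoeff_smul_series, constantCoeff_expH, mul_comm])
    fun x hx => by
      obtain ⟨y, hy, hxy⟩ := hx 1
      have := hxy 0 one_pos
      simp only [PowerSeries.coeff_zero_eq_constantCoeff_apply] at this
      rw [RingHom.comp_apply, this]
      exact hy)

theorem red_mk (f : HFree (Fin 2 × Fin 2)) :
    red (HAlg.mk MhRels f) = freeToMcl (PowerSeries.constantCoeff f) := rfl

@[simp] theorem red_xh (i k : Fin 2) : red (xh i k) = xcl i k := by
  rw [xh, red_mk, fx, gen, PowerSeries.constantCoeff_C]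
  exact FreeAlgebra.lift_ι_apply _ _

@[simp] theorem red_smul (c : Ch) (x : Mh) : red (c • x) = PowerSeries.constantCoeff c • red x := by
  obtain ⟨f, rfl⟩ := HAlg.mk_surjective _ x
  rw [← map_smul, red_mk, red_mk, constantCoeff_smul_series, map_smul]

/-- The kernel of the reduction is `ℏ M_ℏ(2)`: the quotient `M_ℏ(2) / ℏ` is commutative, so that
`M(2)` maps onto it. -/
theorem exists_X_smul_of_red_eq_zero {x : Mh} (hx : red x = 0) :
    ∃ y, x = (PowerSeries.X : Ch) • y := by
  obtain ⟨f, rfl⟩ := HAlg.mk_surjective _ x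
  have hX : ∀ c : Ch, PowerSeries.constantCoeff c = 0 → ∀ x : Mh,
      Ideal.Quotient.mk (hIdeal Mh 1) (c • x) = 0 := fun c hc x => by
    obtain ⟨d, rfl⟩ := PowerSeries.X_dvd_iff.mpr hc
    rw [Ideal.Quotient.eq_zero_iff_mem, mem_hIdeal]
    exact ⟨d • x, by rw [pow_one, mul_smul]⟩
  have hq : ∀ x : Mh, Ideal.Quotient.mk (hIdeal Mh 1) (expH (1 : ℂ) • x) =
      Ideal.Quotient.mk (hIdeal Mh 1) x := fun x => by
    rw [← sub_eq_zero, ← map_sub]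
    have := hX (expH (1 : ℂ) - 1) (by simp [constantCoeff_expH]) x
    rwa [sub_smul, one_smul] at this
  have hM := isQuantumMatrix_xh
  have hcomm : ∀ p r : Fin 2 × Fin 2, Ideal.Quotient.mk (hIdeal Mh 1) (xh p.1 p.2) *
      Ideal.Quotient.mk (hIdeal Mh 1) (xh r.1 r.2) =
      Ideal.Quotient.mk (hIdeal Mh 1) (xh r.1 r.2) *
      Ideal.Quotient.mk (hIdeal Mh 1) (xh p.1 p.2) := by
    have h1 := congrArg (Ideal.Quotient.mk (hIdeal Mh 1)) hM.ab
    have h2 := congrArg (Ideal.Quotient.mk (hIdeal Mh 1)) hM.ac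
    have h3 := congrArg (Ideal.Quotient.mk (hIdeal Mh 1)) hM.bd
    have h4 := congrArg (Ideal.Quotient.mk (hIdeal Mh 1)) hM.cd
    have h5 := congrArg (Ideal.Quotient.mk (hIdeal Mh 1)) hM.bc
    have h6 := congrArg (Ideal.Quotient.mk (hIdeal Mh 1)) hM.ad
    rw [hq] at h1 h2 h3 h4
    rw [map_add, hX _ (by simp [constantCoeff_expH]), add_zero] at h6
    simp only [map_mul] at h1 h2 h3 h4 h5 h6
    rintro ⟨i, k⟩ ⟨i', k'⟩
    fin_cases i <;> fin_cases k <;> fin_cases i' <;> fin_cases k' <;>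
      first | rfl | assumption | (symm; assumption)
  let s : Set (Mh ⧸ hIdeal Mh 1) := Set.range fun p : Fin 2 × Fin 2 =>
    Ideal.Quotient.mk (hIdeal Mh 1) (xh p.1 p.2)
  -- the map out of the commutative polynomial ring needs a commutative target
  have : IsMulCommutative (Algebra.adjoin ℂ s) := Algebra.isMulCommutative_adjoin ℂ (by
    rintro _ ⟨p, rfl⟩ _ ⟨r, rfl⟩; exact hcomm p r)
  let _ : CommRing (Algebra.adjoin ℂ s) :=
    { (Algebra.adjoin ℂ s).toRing with mul_comm := fun x y => this.is_comm.comm x y }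
  let σ : Mcl →ₐ[ℂ] Mh ⧸ hIdeal Mh 1 := (Algebra.adjoin ℂ s).val.comp
    (MvPolynomial.aeval fun p => ⟨_, Algebra.subset_adjoin ⟨p, rfl⟩⟩)
  refine HAlg.exists_eq_X_smul freeToMcl σ (fun p => ?_) f hx
  have : freeToMcl (FreeAlgebra.ι ℂ p) = MvPolynomial.X p := FreeAlgebra.lift_ι_apply _ _
  rw [this, AlgHom.comp_apply, MvPolynomial.aeval_X]
  rfl

/-! ### A faithful representation of quantum matrices -/

section Model

variable (a b c e : ℂ)

/-- Operators on sequences of power series that form a quantum matrix. Modulo `ℏ` they have the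
common eigenvector `n ↦ a⁻ⁿ`, with eigenvalues `a, b, c, (e + b c) / a`. -/
def modelMatrix : Matrix (Fin 2) (Fin 2) (Module.End Ch (ℤ → Ch)) :=
  !![{ toFun := fun f n => f (n - 1), map_add' := fun _ _ => rfl, map_smul' := fun _ _ => rfl },
    { toFun := fun f n => PowerSeries.C b * expH (-(n : ℂ)) * f n
      map_add' := fun _ _ => funext fun _ => mul_add _ _ _
      map_smul' := fun r _ => funext fun _ => mul_left_comm _ r _ };
    { toFun := fun f n => PowerSeries.C c * expH (-(n : ℂ)) * f n
      map_add' := fun _ _ => funext fun _ => mul_add _ _ _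
      map_smul' := fun r _ => funext fun _ => mul_left_comm _ r _ },
    { toFun := fun f n => (PowerSeries.C e + PowerSeries.C (b * c) * expH (-1 - 2 * n : ℂ)) *
        f (n + 1)
      map_add' := fun _ _ => funext fun _ => mul_add _ _ _
      map_smul' := fun r _ => funext fun _ => mul_left_comm _ r _ }]

theorem isQuantumMatrix_model : IsQuantumMatrix (modelMatrix b c e) := by
  constructor <;> refine LinearMap.ext fun f => funext fun n => ?_
  · change PowerSeries.C b * expH (-((n - 1 : ℤ) : ℂ)) * f (n - 1) =
      expH (1 : ℂ) * (PowerSeries.C b * expH (-(n : ℂ)) * f (n - 1))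
    rw [show (-((n - 1 : ℤ) : ℂ)) = 1 + -n by push_cast; ring, expH_add']
    ring
  · change PowerSeries.C c * expH (-((n - 1 : ℤ) : ℂ)) * f (n - 1) =
      expH (1 : ℂ) * (PowerSeries.C c * expH (-(n : ℂ)) * f (n - 1))
    rw [show (-((n - 1 : ℤ) : ℂ)) = 1 + -n by push_cast; ring, expH_add']
    ring
  · change PowerSeries.C b * expH (-(n : ℂ)) * (_ * f (n + 1)) =
      expH (1 : ℂ) * (_ * (PowerSeries.C b * expH (-((n + 1 : ℤ) : ℂ)) * f (n + 1)))
    rw [show (-(n : ℂ)) = 1 + -((n + 1 : ℤ) : ℂ) by push_cast; ring, expH_add']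
    ring
  · change PowerSeries.C c * expH (-(n : ℂ)) * (_ * f (n + 1)) =
      expH (1 : ℂ) * (_ * (PowerSeries.C c * expH (-((n + 1 : ℤ) : ℂ)) * f (n + 1)))
    rw [show (-(n : ℂ)) = 1 + -((n + 1 : ℤ) : ℂ) by push_cast; ring, expH_add']
    ring
  · change PowerSeries.C b * expH (-(n : ℂ)) * (PowerSeries.C c * expH (-(n : ℂ)) * f n) =
      PowerSeries.C c * expH (-(n : ℂ)) * (PowerSeries.C b * expH (-(n : ℂ)) * f n)
    ring
  · change (PowerSeries.C e + PowerSeries.C (b * c) * expH (-1 - 2 * ((n - 1 : ℤ) : ℂ))) *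
        f (n - 1 + 1) =
      (PowerSeries.C e + PowerSeries.C (b * c) * expH (-1 - 2 * n : ℂ)) * f (n + 1 - 1) +
      (expH (1 : ℂ) - expH (-1 : ℂ)) * (PowerSeries.C b * expH (-(n : ℂ)) *
        (PowerSeries.C c * expH (-(n : ℂ)) * f n))
    rw [sub_add_cancel, add_sub_cancel_right,
      show (-1 - 2 * ((n - 1 : ℤ) : ℂ)) = 1 + (-n + -n) by push_cast; ring,
      show (-1 - 2 * n : ℂ) = -1 + (-n + -n) by ring, expH_add' 1, expH_add' (-1),
      expH_add' (-n), map_mul]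
    ring

variable {a} in
theorem model_apply (ha : a ≠ 0) (x : Mh) : ∃ h : ℤ → Ch,
    Mh.lift (isQuantumMatrix_model b c e) x (fun n : ℤ => PowerSeries.C (a ^ (-n))) =
      (PowerSeries.C (MvPolynomial.eval (fun p => !![a, b; c, (e + b * c) / a] p.1 p.2) (red x))
        : Ch) • (fun n : ℤ => PowerSeries.C (a ^ (-n))) + (PowerSeries.X : Ch) • h := by
  set g : ℤ → Ch := fun n => PowerSeries.C (a ^ (-n)) with hg
  set L := Mh.lift (isQuantumMatrix_model b c e)
  set ev := MvPolynomial.eval (fun p : Fin 2 × Fin 2 => !![a, b; c, (e + b * c) / a] p.1 p.2)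
  have hq (z : ℂ) : ∃ s : Ch, expH z = 1 + PowerSeries.X * s := by
    obtain ⟨s, hs⟩ := PowerSeries.X_dvd_iff.mpr
      (show PowerSeries.constantCoeff (expH z - 1) = 0 by simp [constantCoeff_expH])
    exact ⟨s, by rw [← hs]; ring⟩
  obtain ⟨f, rfl⟩ := HAlg.mk_surjective _ x
  have key (w : FreeAlgebra ℂ (Fin 2 × Fin 2)) : ∃ h : ℤ → Ch,
      L (HAlg.mk _ (PowerSeries.C w)) g =
        (PowerSeries.C (ev (freeToMcl w)) : Ch) • g + (PowerSeries.X : Ch) • h := by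
    induction w using FreeAlgebra.induction with
    | grade0 r =>
      refine ⟨0, ?_⟩
      have : HAlg.mk MhRels (PowerSeries.C (algebraMap ℂ _ r)) =
          algebraMap Ch _ (PowerSeries.C r) := by
        rw [← AlgHom.commutes (HAlg.mk MhRels)]
        congr 1
        exact (PowerSeries.map_C _ _).symm
      rw [this, AlgHom.commutes, AlgHom.commutes, smul_zero, add_zero,
        MvPolynomial.algebraMap_eq, MvPolynomial.eval_C]
      rfl
    | grade1 p =>
      have h1 : L (HAlg.mk _ (PowerSeries.C (FreeAlgebra.ι ℂ p))) =
        modelMatrix b c e p.1 p.2 := Mh.lift_xh _ p.1 p.2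
      have h2 : freeToMcl (FreeAlgebra.ι ℂ p) = MvPolynomial.X p := FreeAlgebra.lift_ι_apply _ _
      rw [h1, h2, MvPolynomial.eval_X]
      choose s hs using hq
      obtain ⟨i, k⟩ := p
      fin_cases i <;> fin_cases k
      · refine ⟨0, funext fun n => ?_⟩
        change PowerSeries.C (a ^ (-(n - 1))) = PowerSeries.C a * PowerSeries.C (a ^ (-n)) +
          PowerSeries.X * 0
        rw [← map_mul, mul_zero, add_zero, ← zpow_one_add₀ ha]
        congr 2
        ring
      · refine ⟨fun n => PowerSeries.C b * s (-n) * g n, funext fun n => ?_⟩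
        change PowerSeries.C b * expH (-(n : ℂ)) * g n = PowerSeries.C b * g n +
          PowerSeries.X * (PowerSeries.C b * s (-n) * g n)
        rw [hs]
        ring
      · refine ⟨fun n => PowerSeries.C c * s (-n) * g n, funext fun n => ?_⟩
        change PowerSeries.C c * expH (-(n : ℂ)) * g n = PowerSeries.C c * g n +
          PowerSeries.X * (PowerSeries.C c * s (-n) * g n)
        rw [hs]
        ring
      · refine ⟨fun n => PowerSeries.C (b * c) * s (-1 - 2 * n) * g (n + 1), funext fun n => ?_⟩
        change (PowerSeries.C e + PowerSeries.C (b * c) * expH (-1 - 2 * n : ℂ)) * g (n + 1) =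
          PowerSeries.C ((e + b * c) / a) * PowerSeries.C (a ^ (-n)) +
          PowerSeries.X * (PowerSeries.C (b * c) * s (-1 - 2 * n) * g (n + 1))
        have : PowerSeries.C (a ^ (-n)) = PowerSeries.C a * g (n + 1) := by
          rw [hg, ← map_mul, ← zpow_one_add₀ ha]
          congr 2
          ring
        rw [hs, this, ← mul_assoc, ← map_mul, div_mul_cancel₀ _ ha, map_add]
        ring
    | mul x y hx hy =>
      obtain ⟨h, hh⟩ := hx
      obtain ⟨h', hh'⟩ := hy
      refine ⟨(PowerSeries.C (ev (freeToMcl y)) : Ch) • h +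
        L (HAlg.mk _ (PowerSeries.C x)) h', ?_⟩
      rw [map_mul, map_mul, map_mul, Module.End.mul_apply, hh', map_add, map_smul, map_smul, hh,
        map_mul, map_mul, map_mul, smul_add, smul_add, smul_smul, smul_comm _ PowerSeries.X h,
        mul_comm (PowerSeries.C _), add_assoc]
    | add x y hx hy =>
      obtain ⟨h, hh⟩ := hx
      obtain ⟨h', hh'⟩ := hy
      refine ⟨h + h', ?_⟩
      rw [map_add, map_add, map_add, LinearMap.add_apply, hh, hh', map_add, map_add, map_add,
          add_smul,
        smul_add]
      abel
  obtain ⟨f', hf'⟩ := exists_series_eq f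
  obtain ⟨h, hh⟩ := key (PowerSeries.constantCoeff f)
  refine ⟨h + L (HAlg.mk _ f') g, ?_⟩
  rw [red_mk]
  conv_lhs => rw [hf', ← X_smul_series, map_add, map_smul, map_add, map_smul, LinearMap.add_apply,
      hh]
  rw [LinearMap.smul_apply, smul_add, add_assoc]

end Model

/-- If `ℏᵏ x = 0`, the operator that represents `x` in the model vanishes, since sequences of
power series have no torsion; its eigenvalue modulo `ℏ` is the value of `red x` at the point `(a,
b, c, d)`. As `a ≠ 0` in the model, this gives `a · red x = 0`. -/
theorem red_eq_zero_of_X_pow_smul {x : Mh} {k : ℕ} (h : (PowerSeries.X : Ch) ^ k • x = 0) :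
    red x = 0 := by
  suffices MvPolynomial.X (0, 0) * red x = 0 from
    (mul_eq_zero.mp this).resolve_left (MvPolynomial.X_ne_zero _)
  refine MvPolynomial.funext fun v => ?_
  rw [map_mul, MvPolynomial.eval_X, map_zero]
  by_cases ha : v (0, 0) = 0
  · rw [ha, zero_mul]
  obtain ⟨w, hw⟩ := model_apply (v (0, 1)) (v (1, 0))
    (v (0, 0) * v (1, 1) - v (0, 1) * v (1, 0)) ha x
  rw [sub_add_cancel, mul_div_cancel_left₀ _ ha,
    show (fun p : Fin 2 × Fin 2 => !![v (0, 0), v (0, 1); v (1, 0), v (1, 1)] p.1 p.2) = v by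
      funext ⟨i, k⟩; fin_cases i <;> fin_cases k <;> rfl] at hw
  set L := Mh.lift (isQuantumMatrix_model (v (0, 1)) (v (1, 0))
    (v (0, 0) * v (1, 1) - v (0, 1) * v (1, 0)))
  have h0 := congrArg (fun y => L y (fun n : ℤ => PowerSeries.C (v (0, 0) ^ (-n))) 0) h
  simp only [map_smul, map_zero, LinearMap.smul_apply, hw] at h0
  have h1 := (mul_eq_zero.mp (show (PowerSeries.X : Ch) ^ k * _ = 0 from h0)).resolve_left
    (pow_ne_zero _ PowerSeries.X_ne_zero)
  have h2 := congrArg PowerSeries.constantCoeff h1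
  simp at h2
  rw [h2, mul_zero]

/-- `M_ℏ(2)` has no `ℏ`-torsion. -/
theorem Mh.X_smul_eq_zero {x : Mh} (h : (PowerSeries.X : Ch) • x = 0) : x = 0 := by
  refine eq_zero_of_eq_X_smul
    (fun x : {x : Mh // ∃ k : ℕ, (PowerSeries.X : Ch) ^ k • x = 0} => x.1) (fun x => ?_)
    ⟨x, 1, by rwa [pow_one]⟩
  obtain ⟨x, k, hk⟩ := x
  obtain ⟨y, hy⟩ := exists_X_smul_of_red_eq_zero (red_eq_zero_of_X_pow_smul hk)
  exact ⟨⟨y, k + 1, by rw [pow_succ, mul_smul, ← hy, hk]⟩, hy⟩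

end QuantumEuclid

namespace QuantumEuclid

/-! ### Twisted derivations of quantum matrices -/

/-- `D` is a derivation from `M_ℏ(2)` to itself, where `x` acts from the left by `σ x` and from the
right by `τ x`. -/
def IsTwistedDer (σ τ : Mh →ₐ[Ch] Mh) (D : Module.End Ch Mh) : Prop :=
  ∀ x y, D (x * y) = σ x * D y + D x * τ y

theorem IsQuantumMatrix.map {B B' : Type} [Ring B] [Algebra Ch B] [Ring B'] [Algebra Ch B']
    {x : Fin 2 → Fin 2 → B} (h : IsQuantumMatrix x) (f : B →ₐ[Ch] B') :
    IsQuantumMatrix fun i k => f (x i k) where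
  ab := by rw [← map_mul, ← map_mul, ← map_smul, h.ab]
  ac := by rw [← map_mul, ← map_mul, ← map_smul, h.ac]
  bd := by rw [← map_mul, ← map_mul, ← map_smul, h.bd]
  cd := by rw [← map_mul, ← map_mul, ← map_smul, h.cd]
  bc := by rw [← map_mul, ← map_mul, h.bc]
  ad := by rw [← map_mul, ← map_mul, ← map_mul, ← map_smul, ← map_add, h.ad]

/-- The matrices `((σ x, D x), (0, τ x))` multiply like `x` if `D` is a twisted derivation, so that
a twisted derivation can be prescribed on the generators if it respects the relations. -/
theorem exists_twistedDer (σ τ : Mh →ₐ[Ch] Mh) (δ : Fin 2 → Fin 2 → Mh)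
    (ab : σ (xh 0 0) * δ 0 1 + δ 0 0 * τ (xh 0 1) =
      expH (1 : ℂ) • (σ (xh 0 1) * δ 0 0 + δ 0 1 * τ (xh 0 0)))
    (ac : σ (xh 0 0) * δ 1 0 + δ 0 0 * τ (xh 1 0) =
      expH (1 : ℂ) • (σ (xh 1 0) * δ 0 0 + δ 1 0 * τ (xh 0 0)))
    (bd : σ (xh 0 1) * δ 1 1 + δ 0 1 * τ (xh 1 1) =
      expH (1 : ℂ) • (σ (xh 1 1) * δ 0 1 + δ 1 1 * τ (xh 0 1)))
    (cd : σ (xh 1 0) * δ 1 1 + δ 1 0 * τ (xh 1 1) =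
      expH (1 : ℂ) • (σ (xh 1 1) * δ 1 0 + δ 1 1 * τ (xh 1 0)))
    (bc : σ (xh 0 1) * δ 1 0 + δ 0 1 * τ (xh 1 0) = σ (xh 1 0) * δ 0 1 + δ 1 0 * τ (xh 0 1))
    (ad : σ (xh 0 0) * δ 1 1 + δ 0 0 * τ (xh 1 1) = σ (xh 1 1) * δ 0 0 + δ 1 1 * τ (xh 0 0) +
      (expH (1 : ℂ) - expH (-1 : ℂ)) • (σ (xh 0 1) * δ 1 0 + δ 0 1 * τ (xh 1 0))) :
    ∃ D : Module.End Ch Mh, IsTwistedDer σ τ D ∧ ∀ i k, D (xh i k) = δ i k := by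
  have hσ := isQuantumMatrix_xh.map σ
  have hτ := isQuantumMatrix_xh.map τ
  have h : IsQuantumMatrix fun i k => !![σ (xh i k), δ i k; 0, τ (xh i k)] := by
    constructor <;> ext i j : 1 <;>
      simp only [Matrix.mul_apply, Fin.sum_univ_two, Matrix.smul_apply, Matrix.add_apply] <;>
      fin_cases i <;> fin_cases j <;> simp [-smul_add]
    exacts [hσ.ab, ab, hτ.ab, hσ.ac, ac, hτ.ac, hσ.bd, bd, hτ.bd, hσ.cd, cd, hτ.cd, hσ.bc, bc,
      hτ.bc, hσ.ad, ad, hτ.ad]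
  let L := Mh.lift h
  let entry (i j : Fin 2) : Mh →ₗ[Ch] Mh := (Matrix.entryLinearMap Ch Mh i j).comp L.toLinearMap
  have hmul (i j : Fin 2) (x y : Mh) : entry i j (x * y) =
      entry i 0 x * entry 0 j y + entry i 1 x * entry 1 j y := by
    change L (x * y) i j = L x i 0 * L y 0 j + L x i 1 * L y 1 j
    rw [map_mul, Matrix.mul_apply, Fin.sum_univ_two]
  have hgen (i j m n : Fin 2) : entry i j (xh m n) =
      !![σ (xh m n), δ m n; 0, τ (xh m n)] i j := by
    change L (xh m n) i j = _
    rw [Mh.lift_xh]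
  have hone (i j : Fin 2) : entry i j 1 = (1 : Matrix (Fin 2) (Fin 2) Mh) i j := by
    change L 1 i j = _
    rw [map_one]
  have h10 : entry 1 0 = 0 := Mh.linear_ext (by rw [hone]; rfl) fun m n x hx => by
    rw [hmul, hx, hgen]
    simp
  have h00 : entry 0 0 = σ.toLinearMap :=
    Mh.linear_ext (by rw [hone]; simp) fun m n x hx => by
      rw [hmul, hx, hgen, h10]
      simp
  have h11 : entry 1 1 = τ.toLinearMap :=
    Mh.linear_ext (by rw [hone]; simp) fun m n x hx => by
      rw [hmul, hx, h10, hgen]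
      simp
  -- the upper right entry is the twisted derivation
  refine ⟨entry 0 1, fun x y => ?_, fun m n => hgen 0 1 m n⟩
  rw [hmul, h00, h11]
  rfl

namespace IsTwistedDer

variable {σ τ σ' τ' : Mh →ₐ[Ch] Mh} {D D' : Module.End Ch Mh}

theorem one (h : IsTwistedDer σ τ D) : D 1 = 0 := by
  have := h 1 1
  rw [mul_one, map_one σ, map_one τ, one_mul, mul_one] at this
  exact left_eq_add.mp this

theorem ext (h : IsTwistedDer σ τ D) (h' : IsTwistedDer σ τ D')
    (hg : ∀ i k, D (xh i k) = D' (xh i k)) : D = D' :=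
  Mh.linear_ext (by rw [h.one, h'.one]) fun i k x hx => by rw [h, h', hx, hg]

theorem conj (h : IsTwistedDer σ τ D) (θ : Mh →ₐ[Ch] Mh) :
    IsTwistedDer (θ.comp (σ.comp θ)) (θ.comp (τ.comp θ))
      (θ.toLinearMap ∘ₗ D ∘ₗ θ.toLinearMap) := fun x y => by
  change θ (D (θ (x * y))) = θ (σ (θ x)) * θ (D (θ y)) + θ (D (θ x)) * θ (τ (θ y))
  rw [map_mul, h, map_add, map_mul, map_mul]

/-- A twisted derivation of weight `c` for an automorphism that commutes with its twists. -/
theorem map_comm (h : IsTwistedDer σ τ D) {θ : Mh →ₐ[Ch] Mh} {c : Ch}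
    (hσ : ∀ x, θ (σ x) = σ (θ x)) (hτ : ∀ x, θ (τ x) = τ (θ x))
    (hg : ∀ i k, θ (D (xh i k)) = c • D (θ (xh i k))) (x : Mh) : θ (D x) = c • D (θ x) := by
  have : θ.toLinearMap ∘ₗ D = c • (D ∘ₗ θ.toLinearMap) :=
    Mh.linear_ext (by
      change θ (D 1) = c • D (θ 1)
      rw [map_one θ, h.one, map_zero, smul_zero]) fun i k x hx => by
      change θ (D x) = c • D (θ x) at hx
      change θ (D (xh i k * x)) = c • D (θ (xh i k * x))
      rw [map_mul θ (xh i k), h, h, map_add, map_mul, map_mul, hx, hg, hσ, hτ, smul_add,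
          mul_smul_comm,
        smul_mul_assoc]
  exact LinearMap.congr_fun this x

theorem commute (h : IsTwistedDer σ τ D) (h' : IsTwistedDer σ' τ' D')
    (hσσ : ∀ x, σ (σ' x) = σ' (σ x)) (hττ : ∀ x, τ (τ' x) = τ' (τ x))
    (hDσ : ∀ x, D (σ' x) = σ' (D x)) (hDτ : ∀ x, D (τ' x) = τ' (D x))
    (hDσ' : ∀ x, D' (σ x) = σ (D' x)) (hDτ' : ∀ x, D' (τ x) = τ (D' x))
    (hg : ∀ i k, D (D' (xh i k)) = D' (D (xh i k))) : Commute D D' := by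
  refine Mh.linear_ext (by simp [h.one, h'.one]) fun i k x hx => ?_
  simp only [Module.End.mul_apply] at hx ⊢
  rw [h', map_add, h, h, h, map_add, h', h', hx, hg, hσσ, hττ, hDσ, hDτ, hDσ', hDτ']
  abel

end IsTwistedDer

/-! ### The torus -/

/-- The weights `-1, 1` of the spin-`½` representation. -/
def wt (i : Fin 2) : ℂ := if i = 0 then -1 else 1

@[simp] theorem wt_zero : wt 0 = -1 := rfl
@[simp] theorem wt_one : wt 1 = 1 := rfl

theorem isQuantumMatrix_torus (u : Fin 2 → ℂ) :
    IsQuantumMatrix fun i k => expH (u 0 * wt i + u 1 * wt k) • xh i k := by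
  have h := isQuantumMatrix_xh
  constructor <;> simp only [smul_mul_smul_comm]
  · rw [h.ab, smul_comm, mul_comm]
  · rw [h.ac, smul_comm, mul_comm]
  · rw [h.bd, smul_comm, mul_comm]
  · rw [h.cd, smul_comm, mul_comm]
  · rw [h.bc, mul_comm]
  · rw [h.ad, smul_add, smul_comm, mul_comm, ← expH_add', ← expH_add']
    simp only [wt_zero, wt_one]
    congr 3
    ring_nf

/-- The automorphism of `M_ℏ(2)` by which `e^{ℏ (u₀ H ⊗ 1 + u₁ 1 ⊗ H)}` acts. -/
def torus (u : Fin 2 → ℂ) : Mh →ₐ[Ch] Mh := Mh.lift (isQuantumMatrix_torus u)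

theorem torus_xh (u : Fin 2 → ℂ) (i k : Fin 2) :
    torus u (xh i k) = expH (u 0 * wt i + u 1 * wt k) • xh i k := Mh.lift_xh _ i k

theorem torus_torus (u v : Fin 2 → ℂ) (x : Mh) : torus u (torus v x) = torus (u + v) x := by
  have : (torus u).comp (torus v) = torus (u + v) := Mh.algHom_ext fun i k => by
    rw [AlgHom.comp_apply, torus_xh, map_smul, torus_xh, torus_xh, smul_smul, ← expH_add']
    congr 2
    simp only [Pi.add_apply]
    ring
  exact AlgHom.congr_fun this x

theorem torus_zero : torus 0 = AlgHom.id Ch Mh := Mh.algHom_ext fun i k => by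
  rw [torus_xh]
  simp [expH_zero]

theorem torus_comm (u v : Fin 2 → ℂ) (x : Mh) : torus u (torus v x) = torus v (torus u x) := by
  rw [torus_torus, torus_torus, add_comm]

/-- Transposition of quantum matrices. -/
def transp : Mh →ₐ[Ch] Mh := Mh.lift (x := fun i k => xh k i) (by
  have h := isQuantumMatrix_xh
  exact ⟨h.ac, h.ab, h.cd, h.bd, h.bc.symm, by rw [h.ad, h.bc]⟩)

@[simp] theorem transp_xh (i k : Fin 2) : transp (xh i k) = xh k i := Mh.lift_xh _ i k

theorem transp_torus_transp (u : Fin 2 → ℂ) :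
    transp.comp ((torus u).comp transp) = torus fun i => u (1 - i) :=
  Mh.algHom_ext fun i k => by
    simp only [AlgHom.comp_apply, transp_xh, torus_xh, map_smul]
    rw [add_comm]
    rfl

/-! ### The operators of the deformed action -/

section SpinHalf

variable {M : Type} [AddCommGroup M] [Module Ch M] (y : Fin 2 → M)

theorem irrepH_one_E_zero : ∑ r, irrepH 1 .E r 0 • y r = expH (1 / 2 : ℂ) • y 1 := by
  have h : irrepH 1 .E 1 0 = expH (1 / 2 : ℂ) := by
    simp only [irrepH, Matrix.of_apply]
    norm_num [qNum_one, csqrt_one]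
  rw [Fin.sum_univ_two, h, show irrepH 1 .E 0 0 = 0 by simp [irrepH], zero_smul, zero_add]

theorem irrepH_one_E_one : ∑ r, irrepH 1 .E r 1 • y r = 0 := by
  rw [Fin.sum_univ_two, show irrepH 1 .E 0 1 = 0 by simp [irrepH],
    show irrepH 1 .E 1 1 = 0 by simp [irrepH], zero_smul, zero_smul, zero_add]

theorem irrepH_one_F_zero : ∑ r, irrepH 1 .F r 0 • y r = 0 := by
  rw [Fin.sum_univ_two, show irrepH 1 .F 0 0 = 0 by simp [irrepH],
    show irrepH 1 .F 1 0 = 0 by simp [irrepH], zero_smul, zero_smul, zero_add]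

theorem irrepH_one_F_one : ∑ r, irrepH 1 .F r 1 • y r = expH (-(1 / 2) : ℂ) • y 0 := by
  have h : irrepH 1 .F 0 1 = expH (-(1 / 2) : ℂ) := by
    simp only [irrepH, Matrix.of_apply]
    norm_num [qNum_one, csqrt_one]
  rw [Fin.sum_univ_two, h, show irrepH 1 .F 1 1 = 0 by simp [irrepH], zero_smul, add_zero]

theorem irrepH_one_H (k : Fin 2) :
    ∑ r, irrepH 1 .H r k • y r = (PowerSeries.C (wt k) : Ch) • y k := by
  have h : irrepH 1 .H k k = PowerSeries.C (wt k) := by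
    simp only [irrepH, Matrix.of_apply, if_true]
    congr 1
    fin_cases k <;> norm_num
  rw [Finset.sum_eq_single k (fun r _ hr => by simp [irrepH, hr]) (by simp), h]

end SpinHalf

/-- The left twists of the coproducts of the generators. -/
def twistL : Gen → ℂ
  | .F => -1
  | _ => 0

/-- The right twists of the coproducts of the generators. -/
def twistR : Gen → ℂ
  | .E => 1
  | _ => 0

theorem torus_single_xh (c : ℂ) (i k : Fin 2) :
    torus (Pi.single 1 c) (xh i k) = expH (c * wt k) • xh i k := by
  rw [torus_xh]
  simp

section Scalars

/-- The structure of `ℂ[[ℏ]]` as an algebra over `ℕ` whose scalar multiplication is the one of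
additive monoids; with it `module` can compute over `ℂ[[ℏ]]`. -/
abbrev chNatAlgebra : Algebra ℕ Ch := Semiring.toNatAlgebra

/-- The structure of `ℂ[[ℏ]]` as an algebra over `ℤ` whose scalar multiplication is the one of
additive groups. -/
abbrev chIntAlgebra : Algebra ℤ Ch := Ring.toIntAlgebra Ch

attribute [local instance] chNatAlgebra chIntAlgebra

/-- The relations of quantum matrices are respected by the action of the generators on the
columns. -/
theorem exists_colOp (g : Gen) : ∃ D : Module.End Ch Mh,
    IsTwistedDer (torus (Pi.single 1 (twistL g))) (torus (Pi.single 1 (twistR g))) D ∧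
      ∀ i k, D (xh i k) = ∑ r, irrepH 1 g r k • xh i r := by
  have h := isQuantumMatrix_xh
  have hQ : expH (1 : ℂ) * expH (-1 : ℂ) = 1 := by
    rw [← expH_add', add_neg_cancel, expH_zero]
  apply exists_twistedDer <;> cases g <;>
    simp only [irrepH_one_E_zero, irrepH_one_E_one, irrepH_one_F_zero, irrepH_one_F_one,
      irrepH_one_H, twistL, twistR, torus_single_xh, wt_zero, wt_one, zero_mul, mul_zero,
      neg_mul, mul_neg, mul_one, neg_neg, neg_zero, expH_zero, one_smul, smul_mul_assoc,
      mul_smul_comm,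
      smul_smul, smul_zero, add_zero, zero_add, map_neg, map_one, neg_smul,
      neg_add_cancel, add_neg_cancel]
  case ab.F => rw [mul_comm]
  case ac.E =>
    linear_combination (norm := module) (expH (1 / 2 : ℂ)) • h.ad +
      (expH (1 : ℂ) * expH (1 / 2 : ℂ)) • h.bc -
      (expH (1 / 2 : ℂ) * hQ) • (xh 1 1 * xh 0 0)
  case ac.H => linear_combination (norm := module) -h.ac - h.ac
  case bd.F =>
    linear_combination (norm := module) (expH (-(1 / 2) : ℂ)) • h.ad +
      (expH (1 : ℂ) * expH (-(1 / 2) : ℂ)) • h.bc -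
      (expH (-(1 / 2) : ℂ) * hQ) • (xh 1 1 * xh 0 0)
  case bd.H => linear_combination (norm := module) h.bd + h.bd
  case cd.F => rw [mul_comm]
  case bc.E => linear_combination (norm := module) (expH (1 / 2 : ℂ)) • h.bd
  case bc.F => linear_combination (norm := module) (expH (-(1 / 2) : ℂ)) • h.ac
  case ad.E =>
    linear_combination (norm := module) (expH (-1 : ℂ) * expH (1 / 2 : ℂ)) • h.bd +
      (expH (1 / 2 : ℂ) * hQ) • (xh 1 1 * xh 0 1)
  case ad.F =>
    linear_combination (norm := module) (expH (-1 : ℂ) * expH (-(1 / 2) : ℂ)) • h.ac +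
      (expH (-(1 / 2) : ℂ) * hQ) • (xh 1 0 * xh 0 0)

end Scalars

/-- The operators by which the generators of the second copy of `U_ℏ(sl₂)` act. -/
def colOp (g : Gen) : Module.End Ch Mh := Classical.choose (exists_colOp g)

theorem colOp_twistedDer (g : Gen) :
    IsTwistedDer (torus (Pi.single 1 (twistL g))) (torus (Pi.single 1 (twistR g))) (colOp g) :=
  (Classical.choose_spec (exists_colOp g)).1

theorem colOp_xh (g : Gen) (i k : Fin 2) : colOp g (xh i k) = ∑ r, irrepH 1 g r k • xh i r :=
  (Classical.choose_spec (exists_colOp g)).2 i k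

/-- The operators by which the generators of the two copies of `U_ℏ(sl₂)` act; the first copy is
obtained from the second one by transposition. -/
def op (s : Fin 2) (g : Gen) : Module.End Ch Mh :=
  if s = 0 then transp.toLinearMap ∘ₗ colOp g ∘ₗ transp.toLinearMap else colOp g

theorem op_twistedDer (s : Fin 2) (g : Gen) :
    IsTwistedDer (torus (Pi.single s (twistL g))) (torus (Pi.single s (twistR g))) (op s g) := by
  fin_cases s
  · have h (c : ℂ) : (fun i : Fin 2 => (Pi.single 1 c : Fin 2 → ℂ) (1 - i)) = Pi.single 0 c := by
      funext i
      fin_cases i <;> rfl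
    have := (colOp_twistedDer g).conj transp
    rw [transp_torus_transp, transp_torus_transp, h, h] at this
    exact this
  · exact colOp_twistedDer g

theorem op_zero_xh (g : Gen) (i k : Fin 2) : op 0 g (xh i k) = ∑ r, irrepH 1 g r i • xh r k := by
  change transp (colOp g (transp (xh i k))) = _
  rw [transp_xh, colOp_xh, map_sum]
  simp

theorem op_one_xh (g : Gen) (i k : Fin 2) : op 1 g (xh i k) = ∑ r, irrepH 1 g r k • xh i r :=
  colOp_xh g i k

/-- The weights of the generators. -/
def genWt : Gen → ℂ
  | .E => 2
  | .F => -2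
  | .H => 0

theorem irrepH_one_mul_expH (g : Gen) (r i : Fin 2) (c : ℂ) :
    irrepH 1 g r i * expH (c * wt r) = irrepH 1 g r i * expH (c * genWt g + c * wt i) := by
  cases g <;> fin_cases r <;> fin_cases i <;> simp [irrepH, genWt] <;> left <;> ring_nf

theorem torus_op (u : Fin 2 → ℂ) (s : Fin 2) (g : Gen) (x : Mh) :
    torus u (op s g x) = expH (u s * genWt g) • op s g (torus u x) := by
  refine (op_twistedDer s g).map_comm (torus_comm _ _) (torus_comm _ _) (fun i k => ?_) x
  rw [torus_xh, map_smul, smul_smul, ← expH_add']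
  fin_cases s
  · simp only [Fin.zero_eta, op_zero_xh, map_sum, map_smul, torus_xh, Finset.smul_sum, smul_smul]
    refine Finset.sum_congr rfl fun r _ => ?_
    rw [expH_add', ← mul_assoc, irrepH_one_mul_expH, ← add_assoc,
      expH_add' (u 0 * genWt g + u 0 * wt i)]
    congr 1
    ring
  · simp only [Fin.mk_one, op_one_xh, map_sum, map_smul, torus_xh, Finset.smul_sum, smul_smul]
    refine Finset.sum_congr rfl fun r _ => ?_
    rw [add_comm (u 0 * _), add_comm (u 0 * _), expH_add', ← mul_assoc, irrepH_one_mul_expH,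
      ← add_assoc, expH_add' (u 1 * genWt g + u 1 * wt k)]
    congr 1
    ring

end QuantumEuclid

namespace QuantumEuclid

/-! ### The deformed action -/

/-- A deformed algebra has no torsion over `ℂ[[ℏ]]`. -/
theorem Mh.smul_eq_zero {c : Ch} (hc : c ≠ 0) {x : Mh} (h : c • x = 0) : x = 0 := by
  have hX : ∀ (k : ℕ) (x : Mh), (PowerSeries.X : Ch) ^ k • x = 0 → x = 0 := by
    intro k
    induction k with
    | zero => intro x h; simpa using h
    | succ k ih =>
      intro x h
      rw [pow_succ, mul_smul] at h
      exact Mh.X_smul_eq_zero (ih _ h)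
  rw [← PowerSeries.X_pow_order_mul_divXPowOrder (f := c), mul_smul] at h
  have hu : IsUnit (PowerSeries.divXPowOrder c) := by
    rw [PowerSeries.isUnit_iff_constantCoeff, isUnit_iff_ne_zero,
      PowerSeries.constantCoeff_divXPowOrder]
    exact PowerSeries.coeff_order hc
  obtain ⟨u, hu⟩ := hu
  have := hX _ _ h
  rw [← hu] at this
  rw [← one_smul Ch x, ← u.inv_mul, mul_smul, this, smul_zero]

/-- The coordinates of quantum Euclidean space; the first index is the one on which copy `s` of
`U_ℏ(sl₂)` acts. -/
def xs (s i k : Fin 2) : Mh := if s = 0 then xh i k else xh k i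

theorem forall_xs (s : Fin 2) {P : Mh → Prop} (h : ∀ i k, P (xs s i k)) (i k : Fin 2) :
    P (xh i k) := by
  fin_cases s
  · exact h i k
  · exact h k i

theorem IsTwistedDer.ext_xs {σ τ : Mh →ₐ[Ch] Mh} {D D' : Module.End Ch Mh} (s : Fin 2)
    (h : IsTwistedDer σ τ D) (h' : IsTwistedDer σ τ D')
    (hg : ∀ i k, D (xs s i k) = D' (xs s i k)) : D = D' :=
  h.ext h' (forall_xs s (P := fun x => D x = D' x) hg)

theorem op_xs (s : Fin 2) (g : Gen) (i k : Fin 2) :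
    op s g (xs s i k) = ∑ r, irrepH 1 g r i • xs s r k := by
  fin_cases s
  · exact op_zero_xh g i k
  · exact op_one_xh g k i

theorem torus_xs (s : Fin 2) (c : ℂ) (i k : Fin 2) :
    torus (Pi.single s c) (xs s i k) = expH (c * wt i) • xs s i k := by
  fin_cases s <;> simp [xs, torus_xh]

theorem op_H_twistedDer (s : Fin 2) :
    IsTwistedDer (AlgHom.id Ch Mh) (AlgHom.id Ch Mh) (op s .H) := by
  have := op_twistedDer s .H
  simp only [twistL, twistR, Pi.single_zero, torus_zero] at this
  exact this

/-- The two copies of `U_ℏ(sl₂)` act by commuting operators. -/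
theorem commute_op (g g' : Gen) : Commute (op 0 g) (op 1 g') := by
  have h0 (c : ℂ) (x : Mh) : op 0 g (torus (Pi.single 1 c) x) =
      torus (Pi.single 1 c) (op 0 g x) := by
    rw [torus_op]; simp [expH_zero]
  have h1 (c : ℂ) (x : Mh) :
      op 1 g' (torus (Pi.single 0 c) x) = torus (Pi.single 0 c) (op 1 g' x) := by
    rw [torus_op]; simp [expH_zero]
  refine (op_twistedDer 0 g).commute (op_twistedDer 1 g') (torus_comm _ _) (torus_comm _ _)
    (h0 _) (h0 _) (h1 _) (h1 _) fun i k => ?_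
  rw [op_one_xh, op_zero_xh, map_sum, map_sum]
  simp only [map_smul, op_one_xh, op_zero_xh, Finset.smul_sum]
  rw [Finset.sum_comm]
  exact Finset.sum_congr rfl fun _ _ => Finset.sum_congr rfl fun _ _ => smul_comm _ _ _

theorem irrepH_one_mul_wt (g : Gen) (r i : Fin 2) :
    irrepH 1 g r i * PowerSeries.C (wt r) = irrepH 1 g r i * PowerSeries.C (genWt g + wt i) := by
  have h : irrepH 1 g r i = 0 ∨ wt r = genWt g + wt i := by
    cases g <;> fin_cases r <;> fin_cases i <;>
      first
        | (left; simp [irrepH]; done)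
        | (right; norm_num [genWt])
  rcases h with h | h <;> rw [h]
  rw [zero_mul, zero_mul]

theorem op_H_xs (s i k : Fin 2) : op s .H (xs s i k) = (PowerSeries.C (wt i) : Ch) • xs s i k := by
  rw [op_xs, irrepH_one_H fun r => xs s r k]

/-- The generators are eigenvectors of `ad H`. -/
theorem op_H_mul_op (s : Fin 2) (g : Gen) : op s .H * op s g - op s g * op s .H =
    (PowerSeries.C (genWt g) : Ch) • op s g := by
  have hD := op_twistedDer s g
  have hH := op_H_twistedDer s
  have ht (u x) : torus u (op s .H x) = op s .H (torus u x) := by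
    rw [torus_op]; simp [genWt, expH_zero]
  refine IsTwistedDer.ext_xs s (σ := torus (Pi.single s (twistL g)))
    (τ := torus (Pi.single s (twistR g))) (fun x y => ?_) (fun x y => ?_) fun i k => ?_
  · simp only [LinearMap.sub_apply, Module.End.mul_apply]
    have e1 := hD x y
    have e2 := hH x y
    simp only [AlgHom.id_apply] at e2
    rw [e1, e2, map_add, map_add, hH, hH, hD, hD, ht, ht]
    simp only [AlgHom.id_apply, mul_sub, sub_mul]
    abel
  · rw [LinearMap.smul_apply, LinearMap.smul_apply, LinearMap.smul_apply, hD, smul_add,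
      mul_smul_comm, smul_mul_assoc]
  · rw [LinearMap.sub_apply, Module.End.mul_apply, Module.End.mul_apply, op_H_xs, map_smul, op_xs,
      map_sum, LinearMap.smul_apply, op_xs, Finset.smul_sum, Finset.smul_sum,
      ← Finset.sum_sub_distrib]
    refine Finset.sum_congr rfl fun r _ => ?_
    rw [map_smul, op_H_xs, smul_smul, irrepH_one_mul_wt, smul_smul, smul_smul, ← sub_smul, map_add]
    congr 1
    ring

/-- A product of generators. -/
def word (l : List (Fin 2 × Fin 2)) : Mh := (l.map fun p => xh p.1 p.2).prod

theorem Mh.linear_ext_word {M : Type} [AddCommGroup M] [Module Ch M] [HComplete M]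
    {f f' : Mh →ₗ[Ch] M} (h : ∀ l, f (word l) = f' (word l)) : f = f' := by
  let F (f : Mh →ₗ[Ch] M) : Mh →ₗ[Ch] List (Fin 2 × Fin 2) → M :=
    LinearMap.pi fun l => f ∘ₗ LinearMap.mulLeft Ch (word l)
  have hF : F f = F f' := Mh.linear_ext (funext fun l => by
      change f (word l * 1) = f' (word l * 1)
      rw [mul_one, h]) fun i k x hx => funext fun l => by
      have := congrFun hx (l ++ [(i, k)])
      change f (word l * (xh i k * x)) = f' (word l * (xh i k * x))
      change f (word (l ++ [(i, k)]) * x) = f' (word (l ++ [(i, k)]) * x) at this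
      simpa [word, mul_assoc] using this
  refine LinearMap.ext fun x => ?_
  have := congrFun (LinearMap.congr_fun hF x) []
  change f (word [] * x) = f' (word [] * x) at this
  simpa [word] using this

/-- The weight of a word for copy `s`. -/
def wordWt (s : Fin 2) (l : List (Fin 2 × Fin 2)) : ℂ :=
  (l.map fun p => wt (if s = 0 then p.1 else p.2)).sum

theorem xh_eq_xs (s i k : Fin 2) :
    xh i k = xs s (if s = 0 then i else k) (if s = 0 then k else i) := by
  fin_cases s <;> rfl

theorem torus_word (s : Fin 2) (c : ℂ) (l : List (Fin 2 × Fin 2)) :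
    torus (Pi.single s c) (word l) = expH (c * wordWt s l) • word l := by
  induction l with
  | nil => simp [word, wordWt, expH_zero]
  | cons p l ih =>
    rw [word, List.map_cons, List.prod_cons, map_mul, ← word, ih, xh_eq_xs s, torus_xs,
      smul_mul_smul_comm, ← expH_add', ← mul_add]
    rfl

theorem op_H_word (s : Fin 2) (l : List (Fin 2 × Fin 2)) :
    op s .H (word l) = (PowerSeries.C (wordWt s l) : Ch) • word l := by
  induction l with
  | nil => simp [word, wordWt, (op_H_twistedDer s).one]
  | cons p l ih =>
    rw [word, List.map_cons, List.prod_cons, op_H_twistedDer, ← word, ih, xh_eq_xs s, op_H_xs,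
      AlgHom.id_apply, AlgHom.id_apply, mul_smul_comm, smul_mul_assoc, ← add_smul, ← map_add,
      add_comm]
    rfl

/-- Both sides act on a word by the same scalar. -/
theorem hexp_op_H (s : Fin 2) (c : ℂ) :
    hexp ((PowerSeries.C c : Ch) • op s .H) = (torus (Pi.single s c)).toLinearMap :=
  Mh.linear_ext_word fun l => by
    have : ((PowerSeries.C c : Ch) • op s .H) (word l) =
        (PowerSeries.C (c * wordWt s l) : Ch) • word l := by
      rw [LinearMap.smul_apply, op_H_word, smul_smul, ← map_mul]
    rw [hexp_apply_of_eigen this, AlgHom.toLinearMap_apply, torus_word]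

theorem qDiff_smul_hqNum {B : Type} [Ring B] [Algebra Ch B] [HComplete B] (b : B) :
    qDiff • hqNum b = hexp b - hexp (-b) := by
  have := congrArg (evalH fun _ : Unit => b) (qNum_spec (FreeAlgebra.ι ℂ ()))
  rw [map_mul (evalH _), map_sub (evalH _) (expH _), map_expH_series, map_expH_series,
    map_qNum_series, map_neg, map_neg] at this
  have hg : evalH (fun _ : Unit => b) (PowerSeries.C (FreeAlgebra.ι ℂ ())) = b := evalH_gen _ ()
  rw [hg] at this
  rw [← this, Algebra.smul_def]
  congr 1
  exact ((evalH fun _ : Unit => b).commutes _).symm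

/-- The bracket of `E` and `F`: both sides, multiplied by `e^ℏ - e^{-ℏ}`, are twisted
derivations. -/
theorem op_E_mul_op_F (s : Fin 2) :
    op s .E * op s .F - op s .F * op s .E = hqNum (op s .H) := by
  have hE := op_twistedDer s .E
  have hF := op_twistedDer s .F
  simp only [twistL, twistR, Pi.single_zero, torus_zero] at hE hF
  have key : qDiff • (op s .E * op s .F - op s .F * op s .E) =
      (torus (Pi.single s 1)).toLinearMap - (torus (Pi.single s (-1))).toLinearMap := by
    refine IsTwistedDer.ext_xs s (σ := torus (Pi.single s (-1))) (τ := torus (Pi.single s 1))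
      (fun x y => ?_) (fun x y => ?_) fun i k => ?_
    · simp only [LinearMap.sub_apply, LinearMap.smul_apply, Module.End.mul_apply]
      have e1 := hE x y
      have e2 := hF x y
      simp only [AlgHom.id_apply] at e1 e2
      rw [e1, e2, map_add, map_add, hE, hE, hF, hF]
      have t1 : op s .E (torus (Pi.single s (-1)) x) =
          expH (2 : ℂ) • torus (Pi.single s (-1)) (op s .E x) := by
        rw [torus_op, smul_smul, ← expH_add']
        simp [genWt, expH_zero]
      have t2 : op s .F (torus (Pi.single s 1) y) =
          expH (2 : ℂ) • torus (Pi.single s 1) (op s .F y) := by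
        rw [torus_op, smul_smul, ← expH_add']
        simp [genWt, expH_zero]
      rw [t1, t2]
      simp only [AlgHom.id_apply, mul_smul_comm, smul_mul_assoc, smul_sub, smul_add, mul_sub,
        sub_mul]
      abel
    · simp only [LinearMap.sub_apply, AlgHom.toLinearMap_apply, map_mul, mul_sub, sub_mul]
      abel
    · have hP : expH (1 / 2 : ℂ) * expH (-(1 / 2) : ℂ) = 1 := by
        rw [← expH_add', add_neg_cancel, expH_zero]
      simp only [LinearMap.sub_apply, LinearMap.smul_apply, Module.End.mul_apply,
        AlgHom.toLinearMap_apply, torus_xs, op_xs]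
      fin_cases i
      · simp only [Fin.zero_eta, irrepH_one_E_zero fun r => xs s r k,
          irrepH_one_F_zero fun r => xs s r k, map_zero, map_smul, op_xs, zero_sub,
          irrepH_one_F_one fun r => xs s r k, smul_smul, hP, wt_zero, one_smul, ← sub_smul]
        rw [smul_neg, ← neg_smul, qDiff]
        norm_num
      · simp only [Fin.mk_one, irrepH_one_E_one fun r => xs s r k,
          irrepH_one_F_one fun r => xs s r k, map_zero, map_smul, op_xs, sub_zero,
          irrepH_one_E_zero fun r => xs s r k, smul_smul, mul_comm (expH (-(1 / 2) : ℂ)), hP,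
          wt_one, one_smul, ← sub_smul, mul_one]
        rfl
  rw [← sub_eq_zero]
  refine LinearMap.ext fun x => Mh.smul_eq_zero qDiff_ne_zero ?_
  have h1 := hexp_op_H s 1
  have h2 := hexp_op_H s (-1)
  rw [map_one, one_smul] at h1
  rw [show (PowerSeries.C (-1) : Ch) • op s .H = -op s .H by
    rw [← sub_eq_zero, sub_neg_eq_add, ← one_smul Ch (op s .H), smul_smul, ← add_smul, mul_one,
      ← map_one PowerSeries.C, ← map_add, neg_add_cancel, map_zero, zero_smul]] at h2
  rw [← LinearMap.smul_apply, smul_sub, key, qDiff_smul_hqNum, h1, h2, sub_self,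
    LinearMap.zero_apply]

/-- The representation of one copy of `U_ℏ(sl₂)` on `M_ℏ(2)`. -/
def opHom (s : Fin 2) : Uh →ₐ[Ch] Module.End Ch Mh :=
  Uh.lift (op s) (op_H_mul_op s .E) (op_H_mul_op s .F) (op_E_mul_op_F s)

theorem opHom_gen (s : Fin 2) (g : Gen) : opHom s (Uh.gen g) = op s g := Uh.lift_gen _ _ _ _ g

theorem commute_opHom (x y : Uh) : Commute (opHom 0 x) (opHom 1 y) := by
  have h1 (T : Module.End Ch Mh) (s : Fin 2) (hT : ∀ g, Commute (op s g) T) (x : Uh) :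
      Commute (opHom s x) T := by
    have : LinearMap.mulRight Ch T ∘ₗ (opHom s).toLinearMap =
        LinearMap.mulLeft Ch T ∘ₗ (opHom s).toLinearMap := HAlg.linear_ext (by simp)
      fun g x hx => by
        change opHom s x * T = T * opHom s x at hx
        change opHom s (Uh.gen g * x) * T = T * opHom s (Uh.gen g * x)
        rw [map_mul, mul_assoc, hx, ← mul_assoc, ← mul_assoc, opHom_gen, hT]
    exact LinearMap.congr_fun this x
  exact h1 _ 0 (fun g => (h1 _ 1 (fun g' => (commute_op g g').symm) y).symm) x

theorem exists_action : ∃ ρ : UhSo →ₐ[Ch] Module.End Ch Mh,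
    ∀ s g, ρ (emb s g) = opHom s g := by
  obtain ⟨β, hβ⟩ := exists_isBeta alphaEquiv
  obtain ⟨F, hF⟩ := exists_tensorLift ((opHom 0).comp (alphaEquiv : U⟦X⟧ →ₐ[Ch] Uh))
    ((opHom 1).comp (alphaEquiv : U⟦X⟧ →ₐ[Ch] Uh)) fun x y => commute_opHom _ _
  refine ⟨F.comp β.symm.toAlgHom, fun s g => ?_⟩
  obtain ⟨x, rfl⟩ := alphaEquiv.surjective g
  fin_cases s
  · have := hF x 1
    rw [map_one, map_one, mul_one, mul_one] at this
    change F (β.symm (emb 0 (alphaEquiv x))) = _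
    rw [← hβ.apply_inclL, AlgEquiv.symm_apply_apply, this]
    rfl
  · have := hF 1 x
    rw [map_one, map_one, one_mul, one_mul] at this
    change F (β.symm (emb 1 (alphaEquiv x))) = _
    rw [← hβ.apply_inclR, AlgEquiv.symm_apply_apply, this]
    rfl

theorem emb_expCH {B : Type} [Ring B] [Algebra Ch B] [HComplete B] (ρ : UhSo →ₐ[Ch] B) (s : Fin 2)
    (c : ℂ) : ρ (emb s (Uh.expCH c)) = hexp ((PowerSeries.C c : Ch) • ρ (emb s (Uh.gen .H))) := by
  rw [← embHom_apply, ← embHom_apply, Uh.expCH]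
  have := map_expH_series ((ρ.comp (embHom s)).comp (HAlg.mk UhRels)) (c • FreeAlgebra.ι ℂ Gen.H)
  rw [C_smul_eq, map_smul] at this
  exact this

/-- A deformed action is given by the operators `op`. -/
theorem IsDeformedAction.apply_gen {ρ : UhSo →ₐ[Ch] Module.End Ch Mh} (h : IsDeformedAction ρ)
    (s : Fin 2) (g : Gen) : ρ (emb s (Uh.gen g)) = op s g := by
  have hx (s : Fin 2) (g : Gen) (i k : Fin 2) :
      ρ (emb s (Uh.gen g)) (xh i k) = op s g (xh i k) := by
    fin_cases s
    · exact ((h.gens g i k).1).trans (op_zero_xh g i k).symm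
    · exact ((h.gens g i k).2).trans (op_one_xh g i k).symm
  have hH (s : Fin 2) : ρ (emb s (Uh.gen .H)) = op s .H :=
    IsTwistedDer.ext (σ := AlgHom.id Ch Mh) (τ := AlgHom.id Ch Mh)
      (fun x y => (h.leibniz_H s x y).trans (add_comm _ _)) (op_H_twistedDer s) (hx s .H)
  have ht (s : Fin 2) (c : ℂ) : ρ (emb s (Uh.expCH c)) = (torus (Pi.single s c)).toLinearMap := by
    rw [emb_expCH, hH, hexp_op_H]
  cases g with
  | H => exact hH s
  | E =>
    refine IsTwistedDer.ext (fun x y => ?_) (op_twistedDer s .E) (hx s .E)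
    rw [h.leibniz_E, ht, add_comm]
    simp [twistL, twistR, torus_zero]
  | F =>
    refine IsTwistedDer.ext (fun x y => ?_) (op_twistedDer s .F) (hx s .F)
    rw [h.leibniz_F, ht, add_comm]
    simp [twistL, twistR, torus_zero]

theorem existsUnique_deformedAction :
    ∃! ρ : UhSo →ₐ[Ch] Module.End Ch Mh, IsDeformedAction ρ := by
  obtain ⟨ρ, hρ⟩ := exists_action
  have hg (s : Fin 2) (g : Gen) : ρ (emb s (Uh.gen g)) = op s g := by rw [hρ, opHom_gen]
  have ht (s : Fin 2) (c : ℂ) : ρ (emb s (Uh.expCH c)) = (torus (Pi.single s c)).toLinearMap := by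
    rw [emb_expCH, hg, hexp_op_H]
  refine ⟨ρ, ⟨fun g p p' => ⟨?_, ?_⟩, fun s x y => ?_, fun s x y => ?_, fun s x y => ?_⟩,
    fun ρ' hρ' => UhSo.algHom_ext fun s g => ?_⟩
  · rw [hg, op_zero_xh]
  · rw [hg, op_one_xh]
  · rw [hg, ht, op_twistedDer, add_comm]
    simp [twistL, twistR, torus_zero]
  · rw [hg, ht, op_twistedDer, add_comm]
    simp [twistL, twistR, torus_zero]
  · rw [hg, op_H_twistedDer, add_comm]
    rfl
  · rw [hg, hρ'.apply_gen]

end QuantumEuclid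

namespace QuantumEuclid

/-! ### Highest weight vectors -/

/-- The coefficient of `F̂` between the vectors of index `p` and `p - 1` of the spin-`N/2`
representation. -/
def coefF (N p : ℕ) : Ch :=
  expH (-((p : ℂ) - N / 2)) * csqrt (qNum (p : ℂ) * qNum ((N : ℂ) - p + 1))

/-- The coefficient of `Ê` between the vectors of index `p` and `p + 1` of the spin-`N/2`
representation. -/
def coefE (N p : ℕ) : Ch :=
  expH ((p : ℂ) - N / 2 + 1) * csqrt (qNum ((p : ℂ) + 1) * qNum ((N : ℂ) - p))

theorem coefF_zero (N : ℕ) : coefF N 0 = 0 := by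
  simp [coefF, qNum_zero, csqrt_zero]

theorem coefE_self (N : ℕ) : coefE N N = 0 := by
  simp [coefE, qNum_zero, csqrt_zero]

theorem isPos_qNum_sub {N p : ℕ} (h : p < N) : IsPos (qNum ((N : ℂ) - p)) := by
  have := isPos_qNum_nat (n := N - p) (by omega)
  rwa [Nat.cast_sub h.le] at this

theorem isPos_qNum_succ (p : ℕ) : IsPos (qNum ((p : ℂ) + 1)) := by
  have := isPos_qNum_nat (n := p + 1) (by omega)
  rwa [Nat.cast_succ] at this

theorem isPos_coefF {N p : ℕ} (h : p < N) : IsPos (coefF N (p + 1)) := by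
  rw [coefF]
  refine (isPos_expH _).mul (IsPos.csqrt ?_)
  push_cast
  rw [show (N : ℂ) - (p + 1) + 1 = N - p by ring]
  exact (isPos_qNum_succ p).mul (isPos_qNum_sub h)

theorem coefE_mul_coefF {N p : ℕ} (h : p < N) :
    coefE N p * coefF N (p + 1) = qNum ((p : ℂ) + 1) * qNum ((N : ℂ) - p) := by
  rw [coefE, coefF]
  push_cast
  rw [show (N : ℂ) - (p + 1) + 1 = N - p by ring, mul_mul_mul_comm, ← expH_add',
    csqrt_mul_self ((isPos_qNum_succ p).mul (isPos_qNum_sub h))]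
  rw [show (p : ℂ) - N / 2 + 1 + -(p + 1 - N / 2) = 0 by ring, expH_zero, one_mul]

section Sums

variable {M : Type} [AddCommGroup M] [Module Ch M]

theorem sum_irrepH_F (N : ℕ) (p : Fin (N + 1)) (y : ℕ → M) :
    ∑ r, irrepH N .F r p • y r = coefF N p • y (p - 1) := by
  obtain ⟨p, hp⟩ := p
  cases p with
  | zero =>
    rw [coefF_zero, zero_smul]
    exact Finset.sum_eq_zero fun r _ => by simp [irrepH]
  | succ p =>
    rw [Finset.sum_eq_single ⟨p, by omega⟩]
    · simp only [irrepH, Matrix.of_apply, if_true, coefF, Nat.add_sub_cancel]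
      congr 4
      · congr 1; ring
      · ring_nf
    · intro r _ hr
      have : (r : ℕ) ≠ p := fun h => hr (Fin.ext h)
      simp [irrepH, this]
    · simp

theorem sum_irrepH_E (N : ℕ) (p : Fin (N + 1)) (y : ℕ → M) :
    ∑ r, irrepH N .E r p • y r = coefE N p • y (p + 1) := by
  obtain ⟨p, hp⟩ := p
  rcases Nat.lt_or_ge p N with h | h
  · rw [Finset.sum_eq_single ⟨p + 1, by omega⟩]
    · simp only [irrepH, Matrix.of_apply, if_true, coefE]
      congr 4
      · congr 1; ring
      · ring_nf
    · intro r _ hr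
      have : (r : ℕ) ≠ p + 1 := fun h => hr (Fin.ext h)
      simp [irrepH, this]
    · simp
  · obtain rfl : p = N := by omega
    simp only [coefE_self, zero_smul]
    refine Finset.sum_eq_zero fun r _ => ?_
    have : (r : ℕ) ≠ p + 1 := by omega
    simp [irrepH, this]

theorem sum_irrepH_H (N : ℕ) (p : Fin (N + 1)) (y : ℕ → M) :
    ∑ r, irrepH N .H r p • y r = (PowerSeries.C (2 * ((p : ℂ) - N / 2)) : Ch) • y p := by
  rw [Finset.sum_eq_single p]
  · simp [irrepH]
  · intro r _ hr
    simp [irrepH, hr]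
  · simp

/-- The normalized lowering operator from the highest weight vector to the vector of index `p`. -/
def lower (N : ℕ) (F : Module.End Ch M) (p : ℕ) : Module.End Ch M :=
  (∏ i ∈ Finset.range (N - p), (coefF N (N - i))⁻¹) • F ^ (N - p)

theorem lower_self (N : ℕ) (F : Module.End Ch M) : lower N F N = 1 := by
  simp [lower]

theorem commute_lower {N : ℕ} {F G : Module.End Ch M} (h : Commute G F) (p : ℕ) :
    Commute G (lower N F p) := (h.pow_right _).smul_right _

theorem mul_lower (N : ℕ) (F : Module.End Ch M) {p : ℕ} (hp : p < N) :
    F * lower N F (p + 1) = coefF N (p + 1) • lower N F p := by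
  have h1 : N - p = N - (p + 1) + 1 := by omega
  have h2 : N - (N - (p + 1)) = p + 1 := by omega
  rw [lower, lower, h1, Finset.prod_range_succ, h2, mul_smul_comm, ← pow_succ', smul_smul,
    mul_left_comm, PowerSeries.mul_inv_cancel _ (isPos_coefF hp).ne_zero, mul_one]

variable [HComplete M]

/-- A highest weight vector of weight `N` that generates a representation of dimension at most
`N + 1`. -/
structure IsHighest (N : ℕ) (op : Gen → Module.End Ch M) (v : M) : Prop where
  E : op .E v = 0
  H : op .H v = (PowerSeries.C (N : ℂ) : Ch) • v
  F : (op .F ^ (N + 1)) v = 0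

/-- Operators that represent `U_ℏ(sl₂)`. -/
structure IsRep (op : Gen → Module.End Ch M) : Prop where
  HF : op .H * op .F - op .F * op .H = (PowerSeries.C (-2) : Ch) • op .F
  EF : op .E * op .F - op .F * op .E = hqNum (op .H)

variable {N : ℕ} {op : Gen → Module.End Ch M} {v : M}

theorem IsHighest.H_pow (h : IsHighest N op v) (hr : IsRep op) (k : ℕ) :
    op .H ((op .F ^ k) v) = (PowerSeries.C ((N : ℂ) - 2 * k) : Ch) • (op .F ^ k) v := by
  induction k with
  | zero => simpa using h.H
  | succ k ih =>
    rw [pow_succ', Module.End.mul_apply, ← Module.End.mul_apply, eq_add_of_sub_eq hr.HF,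
      LinearMap.add_apply, LinearMap.smul_apply, Module.End.mul_apply, ih, map_smul, ← add_smul,
      ← map_add]
    congr 2
    push_cast
    ring

/-- The inductive step in the computation of `Ê F̂ᵏ v`: `[k][N - k + 1]` is the coefficient for
`k`, and `[N - 2k]` the contribution of `[Ê, F̂] = [Ĥ]`. -/
theorem qNum_bracket (N k : ℂ) :
    qNum k * qNum (N - k + 1) + qNum (N - 2 * k) = qNum (k + 1) * qNum (N - k) := by
  have e1 : qNum (N - k + 1) = expH 1 * qNum (N - k) + expH (-(N - k)) := qNum_add_one _
  have e2 : qNum (k + 1) = expH (-1) * qNum k + expH k := by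
    rw [add_comm, qNum_add, qNum_one, mul_one, add_comm]
  have e3 : qNum (N - 2 * k) = expH (-k) * qNum (N - k) - expH (-(N - k)) * qNum k := by
    rw [show N - 2 * k = N - k + -k by ring, qNum_add, qNum_neg]; ring
  have e4 : qDiff * qNum k = expH k - expH (-k) := qDiff_mul_qNum k
  rw [e1, e2, e3]
  rw [qDiff] at e4
  linear_combination qNum (N - k) * e4

theorem IsHighest.E_pow (h : IsHighest N op v) (hr : IsRep op) (k : ℕ) :
    op .E ((op .F ^ (k + 1)) v) =
      (qNum ((k : ℂ) + 1) * qNum ((N : ℂ) - k)) • (op .F ^ k) v := by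
  induction k with
  | zero =>
    rw [pow_succ', Module.End.mul_apply, ← Module.End.mul_apply, eq_add_of_sub_eq hr.EF,
      LinearMap.add_apply, hqNum_apply_of_eigen (h.H_pow hr 0), Module.End.mul_apply]
    simp [h.E, qNum_one]
  | succ k ih =>
    rw [pow_succ', Module.End.mul_apply, ← Module.End.mul_apply, eq_add_of_sub_eq hr.EF,
      LinearMap.add_apply, hqNum_apply_of_eigen (h.H_pow hr (k + 1)), Module.End.mul_apply, ih,
      map_smul, ← Module.End.mul_apply, ← pow_succ', ← add_smul, add_comm]
    congr 1
    have := qNum_bracket N (k + 1)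
    push_cast
    rw [← this]
    congr 3
    ring

theorem IsHighest.apply_lower (h : IsHighest N op v) (hr : IsRep op) (g : Gen) (p : Fin (N + 1)) :
    op g (lower N (op .F) p v) = ∑ r, irrepH N g r p • lower N (op .F) r v := by
  obtain ⟨p, hp⟩ := p
  cases g with
  | E =>
    rw [sum_irrepH_E N ⟨p, hp⟩ fun r => lower N (op .F) r v]
    rcases Nat.lt_or_ge p N with hpN | hpN
    · have h1 : N - p = N - (p + 1) + 1 := by omega
      have h2 : N - (N - (p + 1)) = p + 1 := by omega
      have h3 : ((N - (p + 1) : ℕ) : ℂ) = N - p - 1 := by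
        rw [Nat.cast_sub hpN]; push_cast; ring
      simp only [lower]
      rw [LinearMap.smul_apply, map_smul, h1, h.E_pow hr, Finset.prod_range_succ, h2,
        LinearMap.smul_apply, smul_smul, smul_smul, h3]
      congr 1
      have h4 := coefE_mul_coefF hpN
      have h5 := PowerSeries.mul_inv_cancel _ (isPos_coefF hpN).ne_zero
      rw [show (N : ℂ) - p - 1 + 1 = N - p by ring, show (N : ℂ) - (N - p - 1) = p + 1 by ring,
        mul_comm (qNum ((N : ℂ) - p)), ← h4]
      linear_combination (∏ i ∈ Finset.range (N - (p + 1)), (coefF N (N - i))⁻¹) * coefE N p * h5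
    · obtain rfl : p = N := by omega
      simp only [coefE_self, zero_smul, lower_self]
      exact h.E
  | F =>
    rw [sum_irrepH_F N ⟨p, hp⟩ fun r => lower N (op .F) r v]
    cases p with
    | zero =>
      simp only [coefF_zero, zero_smul]
      rw [lower, LinearMap.smul_apply, map_smul, ← Module.End.mul_apply, ← pow_succ']
      simp [h.F]
    | succ p =>
      rw [← Module.End.mul_apply, mul_lower N _ (by omega)]
      rfl
  | H =>
    rw [sum_irrepH_H N ⟨p, hp⟩ fun r => lower N (op .F) r v]
    simp only [lower]
    rw [LinearMap.smul_apply, map_smul, h.H_pow hr, smul_comm]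
    congr 3
    rw [Nat.cast_sub (by omega)]
    ring

end Sums

/-- A family that is lowered with invertible coefficients is determined by its highest member. -/
theorem eq_of_lowering {R M : Type} [CommRing R] [AddCommGroup M] [Module R M] {N : ℕ}
    (F : M → M) (a : ℕ → R) (ha : ∀ p < N, IsUnit (a (p + 1))) {y y' : Fin (N + 1) → M}
    (hy : ∀ (p : ℕ) (hp : p < N), F (y ⟨p + 1, by omega⟩) = a (p + 1) • y ⟨p, by omega⟩)
    (hy' : ∀ (p : ℕ) (hp : p < N), F (y' ⟨p + 1, by omega⟩) = a (p + 1) • y' ⟨p, by omega⟩)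
    (h : y (Fin.last N) = y' (Fin.last N)) : y = y' := by
  suffices ∀ (k p : ℕ) (hp : p + k = N), y ⟨p, by omega⟩ = y' ⟨p, by omega⟩ from
    funext fun p => this (N - p) p (by omega)
  intro k
  induction k with
  | zero => rintro p rfl; exact h
  | succ k ih =>
    intro p hp
    have h1 := hy p (by omega)
    rw [ih (p + 1) (by omega), hy' p (by omega)] at h1
    exact ((ha p (by omega)).smul_left_cancel.mp h1).symm

/-! ### The bases of the irreducible subrepresentations -/

theorem isRep_op (s : Fin 2) : IsRep (op s) := ⟨op_H_mul_op s .F, op_E_mul_op_F s⟩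

theorem xs_mul_xs (s k : Fin 2) : xs s 1 k * xs s 0 k = expH (-1 : ℂ) • (xs s 0 k * xs s 1 k) := by
  have h := isQuantumMatrix_xh
  have key {x y : Mh} (h : x * y = expH (1 : ℂ) • (y * x)) : y * x = expH (-1 : ℂ) • (x * y) := by
    rw [h, smul_smul, expH_neg_mul, one_smul]
  fin_cases s <;> fin_cases k
  exacts [key h.ac, key h.bd, key h.ab, key h.cd]

theorem op_E_xs_one_pow (s k : Fin 2) (y : ℕ) : op s .E (xs s 1 k ^ y) = 0 := by
  induction y with
  | zero => rw [pow_zero, (op_twistedDer s .E).one]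
  | succ y ih =>
    rw [pow_succ', op_twistedDer, ih, op_xs, irrepH_one_E_one fun r => xs s r k, mul_zero,
      zero_mul, add_zero]

theorem op_H_xs_one_pow (s k : Fin 2) (y : ℕ) :
    op s .H (xs s 1 k ^ y) = (PowerSeries.C (y : ℂ) : Ch) • xs s 1 k ^ y := by
  induction y with
  | zero => rw [pow_zero, (op_twistedDer s .H).one]; simp
  | succ y ih =>
    rw [pow_succ', op_H_twistedDer, ih, op_H_xs, AlgHom.id_apply, AlgHom.id_apply, mul_smul_comm,
      smul_mul_assoc, ← add_smul, ← map_add, wt_one]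
    push_cast
    rfl

theorem op_F_xs_pow_mul (s k : Fin 2) (x : ℕ) (z : Mh) :
    op s .F (xs s 0 k ^ x * z) = expH (x : ℂ) • (xs s 0 k ^ x * op s .F z) := by
  induction x with
  | zero => simp [expH_zero]
  | succ x ih =>
    have h1 := op_twistedDer s .F (xs s 0 k) (xs s 0 k ^ x * z)
    simp only [twistL, twistR, torus_xs, op_xs, irrepH_one_F_zero fun r => xs s r k, zero_mul,
      add_zero, wt_zero] at h1
    rw [pow_succ', mul_assoc, h1, ih, mul_smul_comm, smul_mul_assoc, smul_smul, ← expH_add',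
      ← mul_assoc]
    push_cast
    norm_num

theorem op_F_xs_one_pow (s k : Fin 2) (y : ℕ) : op s .F (xs s 1 k ^ y) =
    (expH (-(y : ℂ) + 1 / 2) * qNum (y : ℂ)) • (xs s 0 k * xs s 1 k ^ (y - 1)) := by
  induction y with
  | zero => rw [pow_zero, (op_twistedDer s .F).one]; simp [qNum_zero]
  | succ y ih =>
    have h1 := op_twistedDer s .F (xs s 1 k) (xs s 1 k ^ y)
    simp only [twistL, twistR, torus_xs, op_xs, irrepH_one_F_one fun r => xs s r k,
      wt_one, Pi.single_zero, torus_zero, AlgHom.id_apply] at h1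
    have h2 : qNum (y : ℂ) • (xs s 1 k * (xs s 0 k * xs s 1 k ^ (y - 1))) =
        (qNum (y : ℂ) * expH (-1)) • (xs s 0 k * xs s 1 k ^ y) := by
      cases y with
      | zero => simp [qNum_zero]
      | succ y =>
        rw [← mul_assoc, xs_mul_xs, smul_mul_assoc, mul_assoc, ← pow_succ', smul_smul]
        rfl
    have e2 : qNum ((y : ℂ) + 1) = expH (-1) * qNum (y : ℂ) + expH (y : ℂ) := by
      rw [add_comm, qNum_add, qNum_one, mul_one, add_comm]
    rw [pow_succ', h1, ih, smul_mul_assoc, mul_smul_comm, smul_mul_assoc, mul_smul, h2, smul_smul,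
      smul_smul, ← add_smul, Nat.add_sub_cancel]
    congr 1
    push_cast
    rw [e2, show (-((y : ℂ) + 1) + 1 / 2) = -1 + (-y + 1 / 2) by ring, expH_add' (-1)]
    have e3 : expH (-1 : ℂ) * expH (-(y : ℂ) + 1 / 2) * expH (y : ℂ) = expH (-(1 / 2) : ℂ) := by
      rw [← expH_add', ← expH_add']; congr 1; ring
    rw [mul_one, mul_add, e3]
    ring

/-- The action of `F̂` on monomials in the two coordinates that form a doublet. -/
theorem op_F_monomial (s k : Fin 2) (x y : ℕ) : op s .F (xs s 0 k ^ x * xs s 1 k ^ y) =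
    (expH ((x : ℂ) - y + 1 / 2) * qNum (y : ℂ)) • (xs s 0 k ^ (x + 1) * xs s 1 k ^ (y - 1)) := by
  rw [op_F_xs_pow_mul, op_F_xs_one_pow, mul_smul_comm, smul_smul, ← mul_assoc, ← mul_assoc,
    ← expH_add', pow_succ]
  congr 3
  ring

theorem op_F_pow_monomial (s k : Fin 2) (x y : ℕ) :
    (op s .F ^ (y + 1)) (xs s 0 k ^ x * xs s 1 k ^ y) = 0 := by
  induction y generalizing x with
  | zero => rw [zero_add, pow_one, op_F_monomial]; simp [qNum_zero]
  | succ y ih => rw [pow_succ, Module.End.mul_apply, op_F_monomial, map_smul, Nat.add_sub_cancel,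
      ih, smul_zero]

theorem isHighest_xs (s k : Fin 2) (N : ℕ) : IsHighest N (op s) (xs s 1 k ^ N) where
  E := op_E_xs_one_pow s k N
  H := op_H_xs_one_pow s k N
  F := by
    have := op_F_pow_monomial s k 0 N
    rwa [pow_zero, one_mul] at this

theorem commute_op_of_ne {s t : Fin 2} (h : s ≠ t) (g g' : Gen) : Commute (op s g) (op t g') := by
  fin_cases s <;> fin_cases t
  exacts [absurd rfl h, commute_op g g', (commute_op g' g).symm, absurd rfl h]

theorem IsHighest.map {M : Type} [AddCommGroup M] [Module Ch M] {N : ℕ}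
    {op : Gen → Module.End Ch M} {v : M} (h : IsHighest N op v) {G : Module.End Ch M}
    (hG : ∀ g, Commute (op g) G) : IsHighest N op (G v) where
  E := by rw [← Module.End.mul_apply, hG, Module.End.mul_apply, h.E, map_zero]
  H := by rw [← Module.End.mul_apply, hG, Module.End.mul_apply, h.H, map_smul]
  F := by rw [← Module.End.mul_apply, (hG .F).pow_left, Module.End.mul_apply, h.F, map_zero]

/-- The vectors `T̂^{(j,j)}_{mm'}`, for `j = N/2`, `m = p - j`, `m' = p' - j`. -/
def tH (N p p' : ℕ) : Mh := lower N (op 0 .F) p (lower N (op 1 .F) p' (xh 1 1 ^ N))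

theorem op_zero_tH (N p' : ℕ) (g : Gen) (p : Fin (N + 1)) :
    op 0 g (tH N p p') = ∑ r, irrepH N g r p • tH N r p' :=
  ((isHighest_xs 0 1 N).map fun g => commute_lower (commute_op_of_ne (by decide) _ _) _).apply_lower
    (isRep_op 0) g p

theorem op_one_tH (N p : ℕ) (g : Gen) (p' : Fin (N + 1)) :
    op 1 g (tH N p p') = ∑ r, irrepH N g r p' • tH N p r := by
  have h := (isHighest_xs 1 1 N).apply_lower (isRep_op 1) g p'
  have hc : Commute (op 1 g) (lower N (op 0 .F) p) :=
    commute_lower (commute_op_of_ne (by decide) _ _) _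
  rw [tH, ← Module.End.mul_apply, hc, Module.End.mul_apply, show xh 1 1 = xs 1 1 1 from rfl, h,
    map_sum]
  simp only [map_smul]
  rfl

theorem tH_self (N : ℕ) : tH N N N = xh 1 1 ^ N := by
  rw [tH, lower_self, lower_self]; rfl

theorem isIrrepBasisH_tH {ρ : UhSo →ₐ[Ch] Module.End Ch Mh} (hρ : IsDeformedAction ρ) (N : ℕ) :
    IsIrrepBasisH ρ N fun p p' => tH N p p' := by
  refine ⟨fun g p p' => ⟨?_, ?_⟩, tH_self N⟩
  · rw [hρ.apply_gen, op_zero_tH]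
  · rw [hρ.apply_gen, op_one_tH]

theorem IsIrrepBasisH.eq_tH {ρ : UhSo →ₐ[Ch] Module.End Ch Mh} (hρ : IsDeformedAction ρ) {N : ℕ}
    {T : Fin (N + 1) → Fin (N + 1) → Mh} (h : IsIrrepBasisH ρ N T) (p p' : Fin (N + 1)) :
    T p p' = tH N p p' := by
  have h' := isIrrepBasisH_tH hρ N
  have ha : ∀ p < N, IsUnit (coefF N (p + 1)) := fun p hp => (isPos_coefF hp).isUnit
  have hs (y : Fin (N + 1) → Mh) (p : ℕ) (hp : p < N) :
      ∑ r, irrepH N .F r ⟨p + 1, by omega⟩ • y r = coefF N (p + 1) • y ⟨p, by omega⟩ := by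
    have := sum_irrepH_F N ⟨p + 1, by omega⟩ fun r => y ⟨min r N, by omega⟩
    simp only [Nat.add_sub_cancel, Nat.min_eq_left hp.le] at this
    rw [← this]
    refine Finset.sum_congr rfl fun r _ => ?_
    congr 2
    exact Fin.ext (Nat.min_eq_left (by omega)).symm
  have h1 : T (Fin.last N) = fun p' : Fin (N + 1) => tH N (Fin.last N) p' :=
    eq_of_lowering (ρ (emb 1 (Uh.gen .F))) (coefF N) ha
      (fun p hp => by rw [(h.1 .F _ _).2, hs (T (Fin.last N)) p hp])
      (fun p hp => by
        rw [(h'.1 .F _ _).2, hs (fun p' : Fin (N + 1) => tH N (Fin.last N) p') p hp])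
            (h.2.trans h'.2.symm)
  have h2 (p' : Fin (N + 1)) : (fun p => T p p') = fun p : Fin (N + 1) => tH N p p' :=
    eq_of_lowering (ρ (emb 0 (Uh.gen .F))) (coefF N) ha
      (fun p hp => by rw [(h.1 .F _ _).1, hs (fun p => T p p') p hp])
      (fun p hp => by rw [(h'.1 .F _ _).1, hs (fun p : Fin (N + 1) => tH N p p') p hp])
        (congrFun h1 p')
  exact congrFun (h2 p') p

end QuantumEuclid

namespace QuantumEuclid

/-! ### The undeformed action -/

/-- Induction principle for statements about elements of `M_ℏ(2)` that hold modulo `ℏ`. -/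
theorem Mh.induction {P : Mh → Prop} (hX : ∀ y, P ((PowerSeries.X : Ch) • y))
    (hC : ∀ c : ℂ, P ((PowerSeries.C c : Ch) • 1)) (hg : ∀ i k, P (xh i k))
    (hmul : ∀ x y, P x → P y → P (x * y)) (hadd : ∀ x y, P x → P y → P (x + y)) (x : Mh) : P x := by
  obtain ⟨f, rfl⟩ := HAlg.mk_surjective _ x
  have key (w : FreeAlgebra ℂ (Fin 2 × Fin 2)) : P (HAlg.mk _ (PowerSeries.C w)) := by
    induction w using FreeAlgebra.induction with
    | grade0 r =>
      have := hC r
      rw [← map_one (HAlg.mk MhRels), ← map_smul, ← map_one PowerSeries.C, ← C_smul_eq,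
        ← Algebra.algebraMap_eq_smul_one] at this
      exact this
    | grade1 p => exact hg p.1 p.2
    | mul x y hx hy => rw [map_mul, map_mul]; exact hmul _ _ hx hy
    | add x y hx hy => rw [map_add, map_add]; exact hadd _ _ hx hy
  obtain ⟨g, hg⟩ := exists_series_eq f
  rw [hg, ← X_smul_series, map_add, map_smul]
  exact hadd _ _ (key _) (hX _)

/-- The matrices of the generators of `sl₂`. -/
def slGen : Gen → Matrix (Fin 2) (Fin 2) ℂ
  | .E => slE.val
  | .F => slF.val
  | .H => slH.val

/-- The vector fields by which the generators of the two copies of `sl₂` act on `M(2)`. -/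
def field (s : Fin 2) (g : Gen) : Derivation ℂ Mcl Mcl :=
  if s = 0 then rowField (slGen g) else colField (slGen g)

section

attribute [local instance] LieRing.ofAssociativeRing

theorem rho_tmul_one (g : Gen) (x : Mcl) : rho (uGen g ⊗ₜ[ℂ] 1) x = field 0 g x := by
  rw [rho, Algebra.TensorProduct.lift_tmul, map_one, mul_one]
  cases g <;> exact LinearMap.congr_fun (UniversalEnvelopingAlgebra.lift_ι_apply' _ _ _) x

theorem rho_one_tmul (g : Gen) (x : Mcl) : rho (1 ⊗ₜ[ℂ] uGen g) x = field 1 g x := by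
  rw [rho, Algebra.TensorProduct.lift_tmul, map_one, one_mul]
  cases g <;> exact LinearMap.congr_fun (UniversalEnvelopingAlgebra.lift_ι_apply' _ _ _) x

end

theorem constantCoeff_irrepH (N : ℕ) (g : Gen) (r p : Fin (N + 1)) :
    PowerSeries.constantCoeff (irrepH N g r p) = irrepCl N g r p := by
  cases g <;> simp only [irrepH, irrepCl, Matrix.of_apply] <;> split_ifs <;>
    simp only [map_zero, map_mul, constantCoeff_expH, constantCoeff_csqrt, constantCoeff_qNum,
      one_mul, PowerSeries.constantCoeff_C]
  · congr 2
    rw [show ((N : ℂ) / 2 + (p - N / 2) + 1) * (N / 2 - (p - N / 2)) =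
      ((((N : ℝ) / 2 + (p - N / 2) + 1) * (N / 2 - (p - N / 2)) : ℝ) : ℂ) by push_cast; rfl,
      Complex.ofReal_re]
  · congr 2
    rw [show ((N : ℂ) / 2 + (p - N / 2)) * (N / 2 - (p - N / 2) + 1) =
      ((((N : ℝ) / 2 + (p - N / 2)) * (N / 2 - (p - N / 2) + 1) : ℝ) : ℂ) by push_cast; rfl,
      Complex.ofReal_re]

theorem constantCoeff_irrepH_one (g : Gen) (r p : Fin 2) :
    PowerSeries.constantCoeff (irrepH 1 g r p) = slGen g r p := by
  rw [constantCoeff_irrepH]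
  cases g <;> fin_cases r <;> fin_cases p <;> simp [irrepCl, slGen, slE, slF, slH] <;> norm_num

theorem red_torus (u : Fin 2 → ℂ) (x : Mh) : red (torus u x) = red x := by
  induction x using Mh.induction with
  | hX y => rw [map_smul, red_smul, red_smul]; simp
  | hC c => rw [map_smul, map_one]
  | hg i k => rw [torus_xh, red_smul]; simp [constantCoeff_expH]
  | hmul x y hx hy => rw [map_mul, map_mul, map_mul, hx, hy]
  | hadd x y hx hy => rw [map_add, map_add, map_add, hx, hy]

theorem field_zero_xcl (g : Gen) (i k : Fin 2) :
    field 0 g (xcl i k) = ∑ r, slGen g r i • xcl r k :=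
  MvPolynomial.mkDerivation_X ℂ (fun p : Fin 2 × Fin 2 => ∑ r, slGen g r p.1 • xcl r p.2) (i, k)

theorem field_one_xcl (g : Gen) (i k : Fin 2) :
    field 1 g (xcl i k) = ∑ r, slGen g r k • xcl i r :=
  MvPolynomial.mkDerivation_X ℂ (fun p : Fin 2 × Fin 2 => ∑ r, slGen g r p.2 • xcl p.1 r) (i, k)

/-- The deformed action reduces to the undeformed one modulo `ℏ`. -/
theorem red_op (s : Fin 2) (g : Gen) (x : Mh) : red (op s g x) = field s g (red x) := by
  induction x using Mh.induction with
  | hX y => rw [map_smul, red_smul, red_smul]; simp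
  | hC c => rw [map_smul, (op_twistedDer s g).one, red_smul, red_smul, map_one red]; simp
  | hg i k =>
    fin_cases s
    · rw [Fin.zero_eta, op_zero_xh, map_sum, red_xh, field_zero_xcl]
      simp only [red_smul, red_xh, constantCoeff_irrepH_one]
    · rw [Fin.mk_one, op_one_xh, map_sum, red_xh, field_one_xcl]
      simp only [red_smul, red_xh, constantCoeff_irrepH_one]
  | hmul x y hx hy =>
    rw [op_twistedDer, map_add, map_mul, map_mul, hx, hy, red_torus, red_torus, map_mul,
      Derivation.leibniz, smul_eq_mul, smul_eq_mul, mul_comm (field s g (red x))]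
  | hadd x y hx hy => rw [map_add, map_add, map_add, map_add, hx, hy]

/-- The vectors `T^{(j,j)}_{mm'}`, for `j = N/2`, `m = p - j`, `m' = p' - j`. -/
def tCl (N p p' : ℕ) : Mcl := red (tH N p p')

theorem field_zero_tCl (N p' : ℕ) (g : Gen) (p : Fin (N + 1)) :
    field 0 g (tCl N p p') = ∑ r, irrepCl N g r p • tCl N r p' := by
  rw [tCl, ← red_op, op_zero_tH, map_sum]
  simp only [red_smul, constantCoeff_irrepH]
  rfl

theorem field_one_tCl (N p : ℕ) (g : Gen) (p' : Fin (N + 1)) :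
    field 1 g (tCl N p p') = ∑ r, irrepCl N g r p' • tCl N p r := by
  rw [tCl, ← red_op, op_one_tH, map_sum]
  simp only [red_smul, constantCoeff_irrepH]
  rfl

theorem tCl_self (N : ℕ) : tCl N N N = xcl 1 1 ^ N := by
  rw [tCl, tH_self, map_pow, red_xh]

theorem isIrrepBasisCl_tCl (N : ℕ) : IsIrrepBasisCl N fun p p' => tCl N p p' := by
  refine ⟨fun g p p' => ⟨?_, ?_⟩, tCl_self N⟩
  · rw [rho_tmul_one, field_zero_tCl]
  · rw [rho_one_tmul, field_one_tCl]

theorem sum_irrepCl_F (N : ℕ) {M : Type} [AddCommGroup M] [Module ℂ M] (y : Fin (N + 1) → M) (p : ℕ)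
    (hp : p < N) : ∑ r, irrepCl N .F r ⟨p + 1, by omega⟩ • y r =
      PowerSeries.constantCoeff (coefF N (p + 1)) • y ⟨p, by omega⟩ := by
  let _ : Module Ch M := Module.compHom M (PowerSeries.constantCoeff : Ch →+* ℂ)
  have hc (c : Ch) (x : M) : c • x = PowerSeries.constantCoeff c • x := rfl
  have := sum_irrepH_F N ⟨p + 1, by omega⟩ fun r => y ⟨min r N, by omega⟩
  simp only [Nat.add_sub_cancel, Nat.min_eq_left hp.le, hc, constantCoeff_irrepH] at this
  rw [← this]
  refine Finset.sum_congr rfl fun r _ => ?_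
  congr 2
  exact Fin.ext (Nat.min_eq_left (by omega)).symm

theorem IsIrrepBasisCl.eq_tCl {N : ℕ} {T : Fin (N + 1) → Fin (N + 1) → Mcl}
    (h : IsIrrepBasisCl N T) (p p' : Fin (N + 1)) : T p p' = tCl N p p' := by
  have h' := isIrrepBasisCl_tCl N
  have ha : ∀ p < N, IsUnit (PowerSeries.constantCoeff (coefF N (p + 1))) :=
    fun p hp => (isPos_coefF hp).ne_zero.isUnit
  have h1 : T (Fin.last N) = fun p' : Fin (N + 1) => tCl N (Fin.last N) p' :=
    eq_of_lowering (rho (1 ⊗ₜ[ℂ] uGen .F)) (fun p => PowerSeries.constantCoeff (coefF N p)) ha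
      (fun p hp => by rw [(h.1 .F _ _).2, sum_irrepCl_F N (T (Fin.last N)) p hp])
      (fun p hp => by
        rw [(h'.1 .F _ _).2, sum_irrepCl_F N (fun p' : Fin (N + 1) => tCl N (Fin.last N) p') p hp])
      (h.2.trans h'.2.symm)
  have h2 (p' : Fin (N + 1)) : (fun p => T p p') = fun p : Fin (N + 1) => tCl N p p' :=
    eq_of_lowering (rho (uGen .F ⊗ₜ[ℂ] 1)) (fun p => PowerSeries.constantCoeff (coefF N p)) ha
      (fun p hp => by rw [(h.1 .F _ _).1, sum_irrepCl_F N (fun p => T p p') p hp])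
      (fun p hp => by
        rw [(h'.1 .F _ _).1, sum_irrepCl_F N (fun p : Fin (N + 1) => tCl N p p') p hp])
      (congrFun h1 p')
  exact congrFun (h2 p') p

end QuantumEuclid

namespace QuantumEuclid

/-! ### The Segre map and a basis of `M(2)` -/

/-- The homogeneous coordinates of two projective lines. -/
abbrev Pcl : Type := MvPolynomial (Fin 2 ⊕ Fin 2) ℂ

/-- The homomorphism `x_{ik} ↦ s_i t_k`, whose kernel is generated by the determinant. -/
def segre : Mcl →ₐ[ℂ] Pcl :=
  MvPolynomial.aeval fun p => MvPolynomial.X (.inl p.1) * MvPolynomial.X (.inr p.2)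

@[simp] theorem segre_xcl (i k : Fin 2) :
    segre (xcl i k) = MvPolynomial.X (.inl i) * MvPolynomial.X (.inr k) :=
  MvPolynomial.aeval_X _ _

theorem segre_lsq : segre lsq = 0 := by
  rw [lsq, map_sub, map_mul, map_mul]
  simp only [segre_xcl]
  ring

/-- The index of the coordinates on which copy `s` of `sl₂` acts. -/
def coordIdx (s i : Fin 2) : Fin 2 ⊕ Fin 2 := if s = 0 then .inl i else .inr i

/-- The lowering operator of copy `s` of `sl₂` on homogeneous coordinates. -/
def segreF (s : Fin 2) : Derivation ℂ Pcl Pcl :=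
  MvPolynomial.mkDerivation ℂ fun q => if q = coordIdx s 1 then MvPolynomial.X (coordIdx s 0) else 0

theorem slGen_F_sum {M : Type} [AddCommGroup M] [Module ℂ M] (i : Fin 2) (y : Fin 2 → M) :
    ∑ r, slGen .F r i • y r = if i = 1 then y 0 else 0 := by
  fin_cases i <;> simp [slGen, slF]

/-- The Segre map intertwines the lowering operators. -/
theorem segre_field (s : Fin 2) (f : Mcl) : segre (field s .F f) = segreF s (segre f) := by
  induction f using MvPolynomial.induction_on with
  | C a =>
    rw [← MvPolynomial.algebraMap_eq, Derivation.map_algebraMap, AlgHom.commutes,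
      Derivation.map_algebraMap, map_zero]
  | add f g hf hg => rw [map_add, map_add, map_add, map_add, hf, hg]
  | mul_X f p hf =>
    obtain ⟨i, k⟩ := p
    rw [Derivation.leibniz, map_add, map_mul, Derivation.leibniz, smul_eq_mul, smul_eq_mul,
      map_mul, map_mul, hf, smul_eq_mul, smul_eq_mul]
    congr 2
    fin_cases s
    · rw [Fin.zero_eta, field_zero_xcl, slGen_F_sum, segre_xcl, Derivation.leibniz, segreF,
        MvPolynomial.mkDerivation_X, MvPolynomial.mkDerivation_X]
      fin_cases i <;> simp [coordIdx, mul_comm]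
    · rw [Fin.mk_one, field_one_xcl, slGen_F_sum, segre_xcl, Derivation.leibniz, segreF,
        MvPolynomial.mkDerivation_X, MvPolynomial.mkDerivation_X]
      fin_cases k <;> simp [coordIdx]

/-- The bihomogeneous monomials of bidegree `(N, N)`. -/
def segreMon (N p p' : ℕ) : Pcl :=
  MvPolynomial.X (.inl 0) ^ (N - p) * MvPolynomial.X (.inl 1) ^ p *
    (MvPolynomial.X (.inr 0) ^ (N - p') * MvPolynomial.X (.inr 1) ^ p')

theorem segreF_zero_mon {N p : ℕ} (hp : p < N) (p' : ℕ) :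
    segreF 0 (segreMon N (p + 1) p') = ((p : ℂ) + 1) • segreMon N p p' := by
  have h : N - p = N - (p + 1) + 1 := by omega
  simp only [segreMon, Derivation.leibniz, Derivation.leibniz_pow, segreF,
    MvPolynomial.mkDerivation_X, coordIdx, h]
  simp
  simp only [MvPolynomial.smul_eq_C_mul, map_add, map_one, map_natCast]
  ring

theorem segreF_one_mon {N p' : ℕ} (hp : p' < N) (p : ℕ) :
    segreF 1 (segreMon N p (p' + 1)) = ((p' : ℂ) + 1) • segreMon N p p' := by
  have h : N - p' = N - (p' + 1) + 1 := by omega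
  simp only [segreMon, Derivation.leibniz, Derivation.leibniz_pow, segreF,
    MvPolynomial.mkDerivation_X, coordIdx, h]
  simp
  simp only [MvPolynomial.smul_eq_C_mul, map_add, map_one, map_natCast]
  ring

theorem field_F_zero_tCl {N p : ℕ} (hp : p < N) (p' : ℕ) : field 0 .F (tCl N (p + 1) p') =
    PowerSeries.constantCoeff (coefF N (p + 1)) • tCl N p p' := by
  have := field_zero_tCl N p' .F ⟨p + 1, by omega⟩
  rw [sum_irrepCl_F N (fun r : Fin (N + 1) => tCl N r p') p hp] at this
  exact this

theorem field_F_one_tCl {N p' : ℕ} (hp : p' < N) (p : ℕ) : field 1 .F (tCl N p (p' + 1)) =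
    PowerSeries.constantCoeff (coefF N (p' + 1)) • tCl N p p' := by
  have := field_one_tCl N p .F ⟨p' + 1, by omega⟩
  rw [sum_irrepCl_F N (fun r : Fin (N + 1) => tCl N p r) p' hp] at this
  exact this

/-- The Segre map takes the vectors `T^{(j,j)}_{mm'}` to nonzero multiples of monomials: it does
so with `d^{2j}`, and it intertwines the lowering operators. -/
theorem exists_segre_tCl {N p p' : ℕ} (hp : p ≤ N) (hp' : p' ≤ N) :
    ∃ c : ℂ, c ≠ 0 ∧ segre (tCl N p p') = c • segreMon N p p' := by
  have hcoef {p : ℕ} (hp : p < N) := (isPos_coefF hp).ne_zero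
  have h1 : ∀ k p', p' + k = N → ∃ c : ℂ, c ≠ 0 ∧ segre (tCl N N p') = c • segreMon N N p' := by
    intro k
    induction k with
    | zero =>
      intro p' hk
      obtain rfl : p' = N := hk
      exact ⟨1, one_ne_zero, by simp [tCl_self, segreMon, mul_pow]⟩
    | succ k ih =>
      intro p' hk
      obtain ⟨c, hc, h⟩ := ih (p' + 1) (by omega)
      have h2 := congrArg segre (field_F_one_tCl (N := N) (p' := p') (by omega) N)
      rw [segre_field, h, Derivation.map_smul, map_smul, segreF_one_mon (by omega), smul_smul] at h2
      refine ⟨_, mul_ne_zero (inv_ne_zero (hcoef (p := p') (by omega)))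
        (mul_ne_zero hc (Nat.cast_add_one_ne_zero p')), ?_⟩
      rw [mul_smul, h2, smul_smul, inv_mul_cancel₀ (hcoef (by omega)), one_smul]
  have h2 : ∀ k p, p + k = N → ∃ c : ℂ, c ≠ 0 ∧ segre (tCl N p p') = c • segreMon N p p' := by
    intro k
    induction k with
    | zero => intro p hk; obtain rfl : p = N := hk; exact h1 (p - p') p' (by omega)
    | succ k ih =>
      intro p hk
      obtain ⟨c, hc, h⟩ := ih (p + 1) (by omega)
      have h2 := congrArg segre (field_F_zero_tCl (N := N) (p := p) (by omega) p')
      rw [segre_field, h, Derivation.map_smul, map_smul, segreF_zero_mon (by omega),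
          smul_smul] at h2
      refine ⟨_, mul_ne_zero (inv_ne_zero (hcoef (p := p) (by omega)))
        (mul_ne_zero hc (Nat.cast_add_one_ne_zero p)), ?_⟩
      rw [mul_smul, h2, smul_smul, inv_mul_cancel₀ (hcoef (by omega)), one_smul]
  exact h2 (N - p) p (by omega)

/-- The exponents of `segre` of a monomial. -/
def segreExp (m : Fin 2 × Fin 2 →₀ ℕ) : Fin 2 ⊕ Fin 2 →₀ ℕ :=
  Finsupp.equivFunOnFinite.symm fun q => match q with
    | .inl i => m (i, 0) + m (i, 1)
    | .inr k => m (0, k) + m (1, k)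

theorem segre_monomial (m : Fin 2 × Fin 2 →₀ ℕ) (c : ℂ) :
    segre (MvPolynomial.monomial m c) = MvPolynomial.monomial (segreExp m) c := by
  rw [segre, MvPolynomial.aeval_monomial, MvPolynomial.monomial_eq, MvPolynomial.algebraMap_eq]
  congr 1
  rw [Finsupp.prod_fintype _ _ (by simp), Finsupp.prod_fintype _ _ (by simp),
    Fintype.prod_prod_type, Fintype.prod_sum_type]
  simp only [Fin.prod_univ_two, segreExp, Finsupp.equivFunOnFinite_symm_apply_apply]
  ring

/-- The kernel of the Segre map: modulo the determinant, polynomials are combinations of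
monomials that do not contain both `a` and `d`, and these have different images. -/
theorem exists_eq_lsq_mul {f : Mcl} (hf : segre f = 0) : ∃ g, f = lsq * g := by
  let S : Set (Fin 2 × Fin 2 →₀ ℕ) := {m | m (0, 0) = 0 ∨ m (1, 1) = 0}
  have hmon : ∀ (k : ℕ) (m : Fin 2 × Fin 2 →₀ ℕ), m (0, 0) = k → ∀ c : ℂ,
      MvPolynomial.monomial m c ∈ MvPolynomial.restrictSupport ℂ S ⊔
        LinearMap.range (LinearMap.mulLeft ℂ lsq) := by
    have hS (m) (hm : m ∈ S) (c : ℂ) : MvPolynomial.monomial m c ∈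
        MvPolynomial.restrictSupport ℂ S ⊔ LinearMap.range (LinearMap.mulLeft ℂ lsq) := by
      refine Submodule.mem_sup_left ?_
      rw [MvPolynomial.mem_restrictSupport_iff]
      exact fun m' hm' => by
        rw [Finset.mem_singleton.mp (MvPolynomial.support_monomial_subset hm')]; exact hm
    intro k
    induction k with
    | zero => exact fun m hm c => hS m (Or.inl hm) c
    | succ k ih =>
      intro m hm c
      by_cases h11 : m (1, 1) = 0
      · exact hS m (Or.inr h11) c
      obtain ⟨m', rfl⟩ : ∃ m', m = m' + Finsupp.single (0, 0) 1 + Finsupp.single (1, 1) 1 := by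
        refine ⟨m - Finsupp.single (0, 0) 1 - Finsupp.single (1, 1) 1, ?_⟩
        ext q
        by_cases h0 : q = (0, 0)
        · subst h0; simp; omega
        · by_cases h1 : q = (1, 1)
          · subst h1; simp; omega
          · simp [Ne.symm h0, Ne.symm h1]
      have h1 : MvPolynomial.monomial (m' + Finsupp.single (0, 0) 1 + Finsupp.single (1, 1) 1) c =
          MvPolynomial.monomial (m' + Finsupp.single (0, 1) 1 + Finsupp.single (1, 0) 1) c +
            lsq * MvPolynomial.monomial m' c := by
        simp only [MvPolynomial.monomial_add_single, pow_one, lsq]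
        ring
      rw [h1]
      refine Submodule.add_mem _ (ih _ ?_ c) (Submodule.mem_sup_right ⟨_, rfl⟩)
      simpa using hm
  have hmem : f ∈ MvPolynomial.restrictSupport ℂ S ⊔
      LinearMap.range (LinearMap.mulLeft ℂ lsq) := by
    rw [f.as_sum]
    exact Submodule.sum_mem _ fun m _ => hmon _ m rfl _
  obtain ⟨h, hh, _, ⟨g, rfl⟩, hfh⟩ := Submodule.mem_sup.mp hmem
  refine ⟨g, ?_⟩
  suffices h = 0 by rw [← hfh, this, zero_add]; rfl
  have hπ : segre h = 0 := by
    rw [← hfh, map_add, LinearMap.mulLeft_apply, map_mul, segre_lsq, zero_mul, add_zero] at hf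
    exact hf
  rw [MvPolynomial.mem_restrictSupport_iff] at hh
  refine MvPolynomial.ext _ _ fun m => ?_
  by_contra hm
  have hm : m ∈ h.support := MvPolynomial.mem_support_iff.mpr hm
  rw [h.as_sum, map_sum] at hπ
  have := congrArg (MvPolynomial.coeff (segreExp m)) hπ
  rw [MvPolynomial.coeff_sum, Finset.sum_eq_single m] at this
  · rw [segre_monomial, MvPolynomial.coeff_monomial, if_pos rfl] at this
    exact MvPolynomial.mem_support_iff.mp hm this
  · intro m' hm' hne
    rw [segre_monomial, MvPolynomial.coeff_monomial, if_neg]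
    intro he
    apply hne
    have e1 := DFunLike.congr_fun he (.inl 0)
    have e2 := DFunLike.congr_fun he (.inl 1)
    have e3 := DFunLike.congr_fun he (.inr 0)
    have e4 := DFunLike.congr_fun he (.inr 1)
    simp only [segreExp, Finsupp.equivFunOnFinite_symm_apply_apply] at e1 e2 e3 e4
    have c1 := hh hm
    have c2 := hh hm'
    change _ ∨ _ at c1 c2
    ext ⟨i, k⟩
    fin_cases i <;> fin_cases k <;> simp <;> omega
  · exact fun h' => absurd hm h'

theorem exists_field_eq (s : Fin 2) (g : Gen) : ∃ v : Fin 2 × Fin 2 → Mcl,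
    field s g = MvPolynomial.mkDerivation ℂ v ∧ ∀ p, (v p).IsHomogeneous 1 := by
  fin_cases s
  · refine ⟨fun p => ∑ i, slGen g i p.1 • xcl i p.2, rfl, fun p => ?_⟩
    refine MvPolynomial.IsHomogeneous.sum _ _ _ fun i _ => ?_
    rw [MvPolynomial.smul_eq_C_mul, ← zero_add 1]
    exact (MvPolynomial.isHomogeneous_C _ _).mul (MvPolynomial.isHomogeneous_X _ _)
  · refine ⟨fun p => ∑ k, slGen g k p.2 • xcl p.1 k, rfl, fun p => ?_⟩
    refine MvPolynomial.IsHomogeneous.sum _ _ _ fun i _ => ?_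
    rw [MvPolynomial.smul_eq_C_mul, ← zero_add 1]
    exact (MvPolynomial.isHomogeneous_C _ _).mul (MvPolynomial.isHomogeneous_X _ _)

theorem isHomogeneous_field (s : Fin 2) (g : Gen) {f : Mcl} {n : ℕ} (hf : f.IsHomogeneous n) :
    (field s g f).IsHomogeneous n := by
  obtain ⟨v, hv, hv1⟩ := exists_field_eq s g
  rw [hv, f.as_sum, map_sum]
  refine MvPolynomial.IsHomogeneous.sum _ _ _ fun m hm => ?_
  rw [MvPolynomial.mkDerivation_monomial, MvPolynomial.smul_eq_C_mul, ← zero_add n]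
  refine (MvPolynomial.isHomogeneous_C _ _).mul ?_
  refine MvPolynomial.IsHomogeneous.sum _ _ _ fun i hi => ?_
  have hd : m.degree = n := by
    have := hf (MvPolynomial.mem_support_iff.mp hm)
    rwa [Finsupp.degree_eq_weight_one]
  have hmi : m i ≠ 0 := Finsupp.mem_support_iff.mp hi
  have hle : Finsupp.single i 1 ≤ m := Finsupp.single_le_iff.mpr (by omega)
  have h1 : (m - Finsupp.single i 1).degree + 1 = n := by
    rw [← hd]
    conv_rhs => rw [← tsub_add_cancel_of_le hle, map_add, Finsupp.degree_single]
  rw [← h1]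
  exact (MvPolynomial.isHomogeneous_monomial _ rfl).mul (hv1 i)

theorem isHomogeneous_tCl {N p p' : ℕ} (hp : p ≤ N) (hp' : p' ≤ N) :
    (tCl N p p').IsHomogeneous N := by
  have hcoef {p : ℕ} (hp : p < N) := (isPos_coefF hp).ne_zero
  have hs {c : ℂ} (hc : c ≠ 0) {f : Mcl} (h : (c • f).IsHomogeneous N) : f.IsHomogeneous N := by
    have := (MvPolynomial.isHomogeneous_C (Fin 2 × Fin 2) c⁻¹).mul h
    rwa [zero_add, ← MvPolynomial.smul_eq_C_mul, smul_smul, inv_mul_cancel₀ hc, one_smul] at this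
  have h1 : ∀ k p', p' + k = N → (tCl N N p').IsHomogeneous N := by
    intro k
    induction k with
    | zero =>
      intro p' hk
      obtain rfl : p' = N := hk
      rw [tCl_self]
      exact MvPolynomial.isHomogeneous_X_pow _ _
    | succ k ih =>
      intro p' hk
      have h2 := isHomogeneous_field 1 .F (ih (p' + 1) (by omega))
      rw [field_F_one_tCl (by omega)] at h2
      exact hs (hcoef (by omega)) h2
  have h2 : ∀ k p, p + k = N → (tCl N p p').IsHomogeneous N := by
    intro k
    induction k with
    | zero => intro p hk; obtain rfl : p = N := hk; exact h1 (p - p') p' (by omega)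
    | succ k ih =>
      intro p hk
      have h2 := isHomogeneous_field 0 .F (ih (p + 1) (by omega))
      rw [field_F_zero_tCl (by omega)] at h2
      exact hs (hcoef (by omega)) h2
  exact h2 (N - p) p (by omega)

/-- The indices of the vectors `T^{(j,j)}_{mm'}`. -/
abbrev IrrepIdx : Type := Σ N : ℕ, Fin (N + 1) × Fin (N + 1)

/-- The decomposition of polynomials into the vectors `l²ⁿ T^{(j,j)}_{mm'}`. -/
def expand : (ℕ →₀ IrrepIdx →₀ ℂ) →ₗ[ℂ] Mcl :=
  Finsupp.lsum ℂ fun n => LinearMap.mulLeft ℂ (lsq ^ n) ∘ₗ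
    Finsupp.linearCombination ℂ fun j : IrrepIdx => tCl j.1 j.2.1 j.2.2

theorem segre_linearCombination_injective : Function.Injective (segre.toLinearMap ∘ₗ
    Finsupp.linearCombination ℂ fun j : IrrepIdx => tCl j.1 j.2.1 j.2.2) := by
  choose c hc h using fun j : IrrepIdx => exists_segre_tCl
    (Nat.lt_succ_iff.mp j.2.1.2) (Nat.lt_succ_iff.mp j.2.2.2)
  let e (j : IrrepIdx) : Fin 2 ⊕ Fin 2 →₀ ℕ :=
    Finsupp.single (.inl 0) (j.1 - j.2.1) + Finsupp.single (.inl 1) (j.2.1 : ℕ) +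
      (Finsupp.single (.inr 0) (j.1 - j.2.2) + Finsupp.single (.inr 1) (j.2.2 : ℕ))
  have he : Function.Injective e := by
    rintro ⟨N, ⟨p, hp⟩, ⟨p', hp'⟩⟩ ⟨M, ⟨r, hr⟩, ⟨r', hr'⟩⟩ h
    have e1 := DFunLike.congr_fun h (.inl 0)
    have e2 := DFunLike.congr_fun h (.inl 1)
    have e3 := DFunLike.congr_fun h (.inr 0)
    have e4 := DFunLike.congr_fun h (.inr 1)
    simp [e] at e1 e2 e3 e4
    obtain rfl : N = M := by omega
    subst e2 e4
    rfl
  have hmon (j : IrrepIdx) : segreMon j.1 j.2.1 j.2.2 = MvPolynomial.basisMonomials _ ℂ (e j) := by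
    rw [MvPolynomial.coe_basisMonomials]
    simp only [e, segreMon, MvPolynomial.X_pow_eq_monomial, MvPolynomial.monomial_mul, mul_one]
  have hli := ((MvPolynomial.basisMonomials (Fin 2 ⊕ Fin 2) ℂ).linearIndependent.comp e
    he).units_smul fun j => Units.mk0 (c j) (hc j)
  have : segre.toLinearMap ∘ₗ (Finsupp.linearCombination ℂ fun j : IrrepIdx =>
      tCl j.1 j.2.1 j.2.2) = Finsupp.linearCombination ℂ
      ((fun j => Units.mk0 (c j) (hc j)) •
        (MvPolynomial.basisMonomials (Fin 2 ⊕ Fin 2) ℂ ∘ e)) := by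
    ext j : 2
    simp only [LinearMap.coe_comp, Function.comp_apply, Finsupp.lsingle_apply,
      Finsupp.linearCombination_single, one_smul]
    exact (h j).trans (by rw [hmon]; rfl)
  rw [this]
  exact hli

theorem lsq_ne_zero : lsq ≠ 0 := by
  intro h
  have := congrArg
    (MvPolynomial.eval fun p : Fin 2 × Fin 2 => if p.1 = p.2 then (1 : ℂ) else 0) h
  simp [lsq] at this

theorem totalDegree_lsq : lsq.totalDegree = 2 :=
  MvPolynomial.IsHomogeneous.totalDegree (((MvPolynomial.isHomogeneous_X _ _).mul
    (MvPolynomial.isHomogeneous_X _ _)).sub ((MvPolynomial.isHomogeneous_X _ _).mul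
    (MvPolynomial.isHomogeneous_X _ _))) lsq_ne_zero

/-- Modulo the determinant the Segre map separates the vectors `T^{(j,j)}_{mm'}`, and the
determinant is not a zero divisor. -/
theorem expand_injective : Function.Injective expand := by
  have key : ∀ (K : ℕ) (f : ℕ → IrrepIdx →₀ ℂ), ∑ n ∈ Finset.range K, lsq ^ n *
      Finsupp.linearCombination ℂ (fun j : IrrepIdx => tCl j.1 j.2.1 j.2.2) (f n) = 0 →
      ∀ n < K, f n = 0 := by
    intro K
    induction K with
    | zero => intro f _ n hn; omega
    | succ K ih =>
      intro f hf
      rw [Finset.sum_range_succ'] at hf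
      have h0 : f 0 = 0 := by
        apply segre_linearCombination_injective
        have := congrArg segre hf
        rw [map_add, map_sum, Finset.sum_eq_zero fun n _ => by
          rw [map_mul, map_pow, segre_lsq, zero_pow (by omega), zero_mul]] at this
        simpa using this
      rw [h0, map_zero, mul_zero, add_zero] at hf
      have h1 := ih (fun n => f (n + 1)) (by
        refine mul_left_cancel₀ lsq_ne_zero ?_
        rw [Finset.mul_sum, mul_zero, ← hf]
        exact Finset.sum_congr rfl fun n _ => by rw [pow_succ', mul_assoc])
      rintro (_ | n) hn
      exacts [h0, h1 n (by omega)]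
  intro f g hfg
  rw [← sub_eq_zero] at hfg ⊢
  have hf : expand (f - g) = 0 := (map_sub expand f g).trans hfg
  generalize f - g = f at hf
  obtain ⟨K, hK⟩ : ∃ K, f.support ⊆ Finset.range K := f.support.exists_nat_subset_range
  rw [expand, Finsupp.lsum_apply, Finsupp.sum_of_support_subset f hK _ (by simp)] at hf
  ext1 n
  by_cases hn : n < K
  · exact key K f hf n hn
  · by_contra h
    exact hn (Finset.mem_range.mp (hK (Finsupp.mem_support_iff.mpr h)))

theorem expand_single (n : ℕ) (j : IrrepIdx) :
    expand (Finsupp.single n (Finsupp.single j 1)) = lsq ^ n * tCl j.1 j.2.1 j.2.2 := by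
  simp [expand]

theorem lsq_mul_mem_range {f : Mcl} (hf : f ∈ LinearMap.range expand) :
    lsq * f ∈ LinearMap.range expand := by
  obtain ⟨c, rfl⟩ := hf
  induction c using Finsupp.induction_linear with
  | zero => simp
  | add c d hc hd => rw [map_add, mul_add]; exact Submodule.add_mem _ hc hd
  | single n c =>
    refine ⟨Finsupp.single (n + 1) c, ?_⟩
    simp [expand, pow_succ']

/-- Modulo the determinant every polynomial is a combination of vectors `T^{(j,j)}_{mm'}` of at
most the same degree, and division by the determinant lowers the degree. -/
theorem expand_surjective : Function.Surjective expand := by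
  rw [← LinearMap.range_eq_top, eq_top_iff]
  suffices ∀ (N : ℕ) (f : Mcl), f.totalDegree ≤ N → f ∈ LinearMap.range expand from
    fun f _ => this _ f le_rfl
  intro N
  induction N using Nat.strong_induction_on with
  | _ N ih =>
  intro f hf
  have h1 : segre f ∈ (LinearMap.range expand ⊓
      MvPolynomial.restrictTotalDegree (Fin 2 × Fin 2) ℂ N).map segre.toLinearMap := by
    rw [f.as_sum, map_sum]
    refine Submodule.sum_mem _ fun m hm => ?_
    have hd : m (0, 0) + m (0, 1) + (m (1, 0) + m (1, 1)) ≤ N := by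
      have := (MvPolynomial.le_totalDegree hm).trans hf
      rwa [Finsupp.sum_fintype _ _ (by simp), Fintype.sum_prod_type, Fin.sum_univ_two,
        Fin.sum_univ_two, Fin.sum_univ_two] at this
    let k := m (0, 0) + m (0, 1) + (m (1, 0) + m (1, 1))
    obtain ⟨c, hc, h⟩ := exists_segre_tCl (N := k) (p := m (1, 0) + m (1, 1))
      (p' := m (0, 1) + m (1, 1)) (by omega) (by omega)
    have hmem : tCl k (m (1, 0) + m (1, 1)) (m (0, 1) + m (1, 1)) ∈ LinearMap.range expand :=
      ⟨_, (expand_single 0 ⟨k, ⟨m (1, 0) + m (1, 1), by omega⟩,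
        ⟨m (0, 1) + m (1, 1), by omega⟩⟩).trans (by rw [pow_zero, one_mul])⟩
    have hdeg : tCl k (m (1, 0) + m (1, 1)) (m (0, 1) + m (1, 1)) ∈
        MvPolynomial.restrictTotalDegree (Fin 2 × Fin 2) ℂ N := by
      rw [MvPolynomial.mem_restrictTotalDegree]
      exact ((isHomogeneous_tCl (by omega) (by omega)).totalDegree_le).trans hd
    refine ⟨_, Submodule.smul_mem _ (MvPolynomial.coeff m f * c⁻¹) ⟨hmem, hdeg⟩, ?_⟩
    rw [map_smul, AlgHom.toLinearMap_apply, h, smul_smul, mul_assoc, inv_mul_cancel₀ hc, mul_one,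
      segre_monomial, segreMon, MvPolynomial.smul_eq_C_mul, MvPolynomial.monomial_eq,
      Finsupp.prod_fintype _ _ (by simp), Fintype.prod_sum_type]
    simp only [Fin.prod_univ_two, segreExp, Finsupp.equivFunOnFinite_symm_apply_apply]
    congr 3 <;> congr 1 <;> omega
  obtain ⟨t, ⟨ht, htd⟩, hft⟩ := h1
  obtain ⟨g, hg⟩ := exists_eq_lsq_mul (f := f - t) (by
    rw [map_sub, ← hft, AlgHom.toLinearMap_apply, sub_self])
  rw [← sub_add_cancel f t, hg]
  refine Submodule.add_mem _ (lsq_mul_mem_range ?_) ht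
  by_cases hg0 : g = 0
  · rw [hg0]; exact Submodule.zero_mem _
  have hdeg : (f - t).totalDegree ≤ N :=
    (MvPolynomial.totalDegree_sub _ _).trans (max_le hf
      ((MvPolynomial.mem_restrictTotalDegree _ _ _).mp htd))
  rw [hg, MvPolynomial.totalDegree_mul_of_isDomain lsq_ne_zero hg0, totalDegree_lsq] at hdeg
  exact ih (N - 1) (by omega) g (by omega)

end QuantumEuclid

namespace QuantumEuclid

/-! ### The ordering -/

/-- The basis `l²ⁿ T^{(j,j)}_{mm'}` of `M(2)`, as an isomorphism. -/
def expandEquiv : (ℕ →₀ IrrepIdx →₀ ℂ) ≃ₗ[ℂ] Mcl :=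
  LinearEquiv.ofBijective expand ⟨expand_injective, expand_surjective⟩

/-- The combination of the vectors `l̂²ⁿ T̂^{(j,j)}_{mm'}` with given coefficients. -/
def expandH : (ℕ →₀ IrrepIdx →₀ ℂ) →+ Mh :=
  Finsupp.liftAddHom fun n => Finsupp.liftAddHom fun j =>
    (AddMonoidHom.mulRight (lsqh ^ n * tH j.1 j.2.1 j.2.2)).comp
      ((algebraMap Ch Mh).comp PowerSeries.C).toAddMonoidHom

theorem expandH_single (n : ℕ) (j : IrrepIdx) (z : ℂ) :
    expandH (Finsupp.single n (Finsupp.single j z)) =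
      (PowerSeries.C z : Ch) • (lsqh ^ n * tH j.1 j.2.1 j.2.2) := by
  rw [expandH, Finsupp.liftAddHom_apply_single, Finsupp.liftAddHom_apply_single, Algebra.smul_def]
  rfl

theorem idx_induction {P : (ℕ →₀ IrrepIdx →₀ ℂ) → Prop} (h0 : P 0)
    (hadd : ∀ c d, P c → P d → P (c + d))
    (hs : ∀ n j z, P (Finsupp.single n (Finsupp.single j z))) (c : ℕ →₀ IrrepIdx →₀ ℂ) : P c := by
  induction c using Finsupp.induction_linear with
  | zero => exact h0
  | add c d hc hd => exact hadd c d hc hd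
  | single n c =>
    induction c using Finsupp.induction_linear with
    | zero => rw [Finsupp.single_zero]; exact h0
    | add c d hc hd => rw [Finsupp.single_add]; exact hadd _ _ hc hd
    | single j z => exact hs n j z

theorem expandH_smul (z : ℂ) (c : ℕ →₀ IrrepIdx →₀ ℂ) :
    expandH (z • c) = (PowerSeries.C z : Ch) • expandH c := by
  induction c using idx_induction with
  | h0 => rw [smul_zero, map_zero, smul_zero]
  | hadd c d hc hd =>
    rw [show z • (c + d) = z • c + z • d from smul_add z c d, map_add, map_add, hc, hd, smul_add]
  | hs n j w =>
    rw [Finsupp.smul_single, Finsupp.smul_single, expandH_single, expandH_single, smul_smul,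
      smul_eq_mul, map_mul]

@[simp] theorem red_lsqh : red lsqh = lsq := by
  rw [lsqh, map_sub, red_smul, map_mul, map_mul]
  simp [lsq, constantCoeff_expH]

theorem red_expandH (c : ℕ →₀ IrrepIdx →₀ ℂ) : red (expandH c) = expand c := by
  induction c using idx_induction with
  | h0 => rw [map_zero, map_zero, map_zero]
  | hadd c d hc hd => rw [map_add, map_add, hc, hd, map_add]
  | hs n j z =>
    rw [expandH_single, red_smul, PowerSeries.constantCoeff_C, map_mul, map_pow, red_lsqh]
    simp [expand, tCl]

/-- The linear map `M(2)[[ℏ]] → M_ℏ(2)` that takes `l²ⁿ T^{(j,j)}_{mm'}` to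
`l̂²ⁿ T̂^{(j,j)}_{mm'}`. -/
def phiLin : Mcl⟦X⟧ →ₗ[Ch] Mh :=
  seriesLin (fun f => expandH (expandEquiv.symm f)) (fun a b => by rw [map_add, map_add])
    (fun c a => by rw [map_smul, expandH_smul])

theorem phiLin_C (f : Mcl) : phiLin (PowerSeries.C f) = expandH (expandEquiv.symm f) :=
  seriesLin_C _ _ _ f

theorem red_phiLin_C (f : Mcl) : red (phiLin (PowerSeries.C f)) = f := by
  rw [phiLin_C, red_expandH]
  exact expandEquiv.apply_symm_apply f

/-- Modulo `ℏ` this map is the identity of `M(2)`, and `M_ℏ(2)` has no `ℏ`-torsion. -/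
theorem phiLin_bijective : Function.Bijective phiLin := by
  constructor
  · refine injective_of_injective_mod phiLin fun x hx => ?_
    obtain ⟨y, hy⟩ := exists_series_eq x
    rw [hy, ← X_smul_series, map_add, map_smul] at hx
    have h0 : PowerSeries.constantCoeff x = 0 := by
      have := congrArg red hx
      rw [map_add, red_phiLin_C, red_smul, map_zero] at this
      simpa using this
    rw [h0, map_zero, map_zero, zero_add] at hx
    refine ⟨y, ?_, Mh.X_smul_eq_zero hx⟩
    rw [hy, h0, map_zero, zero_add, X_smul_series]
  · refine surjective_of_surjective_mod phiLin fun z => ?_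
    obtain ⟨y, hy⟩ := exists_X_smul_of_red_eq_zero
      (x := z - phiLin (PowerSeries.C (red z))) (by rw [map_sub, red_phiLin_C, sub_self])
    exact ⟨_, y, by rw [← hy, add_sub_cancel]⟩

/-- The symmetry preserving ordering. -/
def phi : Mcl⟦X⟧ ≃ₗ[Ch] Mh := LinearEquiv.ofBijective phiLin phiLin_bijective

theorem phi_C_expand (c : ℕ →₀ IrrepIdx →₀ ℂ) : phi (PowerSeries.C (expand c)) = expandH c := by
  refine (phiLin_C _).trans ?_
  congr 1
  exact expandEquiv.symm_apply_apply c

theorem phi_apply {N p p' : ℕ} (hp : p ≤ N) (hp' : p' ≤ N) (n : ℕ) :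
    phi (PowerSeries.C (lsq ^ n * tCl N p p')) = lsqh ^ n * tH N p p' := by
  have := phi_C_expand (Finsupp.single n (Finsupp.single
    (⟨N, ⟨p, by omega⟩, ⟨p', by omega⟩⟩ : IrrepIdx) 1))
  rw [expand_single, expandH_single, map_one, one_smul] at this
  exact this

/-- Linear maps on `M(2)[[ℏ]]` are determined by their values on `l²ⁿ T^{(j,j)}_{mm'}`. -/
theorem linear_ext_tCl {M : Type} [AddCommGroup M] [Module Ch M] [HComplete M]
    {f g : Mcl⟦X⟧ →ₗ[Ch] M} (h : ∀ (n N : ℕ) (p p' : Fin (N + 1)),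
      f (PowerSeries.C (lsq ^ n * tCl N p p')) = g (PowerSeries.C (lsq ^ n * tCl N p p'))) :
    f = g := by
  refine series_linear_ext fun x => ?_
  obtain ⟨c, rfl⟩ := expand_surjective x
  induction c using idx_induction with
  | h0 => rw [map_zero, map_zero, map_zero, map_zero]
  | hadd c d hc hd => rw [map_add, map_add, map_add, map_add, hc, hd]
  | hs n j z =>
    have : expand (Finsupp.single n (Finsupp.single j z)) =
        z • (lsq ^ n * tCl j.1 j.2.1 j.2.2) := by
      rw [← expand_single, ← map_smul, Finsupp.smul_single, Finsupp.smul_single, smul_eq_mul,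
        mul_one]
    rw [this, C_smul_eq, map_smul, map_smul, h]

theorem isOrdering_phi {T : ∀ N : ℕ, Fin (N + 1) → Fin (N + 1) → Mcl}
    {Th : ∀ N : ℕ, Fin (N + 1) → Fin (N + 1) → Mh} (hT : ∀ N p p', T N p p' = tCl N p p')
    (hTh : ∀ N p p', Th N p p' = tH N p p') : IsOrdering T Th phi := fun n N p p' => by
  rw [hT, hTh, phi_apply (by omega) (by omega)]

theorem IsOrdering.eq_phi {T : ∀ N : ℕ, Fin (N + 1) → Fin (N + 1) → Mcl}
    {Th : ∀ N : ℕ, Fin (N + 1) → Fin (N + 1) → Mh} {φ : Mcl⟦X⟧ ≃ₗ[Ch] Mh}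
    (h : IsOrdering T Th φ) (hT : ∀ N p p', T N p p' = tCl N p p')
    (hTh : ∀ N p p', Th N p p' = tH N p p') : φ = phi := by
  have : (φ : Mcl⟦X⟧ →ₗ[Ch] Mh) = (phi : Mcl⟦X⟧ →ₗ[Ch] Mh) := linear_ext_tCl fun n N p p' => by
    have h1 := h n N p p'
    have h2 := isOrdering_phi hT hTh n N p p'
    rw [hT] at h1 h2
    exact h1.trans h2.symm
  exact LinearEquiv.toLinearMap_injective this

/-! ### Invariance of the quantum determinant -/

theorem transp_lsqh : transp lsqh = lsqh := by
  rw [lsqh, map_sub, map_smul, map_mul, map_mul]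
  simp only [transp_xh]
  rw [isQuantumMatrix_xh.bc]

theorem torus_lsqh (u : Fin 2 → ℂ) : torus u lsqh = lsqh := by
  rw [lsqh, map_sub, map_smul, map_mul, map_mul]
  simp only [torus_xh, smul_mul_smul_comm, ← expH_add', wt_zero, wt_one]
  rw [show u 0 * -1 + u 1 * -1 + (u 0 * 1 + u 1 * 1) = 0 by ring,
    show u 0 * -1 + u 1 * 1 + (u 0 * 1 + u 1 * -1) = 0 by ring, expH_zero, one_smul, one_smul]

/-- The quantum determinant is invariant. -/
theorem op_lsqh (s : Fin 2) (g : Gen) : op s g lsqh = 0 := by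
  have hcol : op 1 g lsqh = 0 := by
    have h := isQuantumMatrix_xh
    rw [lsqh, map_sub, map_smul, op_twistedDer, op_twistedDer]
    cases g <;>
      simp only [op_one_xh, irrepH_one_E_zero, irrepH_one_E_one, irrepH_one_F_zero,
        irrepH_one_F_one, irrepH_one_H, twistL, twistR, torus_single_xh, wt_zero, wt_one, zero_mul,
        mul_zero, neg_mul, mul_neg, mul_one, neg_neg, neg_zero, expH_zero, one_smul,
        smul_mul_assoc, mul_smul_comm, smul_smul, smul_zero, add_zero, zero_add, map_neg, map_one,
        neg_smul, neg_add_cancel, add_neg_cancel, mul_comm (expH (1 : ℂ)),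
        sub_self]
  fin_cases s
  · change transp (colOp g (transp lsqh)) = 0
    rw [transp_lsqh]
    change transp (op 1 g lsqh) = 0
    rw [hcol, map_zero]
  · exact hcol

theorem op_lsqh_pow_mul (s : Fin 2) (g : Gen) (n : ℕ) (x : Mh) :
    op s g (lsqh ^ n * x) = lsqh ^ n * op s g x := by
  induction n with
  | zero => simp
  | succ n ih => rw [pow_succ', mul_assoc, op_twistedDer, torus_lsqh, op_lsqh, zero_mul, add_zero,
      ih, mul_assoc]

/-- The vectors `l̂²ⁿ T̂^{(j,j)}_{mm'}`; the first index is the one on which copy `s` of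
`U_ℏ(sl₂)` acts. -/
def vH (s : Fin 2) (n N k p : ℕ) : Mh := lsqh ^ n * if s = 0 then tH N p k else tH N k p

theorem op_vH (s : Fin 2) (g : Gen) (n N k : ℕ) (p : Fin (N + 1)) :
    op s g (vH s n N k p) = ∑ r, irrepH N g r p • vH s n N k r := by
  rw [vH, op_lsqh_pow_mul]
  fin_cases s
  · change _ * op 0 g (tH N p k) = _
    rw [op_zero_tH, Finset.mul_sum]
    simp only [mul_smul_comm]
    rfl
  · change _ * op 1 g (tH N k p) = _
    rw [op_one_tH, Finset.mul_sum]
    simp only [mul_smul_comm]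
    rfl

/-- The vectors `l²ⁿ T^{(j,j)}_{mm'}`; the first index is the one on which copy `s` of `sl₂`
acts. -/
def vCl (s : Fin 2) (n N k p : ℕ) : Mcl := red (vH s n N k p)

theorem vCl_eq (s : Fin 2) (n N k p : ℕ) :
    vCl s n N k p = lsq ^ n * if s = 0 then tCl N p k else tCl N k p := by
  rw [vCl, vH, map_mul, map_pow, red_lsqh]
  split_ifs <;> rfl

theorem phi_vCl (s : Fin 2) (n : ℕ) {N k p : ℕ} (hk : k ≤ N) (hp : p ≤ N) :
    phi (PowerSeries.C (vCl s n N k p)) = vH s n N k p := by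
  rw [vCl_eq, vH]
  split_ifs
  · exact phi_apply hp hk n
  · exact phi_apply hk hp n

theorem field_E_vCl (s : Fin 2) (n k : ℕ) {N p : ℕ} (hp : p ≤ N) : field s .E (vCl s n N k p) =
    PowerSeries.constantCoeff (coefE N p) • vCl s n N k (p + 1) := by
  rw [vCl, ← red_op, show p = ((⟨p, by omega⟩ : Fin (N + 1)) : ℕ) from rfl, op_vH,
    sum_irrepH_E N _ fun r => vH s n N k r, red_smul]
  rfl

theorem field_F_vCl (s : Fin 2) (n k : ℕ) {N p : ℕ} (hp : p ≤ N) : field s .F (vCl s n N k p) =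
    PowerSeries.constantCoeff (coefF N p) • vCl s n N k (p - 1) := by
  rw [vCl, ← red_op, show p = ((⟨p, by omega⟩ : Fin (N + 1)) : ℕ) from rfl, op_vH,
    sum_irrepH_F N _ fun r => vH s n N k r, red_smul]
  rfl

theorem field_H_vCl (s : Fin 2) (n k : ℕ) {N p : ℕ} (hp : p ≤ N) : field s .H (vCl s n N k p) =
    (2 * ((p : ℂ) - N / 2)) • vCl s n N k p := by
  rw [vCl, ← red_op, show p = ((⟨p, by omega⟩ : Fin (N + 1)) : ℕ) from rfl, op_vH,
    sum_irrepH_H N _ fun r => vH s n N k r, red_smul, PowerSeries.constantCoeff_C]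

end QuantumEuclid

namespace QuantumEuclid

/-! ### The ordering preserves the symmetry -/

section SeriesAction

variable {A : Type} [Ring A] [Algebra ℂ A] {V : Type} [AddCommGroup V] [Module ℂ V]

/-- The vector `v` is an eigenvector of all coefficients of `w`, with the coefficients of the
scalar series `c` as eigenvalues. -/
def HasEigenSeries (a : A →ₐ[ℂ] Module.End ℂ V) (v : V) (w : A⟦X⟧) (c : Ch) : Prop :=
  ∀ n, a (PowerSeries.coeff n w) v = PowerSeries.coeff n c • v

namespace HasEigenSeries

variable {a : A →ₐ[ℂ] Module.End ℂ V} {v : V} {w w' : A⟦X⟧} {c c' : Ch}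

theorem pow_apply {u : A} {z : ℂ} (h : a u v = z • v) (n : ℕ) : a (u ^ n) v = z ^ n • v := by
  induction n with
  | zero => simp
  | succ n ih => rw [pow_succ, map_mul, Module.End.mul_apply, h, map_smul, ih, smul_smul, pow_succ,
      mul_comm]

theorem mul (h : HasEigenSeries a v w c) (h' : HasEigenSeries a v w' c') :
    HasEigenSeries a v (w * w') (c * c') := fun n => by
  rw [PowerSeries.coeff_mul, PowerSeries.coeff_mul, map_sum, LinearMap.sum_apply, Finset.sum_smul]
  refine Finset.sum_congr rfl fun p _ => ?_
  rw [map_mul, Module.End.mul_apply, h' p.2, map_smul, h p.1, smul_smul, mul_comm]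

theorem sub (h : HasEigenSeries a v w c) (h' : HasEigenSeries a v w' c') :
    HasEigenSeries a v (w - w') (c - c') := fun n => by
  rw [map_sub, map_sub, map_sub, LinearMap.sub_apply, h n, h' n, sub_smul]

theorem map_algebraMap (c : Ch) :
    HasEigenSeries a v (PowerSeries.map (algebraMap ℂ A) c) c := fun n => by
  rw [PowerSeries.coeff_map, AlgHom.commutes, Module.algebraMap_end_apply]

theorem one : HasEigenSeries a v (1 : A⟦X⟧) 1 := by
  have := map_algebraMap (a := a) (v := v) 1
  rwa [map_one] at this

theorem pow (h : HasEigenSeries a v w c) (n : ℕ) : HasEigenSeries a v (w ^ n) (c ^ n) := by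
  induction n with
  | zero => rw [pow_zero, pow_zero]; exact one
  | succ n ih => rw [pow_succ, pow_succ]; exact ih.mul h

theorem expH {u : A} {z : ℂ} (h : a u v = z • v) :
    HasEigenSeries a v (expH u) (QuantumEuclid.expH z) := fun n => by
  rw [QuantumEuclid.expH, QuantumEuclid.expH, PowerSeries.coeff_mk, PowerSeries.coeff_mk,
    map_smul, LinearMap.smul_apply, pow_apply h, smul_smul, smul_eq_mul]

theorem sqrtOne (h : HasEigenSeries a v w c) :
    HasEigenSeries a v (sqrtOne w) (QuantumEuclid.sqrtOne c) := fun n => by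
  rw [QuantumEuclid.sqrtOne, QuantumEuclid.sqrtOne, PowerSeries.coeff_mk, PowerSeries.coeff_mk,
    map_sum, LinearMap.sum_apply, Finset.sum_smul]
  refine Finset.sum_congr rfl fun k _ => ?_
  rw [map_smul, LinearMap.smul_apply, (h.sub one).pow k n, smul_smul, smul_eq_mul]

theorem bracketQuot {u u' : A} {z z' : ℂ} (h : a u v = z • v) (h' : a u' v = z' • v) :
    HasEigenSeries a v (bracketQuot u u') (QuantumEuclid.bracketQuot z z') := by
  refine (map_algebraMap _).mul fun n => ?_
  rw [coshDiff, coshDiff, PowerSeries.coeff_mk, PowerSeries.coeff_mk]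
  split_ifs
  · rw [map_smul, LinearMap.smul_apply, map_sum, LinearMap.sum_apply, smul_eq_mul,
      ← smul_smul, Finset.sum_smul]
    congr 1
    refine Finset.sum_congr rfl fun k _ => ?_
    rw [map_mul, Module.End.mul_apply, pow_apply h', map_smul, pow_apply h, smul_smul, mul_comm]
  · rw [map_zero, LinearMap.zero_apply, zero_smul]

end HasEigenSeries


end SeriesAction

/-- The action of a constant series, coefficient by coefficient. -/
def rhoConst : Uso →+* Module.End Ch Mcl⟦X⟧ where
  toFun u :=
    { toFun := fun x => PowerSeries.mk fun n => rho u (PowerSeries.coeff n x)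
      map_add' := fun x y => by ext1 n; simp
      map_smul' := fun c x => by
        ext1 n
        rw [RingHom.id_apply, PowerSeries.coeff_mk, Algebra.smul_def, Algebra.smul_def,
          PowerSeries.coeff_mul, PowerSeries.coeff_mul, map_sum]
        refine Finset.sum_congr rfl fun p _ => ?_
        rw [PowerSeries.coeff_mk]
        change rho u (PowerSeries.coeff p.1 (PowerSeries.map (algebraMap ℂ Mcl) c) * _) =
          PowerSeries.coeff p.1 (PowerSeries.map (algebraMap ℂ Mcl) c) * _
        rw [PowerSeries.coeff_map, ← Algebra.smul_def, map_smul, Algebra.smul_def] }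
  map_one' := by ext x n; simp
  map_mul' u v := by ext x n; simp
  map_zero' := by ext x n; simp
  map_add' u v := by ext x n; simp

theorem coeff_rhoConst (u : Uso) (x : Mcl⟦X⟧) (n : ℕ) :
    PowerSeries.coeff n (rhoConst u x) = rho u (PowerSeries.coeff n x) := by
  simp [rhoConst]

/-- The action of `U(so₄)[[ℏ]]` on `M(2)[[ℏ]]` as a homomorphism of algebras. -/
def rhoHom : Uso⟦X⟧ →ₐ[Ch] Module.End Ch Mcl⟦X⟧ :=
  seriesLift rhoConst fun c u => by
    refine LinearMap.ext fun x => ?_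
    ext1 n
    rw [LinearMap.smul_apply, C_smul_series, PowerSeries.coeff_smul, coeff_rhoConst,
      coeff_rhoConst, map_smul, LinearMap.smul_apply]

theorem rhoHom_apply (g : Uso⟦X⟧) (x : Mcl⟦X⟧) : rhoHom g x = rhoSeries g x := by
  ext1 n
  have h1 := map_hsum (LinearMap.applyₗ x : Module.End Ch Mcl⟦X⟧ →ₗ[Ch] Mcl⟦X⟧)
    fun k => rhoConst (PowerSeries.coeff k g)
  obtain ⟨y, hy⟩ := hsum_spec (fun k => rhoConst (PowerSeries.coeff k g) x) (n + 1)
  have h2 : rhoHom g x = _ := h1.trans hy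
  rw [h2, map_add, X_pow_smul_series, PowerSeries.coeff_X_pow_mul', if_neg (by omega), add_zero,
    map_sum, rhoSeries, PowerSeries.coeff_mk,
    Finset.Nat.sum_antidiagonal_eq_sum_range_succ
      (fun i j => rho (PowerSeries.coeff i g) (PowerSeries.coeff j x))]
  refine Finset.sum_congr rfl fun k hk => ?_
  rw [X_pow_smul_series, PowerSeries.coeff_X_pow_mul', if_pos (by simpa using hk), coeff_rhoConst]

theorem coeff_rhoHom_C (g : Uso⟦X⟧) (f : Mcl) (n : ℕ) :
    PowerSeries.coeff n (rhoHom g (PowerSeries.C f)) = rho (PowerSeries.coeff n g) f := by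
  rw [rhoHom_apply, rhoSeries, PowerSeries.coeff_mk, Finset.sum_eq_single (n, 0)]
  · simp
  · rintro ⟨i, j⟩ hp hne
    rw [Finset.HasAntidiagonal.mem_antidiagonal] at hp
    rw [PowerSeries.coeff_C, if_neg (fun h => hne (by simp_all)), map_zero]
  · simp

/-- The two embeddings of `U(sl₂)` into `U(so₄)`. -/
def embU (s : Fin 2) : U →ₐ[ℂ] Uso :=
  if s = 0 then Algebra.TensorProduct.includeLeft else Algebra.TensorProduct.includeRight

theorem rho_embU (s : Fin 2) (g : Gen) (f : Mcl) : rho (embU s (uGen g)) f = field s g f := by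
  fin_cases s
  · exact rho_tmul_one g f
  · exact rho_one_tmul g f

theorem IsBeta.symm_emb {α : U⟦X⟧ ≃ₐ[Ch] Uh} {β : Uso⟦X⟧ ≃ₐ[Ch] UhSo} (h : IsBeta α β)
    (s : Fin 2) (x : Uh) :
    β.symm (emb s x) = PowerSeries.map (embU s).toRingHom (α.symm x) := by
  rw [AlgEquiv.symm_apply_eq]
  fin_cases s
  · refine Eq.trans ?_ (h.apply_inclL (α.symm x)).symm
    rw [AlgEquiv.apply_symm_apply]
    rfl
  · refine Eq.trans ?_ (h.apply_inclR (α.symm x)).symm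
    rw [AlgEquiv.apply_symm_apply]
    rfl

/-- The radicands of `α⁻¹(Ê)` and `α⁻¹(F̂)` in terms of quantum numbers. -/
theorem C_mul_bracketQuot (x y : ℂ) :
    PowerSeries.C (x * y) * bracketQuot ((x + y) ^ 2) ((x - y) ^ 2) = qNum x * qNum y := by
  have h := (C_sub_mul_bracketQuot (Commute.all ((x + y) ^ 2) ((x - y) ^ 2))).trans
    (smul_coshc_sub_coshc (Commute.all x y))
  rw [show (x + y) ^ 2 - (x - y) ^ 2 = 4 * (x * y) by ring, map_mul, mul_assoc,
    PowerSeries.smul_eq_C_mul] at h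
  refine mul_left_cancel₀ ?_ h
  rw [Ne, map_eq_zero_iff _ PowerSeries.C_injective]
  norm_num

/-- The deformed root `√([x][y])` is the product of `√(xy)` and the root that occurs in `α⁻¹`. -/
theorem sqrtOne_bracketQuot_mul (x y : ℂ) (h : IsPos (qNum x * qNum y)) :
    sqrtOne (bracketQuot ((x + y) ^ 2) ((x - y) ^ 2)) *
      PowerSeries.C (PowerSeries.constantCoeff (csqrt (qNum x * qNum y))) =
      csqrt (qNum x * qNum y) := by
  have h0 : PowerSeries.constantCoeff (qNum x * qNum y) ≠ 0 := h.ne_zero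
  have hxy : PowerSeries.constantCoeff (qNum x * qNum y) = x * y := by
    rw [map_mul, constantCoeff_qNum, constantCoeff_qNum]
  have : PowerSeries.C (PowerSeries.constantCoeff (qNum x * qNum y))⁻¹ * (qNum x * qNum y) =
      bracketQuot ((x + y) ^ 2) ((x - y) ^ 2) := by
    rw [← C_mul_bracketQuot, C_mul_bracketQuot, hxy, ← C_mul_bracketQuot, ← mul_assoc, ← map_mul,
      inv_mul_cancel₀ (hxy ▸ h0), map_one, one_mul]
  rw [constantCoeff_csqrt, mul_comm]
  conv_rhs => rw [csqrt, this]

/-- The matrix coefficient of `Ê` is that of `E`, times the eigenvalue of the series by which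
`α⁻¹(Ê)` differs from `E`. -/
theorem coefE_eq_mul {N p : ℕ} (hp : p ≤ N) :
    expH ((p : ℂ) - N / 2 + 1) *
        sqrtOne (bracketQuot (((N : ℂ) + 1) ^ 2) ((2 * ((p : ℂ) - N / 2) + 1) ^ 2)) *
      PowerSeries.C (PowerSeries.constantCoeff (coefE N p)) = coefE N p := by
  rcases hp.lt_or_eq with h | rfl
  · have := sqrtOne_bracketQuot_mul ((p : ℂ) + 1) (N - p)
      ((isPos_qNum_succ p).mul (isPos_qNum_sub h))
    rw [show (p : ℂ) + 1 + (N - p) = N + 1 by ring,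
      show (p : ℂ) + 1 - (N - p) = 2 * (p - N / 2) + 1 by ring] at this
    rw [coefE, map_mul, constantCoeff_expH, one_mul, mul_assoc, this]
  · rw [coefE_self, map_zero, map_zero, mul_zero]

/-- The matrix coefficient of `F̂` is that of `F`, times the eigenvalue of the series by which
`α⁻¹(F̂)` differs from `F`. -/
theorem coefF_eq_mul {N p : ℕ} (hp : p ≤ N) :
    expH (-((p : ℂ) - N / 2)) *
        sqrtOne (bracketQuot (((N : ℂ) + 1) ^ 2) ((2 * ((p : ℂ) - N / 2) - 1) ^ 2)) *
      PowerSeries.C (PowerSeries.constantCoeff (coefF N p)) = coefF N p := by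
  rcases Nat.eq_zero_or_pos p with rfl | h
  · rw [coefF_zero, map_zero, map_zero, mul_zero]
  · have := sqrtOne_bracketQuot_mul (p : ℂ) (N - p + 1) ((isPos_qNum_nat h).mul (by
      have := isPos_qNum_succ (N - p)
      rwa [Nat.cast_sub hp] at this))
    rw [show (p : ℂ) + (N - p + 1) = N + 1 by ring,
      show (p : ℂ) - (N - p + 1) = 2 * (p - N / 2) - 1 by ring] at this
    rw [coefF, map_mul, constantCoeff_expH, one_mul, mul_assoc, this]

theorem coeff_smul_C (c : Ch) (f : Mcl) (n : ℕ) :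
    PowerSeries.coeff n (c • (PowerSeries.C f : Mcl⟦X⟧)) = PowerSeries.coeff n c • f := by
  rw [Algebra.smul_def, PowerSeries.coeff_mul_C]
  change PowerSeries.coeff n (PowerSeries.map (algebraMap ℂ Mcl) c) * f = _
  rw [PowerSeries.coeff_map, ← Algebra.smul_def]

section

variable (s : Fin 2) (n k : ℕ) {N p : ℕ}

/-- The action of one copy of `U(sl₂)` on `M(2)`. -/
def rhoU (s : Fin 2) : U →ₐ[ℂ] Module.End ℂ Mcl := rho.comp (embU s)

theorem rhoU_gen (s : Fin 2) (g : Gen) (f : Mcl) : rhoU s (uGen g) f = field s g f := rho_embU s g f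

theorem rhoU_uH (hp : p ≤ N) :
    rhoU s uH (vCl s n N k p) = (2 * ((p : ℂ) - N / 2)) • vCl s n N k p :=
  (rhoU_gen s .H _).trans (field_H_vCl s n k hp)

/-- The Casimir element acts on the spin-`N/2` representation by the scalar for which
`2C + 1 = (N + 1)²`. -/
theorem rhoU_uJ (hp : p ≤ N) :
    rhoU s uJ (vCl s n N k p) = (((N : ℂ) + 1) ^ 2) • vCl s n N k p := by
  have hH : rhoU s (uH - 1) (vCl s n N k p) = (2 * ((p : ℂ) - N / 2) - 1) • vCl s n N k p := by
    rw [map_sub, map_one, LinearMap.sub_apply, rhoU_uH s n k hp, Module.End.one_apply, sub_smul,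
      one_smul]
  have hF : rhoU s uF (vCl s n N k p) = _ := (rhoU_gen s .F _).trans (field_F_vCl s n k hp)
  have hEF : rhoU s (uE * uF) (vCl s n N k p) =
      ((p : ℂ) * (N - p + 1)) • vCl s n N k p := by
    rw [map_mul, Module.End.mul_apply, hF]
    cases p with
    | zero => rw [coefF_zero, map_zero, zero_smul, map_zero, Nat.cast_zero, zero_mul, zero_smul]
    | succ p =>
      have hE : rhoU s uE (vCl s n N k p) = _ := (rhoU_gen s .E _).trans
        (field_E_vCl s n k (by omega : p ≤ N))
      rw [map_smul, Nat.add_sub_cancel, hE, smul_smul, ← map_mul, mul_comm,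
        coefE_mul_coefF (by omega), map_mul, constantCoeff_qNum, constantCoeff_qNum]
      push_cast
      congr 1
      ring
  rw [show uJ = (uH - 1) ^ 2 + (4 : ℂ) • (uE * uF) by
    rw [← sub_eq_iff_eq_add', four_uE_uF, Algebra.smul_def, map_ofNat], map_add, map_smul,
    LinearMap.add_apply, LinearMap.smul_apply, hEF, HasEigenSeries.pow_apply hH, smul_smul,
    ← add_smul]
  congr 1
  ring

/-- The ordering intertwines `α⁻¹(Ê)`, `α⁻¹(F̂)`, `α⁻¹(Ĥ)` with `Ê`, `F̂`, `Ĥ` on basis vectors.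
-/
theorem phi_rhoHom (hp : p ≤ N) (hk : k ≤ N) (g : Gen) :
    phi (rhoHom (PowerSeries.map (embU s).toRingHom (alphaInvGen g))
      (PowerSeries.C (vCl s n N k p))) = op s g (vH s n N k p) := by
  have hp' : p = ((⟨p, by omega⟩ : Fin (N + 1)) : ℕ) := rfl
  have hH := rhoU_uH s n k hp
  have hJ := rhoU_uJ s n k hp
  have hc (w : U⟦X⟧) (m : ℕ) : PowerSeries.coeff m
      (rhoHom (PowerSeries.map (embU s).toRingHom w) (PowerSeries.C (vCl s n N k p))) =
      rhoU s (PowerSeries.coeff m w) (vCl s n N k p) := by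
    rw [coeff_rhoHom_C, PowerSeries.coeff_map]
    rfl
  cases g with
  | H =>
    have : rhoHom (PowerSeries.map (embU s).toRingHom (alphaInvGen .H))
        (PowerSeries.C (vCl s n N k p)) =
        (PowerSeries.C (2 * ((p : ℂ) - N / 2)) : Ch) • PowerSeries.C (vCl s n N k p) := by
      ext1 m
      rw [hc, coeff_smul_C, alphaInvGen, PowerSeries.coeff_C, PowerSeries.coeff_C]
      split_ifs
      · exact hH
      · rw [map_zero, LinearMap.zero_apply, zero_smul]
    rw [this, map_smul, phi_vCl s n hk hp, hp', op_vH, sum_irrepH_H N _ fun r => vH s n N k r]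
  | E =>
    have hW : HasEigenSeries (rhoU s) (vCl s n N k p)
        (expH ((2⁻¹ : ℂ) • uH + 1) * uS (uH + 1)) (expH ((p : ℂ) - N / 2 + 1) *
          sqrtOne (bracketQuot (((N : ℂ) + 1) ^ 2) ((2 * ((p : ℂ) - N / 2) + 1) ^ 2))) := by
      refine .mul (.expH (z := (p : ℂ) - N / 2 + 1) ?_) (.sqrtOne (.bracketQuot hJ
        (HasEigenSeries.pow_apply (z := 2 * ((p : ℂ) - N / 2) + 1) ?_ 2)))
      · rw [map_add, map_smul, map_one, LinearMap.add_apply, LinearMap.smul_apply, hH,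
          Module.End.one_apply]
        module
      · rw [map_add, map_one, LinearMap.add_apply, hH, Module.End.one_apply]
        module
    have hE : rhoU s uE (vCl s n N k p) = _ := (rhoU_gen s .E _).trans (field_E_vCl s n k hp)
    have : rhoHom (PowerSeries.map (embU s).toRingHom (alphaInvGen .E))
        (PowerSeries.C (vCl s n N k p)) = coefE N p • PowerSeries.C (vCl s n N k (p + 1)) := by
      ext1 m
      rw [hc, coeff_smul_C, alphaInvGen, alphaInvE_eq, mul_assoc, PowerSeries.coeff_C_mul, map_mul,
        Module.End.mul_apply, hW, map_smul, hE, smul_smul, ← PowerSeries.coeff_mul_C,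
        coefE_eq_mul hp]
    rw [this, map_smul, hp', op_vH, sum_irrepH_E N _ fun r => vH s n N k r]
    rcases hp.lt_or_eq with h | rfl
    · rw [phi_vCl s n hk (by simpa using h)]
    · rw [coefE_self, zero_smul, zero_smul]
  | F =>
    have hW : HasEigenSeries (rhoU s) (vCl s n N k p)
        (expH (-((2⁻¹ : ℂ) • uH)) * uS (uH - 1)) (expH (-((p : ℂ) - N / 2)) *
          sqrtOne (bracketQuot (((N : ℂ) + 1) ^ 2) ((2 * ((p : ℂ) - N / 2) - 1) ^ 2))) := by
      refine .mul (.expH (z := -((p : ℂ) - N / 2)) ?_) (.sqrtOne (.bracketQuot hJ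
        (HasEigenSeries.pow_apply (z := 2 * ((p : ℂ) - N / 2) - 1) ?_ 2)))
      · rw [map_neg, map_smul, LinearMap.neg_apply, LinearMap.smul_apply, hH]
        module
      · rw [map_sub, map_one, LinearMap.sub_apply, hH, Module.End.one_apply]
        module
    have hF : rhoU s uF (vCl s n N k p) = _ := (rhoU_gen s .F _).trans (field_F_vCl s n k hp)
    have : rhoHom (PowerSeries.map (embU s).toRingHom (alphaInvGen .F))
        (PowerSeries.C (vCl s n N k p)) = coefF N p • PowerSeries.C (vCl s n N k (p - 1)) := by
      ext1 m
      rw [hc, coeff_smul_C, alphaInvGen, alphaInvF_eq, mul_assoc, PowerSeries.coeff_C_mul, map_mul,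
        Module.End.mul_apply, hW, map_smul, hF, smul_smul, ← PowerSeries.coeff_mul_C,
        coefF_eq_mul hp]
    rw [this, map_smul, hp', op_vH, sum_irrepH_F N _ fun r => vH s n N k r,
      phi_vCl s n hk (by simp; omega)]

end

theorem exists_eq_vCl (s : Fin 2) (n : ℕ) {N : ℕ} (p p' : Fin (N + 1)) :
    ∃ k q, k ≤ N ∧ q ≤ N ∧ lsq ^ n * tCl N p p' = vCl s n N k q := by
  obtain rfl | rfl : s = 0 ∨ s = 1 := by omega
  · exact ⟨p', p, by omega, by omega, by rw [vCl_eq, if_pos rfl]⟩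
  · exact ⟨p, p', by omega, by omega, by rw [vCl_eq, if_neg one_ne_zero]⟩

theorem phi_rhoHom_symm {α : U⟦X⟧ ≃ₐ[Ch] Uh} {β : Uso⟦X⟧ ≃ₐ[Ch] UhSo} (hα : IsAlpha α)
    (hβ : IsBeta α β) (s : Fin 2) (g : Gen) (x : Mcl⟦X⟧) :
    phi (rhoHom (β.symm (emb s (Uh.gen g))) x) = op s g (phi x) := by
  rw [hβ.symm_emb, hα.symm_gen]
  have h : phi.toLinearMap ∘ₗ rhoHom (PowerSeries.map (embU s).toRingHom (alphaInvGen g)) =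
      op s g ∘ₗ phi.toLinearMap := linear_ext_tCl fun n N p p' => by
    obtain ⟨k, q, hk, hq, hx⟩ := exists_eq_vCl s n p p'
    rw [hx, LinearMap.comp_apply, LinearMap.comp_apply, LinearEquiv.coe_coe, phi_rhoHom s n k hq hk,
      phi_vCl s n hk hq]
  exact LinearMap.congr_fun h x

/-- The ordering intertwines the two actions: it does so for `α⁻¹(Ê)`, `α⁻¹(F̂)`, `α⁻¹(Ĥ)` on the
vectors `l²ⁿ T^{(j,j)}_{mm'}`. -/
theorem isSymmetryPreserving_phi {α : U⟦X⟧ ≃ₐ[Ch] Uh} {β : Uso⟦X⟧ ≃ₐ[Ch] UhSo}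
    {ρ : UhSo →ₐ[Ch] Module.End Ch Mh} (hα : IsAlpha α) (hβ : IsBeta α β)
    (hρ : IsDeformedAction ρ) : IsSymmetryPreserving β ρ phi := by
  have key : (phi.conjAlgEquiv Ch).toAlgHom.comp (rhoHom.comp β.symm.toAlgHom) = ρ := by
    refine UhSo.algHom_ext fun s g => ?_
    rw [hρ.apply_gen]
    refine LinearMap.ext fun x => ?_
    refine (phi_rhoHom_symm hα hβ s g (phi.symm x)).trans ?_
    rw [LinearEquiv.apply_symm_apply]
  intro g x
  rw [← rhoHom_apply, ← key]
  have h1 : phi.symm (phi x) = x := LinearEquiv.symm_apply_apply phi x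
  have h2 : β.symm (β g) = g := AlgEquiv.symm_apply_apply β g
  refine Eq.trans ?_ (congrArg₂ (fun a b => phi (rhoHom a b)) h2.symm h1.symm)
  rfl

end QuantumEuclid

namespace QuantumEuclid

/-! ### The lowering relation of the quantum Clebsch--Gordan coefficients -/

/-- `1 / [n]!` for an integer `n`, with the value `0` for `n < 0`. -/
def qif (n : ℤ) : Ch := if 0 ≤ n then (qFact n.toNat)⁻¹ else 0

theorem qif_of_neg {n : ℤ} (h : n < 0) : qif n = 0 := if_neg (by omega)

theorem qif_natCast (n : ℕ) : qif n = (qFact n)⁻¹ := by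
  rw [qif, if_pos (by omega), Int.toNat_natCast]

theorem qif_zero : qif 0 = 1 := by
  have := qif_natCast 0
  rw [qFact_zero] at this
  simpa using this

theorem isPos_qif (n : ℕ) : IsPos (qif n) := by
  rw [qif_natCast]; exact (isPos_qFact n).inv

theorem qif_sub_one (n : ℤ) : qif (n - 1) = qNum (n : ℂ) * qif n := by
  rcases lt_trichotomy n 0 with h | rfl | h
  · rw [qif_of_neg h, qif_of_neg (by omega), mul_zero]
  · rw [qif_of_neg (by omega), Int.cast_zero, qNum_zero, zero_mul]
  · obtain ⟨m, rfl⟩ : ∃ m : ℕ, n = (m + 1 : ℕ) := ⟨(n - 1).toNat, by omega⟩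
    rw [show ((m + 1 : ℕ) : ℤ) - 1 = (m : ℕ) by push_cast; ring, qif_natCast, qif_natCast]
    have h1 := PowerSeries.mul_inv_cancel _ (isPos_qFact m).ne_zero
    have h2 := PowerSeries.mul_inv_cancel _ (isPos_qFact (m + 1)).ne_zero
    refine (isPos_qFact m).isUnit.mul_left_cancel ?_
    rw [h1, ← h2, qFact_succ]
    push_cast
    ring

theorem qif_add_one (n : ℤ) : qif n = qNum ((n : ℂ) + 1) * qif (n + 1) := by
  have := qif_sub_one (n + 1)
  rw [add_sub_cancel_right] at this
  rw [this]
  push_cast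
  rfl

/-- The product of inverse factorials in the `r`-th term of the sum in a Clebsch--Gordan
coefficient, where `p₁ = j₁ + m₁`, `p₂ = j₂ + m₂`, `i = j₁ + j₂ - j`. -/
def cgTerm (N₁ N₂ i p₁ p₂ r : ℤ) : Ch :=
  qif r * qif (i - r) * qif (N₁ - p₁ - r) * qif (p₂ - r) * qif (p₁ - i + r) *
    qif (N₂ - p₂ - i + r)

/-- The sum in a quantum Clebsch--Gordan coefficient, where `N₁ = 2j₁`, `N₂ = 2j₂`,
`p₁ = j₁ + m₁`, `p₂ = j₂ + m₂`, `i = j₁ + j₂ - j`. -/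
def cgSum (N₁ N₂ : ℤ) (i : ℕ) (p₁ p₂ : ℤ) : Ch :=
  ∑ r ∈ Finset.range (i + 1), (-1) ^ r * expH (-((r : ℂ) * (N₁ + N₂ - i + 1))) *
    cgTerm N₁ N₂ i p₁ p₂ r

theorem cgTerm_eq_zero {N₁ N₂ i p₁ p₂ : ℤ} (h : p₁ < 0 ∨ N₁ < p₁ ∨ p₂ < 0 ∨ N₂ < p₂ ∨
    p₁ + p₂ < i ∨ N₁ + N₂ - i < p₁ + p₂) (r : ℤ) : cgTerm N₁ N₂ i p₁ p₂ r = 0 := by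
  have : r < 0 ∨ i - r < 0 ∨ N₁ - p₁ - r < 0 ∨ p₂ - r < 0 ∨ p₁ - i + r < 0 ∨
      N₂ - p₂ - i + r < 0 := by omega
  rw [cgTerm]
  rcases this with h | h | h | h | h | h <;> simp [qif_of_neg h]

theorem cgSum_eq_zero {N₁ N₂ p₁ p₂ : ℤ} {i : ℕ} (h : p₁ < 0 ∨ N₁ < p₁ ∨ p₂ < 0 ∨ N₂ < p₂ ∨
    p₁ + p₂ < i ∨ N₁ + N₂ - i < p₁ + p₂) : cgSum N₁ N₂ i p₁ p₂ = 0 :=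
  Finset.sum_eq_zero fun r _ => by rw [cgTerm_eq_zero h, mul_zero]

/-- The failure of the lowering relation for the individual terms is a telescoping difference. -/
theorem cgTerm_telescope (N₁ N₂ i p₁ p₂ r : ℤ) :
    qNum ((N₁ : ℂ) + N₂ - i - p₁ - p₂) * cgTerm N₁ N₂ i p₁ p₂ r =
      expH ((p₂ : ℂ) - N₂) * qNum ((p₁ : ℂ) + 1) * cgTerm N₁ N₂ i (p₁ + 1) p₂ r +
      expH ((N₁ : ℂ) - p₁) * qNum ((p₂ : ℂ) + 1) * cgTerm N₁ N₂ i p₁ (p₂ + 1) r -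
      expH (-((N₂ : ℂ) - i + p₁ - p₂ + r + 1)) * (qif r * qif (i - r - 1) *
        qif (N₁ - p₁ - r - 1) * qif (p₂ - r) * qif (p₁ - i + r + 1) * qif (N₂ - p₂ - i + r)) -
      expH ((N₁ : ℂ) - p₁ + p₂ - r + 1) * (qif (r - 1) * qif (i - r) *
        qif (N₁ - p₁ - r) * qif (p₂ - r + 1) * qif (p₁ - i + r) * qif (N₂ - p₂ - i + r - 1)) := by
  rw [cgTerm, cgTerm, cgTerm, show N₁ - (p₁ + 1) - r = N₁ - p₁ - r - 1 by ring,
    show p₁ + 1 - i + r = p₁ - i + r + 1 by ring, show p₂ + 1 - r = p₂ - r + 1 by ring,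
    show N₂ - (p₂ + 1) - i + r = N₂ - p₂ - i + r - 1 by ring]
  obtain ⟨a, ha⟩ : ∃ a, a = i - r := ⟨_, rfl⟩
  obtain ⟨b, hb⟩ : ∃ b, b = N₁ - p₁ - r := ⟨_, rfl⟩
  obtain ⟨c, hc⟩ : ∃ c, c = p₂ - r := ⟨_, rfl⟩
  obtain ⟨d, hd⟩ : ∃ d, d = p₁ - i + r := ⟨_, rfl⟩
  obtain ⟨e, he⟩ : ∃ e, e = N₂ - p₂ - i + r := ⟨_, rfl⟩
  obtain rfl : i = a + r := by omega
  obtain rfl : p₂ = c + r := by omega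
  obtain rfl : p₁ = d + a := by omega
  obtain rfl : N₁ = b + r + (d + a) := by omega
  obtain rfl : N₂ = e + a + (c + r) := by omega
  rw [← ha, ← hb, ← hc, ← hd, ← he, qif_sub_one a, qif_sub_one b, qif_sub_one e, qif_sub_one r,
    qif_add_one c, qif_add_one d]
  push_cast
  rw [show (b : ℂ) + r + (d + a) + (e + a + (c + r)) - (a + r) - (d + a) - (c + r) = b + e by ring,
    show (c : ℂ) + r - (e + a + (c + r)) = -e + -a by ring,
    show (b : ℂ) + r + (d + a) - (d + a) = b + r by ring,
    show -((e : ℂ) + a + (c + r) - (a + r) + (d + a) - (c + r) + r + 1) =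
      -e + -a + -(d + 1) by ring,
    show (b : ℂ) + r + (c + r) - r + 1 = b + r + (c + 1) by ring,
    show (d : ℂ) + a + 1 = d + 1 + a by ring, show (c : ℂ) + r + 1 = r + (c + 1) by ring,
    show (b : ℂ) + e = e + b by ring, qNum_add (e : ℂ) b, qNum_add ((d : ℂ) + 1) a,
    qNum_add (r : ℂ) (c + 1)]
  rw [expH_add' (-(e : ℂ) + -a), expH_add' (-(e : ℂ)), expH_add' ((b : ℂ) + r), expH_add' (b : ℂ)]
  have h1 := expH_neg_mul a
  have h2 := expH_neg_mul r
  linear_combination -expH (-(e : ℂ)) * qNum ((d : ℂ) + 1) *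
    (qif r * qif a * (qNum (b : ℂ) * qif b) *
    (qNum ((c : ℂ) + 1) * qif (c + 1)) * qif (d + 1) * qif e) * h1 -
    expH (b : ℂ) * qNum ((c : ℂ) + 1) * (qif r * qif a * qif b * qif (c + 1) *
    (qNum ((d : ℂ) + 1) * qif (d + 1)) * (qNum (e : ℂ) * qif e)) * h2

/-- The lowering relation of the sums in the quantum Clebsch--Gordan coefficients. -/
theorem cgSum_lowering (N₁ N₂ p₁ p₂ : ℤ) (i : ℕ) :
    qNum ((N₁ : ℂ) + N₂ - i - p₁ - p₂) * cgSum N₁ N₂ i p₁ p₂ =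
      expH ((p₂ : ℂ) - N₂) * qNum ((p₁ : ℂ) + 1) * cgSum N₁ N₂ i (p₁ + 1) p₂ +
      expH ((N₁ : ℂ) - p₁) * qNum ((p₂ : ℂ) + 1) * cgSum N₁ N₂ i p₁ (p₂ + 1) := by
  -- with their prefactors, the subtracted terms in `cgTerm_telescope` are `-Z (r + 1)` and `Z r`
  let Z : ℕ → Ch := fun r => (-1) ^ r *
    expH (-((r : ℂ) * (N₁ + N₂ - i + 1)) + ((N₁ : ℂ) - p₁ + p₂ - r + 1)) *
      (qif (r - 1) * qif (i - r) * qif (N₁ - p₁ - r) * qif (p₂ - r + 1) * qif (p₁ - i + r) *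
        qif (N₂ - p₂ - i + r - 1))
  have hZ : ∑ r ∈ Finset.range (i + 1), (Z (r + 1) - Z r) = 0 := by
    rw [Finset.sum_range_sub]
    have h1 : qif ((i : ℤ) - ((i + 1 : ℕ) : ℤ)) = 0 := qif_of_neg (by omega)
    have h2 : qif (((0 : ℕ) : ℤ) - 1) = 0 := qif_of_neg (by omega)
    simp only [Z, h1, h2, mul_zero, zero_mul, sub_self]
  rw [← sub_eq_zero, ← hZ, cgSum, cgSum, cgSum, Finset.mul_sum, Finset.mul_sum, Finset.mul_sum,
    ← Finset.sum_add_distrib, ← Finset.sum_sub_distrib]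
  refine Finset.sum_congr rfl fun r _ => ?_
  have h := cgTerm_telescope N₁ N₂ i p₁ p₂ r
  have e1 : expH (-(((r + 1 : ℕ) : ℂ) * (N₁ + N₂ - i + 1)) +
      ((N₁ : ℂ) - p₁ + p₂ - ((r + 1 : ℕ) : ℂ) + 1)) = expH (-((r : ℂ) * (N₁ + N₂ - i + 1))) *
        expH (-((N₂ : ℂ) - i + p₁ - p₂ + r + 1)) := by
    rw [← expH_add']; congr 1; push_cast; ring
  simp only [Z]
  rw [e1, expH_add', show ((r + 1 : ℕ) : ℤ) - 1 = r by omega,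
    show (i : ℤ) - ((r + 1 : ℕ) : ℤ) = i - r - 1 by omega,
    show N₁ - p₁ - ((r + 1 : ℕ) : ℤ) = N₁ - p₁ - r - 1 by omega,
    show p₂ - ((r + 1 : ℕ) : ℤ) + 1 = p₂ - r by omega,
    show p₁ - i + ((r + 1 : ℕ) : ℤ) = p₁ - i + r + 1 by omega,
    show N₂ - p₂ - i + ((r + 1 : ℕ) : ℤ) - 1 = N₂ - p₂ - i + r by omega, pow_succ]
  push_cast at h ⊢
  linear_combination (-1) ^ r * expH (-((r : ℂ) * (N₁ + N₂ - i + 1))) * h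

end QuantumEuclid

namespace QuantumEuclid

/-! ### Lowering relation, with normalization factors -/

/-- `√([n]!)`. -/
def qFactRoot (n : ℕ) : Ch := csqrt (qFact n)

theorem isPos_qFactRoot (n : ℕ) : IsPos (qFactRoot n) := (isPos_qFact n).csqrt

theorem qFactRoot_zero : qFactRoot 0 = 1 := by rw [qFactRoot, qFact_zero, csqrt_one]

theorem qFactRoot_mul_self (n : ℕ) : qFactRoot n * qFactRoot n = qFact n :=
  csqrt_mul_self (isPos_qFact n)

theorem qFactRoot_succ (n : ℕ) : qFactRoot (n + 1) = csqrt (qNum ((n : ℂ) + 1)) * qFactRoot n := by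
  rw [qFactRoot, qFact_succ, csqrt_mul (isPos_qNum_succ n) (isPos_qFact n), qFactRoot]

theorem csqrt_qBinom (n p : ℕ) : csqrt (qBinom n p) * (qFactRoot p * qFactRoot (n - p)) =
    expH ((p : ℂ) * (p - n) / 2) * qFactRoot n := by
  have hp := (isPos_qFact (n - p)).mul (isPos_qFact p)
  rw [qBinom, csqrt_mul ((isPos_expH _).mul (isPos_qFact n)) hp.inv,
    csqrt_mul (isPos_expH _) (isPos_qFact n), csqrt_expH, qFactRoot, qFactRoot, mul_assoc,
    mul_comm (csqrt (qFact p)), ← csqrt_mul (isPos_qFact _) (isPos_qFact p), ← csqrt_mul hp.inv hp,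
    PowerSeries.inv_mul_cancel _ hp.ne_zero, csqrt_one, mul_one, qFactRoot]

theorem coefF_succ {N p : ℕ} (h : p < N) : coefF N (p + 1) =
    expH (-((p : ℂ) + 1 - N / 2)) * (csqrt (qNum ((p : ℂ) + 1)) * csqrt (qNum ((N : ℂ) - p))) := by
  rw [coefF, ← csqrt_mul (isPos_qNum_succ p) (isPos_qNum_sub h)]
  push_cast
  rw [show (N : ℂ) - (p + 1) + 1 = N - p by ring]

theorem qFactRoot_sub {N p : ℕ} (h : p < N) :
    qFactRoot (N - p) = csqrt (qNum ((N : ℂ) - p)) * qFactRoot (N - (p + 1)) := by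
  rw [show N - p = N - (p + 1) + 1 by omega, qFactRoot_succ, Nat.cast_sub h]
  push_cast
  rw [show (N : ℂ) - (p + 1) + 1 = N - p by ring]

theorem coefF_mul_qFactRoot {N p : ℕ} (h : p < N) :
    coefF N (p + 1) * (qFactRoot p * qFactRoot (N - p)) = expH (-((p : ℂ) + 1 - N / 2)) *
      qNum ((N : ℂ) - p) * (qFactRoot (p + 1) * qFactRoot (N - (p + 1))) := by
  rw [coefF_succ h, qFactRoot_sub h, qFactRoot_succ]
  linear_combination expH (-((p : ℂ) + 1 - N / 2)) * csqrt (qNum ((p : ℂ) + 1)) * qFactRoot p *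
    qFactRoot (N - (p + 1)) * csqrt_mul_self (isPos_qNum_sub h)

theorem coefF_mul_qFactRoot_succ {N p : ℕ} (h : p < N) :
    coefF N (p + 1) * (qFactRoot (p + 1) * qFactRoot (N - (p + 1))) =
      expH (-((p : ℂ) + 1 - N / 2)) * qNum ((p : ℂ) + 1) * (qFactRoot p * qFactRoot (N - p)) := by
  rw [coefF_succ h, qFactRoot_sub h, qFactRoot_succ]
  linear_combination expH (-((p : ℂ) + 1 - N / 2)) * csqrt (qNum ((N : ℂ) - p)) * qFactRoot p *
    qFactRoot (N - (p + 1)) * csqrt_mul_self (isPos_qNum_succ p)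

/-- The part of a quantum Clebsch--Gordan coefficient that depends on the spins only. -/
def cgNorm (N₁ N₂ i : ℕ) : Ch :=
  csqrt (qFact i * qFact (N₁ - i) * qFact (N₂ - i) * qif ((N₁ : ℤ) + N₂ - i + 1) *
    qNum ((N₁ : ℂ) + N₂ - 2 * i + 1))

/-- The quantum Clebsch--Gordan coefficient in terms of the integers `N₁ = 2j₁`, `N₂ = 2j₂`,
`i = j₁ + j₂ - j`, `p₁ = j₁ + m₁`, `p₂ = j₂ + m₂`. -/
def cgNat (N₁ N₂ i p₁ p₂ : ℕ) : Ch :=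
  expH (((i : ℂ) * (N₁ + N₂ - i + 1) + (N₁ * p₂ - N₂ * p₁)) / 2) * cgNorm N₁ N₂ i *
    (qFactRoot p₁ * qFactRoot (N₁ - p₁) * (qFactRoot p₂ * qFactRoot (N₂ - p₂)) *
      (qFactRoot (p₁ + p₂ - i) * qFactRoot (N₁ + N₂ - i - (p₁ + p₂)))) *
    cgSum N₁ N₂ i p₁ p₂

theorem cgNat_eq_zero {N₁ N₂ i p₁ p₂ : ℕ} (h : N₁ < p₁ ∨ N₂ < p₂ ∨ p₁ + p₂ < i ∨
    N₁ + N₂ < p₁ + p₂ + i) : cgNat N₁ N₂ i p₁ p₂ = 0 := by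
  rw [cgNat, cgSum_eq_zero (by omega), mul_zero]

/-- At the end `p = N` of the weight string, where truncated subtraction spoils
`coefF_mul_qFactRoot_succ`, the relation is saved by a factor that vanishes. -/
theorem coefF_mul_qFactRoot_of_eq_zero {N p : ℕ} (h : p ≤ N) {z : Ch} (hz : p = N → z = 0) :
    coefF N (p + 1) * (qFactRoot (p + 1) * qFactRoot (N - (p + 1))) * z =
      expH (-((p : ℂ) + 1 - N / 2)) * qNum ((p : ℂ) + 1) *
        (qFactRoot p * qFactRoot (N - p)) * z := by
  rcases h.lt_or_eq with h | h
  · rw [coefF_mul_qFactRoot_succ h]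
  · rw [hz h, mul_zero, mul_zero]

theorem coefF_mul_cgSum {N₁ N₂ i p₁ p₂ : ℕ} (hi : 2 * i ≤ N₁ + N₂)
    (hs : p₁ + p₂ + 1 + i ≤ N₁ + N₂) :
    coefF (N₁ + N₂ - 2 * i) (p₁ + p₂ + 1 - i) *
      (qFactRoot (p₁ + p₂ - i) * qFactRoot (N₁ + N₂ - i - (p₁ + p₂))) * cgSum N₁ N₂ i p₁ p₂ =
      expH (-((p₁ : ℂ) + p₂ + 1 - (N₁ + N₂) / 2)) * qNum ((N₁ : ℂ) + N₂ - i - p₁ - p₂) *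
      (qFactRoot (p₁ + p₂ + 1 - i) * qFactRoot (N₁ + N₂ - i - (p₁ + p₂ + 1))) *
        cgSum N₁ N₂ i p₁ p₂ := by
  rcases Nat.lt_or_ge (p₁ + p₂) i with h | h
  · rw [cgSum_eq_zero (by omega), mul_zero, mul_zero]
  · have := coefF_mul_qFactRoot (N := N₁ + N₂ - 2 * i) (p := p₁ + p₂ - i) (by omega)
    rw [show p₁ + p₂ - i + 1 = p₁ + p₂ + 1 - i by omega,
      show N₁ + N₂ - 2 * i - (p₁ + p₂ - i) = N₁ + N₂ - i - (p₁ + p₂) by omega,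
      show N₁ + N₂ - 2 * i - (p₁ + p₂ + 1 - i) = N₁ + N₂ - i - (p₁ + p₂ + 1) by omega,
      Nat.cast_sub hi, Nat.cast_sub h] at this
    push_cast at this
    rw [show -((p₁ : ℂ) + p₂ - i + 1 - (N₁ + N₂ - 2 * i) / 2) =
        -((p₁ : ℂ) + p₂ + 1 - (N₁ + N₂) / 2) by ring,
      show (N₁ : ℂ) + N₂ - 2 * i - (p₁ + p₂ - i) = N₁ + N₂ - i - p₁ - p₂ by ring] at this
    rw [this]

/-- The passage from the lowering relation of the sums, `hz`, to that of the coefficients: `c`,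
`c₁`, `c₂` are matrix coefficients of the lowering operators, `e`, `e₁`, `e₂` exponential
prefactors, and `K`, `u₁`, `u₂`, `v`, `L` normalization factors. -/
theorem lowering_of_factors {R : Type*} [CommRing R]
    {c c₁ c₂ e e₁ e₂ f f₁ f₂ K L u₁ u₁' u₂ u₂' v n n₁ n₂ q₁ q₂ t z z₁ z₂ : R}
    (h1 : c₁ * u₁' * z₁ = f₁ * n₁ * u₁ * z₁) (h2 : c₂ * u₂' * z₂ = f₂ * n₂ * u₂ * z₂)
    (h : c * v * z = f * n * L * z) (hz : n * z = q₁ * n₁ * z₁ + q₂ * n₂ * z₂)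
    (he₁ : e₁ * f₁ = e * f * q₁) (he₂ : e₂ * (t * f₂) = e * f * q₂) :
    c * (e * K * (u₁ * u₂ * v) * z) =
      c₁ * (e₁ * K * (u₁' * u₂ * L) * z₁) + t * c₂ * (e₂ * K * (u₁ * u₂' * L) * z₂) := by
  linear_combination e * K * u₁ * u₂ * h + e * f * K * L * u₁ * u₂ * hz - e₁ * K * u₂ * L * h1 -
    e₂ * K * u₁ * L * t * h2 - K * u₁ * u₂ * L * n₁ * z₁ * he₁ - K * u₁ * u₂ * L * n₂ * z₂ * he₂

/-- The quantum Clebsch--Gordan coefficients intertwine the lowering operators of the spin-`j`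
representation and of the tensor product. -/
theorem cgNat_lowering {N₁ N₂ i p₁ p₂ : ℕ} (h1 : p₁ ≤ N₁) (h2 : p₂ ≤ N₂) (hi : 2 * i ≤ N₁ + N₂)
    (hs : p₁ + p₂ + 1 + i ≤ N₁ + N₂) :
    coefF (N₁ + N₂ - 2 * i) (p₁ + p₂ + 1 - i) * cgNat N₁ N₂ i p₁ p₂ =
      coefF N₁ (p₁ + 1) * cgNat N₁ N₂ i (p₁ + 1) p₂ +
      expH ((N₁ : ℂ) - 2 * p₁) * coefF N₂ (p₂ + 1) * cgNat N₁ N₂ i p₁ (p₂ + 1) := by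
  have hA := coefF_mul_qFactRoot_of_eq_zero (z := cgSum N₁ N₂ i (p₁ + 1) p₂) h1
    fun h => cgSum_eq_zero (by omega)
  have hB := coefF_mul_qFactRoot_of_eq_zero (z := cgSum N₁ N₂ i p₁ (p₂ + 1)) h2
    fun h => cgSum_eq_zero (by omega)
  have hC := coefF_mul_cgSum hi hs
  have hS := cgSum_lowering N₁ N₂ p₁ p₂ i
  -- the exponents of the terms on the right, relative to that of the left-hand side
  have e1 : expH (((i : ℂ) * (N₁ + N₂ - i + 1) + (N₁ * p₂ - N₂ * ((p₁ + 1 : ℕ) : ℂ))) / 2) *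
      expH (-((p₁ : ℂ) + 1 - N₁ / 2)) =
        expH (((i : ℂ) * (N₁ + N₂ - i + 1) + (N₁ * p₂ - N₂ * p₁)) / 2) *
        expH (-((p₁ : ℂ) + p₂ + 1 - (N₁ + N₂) / 2)) * expH ((p₂ : ℂ) - N₂) := by
    rw [← expH_add', ← expH_add', ← expH_add']; congr 1; push_cast; ring
  have e2 : expH (((i : ℂ) * (N₁ + N₂ - i + 1) + (N₁ * ((p₂ + 1 : ℕ) : ℂ) - N₂ * p₁)) / 2) *
      (expH ((N₁ : ℂ) - 2 * p₁) * expH (-((p₂ : ℂ) + 1 - N₂ / 2))) =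
        expH (((i : ℂ) * (N₁ + N₂ - i + 1) + (N₁ * p₂ - N₂ * p₁)) / 2) *
        expH (-((p₁ : ℂ) + p₂ + 1 - (N₁ + N₂) / 2)) * expH ((N₁ : ℂ) - p₁) := by
    rw [← expH_add', ← expH_add', ← expH_add', ← expH_add']; congr 1; push_cast; ring
  rw [cgNat, cgNat, cgNat, show p₁ + 1 + p₂ = p₁ + p₂ + 1 by ring,
    show p₁ + (p₂ + 1) = p₁ + p₂ + 1 by ring]
  exact lowering_of_factors hA hB hC hS e1 e2

/-! ### Vectors in the products of two rows -/

/-- The weight vectors in the polynomials of degree `N` in the two coordinates that form a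
doublet of copy `s` of `U_ℏ(sl₂)`. -/
def doublet (s k : Fin 2) (N p : ℕ) : Mh :=
  csqrt (qBinom N p) • (xs s 0 k ^ (N - p) * xs s 1 k ^ p)

theorem op_F_doublet (s k : Fin 2) {N p : ℕ} (hp : p ≤ N) :
    op s .F (doublet s k N p) = coefF N p • doublet s k N (p - 1) := by
  rw [doublet, map_smul, op_F_monomial, smul_smul]
  cases p with
  | zero => rw [coefF_zero, zero_smul, Nat.cast_zero, qNum_zero, mul_zero, mul_zero, zero_smul]
  | succ p =>
    rw [doublet, smul_smul, Nat.add_sub_cancel, show N - (p + 1) + 1 = N - p by omega]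
    congr 1
    have hR := (isPos_qFactRoot (p + 1)).mul (isPos_qFactRoot (N - (p + 1)))
    have hR' := (isPos_qFactRoot p).mul (isPos_qFactRoot (N - p))
    refine (hR.mul hR').isUnit.mul_left_cancel ?_
    have h1 := csqrt_qBinom N (p + 1)
    have h2 := csqrt_qBinom N p
    have h3 := coefF_mul_qFactRoot_succ hp
    have e : expH (((p + 1 : ℕ) : ℂ) * (((p + 1 : ℕ) : ℂ) - N) / 2) *
        expH (((N - (p + 1) : ℕ) : ℂ) - ((p + 1 : ℕ) : ℂ) + 1 / 2) =
        expH ((p : ℂ) * (p - N) / 2) * expH (-((p : ℂ) + 1 - N / 2)) := by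
      rw [← expH_add', ← expH_add', Nat.cast_sub hp]; congr 1; push_cast; ring
    push_cast at h1 e ⊢
    linear_combination
      expH (((N - (p + 1) : ℕ) : ℂ) - ((p : ℂ) + 1) + 1 / 2) * qNum ((p : ℂ) + 1) *
        (qFactRoot p * qFactRoot (N - p)) * h1 +
      qFactRoot N * qNum ((p : ℂ) + 1) * (qFactRoot p * qFactRoot (N - p)) * e -
      csqrt (qBinom N p) * (qFactRoot p * qFactRoot (N - p)) * h3 -
      expH (-((p : ℂ) + 1 - N / 2)) * qNum ((p : ℂ) + 1) * (qFactRoot p * qFactRoot (N - p)) * h2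

theorem torus_doublet (s k : Fin 2) {N p : ℕ} (hp : p ≤ N) :
    torus (Pi.single s (-1)) (doublet s k N p) = expH ((N : ℂ) - 2 * p) • doublet s k N p := by
  rw [doublet, map_smul, map_mul, map_pow, map_pow, torus_xs, torus_xs, smul_pow, smul_pow,
    smul_mul_smul_comm, smul_comm, wt_zero, wt_one, ← expH_natMul, ← expH_natMul, ← expH_add',
    Nat.cast_sub hp]
  congr 3
  ring

theorem doublet_self (s k : Fin 2) (N : ℕ) : doublet s k N N = xs s 1 k ^ N := by
  rw [doublet, qBinom, sub_self, mul_zero, expH_zero, Nat.sub_self, qFact_zero, one_mul (qFact N),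
    PowerSeries.mul_inv_cancel _ (isPos_qFact N).ne_zero, csqrt_one, one_smul,
    pow_zero, one_mul]

theorem op_F_tH_zero {N p : ℕ} (p' : ℕ) (hp : p ≤ N) :
    op 0 .F (tH N p p') = coefF N p • tH N (p - 1) p' :=
  (op_zero_tH N p' .F ⟨p, by omega⟩).trans (sum_irrepH_F N ⟨p, by omega⟩ fun r => tH N r p')

theorem op_F_tH_one {N p' : ℕ} (p : ℕ) (hp' : p' ≤ N) :
    op 1 .F (tH N p p') = coefF N p' • tH N p (p' - 1) :=
  (op_one_tH N p .F ⟨p', by omega⟩).trans (sum_irrepH_F N ⟨p', by omega⟩ fun r => tH N p r)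

/-- The vectors `T̂^{(j,j)}_{mj}` are monomials in `b̂` and `d̂`. -/
theorem tH_eq_doublet {N p : ℕ} (hp : p ≤ N) : tH N p N = doublet 0 1 N p := by
  have := eq_of_lowering (op 0 .F) (coefF N) (fun p hp => (isPos_coefF hp).isUnit)
    (y := fun p : Fin (N + 1) => tH N p N) (y' := fun p : Fin (N + 1) => doublet 0 1 N p)
    (fun p hp => op_F_tH_zero N hp) (fun p hp => op_F_doublet 0 1 hp)
    ((tH_self N).trans (doublet_self 0 1 N).symm)
  exact congrFun this ⟨p, by omega⟩

/-- The coupled weight vectors of the second copy of `U_ℏ(sl₂)` in the products of a polynomial of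
degree `N₁` in the first row and a polynomial of degree `N₂` in the second row; the index `s`
stands for the weight `s - (N₁ + N₂) / 2`. -/
def cgVec (N₁ N₂ i s : ℕ) : Mh :=
  ∑ x ∈ Finset.HasAntidiagonal.antidiagonal s,
    cgNat N₁ N₂ i x.1 x.2 • (doublet 1 0 N₁ x.1 * doublet 1 1 N₂ x.2)

/-- The coupled vectors are lowered like the vectors of the spin-`j` representation. -/
theorem op_F_cgVec {N₁ N₂ i s : ℕ} (hi : 2 * i ≤ N₁ + N₂) (hs : s + 1 + i ≤ N₁ + N₂) :
    op 1 .F (cgVec N₁ N₂ i (s + 1)) =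
      coefF (N₁ + N₂ - 2 * i) (s + 1 - i) • cgVec N₁ N₂ i s := by
  have hF (x : ℕ × ℕ) : op 1 .F (cgNat N₁ N₂ i x.1 x.2 •
      (doublet 1 0 N₁ x.1 * doublet 1 1 N₂ x.2)) =
      (coefF N₁ x.1 * cgNat N₁ N₂ i x.1 x.2) • (doublet 1 0 N₁ (x.1 - 1) * doublet 1 1 N₂ x.2) +
      (expH ((N₁ : ℂ) - 2 * x.1) * coefF N₂ x.2 * cgNat N₁ N₂ i x.1 x.2) •
        (doublet 1 0 N₁ x.1 * doublet 1 1 N₂ (x.2 - 1)) := by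
    rcases Nat.lt_or_ge N₁ x.1 with h | h1
    · rw [cgNat_eq_zero (by omega)]; simp
    rcases Nat.lt_or_ge N₂ x.2 with h | h2
    · rw [cgNat_eq_zero (by omega)]; simp
    have := op_twistedDer 1 .F (doublet 1 0 N₁ x.1) (doublet 1 1 N₂ x.2)
    rw [show twistL .F = -1 from rfl, show twistR .F = 0 from rfl, torus_doublet _ _ h1,
        Pi.single_zero, torus_zero, AlgHom.id_apply,
      op_F_doublet _ _ h1, op_F_doublet _ _ h2] at this
    rw [map_smul, this, smul_add, smul_mul_smul_comm, smul_mul_assoc, smul_smul, smul_smul,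
      add_comm]
    congr 2 <;> ring
  rw [cgVec, map_sum, Finset.sum_congr rfl fun x _ => hF x, Finset.sum_add_distrib,
    Finset.Nat.sum_antidiagonal_succ, Finset.Nat.sum_antidiagonal_succ', coefF_zero, coefF_zero,
    zero_mul, mul_zero, zero_mul, zero_smul, zero_smul, zero_add, zero_add,
    ← Finset.sum_add_distrib, cgVec, Finset.smul_sum]
  refine Finset.sum_congr rfl fun x hx => ?_
  rw [Finset.HasAntidiagonal.mem_antidiagonal] at hx
  rw [Nat.add_sub_cancel, Nat.add_sub_cancel, ← add_smul, smul_smul]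
  rcases Nat.lt_or_ge N₁ x.1 with h | h1
  · rw [cgNat_eq_zero (by omega), cgNat_eq_zero (by omega), cgNat_eq_zero (by omega)]; simp
  rcases Nat.lt_or_ge N₂ x.2 with h | h2
  · rw [cgNat_eq_zero (by omega), cgNat_eq_zero (by omega), cgNat_eq_zero (by omega)]; simp
  rw [← cgNat_lowering h1 h2 hi (by omega), hx]

end QuantumEuclid

namespace QuantumEuclid

attribute [local instance] chNatAlgebra chIntAlgebra

/-! ### Powers of the quantum determinant -/

theorem mul_pow_of_mul {x y : Mh} {c : Ch} (h : y * x = c • (x * y)) (n : ℕ) :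
    y * x ^ n = c ^ n • (x ^ n * y) := by
  induction n with
  | zero => simp
  | succ n ih => rw [pow_succ, ← mul_assoc, ih, smul_mul_assoc, mul_assoc, h, mul_smul_comm,
      smul_smul, mul_assoc, pow_succ]

/-- The ordered monomials in the generators of `M_ℏ(2)`. -/
def monom (x y z w : ℕ) : Mh := xh 0 0 ^ x * (xh 0 1 ^ y * (xh 1 0 ^ z * xh 1 1 ^ w))

theorem commute_lsqh_a : Commute lsqh (xh 0 0) := by
  have h := isQuantumMatrix_xh
  have h1 : xh 1 1 * xh 0 0 = xh 0 0 * xh 1 1 -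
      (expH (1 : ℂ) - expH (-1 : ℂ)) • (xh 0 1 * xh 1 0) := by
    rw [h.ad, add_sub_cancel_right]
  have h2 : xh 0 0 * (xh 0 1 * xh 1 0) =
      (expH (1 : ℂ) * expH (1 : ℂ)) • (xh 0 1 * xh 1 0 * xh 0 0) := by
    rw [← mul_assoc, h.ab, smul_mul_assoc, mul_assoc, h.ac, mul_smul_comm, smul_smul, mul_assoc]
  rw [commute_iff_eq, lsqh, sub_mul, mul_sub, mul_assoc, h1, mul_sub, smul_mul_assoc, mul_smul_comm,
    mul_smul_comm, h2, smul_smul, smul_smul]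
  have h3 := expH_neg_mul 1
  have h4 : (expH (1 : ℂ) - expH (-1 : ℂ)) * (expH (1 : ℂ) * expH (1 : ℂ)) + expH (1 : ℂ) =
      expH (1 : ℂ) * (expH (1 : ℂ) * expH (1 : ℂ)) := by linear_combination -expH (1 : ℂ) * h3
  rw [← h4]
  module

theorem lsqh_mul_monom (x y z w : ℕ) : lsqh * monom x y z w =
    expH (-((y : ℂ) + z)) • monom (x + 1) y z (w + 1) -
      expH (1 : ℂ) • monom x (y + 1) (z + 1) w := by
  have hb := mul_pow_of_mul (xs_mul_xs 0 1) y
  have hc := mul_pow_of_mul (xs_mul_xs 1 1) z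
  change xh 1 1 * xh 0 1 ^ y = _ • (xh 0 1 ^ y * xh 1 1) at hb
  change xh 1 1 * xh 1 0 ^ z = _ • (xh 1 0 ^ z * xh 1 1) at hc
  have hbc : Commute (xh 1 0) (xh 0 1 ^ y) := (show Commute (xh 1 0) (xh 0 1) from
    isQuantumMatrix_xh.bc.symm).pow_right y
  have h1 : xh 1 1 * (xh 0 1 ^ y * (xh 1 0 ^ z * xh 1 1 ^ w)) =
      expH (-((y : ℂ) + z)) • (xh 0 1 ^ y * (xh 1 0 ^ z * xh 1 1 ^ (w + 1))) := by
    rw [← mul_assoc, hb, smul_mul_assoc, mul_assoc, ← mul_assoc (xh 1 1), hc, smul_mul_assoc,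
      mul_smul_comm, smul_smul, mul_assoc, ← pow_succ', ← pow_add, ← expH_natMul]
    push_cast
    rw [mul_neg, mul_one]
  have h2 : xh 0 1 * (xh 1 0 * (xh 0 1 ^ y * (xh 1 0 ^ z * xh 1 1 ^ w))) =
      xh 0 1 ^ (y + 1) * (xh 1 0 ^ (z + 1) * xh 1 1 ^ w) := by
    rw [← mul_assoc (xh 1 0), hbc.eq, mul_assoc, ← mul_assoc, ← pow_succ', ← mul_assoc (xh 1 0),
      ← pow_succ']
  rw [monom, ← mul_assoc, (commute_lsqh_a.pow_right x).eq, mul_assoc, lsqh, sub_mul, mul_sub,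
    mul_assoc (xh 0 0), h1, mul_smul_comm, mul_smul_comm, ← mul_assoc (xh 0 0 ^ x), ← pow_succ,
    smul_mul_assoc, mul_smul_comm, mul_assoc (xh 0 1), h2]
  rfl

/-- The expansion of `l̂²ⁱ b̂^B d̂^D`, up to normalization. -/
def lsqSum (B D i : ℕ) : Mh := ∑ x ∈ Finset.HasAntidiagonal.antidiagonal i,
  ((-1) ^ x.1 * expH (-((x.1 : ℂ) * (B + x.2 + 1))) * (qif x.1 * qif x.2)) •
    monom x.1 (B + x.2) x.2 (D + x.1)

/-- The quantum Pascal rule for the coefficients of the powers of the quantum determinant. -/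
theorem lsqh_mul_lsqSum (B D i : ℕ) :
    lsqh * lsqSum B D i = (-expH (1 : ℂ) * qNum ((i : ℂ) + 1)) • lsqSum B D (i + 1) := by
  let f (x : ℕ × ℕ) : Mh := (-(-1) ^ x.1 * expH (-((x.1 : ℂ) * (B + x.2 + 1)) + (1 - x.2)) *
    (qif (x.1 - 1) * qif x.2)) • monom x.1 (B + x.2) x.2 (D + x.1)
  let g (x : ℕ × ℕ) : Mh := (-(-1) ^ x.1 * expH (-((x.1 : ℂ) * (B + x.2 + 1)) + (1 + x.1)) *
    (qif x.1 * qif (x.2 - 1))) • monom x.1 (B + x.2) x.2 (D + x.1)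
  have h1 : lsqh * lsqSum B D i =
      ∑ x ∈ Finset.HasAntidiagonal.antidiagonal (i + 1), (f x + g x) := by
    rw [Finset.sum_add_distrib, Finset.Nat.sum_antidiagonal_succ, Finset.Nat.sum_antidiagonal_succ']
    have hf : f (0, i + 1) = 0 := by
      simp only [f]
      rw [qif_of_neg (by simp), zero_mul, mul_zero, zero_smul]
    have hg : g (i + 1, 0) = 0 := by
      simp only [g]
      rw [qif_of_neg (n := ((0 : ℕ) : ℤ) - 1) (by simp), mul_zero, mul_zero, zero_smul]
    rw [hf, hg, zero_add, zero_add, lsqSum, Finset.mul_sum, ← Finset.sum_add_distrib]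
    refine Finset.sum_congr rfl fun x _ => ?_
    rw [mul_smul_comm, lsqh_mul_monom, smul_sub, smul_smul, smul_smul, sub_eq_add_neg, ← neg_smul]
    simp only [f, g]
    push_cast
    rw [add_sub_cancel_right, add_sub_cancel_right]
    congr 1
    · congr 1
      rw [show -(((x.1 : ℂ) + 1) * (B + x.2 + 1)) + (1 - x.2) =
        -((x.1 : ℂ) * (B + x.2 + 1)) + -((B : ℂ) + x.2 + x.2) by ring, expH_add', pow_succ]
      ring
    · congr 1
      rw [show -((x.1 : ℂ) * (B + (x.2 + 1) + 1)) + (1 + x.1) =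
        -((x.1 : ℂ) * (B + x.2 + 1)) + 1 by ring, expH_add']
      ring
  rw [h1, lsqSum, Finset.smul_sum]
  refine Finset.sum_congr rfl fun x hx => ?_
  rw [Finset.HasAntidiagonal.mem_antidiagonal] at hx
  simp only [f, g]
  rw [← add_smul, smul_smul, qif_sub_one, qif_sub_one, expH_add', expH_add' _ (1 + (x.1 : ℂ)),
    sub_eq_add_neg, expH_add' 1, expH_add' 1]
  have h2 : qNum ((i : ℂ) + 1) = _ := (congrArg qNum (show (i : ℂ) + 1 = x.2 + x.1 by
    rw [add_comm (x.2 : ℂ)]; exact_mod_cast hx.symm)).trans (qNum_add _ _)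
  rw [h2]
  push_cast
  congr 1
  ring

theorem lsqh_pow_mul (B D i : ℕ) : lsqh ^ i * monom 0 B 0 D =
    ((-expH (1 : ℂ)) ^ i * qFact i) • lsqSum B D i := by
  induction i with
  | zero => simp [lsqSum, qFact_zero, qif_zero, expH_zero]
  | succ i ih =>
    rw [pow_succ', mul_assoc, ih, mul_smul_comm, lsqh_mul_lsqSum, smul_smul, qFact_succ, pow_succ]
    congr 1
    ring

/-! ### The highest coupled vector -/

theorem cgSum_eq_single {N₁ N₂ p₁ p₂ : ℤ} {i r : ℕ} (hr : r ≤ i)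
    (h : ∀ r' : ℤ, r' ≠ r → cgTerm N₁ N₂ i p₁ p₂ r' = 0) : cgSum N₁ N₂ i p₁ p₂ =
      (-1) ^ r * expH (-((r : ℂ) * (N₁ + N₂ - i + 1))) * cgTerm N₁ N₂ i p₁ p₂ r :=
  Finset.sum_eq_single r (fun r' _ hr' => by rw [h r' (by exact_mod_cast hr'), mul_zero])
    fun hr' => absurd (Finset.mem_range.mpr (by omega)) hr'

/-- For the highest weight only one term of the sum remains. -/
theorem cgSum_top (N₁ N₂ : ℤ) {i x z : ℕ} (h : x + z = i) : cgSum N₁ N₂ i (N₁ - x) (N₂ - z) =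
    (-1) ^ x * expH (-((x : ℂ) * (N₁ + N₂ - i + 1))) *
      (qif x * qif z * qif (N₁ - i) * qif (N₂ - i)) := by
  rw [cgSum_eq_single (r := x) (by omega) fun r hr => ?_]
  · rw [cgTerm, show (i : ℤ) - x = z by omega, show N₁ - (N₁ - x) - (x : ℤ) = 0 by omega,
      show N₂ - z - (x : ℤ) = N₂ - i by omega, show N₁ - (x : ℤ) - i + x = N₁ - i by omega,
      show N₂ - (N₂ - (z : ℤ)) - i + x = 0 by omega, qif_zero]
    ring
  · have : N₁ - (N₁ - x) - r < 0 ∨ N₂ - (N₂ - z) - i + r < 0 := by omega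
    rw [cgTerm]
    rcases this with h | h <;> simp only [qif_of_neg h, mul_zero, zero_mul]

/-- For the coefficients in the denominators of the formula only one term of the sum remains. -/
theorem cgSum_row (N₁ N₂ : ℤ) (i : ℕ) : cgSum N₁ N₂ i 0 N₂ =
    (-1) ^ i * expH (-((i : ℂ) * (N₁ + N₂ - i + 1))) *
      (qif i * qif (N₁ - i) * qif (N₂ - i)) := by
  rw [cgSum_eq_single le_rfl fun r hr => ?_]
  · rw [cgTerm, sub_self, sub_zero, sub_self, zero_sub, neg_add_cancel, qif_zero]
    ring
  · have : i - r < 0 ∨ 0 - i + r < 0 := by omega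
    rw [cgTerm]
    rcases this with h | h <;> simp only [qif_of_neg h, mul_zero, zero_mul]

/-- The normalization of the coupled vector of highest weight. -/
def topNorm (N₁ N₂ i : ℕ) : Ch :=
  expH ((i : ℂ) / 2) * cgNorm N₁ N₂ i *
    (qFactRoot N₁ * qFactRoot N₂ * qFactRoot (N₁ + N₂ - 2 * i)) *
    (qif ((N₁ : ℤ) - i) * qif ((N₂ : ℤ) - i))

theorem cgNat_top {N₁ N₂ i x z : ℕ} (h1 : i ≤ N₁) (h2 : i ≤ N₂) (h : x + z = i) :
    cgNat N₁ N₂ i (N₁ - x) (N₂ - z) * (csqrt (qBinom N₁ (N₁ - x)) * csqrt (qBinom N₂ (N₂ - z))) =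
      topNorm N₁ N₂ i * ((-1) ^ x * expH (-((x : ℂ) * (((N₁ - i : ℕ) : ℂ) + z + 1))) *
        (qif x * qif z)) := by
  have hS := cgSum_top N₁ N₂ h
  have b1 := csqrt_qBinom N₁ (N₁ - x)
  have b2 := csqrt_qBinom N₂ (N₂ - z)
  have e : expH (((i : ℂ) * (N₁ + N₂ - i + 1) + (N₁ * (N₂ - z) - N₂ * (N₁ - x))) / 2) *
      expH (-((x : ℂ) * (N₁ + N₂ - i + 1))) * expH (((N₁ : ℂ) - x) * (N₁ - x - N₁) / 2) *
      expH (((N₂ : ℂ) - z) * (N₂ - z - N₂) / 2) =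
      expH ((i : ℂ) / 2) * expH (-((x : ℂ) * ((N₁ : ℂ) - i + z + 1))) := by
    rw [← expH_add', ← expH_add', ← expH_add', ← expH_add', ← h]
    congr 1
    push_cast
    ring
  rw [cgNat, topNorm, Nat.cast_sub h1, show N₁ - x + (N₂ - z) - i = N₁ + N₂ - 2 * i by omega,
    show N₁ + N₂ - i - (N₁ - x + (N₂ - z)) = 0 by omega, qFactRoot_zero]
  rw [Nat.cast_sub (show x ≤ N₁ by omega)] at b1 ⊢
  rw [Nat.cast_sub (show z ≤ N₂ by omega)] at b2 ⊢
  rw [Nat.cast_sub (show x ≤ N₁ by omega), Nat.cast_sub (show z ≤ N₂ by omega), hS]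
  push_cast
  linear_combination expH (((i : ℂ) * (N₁ + N₂ - i + 1) + (N₁ * (N₂ - z) - N₂ * (N₁ - x))) / 2) *
      cgNorm N₁ N₂ i * qFactRoot (N₁ + N₂ - 2 * i) *
      ((-1) ^ x * expH (-((x : ℂ) * (N₁ + N₂ - i + 1))) *
        (qif x * qif z * qif ((N₁ : ℤ) - i) * qif ((N₂ : ℤ) - i))) *
      (qFactRoot (N₂ - z) * qFactRoot (N₂ - (N₂ - z)) * csqrt (qBinom N₂ (N₂ - z)) * b1 +
        expH (((N₁ : ℂ) - x) * (N₁ - x - N₁) / 2) * qFactRoot N₁ * b2) +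
    cgNorm N₁ N₂ i * qFactRoot (N₁ + N₂ - 2 * i) * qFactRoot N₁ * qFactRoot N₂ *
      ((-1) ^ x * (qif x * qif z * qif ((N₁ : ℤ) - i) * qif ((N₂ : ℤ) - i))) * e

theorem cgNat_row {N₁ N₂ i : ℕ} (h1 : i ≤ N₁) (h2 : i ≤ N₂) :
    cgNat N₁ N₂ i 0 N₂ * csqrt (qBinom (N₁ + N₂ - 2 * i) (N₂ - i)) *
      ((-expH (1 : ℂ)) ^ i * qFact i) = topNorm N₁ N₂ i := by
  have hS := cgSum_row N₁ N₂ i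
  have b := csqrt_qBinom (N₁ + N₂ - 2 * i) (N₂ - i)
  have e : expH (((i : ℂ) * (N₁ + N₂ - i + 1) + N₁ * N₂) / 2) *
      expH (-((i : ℂ) * (N₁ + N₂ - i + 1))) *
      expH (((N₂ : ℂ) - i) * (N₂ - i - (N₁ + N₂ - 2 * i)) / 2) * expH ((i : ℂ) * 1) =
      expH ((i : ℂ) / 2) := by
    rw [← expH_add', ← expH_add', ← expH_add']
    congr 1
    ring
  have f : qif i * qFact i = 1 := by
    rw [qif_natCast, PowerSeries.inv_mul_cancel _ (isPos_qFact i).ne_zero]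
  have g : ((-1 : Ch) ^ i) * (-1) ^ i = 1 := by rw [← mul_pow]; simp
  rw [show N₁ + N₂ - 2 * i - (N₂ - i) = N₁ - i by omega, Nat.cast_sub h2,
    Nat.cast_sub (show 2 * i ≤ N₁ + N₂ by omega)] at b
  push_cast at hS b
  rw [cgNat, topNorm, Nat.cast_zero, Nat.cast_zero, hS, Nat.sub_zero, Nat.sub_self, zero_add,
    show N₁ + N₂ - i - N₂ = N₁ - i by omega, qFactRoot_zero, mul_zero, sub_zero,
    neg_pow (expH (1 : ℂ)),
    ← expH_natMul, ← e]
  linear_combination cgNorm N₁ N₂ i * qFactRoot N₁ * qFactRoot N₂ *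
      qif ((N₁ : ℤ) - i) * qif ((N₂ : ℤ) - i) * expH (((i : ℂ) * (N₁ + N₂ - i + 1) + N₁ * N₂) / 2) *
      expH (-((i : ℂ) * (N₁ + N₂ - i + 1))) * expH ((i : ℂ) * 1) *
    (((-1) ^ i * (-1) ^ i * (qif i * qFact i)) * b +
      expH (((N₂ : ℂ) - i) * (N₂ - i - (N₁ + N₂ - 2 * i)) / 2) * qFactRoot (N₁ + N₂ - 2 * i) *
      (qif i * qFact i * g + f))

theorem sum_antidiagonal_top {M : Type*} [AddCommMonoid M] {N₁ N₂ i : ℕ} (h1 : i ≤ N₁)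
    (h2 : i ≤ N₂) (f : ℕ × ℕ → M) (hf : ∀ x, N₁ < x.1 ∨ N₂ < x.2 → f x = 0) :
    ∑ x ∈ Finset.HasAntidiagonal.antidiagonal (N₁ + N₂ - i), f x =
      ∑ x ∈ Finset.HasAntidiagonal.antidiagonal i, f (N₁ - x.1, N₂ - x.2) := by
  refine (Finset.sum_of_injOn (fun x : ℕ × ℕ => (N₁ - x.1, N₂ - x.2)) ?_ ?_ ?_ fun _ _ => rfl).symm
  · rintro ⟨x, z⟩ hx ⟨x', z'⟩ hx' h
    simp only [Finset.mem_coe, Finset.HasAntidiagonal.mem_antidiagonal,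
      Prod.mk.injEq] at hx hx' h ⊢
    omega
  · rintro ⟨x, z⟩ hx
    simp only [Finset.mem_coe, Finset.HasAntidiagonal.mem_antidiagonal] at hx ⊢
    omega
  · rintro ⟨x, z⟩ hx hx'
    rw [Finset.HasAntidiagonal.mem_antidiagonal] at hx
    refine hf _ ?_
    by_contra h
    refine hx' ⟨(N₁ - x, N₂ - z), ?_, ?_⟩
    · simp only [Finset.mem_coe, Finset.HasAntidiagonal.mem_antidiagonal] at hx ⊢
      omega
    · simp only [Prod.mk.injEq] at hx ⊢
      omega

/-- The coupled vector of highest weight is a multiple of `l̂²ⁱ b̂^B d̂^D`, by comparison of the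
coefficients of ordered monomials. -/
theorem cgVec_top {N₁ N₂ i : ℕ} (h1 : i ≤ N₁) (h2 : i ≤ N₂) : cgVec N₁ N₂ i (N₁ + N₂ - i) =
    cgNat N₁ N₂ i 0 N₂ • (lsqh ^ i * tH (N₁ + N₂ - 2 * i) (N₂ - i) (N₁ + N₂ - 2 * i)) := by
  have hR : lsqh ^ i * tH (N₁ + N₂ - 2 * i) (N₂ - i) (N₁ + N₂ - 2 * i) =
      (csqrt (qBinom (N₁ + N₂ - 2 * i) (N₂ - i)) * ((-expH (1 : ℂ)) ^ i * qFact i)) •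
        lsqSum (N₁ - i) (N₂ - i) i := by
    rw [tH_eq_doublet (by omega), doublet, mul_smul_comm, mul_smul, ← lsqh_pow_mul,
      show N₁ + N₂ - 2 * i - (N₂ - i) = N₁ - i by omega]
    simp only [monom, pow_zero, one_mul]
    rfl
  rw [hR, smul_smul, ← mul_assoc, cgNat_row h1 h2, cgVec, lsqSum, Finset.smul_sum]
  rw [sum_antidiagonal_top h1 h2 _ fun x hx => by
    rw [cgNat_eq_zero (by omega), zero_smul]]
  refine Finset.sum_congr rfl fun ⟨x, z⟩ hx => ?_
  rw [Finset.HasAntidiagonal.mem_antidiagonal] at hx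
  simp only at hx ⊢
  rw [doublet, doublet, smul_mul_smul_comm, smul_smul, smul_smul, cgNat_top h1 h2 hx,
    show N₁ - (N₁ - x) = x by omega, show N₂ - (N₂ - z) = z by omega,
    show N₁ - i + z = N₁ - x by omega, show N₂ - i + x = N₂ - z by omega, monom,
    mul_assoc (xs 1 0 0 ^ x)]
  rfl

/-- The coupled vectors are multiples of the vectors `l̂²ⁱ T̂^{(j,j)}_{mm'}`: this holds for the
highest weight, and is preserved by the lowering operator. -/
theorem cgVec_eq {N₁ N₂ i s : ℕ} (h1 : i ≤ N₁) (h2 : i ≤ N₂) (hs : i ≤ s)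
    (hs' : s + i ≤ N₁ + N₂) : cgVec N₁ N₂ i s =
      cgNat N₁ N₂ i 0 N₂ • (lsqh ^ i * tH (N₁ + N₂ - 2 * i) (N₂ - i) (s - i)) := by
  have := eq_of_lowering (N := N₁ + N₂ - 2 * i) (op 1 .F) (coefF (N₁ + N₂ - 2 * i))
    (fun p hp => (isPos_coefF hp).isUnit) (y := fun p => cgVec N₁ N₂ i (p + i))
    (y' := fun p => cgNat N₁ N₂ i 0 N₂ • (lsqh ^ i * tH (N₁ + N₂ - 2 * i) (N₂ - i) p))
    (fun p hp => ?_) (fun p hp => ?_) ?_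
  · have h := congrFun this ⟨s - i, by omega⟩
    simp only [Nat.sub_add_cancel hs] at h
    exact h
  · rw [show p + 1 + i = p + i + 1 by ring, op_F_cgVec (by omega) (by omega),
      show p + i + 1 - i = p + 1 by omega]
  · rw [map_smul, op_lsqh_pow_mul, op_F_tH_one _ (by omega), Nat.add_sub_cancel, mul_smul_comm,
      smul_comm]
  · simp only [Fin.val_last]
    rw [show N₁ + N₂ - 2 * i + i = N₁ + N₂ - i by omega, cgVec_top h1 h2]

end QuantumEuclid

namespace QuantumEuclid

/-! ### Orthogonality of the ordinary Clebsch--Gordan coefficients -/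

/-- The ordinary Clebsch--Gordan coefficients, as the values at `ℏ = 0` of the quantum ones. -/
def cgCl (N₁ N₂ i p₁ p₂ : ℕ) : ℂ := PowerSeries.constantCoeff (cgNat N₁ N₂ i p₁ p₂)

/-- The matrix coefficients of the lowering operator of the spin-`N/2` representation of `sl₂`. -/
def coefCl (N p : ℕ) : ℂ := PowerSeries.constantCoeff (coefF N p)

theorem coefCl_zero (N : ℕ) : coefCl N 0 = 0 := by rw [coefCl, coefF_zero, map_zero]

theorem coefCl_ne_zero {N p : ℕ} (h : 0 < p) (hp : p ≤ N) : coefCl N p ≠ 0 := by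
  obtain ⟨q, rfl⟩ := Nat.exists_eq_succ_of_ne_zero h.ne'
  exact (isPos_coefF hp).ne_zero

theorem coefCl_symm {N p : ℕ} (h : p ≤ N + 1) : coefCl N (N + 1 - p) = coefCl N p := by
  rw [coefCl, coefCl, coefF, coefF, map_mul, map_mul, constantCoeff_expH, constantCoeff_expH,
    constantCoeff_csqrt, constantCoeff_csqrt, map_mul, map_mul, constantCoeff_qNum,
    constantCoeff_qNum, constantCoeff_qNum, constantCoeff_qNum, Nat.cast_sub h]
  push_cast
  rw [show (N : ℂ) - (N + 1 - p) + 1 = p by ring, show (N : ℂ) + 1 - p = N - p + 1 by ring,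
    mul_comm (p : ℂ)]

theorem cgCl_eq_zero {N₁ N₂ i p₁ p₂ : ℕ} (h : N₁ < p₁ ∨ N₂ < p₂ ∨ p₁ + p₂ < i ∨
    N₁ + N₂ < p₁ + p₂ + i) : cgCl N₁ N₂ i p₁ p₂ = 0 := by rw [cgCl, cgNat_eq_zero h, map_zero]

theorem cgCl_lowering {N₁ N₂ i p₁ p₂ : ℕ} (h1 : p₁ ≤ N₁) (h2 : p₂ ≤ N₂) (hi : 2 * i ≤ N₁ + N₂)
    (hs : p₁ + p₂ + 1 + i ≤ N₁ + N₂) :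
    coefCl (N₁ + N₂ - 2 * i) (p₁ + p₂ + 1 - i) * cgCl N₁ N₂ i p₁ p₂ =
      coefCl N₁ (p₁ + 1) * cgCl N₁ N₂ i (p₁ + 1) p₂ +
      coefCl N₂ (p₂ + 1) * cgCl N₁ N₂ i p₁ (p₂ + 1) := by
  have := congrArg PowerSeries.constantCoeff (cgNat_lowering h1 h2 hi hs)
  rw [map_mul, map_add, map_mul, map_mul, map_mul, constantCoeff_expH, one_mul] at this
  exact this

theorem constantCoeff_cgSum (N₁ N₂ p₁ p₂ : ℤ) (i : ℕ) :
    PowerSeries.constantCoeff (cgSum N₁ N₂ i p₁ p₂) =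
      ∑ r ∈ Finset.range (i + 1),
        (-1) ^ r * PowerSeries.constantCoeff (cgTerm N₁ N₂ i p₁ p₂ r) := by
  rw [cgSum, map_sum]
  refine Finset.sum_congr rfl fun r _ => ?_
  rw [map_mul, map_mul, constantCoeff_expH, mul_one, map_pow, map_neg, map_one]

theorem cgTerm_symm (N₁ N₂ i p₁ p₂ r : ℤ) :
    cgTerm N₁ N₂ i (N₁ - p₁) (N₂ - p₂) (i - r) = cgTerm N₁ N₂ i p₁ p₂ r := by
  rw [cgTerm, cgTerm, sub_sub_cancel i, show N₁ - (N₁ - p₁) - (i - r) = p₁ - i + r by ring,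
    show N₂ - p₂ - (i - r) = N₂ - p₂ - i + r by ring,
    show N₁ - p₁ - i + (i - r) = N₁ - p₁ - r by ring,
    show N₂ - (N₂ - p₂) - i + (i - r) = p₂ - r by ring]
  generalize qif r = x1
  generalize qif (i - r) = x2
  ring

theorem constantCoeff_cgSum_symm (N₁ N₂ p₁ p₂ : ℤ) (i : ℕ) :
    PowerSeries.constantCoeff (cgSum N₁ N₂ i (N₁ - p₁) (N₂ - p₂)) =
      (-1) ^ i * PowerSeries.constantCoeff (cgSum N₁ N₂ i p₁ p₂) := by
  rw [constantCoeff_cgSum, constantCoeff_cgSum, ← Finset.sum_range_reflect, Finset.mul_sum]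
  refine Finset.sum_congr rfl fun r hr => ?_
  rw [Finset.mem_range] at hr
  have h3 : (-1 : ℂ) ^ (i + 1 - 1 - r) = (-1) ^ i * (-1) ^ r := by
    obtain ⟨k, rfl⟩ : ∃ k, i = k + r := ⟨i - r, by omega⟩
    rw [show k + r + 1 - 1 - r = k by omega, pow_add, mul_assoc, ← mul_pow]
    simp
  rw [h3, mul_assoc, show ((i + 1 - 1 - r : ℕ) : ℤ) = i - r by omega, cgTerm_symm]

/-- The symmetry `m ↦ -m`, from the substitution `r ↦ i - r` in the sum. -/
theorem cgCl_symm {N₁ N₂ i p₁ p₂ : ℕ} (h1 : p₁ ≤ N₁) (h2 : p₂ ≤ N₂) :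
    cgCl N₁ N₂ i (N₁ - p₁) (N₂ - p₂) = (-1) ^ i * cgCl N₁ N₂ i p₁ p₂ := by
  have hS := constantCoeff_cgSum_symm N₁ N₂ p₁ p₂ i
  rw [← Nat.cast_sub h1, ← Nat.cast_sub h2] at hS
  have hR : qFactRoot (N₁ - p₁) * qFactRoot p₁ * (qFactRoot (N₂ - p₂) * qFactRoot p₂) *
      (qFactRoot (N₁ + N₂ - i - (p₁ + p₂)) * qFactRoot (p₁ + p₂ - i)) =
      qFactRoot p₁ * qFactRoot (N₁ - p₁) * (qFactRoot p₂ * qFactRoot (N₂ - p₂)) *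
      (qFactRoot (p₁ + p₂ - i) * qFactRoot (N₁ + N₂ - i - (p₁ + p₂))) := by ring
  rw [cgCl, cgCl, cgNat, cgNat, show N₁ - (N₁ - p₁) = p₁ by omega,
    show N₂ - (N₂ - p₂) = p₂ by omega,
    show N₁ - p₁ + (N₂ - p₂) - i = N₁ + N₂ - i - (p₁ + p₂) by omega,
    show N₁ + N₂ - i - (N₁ - p₁ + (N₂ - p₂)) = p₁ + p₂ - i by omega, hR,
    map_mul, map_mul, map_mul, map_mul PowerSeries.constantCoeff _ (cgSum N₁ N₂ i p₁ p₂),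
    map_mul PowerSeries.constantCoeff _ (_ * (_ * _)),
    map_mul PowerSeries.constantCoeff _ (cgNorm N₁ N₂ i), hS, constantCoeff_expH,
    constantCoeff_expH]
  ring

/-- The raising relation follows from the lowering relation by the symmetry `m ↦ -m`. -/
theorem cgCl_raising {N₁ N₂ i p₁ p₂ : ℕ} (h1 : p₁ ≤ N₁) (h2 : p₂ ≤ N₂) (hi : 2 * i ≤ N₁ + N₂)
    (hs : p₁ + p₂ + i ≤ N₁ + N₂) :
    coefCl (N₁ + N₂ - 2 * i) (p₁ + p₂ - i) * cgCl N₁ N₂ i p₁ p₂ =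
      coefCl N₁ p₁ * cgCl N₁ N₂ i (p₁ - 1) p₂ + coefCl N₂ p₂ * cgCl N₁ N₂ i p₁ (p₂ - 1) := by
  have hz (N p : ℕ) (f : ℕ → ℂ) (h : 0 < p → f (p - 1) = 0) : coefCl N p * f (p - 1) = 0 := by
    rcases Nat.eq_zero_or_pos p with rfl | hp
    · rw [coefCl_zero, zero_mul]
    · rw [h hp, mul_zero]
  rcases Nat.lt_or_ge i (p₁ + p₂) with h | h
  · have hr := cgCl_lowering (i := i) (Nat.sub_le N₁ p₁) (Nat.sub_le N₂ p₂) hi (by omega)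
    have e (N p : ℕ) (hp : p ≤ N) (f : ℕ → ℂ) (g : ℕ → ℂ)
        (hf : 0 < p → f (N - (p - 1)) = (-1) ^ i * g (p - 1)) :
        coefCl N (N - p + 1) * f (N - p + 1) = (-1) ^ i * (coefCl N p * g (p - 1)) := by
      rw [← Nat.sub_add_comm hp, coefCl_symm (by omega)]
      rcases Nat.eq_zero_or_pos p with rfl | h0
      · rw [coefCl_zero, zero_mul, zero_mul, mul_zero]
      · rw [show N + 1 - p = N - (p - 1) by omega, hf h0]
        ring
    rw [show N₁ - p₁ + (N₂ - p₂) + 1 - i = N₁ + N₂ - 2 * i + 1 - (p₁ + p₂ - i) by omega,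
      coefCl_symm (by omega), cgCl_symm h1 h2,
      e N₁ p₁ h1 (fun q => cgCl N₁ N₂ i q (N₂ - p₂)) (fun q => cgCl N₁ N₂ i q p₂)
        fun _ => cgCl_symm (by omega) h2,
      e N₂ p₂ h2 (fun q => cgCl N₁ N₂ i (N₁ - p₁) q) (fun q => cgCl N₁ N₂ i p₁ q)
        fun _ => cgCl_symm h1 (by omega)] at hr
    refine mul_left_cancel₀ (pow_ne_zero i (neg_ne_zero.mpr (one_ne_zero (α := ℂ)))) ?_
    linear_combination hr
  · rw [Nat.sub_eq_zero_of_le h, coefCl_zero, zero_mul,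
      hz N₁ p₁ (fun q => cgCl N₁ N₂ i q p₂) fun _ => cgCl_eq_zero (by omega),
      hz N₂ p₂ (fun q => cgCl N₁ N₂ i p₁ q) fun _ => cgCl_eq_zero (by omega), add_zero]

/-- The inner product of two rows of Clebsch--Gordan coefficients. -/
def cgGram (N₁ N₂ i i' s : ℕ) : ℂ :=
  ∑ x ∈ Finset.HasAntidiagonal.antidiagonal s, cgCl N₁ N₂ i x.1 x.2 * cgCl N₁ N₂ i' x.1 x.2

/-- The lowering operator is the adjoint of the raising operator. -/
theorem cgGram_succ {N₁ N₂ i i' s : ℕ} (hi : 2 * i ≤ N₁ + N₂) (hi' : 2 * i' ≤ N₁ + N₂)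
    (hs : s + 1 + i ≤ N₁ + N₂) (hs' : s + 1 + i' ≤ N₁ + N₂) :
    coefCl (N₁ + N₂ - 2 * i) (s + 1 - i) * cgGram N₁ N₂ i i' s =
      coefCl (N₁ + N₂ - 2 * i') (s + 1 - i') * cgGram N₁ N₂ i i' (s + 1) := by
  have hR : coefCl (N₁ + N₂ - 2 * i') (s + 1 - i') * cgGram N₁ N₂ i i' (s + 1) =
      ∑ x ∈ Finset.HasAntidiagonal.antidiagonal (s + 1),
        (coefCl N₁ x.1 * (cgCl N₁ N₂ i x.1 x.2 * cgCl N₁ N₂ i' (x.1 - 1) x.2) +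
          coefCl N₂ x.2 * (cgCl N₁ N₂ i x.1 x.2 * cgCl N₁ N₂ i' x.1 (x.2 - 1))) := by
    rw [cgGram, Finset.mul_sum]
    refine Finset.sum_congr rfl fun x hx => ?_
    rw [Finset.HasAntidiagonal.mem_antidiagonal] at hx
    rcases Nat.lt_or_ge N₁ x.1 with h | h1
    · rw [cgCl_eq_zero (by omega)]; simp
    rcases Nat.lt_or_ge N₂ x.2 with h | h2
    · rw [cgCl_eq_zero (by omega)]; simp
    have := cgCl_raising (i := i') h1 h2 hi' (by omega)
    rw [hx] at this
    linear_combination cgCl N₁ N₂ i x.1 x.2 * this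
  rw [hR, Finset.sum_add_distrib, Finset.Nat.sum_antidiagonal_succ,
    Finset.Nat.sum_antidiagonal_succ', coefCl_zero, coefCl_zero, zero_mul, zero_mul, zero_add,
    zero_add, ← Finset.sum_add_distrib, cgGram, Finset.mul_sum]
  refine Finset.sum_congr rfl fun x hx => ?_
  rw [Finset.HasAntidiagonal.mem_antidiagonal] at hx
  rw [Nat.add_sub_cancel, Nat.add_sub_cancel]
  rcases Nat.lt_or_ge N₁ x.1 with h | h1
  · rw [cgCl_eq_zero (i := i') (by omega)]; simp
  rcases Nat.lt_or_ge N₂ x.2 with h | h2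
  · rw [cgCl_eq_zero (i := i') (by omega)]; simp
  have := cgCl_lowering h1 h2 hi (by omega)
  rw [hx] at this
  linear_combination cgCl N₁ N₂ i' x.1 x.2 * this

theorem cgGram_comm (N₁ N₂ i i' s : ℕ) : cgGram N₁ N₂ i i' s = cgGram N₁ N₂ i' i s :=
  Finset.sum_congr rfl fun _ _ => mul_comm _ _

/-- Rows for different spins are orthogonal: at the lowest weight `s = i'` of the smaller spin the
lowering operator annihilates the row of index `i'` but not that of index `i`, and the inner
products for the other weights are multiples of this one. -/
theorem cgGram_of_lt {N₁ N₂ i i' s : ℕ} (h : i < i') (hi' : 2 * i' ≤ N₁ + N₂) (hs : i' ≤ s)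
    (hs' : s + i' ≤ N₁ + N₂) : cgGram N₁ N₂ i' i s = 0 := by
  induction s, hs using Nat.le_induction with
  | base =>
    obtain ⟨k, rfl⟩ := Nat.exists_eq_succ_of_ne_zero (by omega : i' ≠ 0)
    have := cgGram_succ (N₁ := N₁) (N₂ := N₂) (i := k + 1) (i' := i) (s := k) (by omega) (by omega)
      (by omega) (by omega)
    rw [Nat.sub_self, coefCl_zero, zero_mul] at this
    exact (mul_eq_zero.mp this.symm).resolve_left (coefCl_ne_zero (by omega) (by omega))
  | succ s hs ih =>
    have := cgGram_succ (N₁ := N₁) (N₂ := N₂) (i := i') (i' := i) (s := s) (by omega) (by omega)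
      (by omega) (by omega)
    rw [ih (by omega), mul_zero] at this
    exact (mul_eq_zero.mp this.symm).resolve_left (coefCl_ne_zero (by omega) (by omega))

/-- The Vandermonde convolution that gives the norm of the vector of highest weight, from `(1 -
x)^{-(a+1)} (1 - x)^{-(b+1)} = (1 - x)^{-(a+b+2)}`. -/
theorem sum_choose_mul_choose (a b i : ℕ) : ∑ x ∈ Finset.HasAntidiagonal.antidiagonal i,
    (((a + x.1).choose a * (b + x.2).choose b : ℕ) : ℂ) =
      ((a + b + 1 + i).choose (a + b + 1) : ℂ) := by
  have h := congrArg (fun u : (ℂ⟦X⟧)ˣ => PowerSeries.coeff i (u : ℂ⟦X⟧))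
    (PowerSeries.invOneSubPow_add ℂ (a + 1) (b + 1))
  simp only [Units.val_mul, PowerSeries.invOneSubPow_val_succ_eq_mk_add_choose,
    show a + 1 + (b + 1) = a + b + 1 + 1 by ring, PowerSeries.coeff_mk, PowerSeries.coeff_mul] at h
  rw [h]
  push_cast
  rfl

end QuantumEuclid

namespace QuantumEuclid

theorem isPos_cgNorm_sq {N₁ N₂ i : ℕ} (h1 : i ≤ N₁) (h2 : i ≤ N₂) :
    IsPos (qFact i * qFact (N₁ - i) * qFact (N₂ - i) * qif ((N₁ : ℤ) + N₂ - i + 1) *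
      qNum ((N₁ : ℂ) + N₂ - 2 * i + 1)) := by
  have e1 : (N₁ : ℤ) + N₂ - i + 1 = ((N₁ + N₂ - i + 1 : ℕ) : ℤ) := by omega
  have e2 : (N₁ : ℂ) + N₂ - 2 * i + 1 = ((N₁ + N₂ - 2 * i + 1 : ℕ) : ℂ) := by
    rw [Nat.cast_succ, Nat.cast_sub (by omega)]; push_cast; rfl
  rw [e1, e2]
  exact ((((isPos_qFact _).mul (isPos_qFact _)).mul (isPos_qFact _)).mul (isPos_qif _)).mul
    (isPos_qNum_nat (by omega))

theorem isPos_cgNorm {N₁ N₂ i : ℕ} (h1 : i ≤ N₁) (h2 : i ≤ N₂) : IsPos (cgNorm N₁ N₂ i) :=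
  (isPos_cgNorm_sq h1 h2).csqrt

theorem constantCoeff_qif (n : ℕ) :
    PowerSeries.constantCoeff (qif n) = ((n.factorial : ℂ))⁻¹ := by
  rw [qif_natCast, PowerSeries.constantCoeff_inv, constantCoeff_qFact]

theorem constantCoeff_qFactRoot_sq (n : ℕ) : PowerSeries.constantCoeff (qFactRoot n) ^ 2 =
    (n.factorial : ℂ) := by
  rw [← map_pow, sq, qFactRoot_mul_self, constantCoeff_qFact]

/-- The squares of the coefficients for the highest weight, where `A = N₁ - i`, `B = N₂ - i` and
`i = x + z`. -/
theorem cgCl_top_sq (A B x z : ℕ) :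
    cgCl (A + (x + z)) (B + (x + z)) (x + z) (A + z) (B + x) ^ 2 =
      ((x + z).factorial * (A + B + 1).factorial * ((A + B + (x + z) + 1).factorial : ℂ)⁻¹) *
        ((B + x).choose B * (A + z).choose A : ℕ) := by
  have hn : PowerSeries.constantCoeff (cgNorm (A + (x + z)) (B + (x + z)) (x + z)) ^ 2 =
      (x + z).factorial * A.factorial * B.factorial *
        ((A + B + (x + z) + 1).factorial : ℂ)⁻¹ * (A + B + 1) := by
    rw [← map_pow, sq, cgNorm, csqrt_mul_self (isPos_cgNorm_sq (by omega) (by omega)),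
      map_mul, map_mul, map_mul, map_mul, constantCoeff_qFact, constantCoeff_qFact,
      constantCoeff_qFact, constantCoeff_qNum, Nat.add_sub_cancel, Nat.add_sub_cancel,
      show ((A + (x + z) : ℕ) : ℤ) + (B + (x + z) : ℕ) - (x + z : ℕ) + 1 =
        ((A + B + (x + z) + 1 : ℕ) : ℤ) by push_cast; ring, constantCoeff_qif]
    congr 1
    push_cast
    ring
  have hS : PowerSeries.constantCoeff (cgSum ((A + (x + z) : ℕ) : ℤ) ((B + (x + z) : ℕ) : ℤ)
      (x + z) ((A + z : ℕ) : ℤ) ((B + x : ℕ) : ℤ)) ^ 2 =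
      ((x.factorial : ℂ)⁻¹ * (z.factorial : ℂ)⁻¹ * (A.factorial : ℂ)⁻¹ *
        (B.factorial : ℂ)⁻¹) ^ 2 := by
    have := cgSum_top ((A + (x + z) : ℕ) : ℤ) ((B + (x + z) : ℕ) : ℤ) (rfl : x + z = x + z)
    rw [show ((A + (x + z) : ℕ) : ℤ) - x = ((A + z : ℕ) : ℤ) by push_cast; ring,
      show ((B + (x + z) : ℕ) : ℤ) - z = ((B + x : ℕ) : ℤ) by push_cast; ring,
      show ((A + (x + z) : ℕ) : ℤ) - (x + z : ℕ) = (A : ℤ) by push_cast; ring,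
      show ((B + (x + z) : ℕ) : ℤ) - (x + z : ℕ) = (B : ℤ) by push_cast; ring] at this
    rw [this, map_mul, map_mul, map_mul, map_mul, map_mul, constantCoeff_expH, constantCoeff_qif,
      constantCoeff_qif, constantCoeff_qif, constantCoeff_qif, map_pow, map_neg, map_one, mul_one,
      mul_pow, ← pow_mul, mul_comm x, pow_mul]
    norm_num
  rw [cgCl, cgNat, map_mul, map_mul, map_mul, map_mul, map_mul, map_mul, map_mul, map_mul,
    constantCoeff_expH, mul_pow, mul_pow, mul_pow, mul_pow, mul_pow, mul_pow, mul_pow, mul_pow, hn,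
    hS]
  simp only [constantCoeff_qFactRoot_sq]
  rw [show A + (x + z) - (A + z) = x by omega, show B + (x + z) - (B + x) = z by omega,
    show A + z + (B + x) - (x + z) = A + B by omega,
    show A + (x + z) + (B + (x + z)) - (x + z) - (A + z + (B + x)) = 0 by omega]
  have c1 : ((B + x).choose B : ℂ) = (B + x).factorial *
      ((B.factorial : ℂ)⁻¹ * (x.factorial : ℂ)⁻¹) := by
    rw [Nat.cast_add_choose, div_eq_mul_inv, mul_inv]
  have c2 : ((A + z).choose A : ℂ) = (A + z).factorial *
      ((A.factorial : ℂ)⁻¹ * (z.factorial : ℂ)⁻¹) := by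
    rw [Nat.cast_add_choose, div_eq_mul_inv, mul_inv]
  have f (n : ℕ) : (n.factorial : ℂ) ≠ 0 := by exact_mod_cast n.factorial_ne_zero
  have fA := f A
  have fB := f B
  have fx := f x
  have fz := f z
  have fN := f (A + B + (x + z) + 1)
  rw [Nat.cast_mul, c1, c2, Nat.factorial_succ (A + B)]
  push_cast
  field_simp
  simp

theorem cgGram_top {N₁ N₂ i : ℕ} (h1 : i ≤ N₁) (h2 : i ≤ N₂) :
    cgGram N₁ N₂ i i (N₁ + N₂ - i) = 1 := by
  obtain ⟨A, rfl⟩ := Nat.exists_eq_add_of_le' h1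
  obtain ⟨B, rfl⟩ := Nat.exists_eq_add_of_le' h2
  rw [cgGram, sum_antidiagonal_top h1 h2 _ fun x hx => by
    rw [cgCl_eq_zero (by omega), zero_mul]]
  have hx (x : ℕ × ℕ) (hx : x ∈ Finset.HasAntidiagonal.antidiagonal i) :
      cgCl (A + i) (B + i) i (A + i - x.1) (B + i - x.2) *
        cgCl (A + i) (B + i) i (A + i - x.1) (B + i - x.2) =
      (i.factorial * (A + B + 1).factorial * ((A + B + i + 1).factorial : ℂ)⁻¹) *
        ((B + x.1).choose B * (A + x.2).choose A : ℕ) := by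
    rw [Finset.HasAntidiagonal.mem_antidiagonal] at hx
    rw [← hx, ← cgCl_top_sq A B x.1 x.2, sq, show A + (x.1 + x.2) - x.1 = A + x.2 by omega,
      show B + (x.1 + x.2) - x.2 = B + x.1 by omega]
  rw [Finset.sum_congr rfl hx, ← Finset.mul_sum, sum_choose_mul_choose, Nat.cast_add_choose,
    show B + A + 1 + i = A + B + i + 1 by ring, show B + A + 1 = A + B + 1 by ring]
  have f (n : ℕ) : (n.factorial : ℂ) ≠ 0 := by exact_mod_cast n.factorial_ne_zero
  have f1 := f i
  have f2 := f (A + B + 1)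
  have f3 := f (A + B + i + 1)
  field_simp

/-- The norms for the different weights agree, and for the highest weight they are known. -/
theorem cgGram_self {N₁ N₂ i s : ℕ} (h1 : i ≤ N₁) (h2 : i ≤ N₂) (hs : i ≤ s)
    (hs' : s + i ≤ N₁ + N₂) : cgGram N₁ N₂ i i s = 1 := by
  obtain ⟨k, hk⟩ : ∃ k, k = N₁ + N₂ - i - s := ⟨_, rfl⟩
  induction k generalizing s with
  | zero => rw [show s = N₁ + N₂ - i by omega, cgGram_top h1 h2]
  | succ k ih =>
    have := cgGram_succ (N₁ := N₁) (N₂ := N₂) (i := i) (i' := i) (s := s) (by omega) (by omega)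
      (by omega) (by omega)
    rw [ih (s := s + 1) (by omega) (by omega) (by omega)] at this
    exact mul_left_cancel₀ (coefCl_ne_zero (by omega) (by omega)) this

theorem cgGram_eq {N₁ N₂ i i' s : ℕ} (h : i ≤ min (min N₁ N₂) (min s (N₁ + N₂ - s)))
    (h' : i' ≤ min (min N₁ N₂) (min s (N₁ + N₂ - s))) (hs : s ≤ N₁ + N₂) :
    cgGram N₁ N₂ i i' s = if i = i' then 1 else 0 := by
  split_ifs with hi
  · subst hi
    exact cgGram_self (by omega) (by omega) (by omega) (by omega)
  · rcases Nat.lt_or_gt_of_ne hi with hi | hi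
    · rw [cgGram_comm, cgGram_of_lt hi (by omega) (by omega) (by omega)]
    · rw [cgGram_of_lt hi (by omega) (by omega) (by omega)]

/-- The weight space of the tensor product of two irreducible representations has a basis indexed
by as many elements as there are irreducible components that meet it. -/
theorem sum_antidiagonal_eq_sum_fin {M : Type*} [AddCommMonoid M] {N₁ N₂ s : ℕ} (hs : s ≤ N₁ + N₂)
    (f : ℕ × ℕ → M) (hf : ∀ x, N₁ < x.1 ∨ N₂ < x.2 → f x = 0) :
    ∑ x ∈ Finset.HasAntidiagonal.antidiagonal s, f x =
      ∑ t : Fin (min (min N₁ N₂) (min s (N₁ + N₂ - s)) + 1), f (s - N₂ + t, s - (s - N₂ + t)) := by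
  refine (Finset.sum_of_injOn (fun t : Fin (min (min N₁ N₂) (min s (N₁ + N₂ - s)) + 1) =>
    (s - N₂ + (t : ℕ), s - (s - N₂ + (t : ℕ)))) ?_ ?_ ?_ fun _ _ => rfl).symm
  · intro t _ t' _ h
    simp only [Prod.mk.injEq] at h
    exact Fin.ext (by omega)
  · intro t _
    simp only [Finset.mem_coe, Finset.HasAntidiagonal.mem_antidiagonal]
    omega
  · rintro ⟨x, z⟩ hx hx'
    rw [Finset.HasAntidiagonal.mem_antidiagonal] at hx
    refine hf _ ?_
    by_contra h
    simp only at hx h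
    refine hx' ⟨⟨x - (s - N₂), by omega⟩, Finset.mem_coe.mpr (Finset.mem_univ _), ?_⟩
    simp only [Prod.mk.injEq]
    omega

/-- The rows of the square matrix of Clebsch--Gordan coefficients are orthonormal, hence so are its
columns. -/
theorem sum_cgCl_mul_cgCl {N₁ N₂ p₁ p₂ x₁ x₂ : ℕ} (h1 : p₁ ≤ N₁) (h2 : p₂ ≤ N₂)
    (hx : x₁ + x₂ = p₁ + p₂) : ∑ i ∈ Finset.range (min N₁ N₂ + 1),
      cgCl N₁ N₂ i p₁ p₂ * cgCl N₁ N₂ i x₁ x₂ = if x₁ = p₁ then 1 else 0 := by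
  by_cases hx' : x₁ ≤ N₁ ∧ x₂ ≤ N₂
  swap
  · rw [if_neg (by omega)]
    exact Finset.sum_eq_zero fun i _ => by
      rw [cgCl_eq_zero (p₁ := x₁) (p₂ := x₂) (by omega), mul_zero]
  obtain ⟨s, hs⟩ : ∃ s, s = p₁ + p₂ := ⟨_, rfl⟩
  obtain ⟨m, hm⟩ : ∃ m, m = min (min N₁ N₂) (min s (N₁ + N₂ - s)) := ⟨_, rfl⟩
  let M : Matrix (Fin (m + 1)) (Fin (m + 1)) ℂ :=
    Matrix.of fun i t => cgCl N₁ N₂ i (s - N₂ + t) (s - (s - N₂ + t))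
  have hM : M * M.transpose = 1 := by
    ext i i'
    have := sum_antidiagonal_eq_sum_fin (by omega : s ≤ N₁ + N₂)
      (fun x => cgCl N₁ N₂ i x.1 x.2 * cgCl N₁ N₂ i' x.1 x.2) fun x hx => by
        rw [cgCl_eq_zero (by omega), zero_mul]
    rw [← hm] at this
    rw [Matrix.mul_apply, Matrix.one_apply]
    refine this.symm.trans ?_
    refine (cgGram_eq (by omega) (by omega) (by omega)).trans ?_
    simp only [Fin.ext_iff]
  -- a right inverse of a square matrix is a left inverse
  have hM' := mul_eq_one_comm.mp hM
  have hMx := congrFun (congrFun hM' ⟨p₁ - (s - N₂), by omega⟩) ⟨x₁ - (s - N₂), by omega⟩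
  rw [Matrix.mul_apply, Matrix.one_apply] at hMx
  simp only [Matrix.transpose_apply, M, Matrix.of_apply, Fin.mk.injEq,
    show s - N₂ + (p₁ - (s - N₂)) = p₁ by omega, show s - N₂ + (x₁ - (s - N₂)) = x₁ by omega,
    show s - p₁ = p₂ by omega, show s - x₁ = x₂ by omega] at hMx
  rw [Fin.sum_univ_eq_sum_range (fun i => cgCl N₁ N₂ i p₁ p₂ * cgCl N₁ N₂ i x₁ x₂)] at hMx
  have hsub : Finset.range (m + 1) ⊆ Finset.range (min N₁ N₂ + 1) :=
    Finset.range_subset_range.mpr (by omega)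
  rw [← Finset.sum_subset hsub fun i hi hi' => ?_, hMx]
  · exact if_congr (by omega) rfl rfl
  · rw [Finset.mem_range] at hi hi'
    rw [cgCl_eq_zero (p₁ := p₁) (by omega), zero_mul]

end QuantumEuclid

namespace QuantumEuclid

/-! ### Clebsch--Gordan coefficients with half-integral arguments -/

theorem qInvFact_intCast (n : ℤ) : qInvFact (n : ℚ) = qif n := by
  rcases lt_or_ge n 0 with h | h
  · rw [qif_of_neg h, qInvFact, if_neg]
    rintro ⟨k, hk⟩
    have : n = k := by exact_mod_cast hk
    omega
  · obtain ⟨k, rfl⟩ := Int.eq_ofNat_of_zero_le h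
    rw [qif_natCast, qInvFact, if_pos ⟨k, by simp⟩]
    simp

theorem constantCoeff_qInvFact (x : ℚ) :
    PowerSeries.constantCoeff (qInvFact x) = (invFact x : ℂ) := by
  rw [qInvFact, invFact]
  split_ifs
  · rw [PowerSeries.constantCoeff_inv, constantCoeff_qFact]
    push_cast
    rfl
  · simp

theorem constantCoeff_qcg (j₁ j₂ j m₁ m₂ m : ℚ) :
    PowerSeries.constantCoeff (qcg j₁ j₂ j m₁ m₂ m) = (cg j₁ j₂ j m₁ m₂ m : ℂ) := by
  rw [qcg, cg]
  split_ifs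
  · rw [map_mul, map_mul, constantCoeff_expH, one_mul, constantCoeff_csqrt, map_sum,
      Complex.ofReal_mul, Complex.ofReal_sum]
    congr 1
    · congr 2
      simp only [map_mul, constantCoeff_qFact, constantCoeff_qInvFact, constantCoeff_qNum]
      rw [← Complex.ofReal_re (_ * _)]
      congr 1
      push_cast
      ring
    · refine Finset.sum_congr rfl fun r _ => ?_
      simp only [map_mul, map_pow, map_neg, map_one, constantCoeff_expH, constantCoeff_qInvFact]
      push_cast
      ring
  · simp

theorem floor_eq {x : ℚ} {n : ℕ} (h : x = n) : ⌊x⌋₊ = n := by rw [h, Nat.floor_natCast]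

/-- The coefficients of the theorem in terms of natural numbers: `i = j₁ + j₂ - j`, `p₁ = j₁ + m₁`
and `p₂ = j₂ + m₂`. If the weight `m` does not occur for spin `j`, both sides vanish. -/
theorem qcg_eq_cgNat {N₁ N₂ i p₁ p₂ : ℕ} (h1 : p₁ ≤ N₁) (h2 : p₂ ≤ N₂) (hi1 : i ≤ N₁)
    (hi2 : i ≤ N₂) {j₁ j₂ j m₁ m₂ m : ℚ} (hj₁ : j₁ = N₁ / 2) (hj₂ : j₂ = N₂ / 2)
    (hj : j = j₁ + j₂ - i) (hm₁ : m₁ = p₁ - j₁) (hm₂ : m₂ = p₂ - j₂) (hm : m = m₁ + m₂) :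
    qcg j₁ j₂ j m₁ m₂ m = cgNat N₁ N₂ i p₁ p₂ := by
  have hi1' : (i : ℚ) ≤ N₁ := by exact_mod_cast hi1
  have hi2' : (i : ℚ) ≤ N₂ := by exact_mod_cast hi2
  have e1 : j₁ + m₁ = (p₁ : ℕ) := by rw [hm₁]; ring
  have e2 : j₁ - m₁ = (N₁ - p₁ : ℕ) := by rw [hm₁, hj₁, Nat.cast_sub h1]; ring
  have e3 : j₂ + m₂ = (p₂ : ℕ) := by rw [hm₂]; ring
  have e4 : j₂ - m₂ = (N₂ - p₂ : ℕ) := by rw [hm₂, hj₂, Nat.cast_sub h2]; ring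
  by_cases hs : i ≤ p₁ + p₂ ∧ p₁ + p₂ + i ≤ N₁ + N₂
  · have e5 : j + m = (p₁ + p₂ - i : ℕ) := by
      rw [hm, hm₁, hm₂, hj, Nat.cast_sub hs.1]; push_cast; ring
    have e6 : j - m = (N₁ + N₂ - i - (p₁ + p₂) : ℕ) := by
      rw [hm, hm₁, hm₂, hj, hj₁, hj₂, Nat.cast_sub (by omega), Nat.cast_sub (by omega)]
      push_cast; ring
    have e7 : j₁ + j₂ - j = (i : ℕ) := by rw [hj]; ring
    have e8 : j₁ - j₂ + j = (N₁ - i : ℕ) := by rw [hj, hj₁, Nat.cast_sub hi1]; ring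
    have e9 : -j₁ + j₂ + j = (N₂ - i : ℕ) := by rw [hj, hj₂, Nat.cast_sub hi2]; ring
    have hadm : Admissible j₁ j₂ j m₁ m₂ m := by
      refine ⟨⟨⟨_, e2⟩, _, e1⟩, ⟨⟨_, e4⟩, _, e3⟩, ⟨⟨_, e6⟩, _, e5⟩, hm.symm, ?_, ?_⟩
      · rw [abs_le, hj, hj₁, hj₂]
        constructor <;> linarith
      · rw [hj]
        have : (0 : ℚ) ≤ i := Nat.cast_nonneg i
        linarith
    have e10 : j₁ + j₂ + j + 1 = (((N₁ : ℤ) + N₂ - i + 1 : ℤ) : ℚ) := by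
      rw [hj, hj₁, hj₂]; push_cast; ring
    have e11 : ((2 * j + 1 : ℚ) : ℂ) = (N₁ : ℂ) + N₂ - 2 * i + 1 := by
      rw [hj, hj₁, hj₂]; push_cast; ring
    have e12 : ((1 / 2 * (j₁ + j₂ - j) * (j₁ + j₂ + j + 1) + j₁ * m₂ - j₂ * m₁ : ℚ) : ℂ) =
        ((i : ℂ) * (N₁ + N₂ - i + 1) + (N₁ * p₂ - N₂ * p₁)) / 2 := by
      rw [hm₁, hm₂, hj, hj₁, hj₂]; push_cast; ring
    have hR (n : ℕ) : csqrt (qFact n) = qFactRoot n := rfl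
    rw [qcg, if_pos hadm, floor_eq e1, floor_eq e2, floor_eq e3, floor_eq e4, floor_eq e5,
      floor_eq e6, floor_eq e7, floor_eq e8, floor_eq e9, e12, e10, e11, qInvFact_intCast,
      csqrt_mul (isPos_cgNorm_sq hi1 hi2) ((((((isPos_qFact _).mul (isPos_qFact _)).mul
        (isPos_qFact _)).mul (isPos_qFact _)).mul (isPos_qFact _)).mul (isPos_qFact _)),
      csqrt_mul ((((((isPos_qFact _).mul (isPos_qFact _)).mul (isPos_qFact _)).mul
        (isPos_qFact _)).mul (isPos_qFact _))) (isPos_qFact _),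
      csqrt_mul (((((isPos_qFact _).mul (isPos_qFact _)).mul (isPos_qFact _)).mul
        (isPos_qFact _))) (isPos_qFact _),
      csqrt_mul ((((isPos_qFact _).mul (isPos_qFact _)).mul (isPos_qFact _))) (isPos_qFact _),
      csqrt_mul (((isPos_qFact _).mul (isPos_qFact _))) (isPos_qFact _),
      csqrt_mul (isPos_qFact _) (isPos_qFact _)]
    simp only [hR]
    have hS : ∑ r ∈ Finset.range (i + 1),
        (-1) ^ r * expH ((-(r * (j₁ + j₂ + j + 1)) : ℚ) : ℂ) *
        (qInvFact r * qInvFact (j₁ + j₂ - j - r) * qInvFact (j₁ - m₁ - r) * qInvFact (j₂ + m₂ - r) *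
          qInvFact (j - j₂ + m₁ + r) * qInvFact (j - j₁ - m₂ + r)) = cgSum N₁ N₂ i p₁ p₂ := by
      refine Finset.sum_congr rfl fun r _ => ?_
      have t0 : ((r : ℚ)) = ((r : ℤ) : ℚ) := by push_cast; rfl
      have t1 : j₁ + j₂ - j - r = (((i : ℤ) - r : ℤ) : ℚ) := by rw [e7]; push_cast; rfl
      have t2 : j₁ - m₁ - r = (((N₁ : ℤ) - p₁ - r : ℤ) : ℚ) := by
        rw [hm₁, hj₁]; push_cast; ring
      have t3 : j₂ + m₂ - r = (((p₂ : ℤ) - r : ℤ) : ℚ) := by rw [e3]; push_cast; rfl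
      have t4 : j - j₂ + m₁ + r = (((p₁ : ℤ) - i + r : ℤ) : ℚ) := by
        rw [hm₁, hj]; push_cast; ring
      have t5 : j - j₁ - m₂ + r = (((N₂ : ℤ) - p₂ - i + r : ℤ) : ℚ) := by
        rw [hm₂, hj, hj₂]; push_cast; ring
      rw [t1, t2, t3, t4, t5, t0, e10, cgTerm]
      simp only [qInvFact_intCast]
      congr 3
      push_cast
      rfl
    rw [e10] at hS
    rw [hS, cgNat, cgNorm]
    ring
  · have hn : ¬ Admissible j₁ j₂ j m₁ m₂ m := by
      rintro ⟨-, -, ⟨⟨a, ha⟩, b, hb⟩, -⟩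
      have ha' : (N₁ : ℚ) + N₂ = p₁ + p₂ + i + a := by
        rw [← ha, hm, hm₁, hm₂, hj, hj₁, hj₂]; ring
      have hb' : (p₁ : ℚ) + p₂ = i + b := by
        rw [← hb, hm, hm₁, hm₂, hj]; ring
      have ha'' : N₁ + N₂ = p₁ + p₂ + i + a := by exact_mod_cast ha'
      have hb'' : p₁ + p₂ = i + b := by exact_mod_cast hb'
      omega
    rw [qcg, if_neg hn, cgNat_eq_zero (by omega)]

/-- The coefficients that occur in the expansion of a monomial of degrees `Na, Nb, Nc, Nd`. -/
theorem qcg_eq_cgNat_monomial {Na Nb Nc Nd i p₁ p₂ : ℕ} (hi1 : i ≤ Na + Nb) (hi2 : i ≤ Nc + Nd)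
    (h1 : p₁ ≤ Na + Nb) (h2 : p₂ ≤ Nc + Nd) {m₁ m₂ m : ℚ} (hm₁ : m₁ = p₁ - (Na / 2 + Nb / 2))
    (hm₂ : m₂ = p₂ - (Nc / 2 + Nd / 2))
    (hm : m = p₁ - (Na / 2 + Nb / 2) + (p₂ - (Nc / 2 + Nd / 2))) :
    qcg (Na / 2 + Nb / 2) (Nc / 2 + Nd / 2) (Na / 2 + Nb / 2 + Nc / 2 + Nd / 2 - i) m₁ m₂ m =
      cgNat (Na + Nb) (Nc + Nd) i p₁ p₂ :=
  qcg_eq_cgNat h1 h2 hi1 hi2 (by push_cast; ring) (by push_cast; ring) (by ring) hm₁ hm₂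
    (by rw [hm, hm₁, hm₂])

theorem isUnit_cgNat_row {N₁ N₂ i : ℕ} (h1 : i ≤ N₁) (h2 : i ≤ N₂) :
    IsUnit (cgNat N₁ N₂ i 0 N₂) := by
  have hS := cgSum_row N₁ N₂ i
  rw [← Nat.cast_sub h1, ← Nat.cast_sub h2] at hS
  rw [cgNat, show ((0 : ℕ) : ℤ) = 0 from rfl, hS]
  exact (((isUnit_expH _).mul (isPos_cgNorm h1 h2).isUnit).mul
    ((((isPos_qFactRoot _).mul (isPos_qFactRoot _)).mul ((isPos_qFactRoot _).mul
      (isPos_qFactRoot _))).mul ((isPos_qFactRoot _).mul (isPos_qFactRoot _))).isUnit).mul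
    ((((isUnit_one.neg).pow i).mul (isUnit_expH _)).mul
      (((isPos_qif _).mul (isPos_qif _)).mul (isPos_qif _)).isUnit)

/-! ### The ordering of monomials -/

theorem C_red_smul (c : Ch) (v : Mh) :
    (PowerSeries.C (red (c • v)) : Mcl⟦X⟧) =
      (PowerSeries.C (PowerSeries.constantCoeff c) : Ch) • PowerSeries.C (red v) := by
  rw [red_smul, C_smul_eq]

/-- The ordering takes the undeformed coupled vectors to multiples of the deformed ones. -/
theorem phi_red_cgVec {N₁ N₂ i : ℕ} (h1 : i ≤ N₁) (h2 : i ≤ N₂) (s : ℕ) :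
    phi (PowerSeries.C (red (cgVec N₁ N₂ i s))) =
      (PowerSeries.C (cgCl N₁ N₂ i 0 N₂) * (cgNat N₁ N₂ i 0 N₂)⁻¹) • cgVec N₁ N₂ i s := by
  by_cases hs : i ≤ s ∧ s + i ≤ N₁ + N₂
  · have hu := (isUnit_cgNat_row h1 h2)
    rw [PowerSeries.isUnit_iff_constantCoeff] at hu
    rw [cgVec_eq h1 h2 hs.1 hs.2, C_red_smul, map_smul, map_mul, map_pow, red_lsqh]
    have := phi_apply (N := N₁ + N₂ - 2 * i) (p := N₂ - i) (p' := s - i) (by omega) (by omega) i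
    rw [tCl] at this
    rw [this, smul_smul, mul_assoc, PowerSeries.inv_mul_cancel _ hu.ne_zero, mul_one, cgCl]
  · have : cgVec N₁ N₂ i s = 0 := Finset.sum_eq_zero fun x hx => by
      rw [Finset.HasAntidiagonal.mem_antidiagonal] at hx
      rw [cgNat_eq_zero (by omega), zero_smul]
    rw [this, map_zero, map_zero, map_zero, smul_zero]

/-- The inversion of the Clebsch--Gordan decomposition at `ℏ = 0`, by the orthogonality of the
coefficients. -/
theorem red_doublet_mul_doublet {N₁ N₂ p₁ p₂ : ℕ} (h1 : p₁ ≤ N₁) (h2 : p₂ ≤ N₂) :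
    red (doublet 1 0 N₁ p₁ * doublet 1 1 N₂ p₂) =
      ∑ i ∈ Finset.range (min N₁ N₂ + 1),
        cgCl N₁ N₂ i p₁ p₂ • red (cgVec N₁ N₂ i (p₁ + p₂)) := by
  have h (i : ℕ) : cgCl N₁ N₂ i p₁ p₂ • red (cgVec N₁ N₂ i (p₁ + p₂)) =
      ∑ x ∈ Finset.HasAntidiagonal.antidiagonal (p₁ + p₂),
        (cgCl N₁ N₂ i p₁ p₂ * cgCl N₁ N₂ i x.1 x.2) •
          red (doublet 1 0 N₁ x.1 * doublet 1 1 N₂ x.2) := by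
    rw [cgVec, map_sum, Finset.smul_sum]
    refine Finset.sum_congr rfl fun x _ => ?_
    rw [red_smul, smul_smul, cgCl, cgCl]
  rw [Finset.sum_congr rfl fun i _ => h i, Finset.sum_comm, Finset.sum_eq_single (p₁, p₂)]
  · rw [← Finset.sum_smul, sum_cgCl_mul_cgCl h1 h2 rfl, if_pos rfl, one_smul]
  · rintro ⟨x, z⟩ hx hne
    rw [Finset.HasAntidiagonal.mem_antidiagonal] at hx
    rw [← Finset.sum_smul, sum_cgCl_mul_cgCl h1 h2 hx, if_neg, zero_smul]
    rintro rfl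
    exact hne (Prod.ext rfl (by simp only at hx ⊢; omega))
  · exact fun hx => absurd (by simp) hx

theorem qBinom_symm {n k : ℕ} (h : k ≤ n) : qBinom n (n - k) = qBinom n k := by
  rw [qBinom, qBinom, Nat.cast_sub h, Nat.sub_sub_self h, mul_comm (qFact k)]
  congr 3
  ring

theorem constantCoeff_csqrt_qBinom {n k : ℕ} (h : k ≤ n) :
    PowerSeries.constantCoeff (csqrt (qBinom n k)) = ((Real.sqrt (n.choose k) : ℝ) : ℂ) := by
  rw [constantCoeff_csqrt, qBinom, map_mul, map_mul, constantCoeff_expH, one_mul,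
    PowerSeries.constantCoeff_inv, map_mul, constantCoeff_qFact, constantCoeff_qFact,
    constantCoeff_qFact, Nat.choose_eq_factorial_div_factorial h,
    Nat.cast_div (Nat.factorial_mul_factorial_dvd_factorial h)
      (by exact_mod_cast (Nat.mul_pos k.factorial_pos (n - k).factorial_pos).ne')]
  congr 2
  rw [← Complex.ofReal_re (_ / _)]
  congr 1
  push_cast
  rw [mul_comm ((n - k).factorial : ℂ), div_eq_mul_inv]

theorem red_doublet {s k : Fin 2} {N p : ℕ} (hp : p ≤ N) : red (doublet s k N p) =
    ((Real.sqrt (N.choose p) : ℝ) : ℂ) • (red (xs s 0 k) ^ (N - p) * red (xs s 1 k) ^ p) := by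
  rw [doublet, red_smul, constantCoeff_csqrt_qBinom hp, map_mul, map_pow, map_pow]

/-- A monomial is a product of two undeformed doublets; it is decomposed into coupled vectors, on
each of which the ordering is known, and these are expanded into products of deformed doublets. -/
theorem phi_monomial (Na Nb Nc Nd : ℕ) :
    phi (PowerSeries.C (xcl 0 0 ^ Na * xcl 0 1 ^ Nb * xcl 1 0 ^ Nc * xcl 1 1 ^ Nd)) =
      ∑ i ∈ Finset.range (min (Na + Nb) (Nc + Nd) + 1),
        ∑ k ∈ Finset.Icc (-(min Nb Nc : ℤ)) (min Na Nd : ℤ),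
          ((PowerSeries.C (cgCl (Na + Nb) (Nc + Nd) i 0 (Nc + Nd)) *
              csqrt (qBinom (Na + Nb) (Nb + k).toNat) *
              csqrt (qBinom (Nc + Nd) (Nc + k).toNat)) *
            (cgNat (Na + Nb) (Nc + Nd) i 0 (Nc + Nd) *
              PowerSeries.C ((Real.sqrt ((Na + Nb).choose Nb) : ℝ) : ℂ) *
              PowerSeries.C ((Real.sqrt ((Nc + Nd).choose Nc) : ℝ) : ℂ))⁻¹ *
            PowerSeries.C (cgCl (Na + Nb) (Nc + Nd) i Nb Nd) *
            cgNat (Na + Nb) (Nc + Nd) i (Nb + k).toNat (Nd - k : ℤ).toNat) •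
          (xh 0 0 ^ (Na - k : ℤ).toNat * xh 0 1 ^ (Nb + k : ℤ).toNat *
            xh 1 0 ^ (Nc + k : ℤ).toNat * xh 1 1 ^ (Nd - k : ℤ).toNat) := by
  obtain ⟨r₁, hr₁⟩ : ∃ r : ℂ, r = ((Real.sqrt ((Na + Nb).choose Nb) : ℝ) : ℂ) := ⟨_, rfl⟩
  obtain ⟨r₂, hr₂⟩ : ∃ r : ℂ, r = ((Real.sqrt ((Nc + Nd).choose Nc) : ℝ) : ℂ) := ⟨_, rfl⟩
  have hr₁0 : r₁ ≠ 0 := by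
    rw [hr₁]
    exact_mod_cast (Real.sqrt_pos.mpr (by exact_mod_cast Nat.choose_pos (by omega))).ne'
  have hr₂0 : r₂ ≠ 0 := by
    rw [hr₂]
    exact_mod_cast (Real.sqrt_pos.mpr (by exact_mod_cast Nat.choose_pos (by omega))).ne'
  have hv : xcl 0 0 ^ Na * xcl 0 1 ^ Nb * xcl 1 0 ^ Nc * xcl 1 1 ^ Nd =
      (r₁⁻¹ * r₂⁻¹) • red (doublet 1 0 (Na + Nb) Nb * doublet 1 1 (Nc + Nd) Nd) := by
    rw [map_mul, red_doublet (by omega), red_doublet (by omega), smul_mul_smul_comm, smul_smul,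
      ← Nat.choose_symm_add (a := Nc) (b := Nd), ← hr₁, ← hr₂, mul_mul_mul_comm,
      inv_mul_cancel₀ hr₁0,
      inv_mul_cancel₀ hr₂0, one_mul, one_smul, Nat.add_sub_cancel, Nat.add_sub_cancel, mul_assoc,
      mul_assoc, mul_assoc]
    simp only [xs, if_neg (one_ne_zero (α := Fin 2)), red_xh]
  rw [← hr₁, ← hr₂, hv, red_doublet_mul_doublet (by omega) (by omega), Finset.smul_sum, map_sum,
    map_sum]
  refine Finset.sum_congr rfl fun i hi => ?_
  rw [Finset.mem_range] at hi
  rw [smul_smul, C_smul_eq, map_smul, phi_red_cgVec (by omega) (by omega), smul_smul, cgVec,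
    Finset.smul_sum]
  symm
  -- the terms whose exponents would be negative vanish in the sum over weights
  refine Finset.sum_of_injOn (fun k : ℤ => ((Nb + k).toNat, (Nd - k).toNat)) ?_ ?_ ?_ ?_
  · intro k hk k' hk' h
    simp only [Finset.coe_Icc, Set.mem_Icc, Prod.mk.injEq] at hk hk' h
    omega
  · intro k hk
    simp only [Finset.coe_Icc, Set.mem_Icc, Finset.mem_coe,
      Finset.HasAntidiagonal.mem_antidiagonal] at hk ⊢
    omega
  · rintro ⟨x, z⟩ hx hx'
    rw [Finset.HasAntidiagonal.mem_antidiagonal] at hx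
    simp only at hx
    have h0 : cgNat (Na + Nb) (Nc + Nd) i x z = 0 := cgNat_eq_zero <| by
      by_contra h
      refine hx' ⟨(x : ℤ) - Nb, ?_, ?_⟩
      · simp only [Finset.coe_Icc, Set.mem_Icc]
        omega
      · simp only [Prod.mk.injEq]
        omega
    simp only [h0, zero_smul, smul_zero]
  · intro k hk
    rw [Finset.mem_Icc] at hk
    have e : qBinom (Nc + Nd) (Nd - k : ℤ).toNat = qBinom (Nc + Nd) (Nc + k : ℤ).toNat := by
      rw [← qBinom_symm (by omega)]
      congr 1
      omega
    rw [doublet, doublet, smul_mul_smul_comm, smul_smul, smul_smul, e,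
      show Na + Nb - (Nb + k : ℤ).toNat = (Na - k : ℤ).toNat by omega,
      show Nc + Nd - (Nd - k : ℤ).toNat = (Nc + k : ℤ).toNat by omega]
    have hr (r : ℂ) : (PowerSeries.C r : Ch)⁻¹ = PowerSeries.C r⁻¹ := by
      rcases eq_or_ne r 0 with rfl | h
      · simp
      · rw [PowerSeries.inv_eq_iff_mul_eq_one (by simpa using h), ← map_mul, inv_mul_cancel₀ h,
          map_one]
    rw [PowerSeries.mul_inv_rev, PowerSeries.mul_inv_rev, hr, hr, map_mul, map_mul, mul_assoc,
      mul_assoc (_ ^ _ * _)]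
    simp only [xs, if_neg (one_ne_zero (α := Fin 2))]
    generalize (cgNat (Na + Nb) (Nc + Nd) i 0 (Nc + Nd))⁻¹ = u
    have hsmul {c c' : Ch} (h : c = c') (v : Mh) : c • v = c' • v := by rw [h]
    exact hsmul (by ring) _

end QuantumEuclid


open QuantumEuclid in
theorem mainTheorem3 :
    -- the isomorphisms `α`, `β = α ⊗ α`, the action of `U_ℏ(so₄)` on `M_ℏ(2)` and the bases of the
    -- irreducible subrepresentations exist and are unique
    (∃! α : PowerSeries U ≃ₐ[Ch] Uh, IsAlpha α) ∧
    (∀ α, IsAlpha α → ∃! β : PowerSeries Uso ≃ₐ[Ch] UhSo, IsBeta α β) ∧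
    (∃! ρ : UhSo →ₐ[Ch] Module.End Ch Mh, IsDeformedAction ρ) ∧
    (∀ N : ℕ, ∃! T : Fin (N + 1) → Fin (N + 1) → Mcl, IsIrrepBasisCl N T) ∧
    (∀ ρ, IsDeformedAction ρ →
      ∀ N : ℕ, ∃! T : Fin (N + 1) → Fin (N + 1) → Mh, IsIrrepBasisH ρ N T) ∧
    -- the coefficients in the denominators of the formula are invertible
    (∀ Na Nb Nc Nd i : ℕ, i ≤ min (Na + Nb) (Nc + Nd) →
      let na : ℚ := Na / 2
      let nb : ℚ := Nb / 2
      let nc : ℚ := Nc / 2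
      let nd : ℚ := Nd / 2
      IsUnit (qcg (na + nb) (nc + nd) (na + nb + nc + nd - i)
        (-na - nb) (nc + nd) (-na - nb + nc + nd))) ∧
    ∀ (α : PowerSeries U ≃ₐ[Ch] Uh) (β : PowerSeries Uso ≃ₐ[Ch] UhSo)
      (ρ : UhSo →ₐ[Ch] Module.End Ch Mh)
      (T : ∀ N : ℕ, Fin (N + 1) → Fin (N + 1) → Mcl)
      (Th : ∀ N : ℕ, Fin (N + 1) → Fin (N + 1) → Mh),
      IsAlpha α → IsBeta α β → IsDeformedAction ρ →
      (∀ N, IsIrrepBasisCl N (T N)) → (∀ N, IsIrrepBasisH ρ N (Th N)) →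
      -- the ordering exists and is unique, it preserves the symmetry, and it is given by the formula
      (∃! φ : PowerSeries Mcl ≃ₗ[Ch] Mh, IsOrdering T Th φ) ∧
      ∀ φ : PowerSeries Mcl ≃ₗ[Ch] Mh, IsOrdering T Th φ →
        IsSymmetryPreserving β ρ φ ∧
        ∀ Na Nb Nc Nd : ℕ,
          let na : ℚ := Na / 2
          let nb : ℚ := Nb / 2
          let nc : ℚ := Nc / 2
          let nd : ℚ := Nd / 2
          let n₁ : ℚ := -na - nb + nc + nd
          let n₂ : ℚ := -na + nb - nc + nd
          φ (PowerSeries.C (xcl 0 0 ^ Na * xcl 0 1 ^ Nb * xcl 1 0 ^ Nc * xcl 1 1 ^ Nd)) =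
            ∑ i ∈ Finset.range (min (Na + Nb) (Nc + Nd) + 1),
              ∑ k ∈ Finset.Icc (-(min Nb Nc : ℤ)) (min Na Nd : ℤ),
                let j : ℚ := na + nb + nc + nd - i
                ((PowerSeries.C ((cg (na + nb) (nc + nd) j (-na - nb) (nc + nd) n₁ : ℝ) : ℂ) *
                    csqrt (qBinom (Na + Nb) (Nb + k).toNat) *
                    csqrt (qBinom (Nc + Nd) (Nc + k).toNat)) *
                  (qcg (na + nb) (nc + nd) j (-na - nb) (nc + nd) n₁ *
                    PowerSeries.C ((Real.sqrt ((Na + Nb).choose Nb) : ℝ) : ℂ) *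
                    PowerSeries.C ((Real.sqrt ((Nc + Nd).choose Nc) : ℝ) : ℂ))⁻¹ *
                  PowerSeries.C ((cg (na + nb) (nc + nd) j (-na + nb) (-nc + nd) n₂ : ℝ) : ℂ) *
                  qcg (na + nb) (nc + nd) j (-na + nb + k) (-nc + nd - k) n₂) •
                (xh 0 0 ^ (Na - k : ℤ).toNat * xh 0 1 ^ (Nb + k : ℤ).toNat *
                  xh 1 0 ^ (Nc + k : ℤ).toNat * xh 1 1 ^ (Nd - k : ℤ).toNat) := by
  refine ⟨existsUnique_alpha, fun α _ => existsUnique_beta α, existsUnique_deformedAction,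
    fun N => ⟨_, isIrrepBasisCl_tCl N, fun T hT => funext₂ hT.eq_tCl⟩,
    fun ρ hρ N => ⟨_, isIrrepBasisH_tH hρ N, fun T hT => funext₂ (hT.eq_tH hρ)⟩, ?_, ?_⟩
  · intro Na Nb Nc Nd i hi
    rw [le_min_iff] at hi
    simp only
    rw [qcg_eq_cgNat_monomial hi.1 hi.2 (p₁ := 0) (p₂ := Nc + Nd) (Nat.zero_le _) le_rfl
      (by push_cast; ring) (by push_cast; ring) (by push_cast; ring)]
    exact isUnit_cgNat_row hi.1 hi.2
  · intro α β ρ T Th hα hβ hρ hT hTh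
    have hT' (N : ℕ) (p p' : Fin (N + 1)) : T N p p' = tCl N p p' := (hT N).eq_tCl p p'
    have hTh' (N : ℕ) (p p' : Fin (N + 1)) : Th N p p' = tH N p p' := (hTh N).eq_tH hρ p p'
    refine ⟨⟨phi, isOrdering_phi hT' hTh', fun φ h => h.eq_phi hT' hTh'⟩, fun φ h => ?_⟩
    obtain rfl := h.eq_phi hT' hTh'
    refine ⟨isSymmetryPreserving_phi hα hβ hρ, fun Na Nb Nc Nd => ?_⟩
    simp only
    rw [phi_monomial]
    refine Finset.sum_congr rfl fun i hi => Finset.sum_congr rfl fun k hk => ?_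
    rw [Finset.mem_range, Nat.lt_succ_iff, le_min_iff] at hi
    rw [Finset.mem_Icc] at hk
    have hb : (((Nb + k).toNat : ℕ) : ℚ) = Nb + k := by
      exact_mod_cast congrArg (Int.cast : ℤ → ℚ) (Int.toNat_of_nonneg (a := Nb + k) (by omega))
    have hd : (((Nd - k : ℤ).toNat : ℕ) : ℚ) = Nd - k := by
      exact_mod_cast congrArg (Int.cast : ℤ → ℚ) (Int.toNat_of_nonneg (a := Nd - k) (by omega))
    rw [← constantCoeff_qcg, ← constantCoeff_qcg,
      qcg_eq_cgNat_monomial hi.1 hi.2 (p₁ := 0) (p₂ := Nc + Nd) (Nat.zero_le _) le_rfl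
        (by push_cast; ring) (by push_cast; ring) (by push_cast; ring),
      qcg_eq_cgNat_monomial hi.1 hi.2 (p₁ := Nb) (p₂ := Nd) (by omega) (by omega)
        (by ring) (by ring) (by ring),
      qcg_eq_cgNat_monomial hi.1 hi.2 (p₁ := (Nb + k).toNat) (p₂ := (Nd - k : ℤ).toNat) (by omega)
        (by omega) (by rw [hb]; ring) (by rw [hd]; ring) (by rw [hb, hd]; ring)]
    rfl
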